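/- **Setting.** Let $n\ge 2$, $k\ge 1$, $\theta\in(0,1)$, and let $R_0,\eta_A>0$ and $M_\psi,M_A$ be real numbers. Write $z=(\tilde z,z_n)\in\mathbf R^{n-1}\times\mathbf R$ and let $B_R\subset\mathbf R^{n-1}$ be the open ball of radius $R$ centred at $0$. Let $\psi\in C^{k+1}(B_{R_0})$ be real valued with $\psi(0)=0$, $\nabla\psi(0)=0$, $\psi(B_R)\subset(-R/2,R/2)$ for $0<R\le R_0$, and with derivatives of order $0,\dots,k+1$ bounded by $M_\psi$ on $B_{R_0}$. For $R\in(0,R_0]$ let $$W_R=\{(\tilde z,z_n):\tilde z\in B_R,\ -R<z_n<\psi(\tilde z)\},\qquad \partial W_R^+=\{(\tilde z,z_n):\tilde z\in B_R,\ z_n=\psi(\tilde z)\},$$ the latter being the top of $W_R$; for $R<R_0$ the rest of $\partial W_R$ consists of the sides and bottom. Let $A$ be a real $n\times n$ matrix valued $C^k$ function on $W_{R_0}$ whose entries have derivatives of order $0,\dots,k$ bounded by $M_A$ on $W_{R_0}$, with $(A(x)\xi)\cdot\xi\ge\eta_A|\xi|^2$ for all $x\in W_{R_0}$, $\xi\in\mathbf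 R^n$. Let $\delta\in(0,R_0)$ and $\delta'\in(0,\theta\delta]$, put $\varepsilon=\delta-\delta'$, and let $u\in H^1(W_\delta)$ satisfy one of the following: * (D) $u=0$ on $\partial W_\delta^+$ in the sense of traces and $$\int_{W_\delta}(A\nabla u)\cdot\nabla v=F\cdot v \qquad(1)$$ for all $v\in H^1_0(W_\delta)$, where $F$ is in the dual of $H^1_0(W_\delta)$; * (N) (1) holds for all $v\in H^1(W_\delta)$ which vanish in the sense of traces on the sides and bottom of $W_\delta$, where $F$ is in the dual of $H^1(W_\delta)$. The functions $v$ described in the respective case are called the allowable test functions. **Theorem 7.2.** In either case (D) or (N) the following hold. (a) There is a constant $C$ depending only on $n,k,\theta,R_0,M_\psi,M_A,\eta_A$ such that if, for some constants $a,b\ge 0$, $|F\cdot v|\le a|v|_{L^2(W_\delta)}+b|\nabla v|_{L^2(W_\delta)}$ for all allowable $v$, then $$|\nabla u|^2_{L^2(W_{\delta'})}\le C\big[\varepsilon^{-2}|u|^2_{L^2(W_\delta)}+a|u|_{L^2(W_\delta)}+b^2\big].$$ (b) There is a constant $C$ depending only on $n,k,\theta,R_0,M_\psi,M_A,\eta_A$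 such that if $F\cdot v=\int_{W_\delta}(\varphi v+\Phi\cdot\nabla v)$ for all allowable $v$, where $\varphi\in H^{\max\{k-2,0\}}(W_\delta)$ and $\Phi\in[H^{k-1}(W_\delta)]^n$, then $u\in H^k(W_{\delta'})$ and for $j=1,\dots,k$ $$\sum_{|\alpha|=j}|D^\alpha u|_{L^2(W_{\delta'})}\le C\varepsilon^{-j}\Big[|u|_{L^2}+\varepsilon^2|\varphi|_{L^2}+\varepsilon|\Phi|_{L^2}+\sum_{i=1}^{j-1}\varepsilon^{i+1}\big(|\varphi|_{H^{i-1}}+|\Phi|_{H^i}\big)\Big],$$ where the norms on the right are taken over $W_\delta$ and the last sum is omitted if $j=1$. (c) Independently of the hypotheses in (a) and (b), let $n\ge 3$, $\theta'\in(0,\theta)$, $p\in(1,2]$ and $q=np/(n-2)$. There is a constant $C$ depending only on $n,k,\theta,\theta',R_0,M_\psi,M_A,\eta_A$ and $p$ such that if $\delta'\in[\theta'\delta,\theta\delta]$ and if, for some $\varphi\in L^p(W_\delta)$, $\varphi v$ is integrable and $F\cdot v=\int_{W_\delta}\varphi v$ for all allowable $v$, then $u\in L^q(W_{\delta'})$ and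 $$|u|_{L^q(W_{\delta'})}\le C\big[\varepsilon^{-2/p}|u|_{L^p(W_\delta)}+\varepsilon^{2(p-1)/p}|\varphi|_{L^p(W_\delta)}\big].$$ -/

import Mathlib

open MeasureTheory Set Filter Topology
open scoped ENNReal ContDiff Matrix

noncomputable section

namespace BoundaryEstimates

/-- Euclidean space `ℝⁿ`. -/
abbrev Eu (n : ℕ) : Type := EuclideanSpace ℝ (Fin n)

section Sobolev

variable {n : ℕ}

/-- The classical partial derivative `∂f/∂xᵢ`. -/
def partialD (i : Fin n) (f : Eu n → ℝ) : Eu n → ℝ :=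
  fun x => fderiv ℝ f x (EuclideanSpace.single i 1)

/-- The classical derivative `D^α f = ∂₁^{α₁} ⋯ ∂ₙ^{αₙ} f` for a multi-index `α`. -/
def multiD (α : Fin n → ℕ) (f : Eu n → ℝ) : Eu n → ℝ :=
  (List.finRange n).foldr (fun i g => (partialD i)^[α i] g) f

/-- The order `|α|` of a multi-index. -/
def order (α : Fin n → ℕ) : ℕ := ∑ i, α i

/-- The class `C_c^∞(W)`. -/
def IsTestFunction (W : Set (Eu n)) (φ : Eu n → ℝ) : Prop :=
  ContDiff ℝ ∞ φ ∧ HasCompactSupport φ ∧ tsupport φ ⊆ W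

/-- `g` is the weak derivative `D^α u` on the open set `W`. -/
def IsWeakDeriv (W : Set (Eu n)) (α : Fin n → ℕ) (u g : Eu n → ℝ) : Prop :=
  LocallyIntegrableOn u W ∧ LocallyIntegrableOn g W ∧
    ∀ φ : Eu n → ℝ, IsTestFunction W φ →
      ∫ x in W, u x * multiD α φ x = (-1) ^ order α * ∫ x in W, g x * φ x

open Classical in
/-- The weak derivative `D^α u` on `W` (unique up to null sets), and `0` if there is none. -/
def weakDeriv (W : Set (Eu n)) (α : Fin n → ℕ) (u : Eu n → ℝ) : Eu n → ℝ :=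
  if h : ∃ g, IsWeakDeriv W α u g then h.choose else 0

/-- The weak gradient on `W`. -/
def weakGrad (W : Set (Eu n)) (u : Eu n → ℝ) (x : Eu n) : Eu n :=
  WithLp.toLp 2 fun i => weakDeriv W (Pi.single i 1) u x

/-- The `L^p(W)` norm of a scalar or vector valued function. -/
def normLp {F : Type} [NormedAddCommGroup F] (W : Set (Eu n)) (p : ℝ≥0∞) (u : Eu n → F) : ℝ :=
  lpNorm u p (volume.restrict W)

/-- `u ∈ H^k(W)`: `u ∈ L²(W)`, with weak derivatives up to order `k` in `L²(W)`. -/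
def MemH (W : Set (Eu n)) (k : ℕ) (u : Eu n → ℝ) : Prop :=
  MemLp u 2 (volume.restrict W) ∧
    ∀ α : Fin n → ℕ, order α ≤ k →
      ∃ g, IsWeakDeriv W α u g ∧ MemLp g 2 (volume.restrict W)

/-- The square of the norm of `H^k(W)`; `Finset.piAntidiag Finset.univ j` is the set of
multi-indices of order `j`. -/
def normHSq (W : Set (Eu n)) (k : ℕ) (u : Eu n → ℝ) : ℝ :=
  ∑ j ∈ Finset.range (k + 1), ∑ α ∈ Finset.piAntidiag (Finset.univ : Finset (Fin n)) j,
    normLp W 2 (weakDeriv W α u) ^ 2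

/-- The norm of `H^k(W)`. -/
def normH (W : Set (Eu n)) (k : ℕ) (u : Eu n → ℝ) : ℝ := √(normHSq W k u)

/-- The norm of `[H^k(W)]ⁿ`. -/
def normHVec (W : Set (Eu n)) (k : ℕ) (Φ : Eu n → Eu n) : ℝ :=
  √(∑ i, normHSq W k fun x => Φ x i)

/-- `v ∈ H¹₀(W)`: `v` is the limit in `H¹(W)` of elements of `C_c^∞(W)`. -/
def MemH10 (W : Set (Eu n)) (v : Eu n → ℝ) : Prop :=
  MemH W 1 v ∧ ∃ w : ℕ → Eu n → ℝ, (∀ j, IsTestFunction W (w j)) ∧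
    Tendsto (fun j => normH W 1 fun x => w j x - v x) atTop (𝓝 0)

/-- `u ∈ H¹(W)` vanishes on `Γ ⊆ ∂W` in the sense of traces. The trace operator is the continuous
extension to `H¹(W)` of the restriction to `∂W` of functions that are smooth on `ℝⁿ`, so the
trace of `u` is the limit of the traces of smooth functions converging to `u` in `H¹(W)`; here
that limit is `0` in `L²(Γ)`, with respect to `(n-1)`-dimensional Hausdorff (surface) measure. -/
def TraceZeroOn (W Γ : Set (Eu n)) (u : Eu n → ℝ) : Prop :=
  MemH W 1 u ∧ ∃ w : ℕ → Eu n → ℝ, (∀ j, ContDiff ℝ ∞ (w j)) ∧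
    Tendsto (fun j => normH W 1 fun x => w j x - u x) atTop (𝓝 0) ∧
    Tendsto (fun j => ∫⁻ x in Γ, ‖w j x‖ₑ ^ 2 ∂(Measure.hausdorffMeasure ((n : ℝ) - 1)))
      atTop (𝓝 0)

/-- `F` is a bounded linear functional on the subspace `V` of `H¹(W)`. -/
def IsDualElement (W : Set (Eu n)) (V : (Eu n → ℝ) → Prop) (F : (Eu n → ℝ) → ℝ) : Prop :=
  (∀ v w, V v → V w → F (fun x => v x + w x) = F v + F w) ∧
  (∀ (c : ℝ) (v), V v → F (fun x => c * v x) = c * F v) ∧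
  ∃ K : ℝ, ∀ v, V v → |F v| ≤ K * normH W 1 v

/-- The action of an `n × n` matrix on a vector. -/
def act (M : Matrix (Fin n) (Fin n) ℝ) (ξ : Eu n) : Eu n := WithLp.toLp 2 (M *ᵥ ξ.ofLp)

/-- The bilinear form `∫_W (A ∇u) · ∇v`. -/
def energyForm (W : Set (Eu n)) (A : Eu n → Matrix (Fin n) (Fin n) ℝ) (u v : Eu n → ℝ) : ℝ :=
  ∫ x in W, inner ℝ (act (A x) (weakGrad W u x)) (weakGrad W v x)

end Sobolev

section Domain

variable {m : ℕ}

/-- The horizontal part `z̃` of `z = (z̃, zₙ) ∈ ℝⁿ`, where `n = m + 1`. -/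
def horiz (z : Eu (m + 1)) : Eu m := WithLp.toLp 2 fun i => z i.castSucc

/-- The last coordinate `zₙ`. -/
def vert (z : Eu (m + 1)) : ℝ := z (Fin.last m)

/-- `W_R = {(z̃, zₙ) : |z̃| < R, -R < zₙ < ψ(z̃)}`. -/
def dom (ψ : Eu m → ℝ) (R : ℝ) : Set (Eu (m + 1)) :=
  {z | ‖horiz z‖ < R ∧ -R < vert z ∧ vert z < ψ (horiz z)}

/-- The top of `W_R`. -/
def top (ψ : Eu m → ℝ) (R : ℝ) : Set (Eu (m + 1)) :=
  {z | ‖horiz z‖ < R ∧ vert z = ψ (horiz z)}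

/-- The sides and bottom of `W_R`. -/
def sidesBottom (ψ : Eu m → ℝ) (R : ℝ) : Set (Eu (m + 1)) :=
  {z | ‖horiz z‖ = R ∧ -R ≤ vert z ∧ vert z ≤ ψ (horiz z)} ∪
    {z | ‖horiz z‖ ≤ R ∧ vert z = -R}

/-- The standing assumptions on the boundary function `ψ` and the coefficient matrix `A`. -/
structure Admissible (k : ℕ) (R₀ Mψ MA η : ℝ) (ψ : Eu m → ℝ)
    (A : Eu (m + 1) → Matrix (Fin (m + 1)) (Fin (m + 1)) ℝ) : Prop where
  psi_smooth : ContDiffOn ℝ ((k + 1 : ℕ) : WithTop ℕ∞) ψ (Metric.ball 0 R₀)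
  psi_zero : ψ 0 = 0
  grad_psi_zero : fderiv ℝ ψ 0 = 0
  psi_small : ∀ R ∈ Ioc 0 R₀, ∀ y ∈ Metric.ball (0 : Eu m) R, ψ y ∈ Ioo (-R / 2) (R / 2)
  psi_bound : ∀ j ≤ k + 1, ∀ y ∈ Metric.ball (0 : Eu m) R₀, ‖iteratedFDeriv ℝ j ψ y‖ ≤ Mψ
  A_smooth : ∀ i l, ContDiffOn ℝ (k : WithTop ℕ∞) (fun x => A x i l) (dom ψ R₀)
  A_bound : ∀ i l, ∀ j ≤ k, ∀ x ∈ dom ψ R₀, ‖iteratedFDeriv ℝ j (fun x => A x i l) x‖ ≤ MA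
  A_elliptic : ∀ x ∈ dom ψ R₀, ∀ ξ : Eu (m + 1), η * ‖ξ‖ ^ 2 ≤ inner ℝ (act (A x) ξ) ξ

/-- The two boundary conditions on the top: (D) Dirichlet, (N) Neumann (conormal). -/
inductive BC
  | D
  | N

/-- The test functions on `W_δ`: in case (D) they are the elements of `H¹₀(W_δ)`, in case (N) the
elements of `H¹(W_δ)` vanishing on the sides and bottom in the sense of traces. -/
def IsAllowable (bc : BC) (ψ : Eu m → ℝ) (δ : ℝ) (v : Eu (m + 1) → ℝ) : Prop :=
  match bc with
  | BC.D => MemH10 (dom ψ δ) v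
  | BC.N => TraceZeroOn (dom ψ δ) (sidesBottom ψ δ) v

/-- The space to whose dual `F` belongs: `H¹₀(W_δ)` in case (D), `H¹(W_δ)` in case (N). -/
def dualSpace (bc : BC) (ψ : Eu m → ℝ) (δ : ℝ) (v : Eu (m + 1) → ℝ) : Prop :=
  match bc with
  | BC.D => MemH10 (dom ψ δ) v
  | BC.N => MemH (dom ψ δ) 1 v

/-- `u ∈ H¹(W_δ)` satisfies (D) or (N) with the right-hand side `F`. -/
structure IsWeakSolution (bc : BC) (ψ : Eu m → ℝ)
    (A : Eu (m + 1) → Matrix (Fin (m + 1)) (Fin (m + 1)) ℝ) (δ : ℝ)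
    (F : (Eu (m + 1) → ℝ) → ℝ) (u : Eu (m + 1) → ℝ) : Prop where
  memH1 : MemH (dom ψ δ) 1 u
  trace : bc = BC.D → TraceZeroOn (dom ψ δ) (top ψ δ) u
  dual : IsDualElement (dom ψ δ) (dualSpace bc ψ δ) F
  equation : ∀ v, IsAllowable bc ψ δ v → energyForm (dom ψ δ) A u v = F v

end Domain

end BoundaryEstimates

end

open BoundaryEstimates

namespace BoundaryEstimates

open scoped Pointwise

variable {n : ℕ}

/-! Multiplying `ψ` by a bump function makes it globally smooth without changing it over `W_δ`
(`Admissible.exists_graphData`). The shear `z ↦ z + ψ(z̃) eₙ` preserves Lebesgue measure and carries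
`flat ψ δ ∩ lowerHalf m` onto `W_δ`. In the new variables the equation has the same form, and the
size, the derivatives and the ellipticity of its coefficients `flatCoef` are controlled by the given
bounds. It therefore suffices to prove estimates below a flat boundary and to shear back.

The boundary condition is encoded only by where relations may be tested. In case (D) the gradient
relation `WD` holds against test functions crossing the flat boundary, because the extension of `u`
by zero is in `H¹` (`wd_flat_of_traceZero`), while the equation is tested strictly below it. In case
(N) the roles are exchanged. The sets `gradSet` and `eqnSet` record this, and with them one proof
serves both cases. The bridge between the two is `exists_test_approx`: a cut-off function satisfying
the gradient relation is an `H¹` limit of functions with which the equation may be tested.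

The gradient estimate is the Caccioppoli argument: test with `ζ² u`, where `ζ` is a cutoff with
gradient of size `1/ε`, use ellipticity, and absorb the terms linear in `ζ∇u` (`energy_estimate`,
with cutoffs from `exists_gap_bowl`).

For higher derivatives, difference quotients in tangential directions satisfy the equation up to
bounded errors, so the energy estimate bounds them. In the limit a tangential derivative solves an
equation of the same type with the same boundary condition (`FlatSol.exists_tangential`). The second
normal derivative is then read off from the equation, since `aₙₙ ≥ η` can be inverted
(`FlatSol.exists_sobB_normal`). Induction over a finite chain of shrinking sets gives
`FlatSol.regularity`. Every derivative carries a factor `ε` (`SobB`, `CB`), so the constants are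
independent of the scale and the powers of `ε` come out as claimed.

For higher integrability the test function is `ζ² G(u)` with `G` a regularisation of `|t|^{p-2} t`.
It controls the gradient of a regularised `|u|^{p/2}` in `L²`. The Sobolev inequality in the half
space, obtained by even reflection (`exists_sobolev_lowerHalf`), puts this power in `L^{2n/(n-2)}`,
and hence `u` in `L^q` once the regularisation is removed. -/

lemma sq_eLpNorm_two {α F : Type*} [MeasurableSpace α] [NormedAddCommGroup F] {μ : Measure α}
    (f : α → F) : eLpNorm f 2 μ ^ 2 = ∫⁻ x, ‖f x‖ₑ ^ 2 ∂μ := by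
  have := eLpNorm_nnreal_pow_eq_lintegral (f := f) (μ := μ) (p := 2) (by norm_num)
  norm_num at this
  exact_mod_cast this

/-! ### Translations, averages and mollification in `L²`. -/

lemma tendsto_eLpNorm_translate_sub {f : Eu n → ℝ} (hf : MemLp f 2 volume) :
    Tendsto (fun t => eLpNorm (fun x => f (x - t) - f x) 2 volume) (𝓝 0) (𝓝 0) := by
  have : Fact ((2 : ℝ≥0∞) ≠ ⊤) := ⟨by simp⟩
  let F := hf.toLp f
  have hc : Continuous fun t : Eu n => DomAddAct.mk (-t) +ᵥ F := by
    have h1 : Continuous fun t : Eu n => DomAddAct.mk (-t) :=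
      DomAddAct.mkHomeomorph.continuous.comp continuous_neg
    exact h1.vadd continuous_const
  have h2 : Tendsto (fun t : Eu n => edist (DomAddAct.mk (-t) +ᵥ F) F) (𝓝 0) (𝓝 0) := by
    have h3 := (hc.edist continuous_const (f := fun t : Eu n => DomAddAct.mk (-t) +ᵥ F) (g := fun _ => F)).tendsto 0
    have h4 : DomAddAct.mk (-(0 : Eu n)) +ᵥ F = F := by
      rw [neg_zero, DomAddAct.mk_zero, zero_vadd]
    simpa only [h4, edist_self] using h3
  refine h2.congr fun t => ?_
  rw [DomAddAct.mk_vadd_toLp, Lp.edist_toLp_toLp]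
  congr 1
  ext x
  simp [sub_eq_neg_add]

/-- Averages of the translates of an `L²` function. -/
lemma eLpNorm_average_sub_le {μ : Measure (Eu n)} [IsProbabilityMeasure μ] {f : Eu n → ℝ}
    (hf : MemLp f 2 volume) {δ : ℝ≥0∞}
    (h : ∀ᵐ t ∂μ, eLpNorm (fun x => f (x - t) - f x) 2 volume ≤ δ) :
    AEStronglyMeasurable (fun x => ∫ t, f (x - t) ∂μ) volume ∧
    (∀ᵐ x, Integrable (fun t => f (x - t)) μ) ∧
    eLpNorm (fun x => (∫ t, f (x - t) ∂μ) - f x) 2 volume ≤ δ := by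
  have hm : AEStronglyMeasurable (fun p : Eu n × Eu n => f (p.1 - p.2)) (volume.prod μ) :=
    hf.1.comp_quasiMeasurePreserving (quasiMeasurePreserving_sub_of_right_invariant volume μ)
  have hm1 : AEStronglyMeasurable (fun p : Eu n × Eu n => f p.1) (volume.prod μ) := hf.1.comp_fst
  have hint : ∀ᵐ x, Integrable (fun t => f (x - t)) μ := by
    have h1 : ∫⁻ x, ∫⁻ t, ‖f (x - t)‖ₑ ^ 2 ∂μ ≠ ⊤ := by
      rw [lintegral_lintegral_swap ((hm.enorm.pow_const 2))]
      have : ∀ t : Eu n, ∫⁻ x, ‖f (x - t)‖ₑ ^ 2 = eLpNorm f 2 volume ^ 2 := fun t => by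
        rw [sq_eLpNorm_two]
        exact lintegral_sub_right_eq_self (fun x => ‖f x‖ₑ ^ 2) t
      simp_rw [this]
      simpa using hf.2.ne
    have h2 := ae_lt_top' (by exact (hm.enorm.pow_const 2).lintegral_prod_right') h1
    filter_upwards [h2, hm.prodMk_left] with x hx hx'
    have : MemLp (fun t => f (x - t)) 2 μ := by
      refine ⟨hx', ?_⟩
      rw [← sq_eLpNorm_two] at hx
      simpa using hx
    exact this.integrable (by norm_num)
  refine ⟨hm.integral_prod_right', hint, ?_⟩
  -- Jensen's inequality for the probability measure `μ`, in the form `L¹ ≤ L²`, followed by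
  -- Tonelli.
  have key : eLpNorm (fun x => (∫ t, f (x - t) ∂μ) - f x) 2 volume ^ 2 ≤ δ ^ 2 := by
    rw [sq_eLpNorm_two]
    calc ∫⁻ x, ‖(∫ t, f (x - t) ∂μ) - f x‖ₑ ^ 2
        ≤ ∫⁻ x, ∫⁻ t, ‖f (x - t) - f x‖ₑ ^ 2 ∂μ := by
          refine lintegral_mono_ae ?_
          filter_upwards [hint, hm.prodMk_left] with x hx hx'
          have e1 : (∫ t, f (x - t) ∂μ) - f x = ∫ t, (f (x - t) - f x) ∂μ := by
            rw [integral_sub hx (integrable_const _)]; simp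
          rw [e1, ← sq_eLpNorm_two]
          gcongr
          calc ‖∫ t, (f (x - t) - f x) ∂μ‖ₑ ≤ ∫⁻ t, ‖f (x - t) - f x‖ₑ ∂μ :=
                enorm_integral_le_lintegral_enorm _
            _ = eLpNorm (fun t => f (x - t) - f x) 1 μ := by rw [eLpNorm_one_eq_lintegral_enorm]
            _ ≤ eLpNorm (fun t => f (x - t) - f x) 2 μ :=
                eLpNorm_le_eLpNorm_of_exponent_le (by norm_num)
                  (hx'.sub aestronglyMeasurable_const)
      _ = ∫⁻ t, (∫⁻ x, ‖f (x - t) - f x‖ₑ ^ 2) ∂μ :=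
          lintegral_lintegral_swap ((hm.sub hm1).enorm.pow_const 2)
      _ ≤ ∫⁻ _, δ ^ 2 ∂μ := by
          refine lintegral_mono_ae ?_
          filter_upwards [h] with t ht
          rw [← sq_eLpNorm_two]
          gcongr
      _ = δ ^ 2 := by simp
  exact (ENNReal.pow_le_pow_left_iff (two_ne_zero)).1 key

/-- `∂ᵢu = g` on `W`, tested against `C_c^∞(S)`. -/
def WD (W S : Set (Eu n)) (i : Fin n) (u g : Eu n → ℝ) : Prop :=
  ∀ φ : Eu n → ℝ, IsTestFunction S φ →
    ∫ x in W, u x * partialD i φ x = -∫ x in W, g x * φ x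

/-- The bump is centred at `h • e` and has radius `h / 2`, so one convolution both mollifies and
translates. For `‖e‖ = 1` the shift exceeds the radius, which allows supports to be moved strictly
to one side of a hyperplane, or values to be taken from strictly one side of it; `e = 0` is ordinary
mollification. Where the ball about `x - h • e` lies in `S`, the function `z ↦ ρ (x - z)` is a test
function there, so the derivative of the mollification of `V` is the mollification of `G i`. Both
errors are small by continuity of translations. -/
lemma exists_mollification {V : Eu n → ℝ} {G : Fin n → Eu n → ℝ} (hV : MemLp V 2 volume)
    (hG : ∀ i, MemLp (G i) 2 volume) {S : Set (Eu n)} (hWD : ∀ i, WD univ S i V (G i))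
    {e : Eu n} (he : ‖e‖ ≤ 1) {ε : ℝ} (hε : 0 < ε) :
    ∃ h ∈ Ioo 0 ε, ∃ V' : Eu n → ℝ, ContDiff ℝ ∞ V' ∧
      (∀ K : Set (Eu n), IsCompact K → (∀ x ∉ K, V x = 0) → HasCompactSupport V' ∧
        ∀ x ∈ tsupport V', ∃ z ∈ K, dist x (z + h • e) ≤ h / 2) ∧
      eLpNorm (fun x => V' x - V x) 2 volume ≤ ENNReal.ofReal ε ∧
      ∀ i, ∀ X : Set (Eu n), (∀ x ∈ X, Metric.closedBall (x - h • e) (h / 2) ⊆ S) →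
        MeasurableSet X →
        eLpNorm (fun x => partialD i V' x - G i x) 2 (volume.restrict X) ≤ ENNReal.ofReal ε := by
  have hev : ∀ᶠ t : Eu n in 𝓝 0, eLpNorm (fun x => V (x - t) - V x) 2 volume ≤ ENNReal.ofReal ε ∧
      ∀ i, eLpNorm (fun x => G i (x - t) - G i x) 2 volume ≤ ENNReal.ofReal ε := by
    have h0 : (0 : ℝ≥0∞) < ENNReal.ofReal ε := by simpa using hε
    exact ((tendsto_eLpNorm_translate_sub hV).eventually_le_const h0).and
      (eventually_all.2 fun i => (tendsto_eLpNorm_translate_sub (hG i)).eventually_le_const h0)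
  obtain ⟨r, hr, hball⟩ := Metric.eventually_nhds_iff.1 hev
  -- Points of the bump's support have norm at most `3h/2`, which is below `r` because `2h ≤ r`.
  set h : ℝ := min ε r / 2 with hh
  have hmin : 0 < min ε r := lt_min hε hr
  have hpos : 0 < h := by positivity
  have hhe : h < ε := by have := min_le_left ε r; linarith
  have hhr : 2 * h ≤ r := by have := min_le_right ε r; linarith
  let b : ContDiffBump (h • e) := ⟨h / 4, h / 2, by positivity, by linarith⟩
  set ρ := b.normed volume with hρ
  have hρs : ContDiff ℝ ∞ ρ := b.contDiff_normed
  have hρc : HasCompactSupport ρ := b.hasCompactSupport_normed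
  have hρ0 : ∀ t, 0 ≤ ρ t := b.nonneg_normed
  have hρsupp : tsupport ρ = Metric.closedBall (h • e) (h / 2) := b.tsupport_normed_eq
  have hρint : ∫ t, ρ t = 1 := b.integral_normed
  have hρi : Integrable ρ := hρs.continuous.integrable_of_hasCompactSupport hρc
  -- Convolution with `ρ` is averaging of translates against this probability measure, so
  -- `eLpNorm_average_sub_le` bounds the errors.
  let μ : Measure (Eu n) := volume.withDensity fun t => ENNReal.ofReal (ρ t)
  have hμ : IsProbabilityMeasure μ := by
    constructor
    rw [withDensity_apply _ MeasurableSet.univ, Measure.restrict_univ,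
      ← ofReal_integral_eq_lintegral_ofReal hρi (Eventually.of_forall hρ0), hρint]
    simp
  have hμint : ∀ f : Eu n → ℝ, ∫ t, f t ∂μ = ∫ t, ρ t * f t := fun f => by
    rw [integral_withDensity_eq_integral_toReal_smul]
    · simp [ENNReal.toReal_ofReal (hρ0 _)]
    · exact (hρs.continuous.measurable).ennreal_ofReal
    · simp
  have hμae : ∀ᵐ t ∂μ, dist t 0 < r := by
    rw [ae_withDensity_iff (hρs.continuous.measurable).ennreal_ofReal]
    refine Eventually.of_forall fun t ht => ?_
    have h1 : ρ t ≠ 0 := fun h0 => ht (by simp [h0])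
    have h2 : t ∈ Metric.closedBall (h • e) (h / 2) := hρsupp ▸ subset_tsupport _ h1
    rw [Metric.mem_closedBall] at h2
    have h3 : ‖h • e‖ ≤ h := by
      rw [norm_smul, Real.norm_of_nonneg hpos.le]; nlinarith
    have := dist_triangle t (h • e) 0
    rw [dist_zero_right (h • e)] at this
    linarith
  have hloc : ∀ {f : Eu n → ℝ}, MemLp f 2 volume → LocallyIntegrable f volume :=
    fun hf => hf.locallyIntegrable (by norm_num)
  have hneg : ∀ (F : Eu n → ℝ) x, ∫ t, F (x - t) = ∫ t, F t := fun F x =>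
    integral_sub_left_eq_self F volume x
  let L := ContinuousLinearMap.lsmul ℝ ℝ (E := ℝ)
  let V' : Eu n → ℝ := convolution ρ V L volume
  have hV' : ∀ x, V' x = ∫ t, V (x - t) ∂μ := fun x => by
    rw [hμint]; simp [V', L, convolution]
  have hsm : ContDiff ℝ ∞ V' := hρc.contDiff_convolution_left L hρs (hloc hV)
  have hsub : ∀ K : Set (Eu n), IsCompact K → (∀ x ∉ K, V x = 0) →
      tsupport V' ⊆ tsupport ρ + K := by
    intro K hK hVK
    refine closure_minimal ?_ (hρc.isCompact.add hK).isClosed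
    refine (support_convolution_subset L).trans (add_subset_add (subset_tsupport _) ?_)
    intro x hx
    by_contra hxK
    exact hx (hVK x hxK)
  refine ⟨h, ⟨hpos, hhe⟩, V', hsm, ?_, ?_, ?_⟩
  · intro K hK hVK
    refine ⟨(hρc.isCompact.add hK).of_isClosed_subset (isClosed_tsupport _) (hsub K hK hVK), ?_⟩
    intro x hx
    obtain ⟨t, ht, z, hz, rfl⟩ := hsub K hK hVK hx
    rw [hρsupp, Metric.mem_closedBall] at ht
    refine ⟨z, hz, ?_⟩
    simpa [add_comm z] using ht
  · have := (eLpNorm_average_sub_le (μ := μ) hV (hμae.mono fun t ht => (hball ht).1)).2.2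
    simpa only [← hV'] using this
  · intro i X hX hXm
    have h1 := (eLpNorm_average_sub_le (μ := μ) (hG i) (hμae.mono fun t ht => (hball ht).2 i)).2.2
    refine le_trans (le_trans (le_of_eq ?_) (eLpNorm_restrict_le _ _ volume X)) h1
    refine eLpNorm_congr_ae ?_
    filter_upwards [ae_restrict_mem hXm] with x hx
    congr 1
    have hd := hρc.hasFDerivAt_convolution_left L (hρs.of_le (by simp)) (hloc hV) x
    have hd' : partialD i V' x = ∫ t, partialD i ρ t * V (x - t) := by
      rw [partialD, hd.fderiv, convolution_def, ContinuousLinearMap.integral_apply]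
      · simp [partialD, L, ContinuousLinearMap.precompL_apply]
      · exact (hρc.fderiv ℝ).convolutionExists_left _ (hρs.continuous_fderiv (by simp)) (hloc hV) x
    rw [hd', hμint]
    have htest : IsTestFunction S fun z => ρ (x - z) := by
      have hcont : ContDiff ℝ ∞ fun z => ρ (x - z) := hρs.comp (contDiff_const.sub contDiff_id)
      have hts : tsupport (fun z => ρ (x - z)) ⊆ Metric.closedBall (x - h • e) (h / 2) := by
        refine closure_minimal ?_ Metric.isClosed_closedBall
        intro z hz
        have h2 : x - z ∈ Metric.closedBall (h • e) (h / 2) := hρsupp ▸ subset_tsupport _ hz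
        rw [Metric.mem_closedBall, dist_eq_norm] at h2 ⊢
        rw [← norm_neg]
        have e1 : -(z - (x - h • e)) = x - z - h • e := by abel
        rwa [e1]
      exact ⟨hcont, (isCompact_closedBall _ _).of_isClosed_subset (isClosed_tsupport _) hts,
        hts.trans (hX x hx)⟩
    have h3 := hWD i _ htest
    have h4 : ∀ z, partialD i (fun z => ρ (x - z)) z = -partialD i ρ (x - z) := fun z => by
      have := ((hρs.differentiable (by simp)) (x - z)).hasFDerivAt.comp z
        ((hasFDerivAt_const x z).sub (hasFDerivAt_id z))
      rw [partialD, show (fun z => ρ (x - z)) = ρ ∘ HSub.hSub x from rfl, this.fderiv]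
      simp [partialD]
    simp only [setIntegral_univ, h4, mul_neg, integral_neg, neg_inj] at h3
    rw [← hneg (fun t => partialD i ρ t * V (x - t)) x, ← hneg (fun t => ρ t * G i (x - t)) x]
    simpa [mul_comm] using h3

/-! ### Pairings and limits in `L²`. -/

section LTwo

variable {α : Type*} [MeasurableSpace α] {μ : Measure α}

lemma memLp_bdd_mul {p : ℝ≥0∞} {c f : α → ℝ} {B : ℝ} (hf : MemLp f p μ)
    (hc : AEStronglyMeasurable c μ) (hB : ∀ᵐ x ∂μ, |c x| ≤ B) :
    MemLp (fun x => c x * f x) p μ := by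
  refine hf.of_le_mul (c := B) (hc.mul hf.1) (hB.mono fun x hx => ?_)
  rw [norm_mul]
  exact mul_le_mul_of_nonneg_right hx (norm_nonneg _)

lemma integrable_mul_of_memLp {f g : α → ℝ} (hf : MemLp f 2 μ) (hg : MemLp g 2 μ) :
    Integrable (fun x => f x * g x) μ := hf.integrable_mul hg

lemma abs_integral_mul_le {f g : α → ℝ} (hf : MemLp f 2 μ) (hg : MemLp g 2 μ) :
    |∫ x, f x * g x ∂μ| ≤ lpNorm f 2 μ * lpNorm g 2 μ := by
  have h1 : eLpNorm (f • g) 1 μ ≤ eLpNorm f 2 μ * eLpNorm g 2 μ :=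
    eLpNorm_smul_le_mul_eLpNorm (p := 2) (q := 2) (r := 1) hg.1 hf.1
  have h2 : ‖∫ x, f x * g x ∂μ‖ₑ ≤ eLpNorm f 2 μ * eLpNorm g 2 μ := by
    refine (enorm_integral_le_lintegral_enorm _).trans ?_
    rw [← eLpNorm_one_eq_lintegral_enorm]
    exact h1
  rw [← toReal_eLpNorm hf.1, ← toReal_eLpNorm hg.1, ← ENNReal.toReal_mul]
  have := ENNReal.toReal_mono (ENNReal.mul_ne_top hf.2.ne hg.2.ne) h2
  simpa using this

lemma sq_lpNorm_two {f : α → ℝ} (hf : MemLp f 2 μ) : lpNorm f 2 μ ^ 2 = ∫ x, f x ^ 2 ∂μ := by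
  rw [← toReal_eLpNorm hf.1, ← ENNReal.toReal_pow, sq_eLpNorm_two,
    integral_eq_lintegral_of_nonneg_ae (Eventually.of_forall fun x => sq_nonneg _)
      (hf.1.pow 2)]
  congr 1
  refine lintegral_congr fun x => ?_
  rw [Real.enorm_eq_ofReal_abs, ← ENNReal.ofReal_pow (abs_nonneg _), sq_abs]

/-- Convergence in `L²`. -/
structure L2Lim (μ : Measure α) (f : ℕ → α → ℝ) (g : α → ℝ) : Prop where
  memLp : ∀ j, MemLp (f j) 2 μ
  memLp_lim : MemLp g 2 μ
  tendsto : Tendsto (fun j => eLpNorm (fun x => f j x - g x) 2 μ) atTop (𝓝 0)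

namespace L2Lim

variable {f f' : ℕ → α → ℝ} {g g' : α → ℝ}

lemma of_le (hf : ∀ j, MemLp (f j) 2 μ) (hg : MemLp g 2 μ)
    (h : ∀ j : ℕ, eLpNorm (fun x => f j x - g x) 2 μ ≤ ENNReal.ofReal (1 / ((j : ℝ) + 1))) :
    L2Lim μ f g := by
  refine ⟨hf, hg, tendsto_of_tendsto_of_tendsto_of_le_of_le tendsto_const_nhds ?_
    (fun _ => zero_le) h⟩
  have := ENNReal.tendsto_ofReal (tendsto_one_div_add_atTop_nhds_zero_nat (𝕜 := ℝ))
  simpa using this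

lemma tendsto_lpNorm_sub (h : L2Lim μ f g) :
    Tendsto (fun j => lpNorm (fun x => f j x - g x) 2 μ) atTop (𝓝 0) := by
  have h1 := (ENNReal.tendsto_toReal ENNReal.zero_ne_top).comp h.tendsto
  simp only [ENNReal.toReal_zero] at h1
  refine h1.congr fun j => ?_
  exact toReal_eLpNorm ((h.memLp j).1.sub h.memLp_lim.1)

lemma of_lpNorm (hf : ∀ j, MemLp (f j) 2 μ) (hg : MemLp g 2 μ)
    (h : Tendsto (fun j => lpNorm (fun x => f j x - g x) 2 μ) atTop (𝓝 0)) : L2Lim μ f g := by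
  refine ⟨hf, hg, ?_⟩
  have h1 := ENNReal.tendsto_ofReal h
  simp only [ENNReal.ofReal_zero] at h1
  exact h1.congr fun _ => ofReal_lpNorm ((hf _).sub hg)

lemma mono {ν : Measure α} (h : L2Lim μ f g) (hν : ν ≤ μ) : L2Lim ν f g :=
  ⟨fun _ => (h.memLp _).mono_measure hν, h.memLp_lim.mono_measure hν,
    tendsto_of_tendsto_of_tendsto_of_le_of_le tendsto_const_nhds h.tendsto (fun _ => zero_le)
      fun _ => eLpNorm_mono_measure _ hν⟩

lemma const (hg : MemLp g 2 μ) : L2Lim μ (fun _ => g) g :=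
  ⟨fun _ => hg, hg, by simp⟩

lemma congr (h : L2Lim μ f g) (hf : ∀ j, f j =ᵐ[μ] f' j) (hg : g =ᵐ[μ] g') : L2Lim μ f' g' :=
  ⟨fun j => (h.memLp j).ae_eq (hf j), h.memLp_lim.ae_eq hg,
    h.tendsto.congr fun j => eLpNorm_congr_ae ((hf j).sub hg)⟩

lemma comp {ns : ℕ → ℕ} (h : L2Lim μ f g) (hns : Tendsto ns atTop atTop) :
    L2Lim μ (fun j => f (ns j)) g :=
  ⟨fun _ => h.memLp _, h.memLp_lim, h.tendsto.comp hns⟩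

lemma add (h : L2Lim μ f g) (h' : L2Lim μ f' g') :
    L2Lim μ (fun j x => f j x + f' j x) (fun x => g x + g' x) := by
  refine ⟨fun j => (h.memLp j).add (h'.memLp j), h.memLp_lim.add h'.memLp_lim, ?_⟩
  have h1 := h.tendsto.add h'.tendsto
  rw [add_zero] at h1
  refine tendsto_of_tendsto_of_tendsto_of_le_of_le tendsto_const_nhds h1 (fun _ => zero_le) ?_
  intro j
  have h2 : (fun x => f j x + f' j x - (g x + g' x)) = (f j - g) + (f' j - g') := by
    ext x
    simp only [Pi.add_apply, Pi.sub_apply]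
    ring
  have h3 := eLpNorm_add_le ((h.memLp j).sub h.memLp_lim).1
    ((h'.memLp j).sub h'.memLp_lim).1 (p := 2) (by norm_num)
  rw [← h2] at h3
  exact h3

lemma bdd_mul {c : α → ℝ} {B : ℝ} (h : L2Lim μ f g) (hc : AEStronglyMeasurable c μ)
    (hB : ∀ᵐ x ∂μ, |c x| ≤ B) : L2Lim μ (fun j x => c x * f j x) (fun x => c x * g x) := by
  refine ⟨fun j => memLp_bdd_mul (h.memLp j) hc hB, memLp_bdd_mul h.memLp_lim hc hB, ?_⟩
  have h1 := ENNReal.Tendsto.const_mul (a := ENNReal.ofReal B) h.tendsto (Or.inr (by simp))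
  rw [mul_zero] at h1
  refine tendsto_of_tendsto_of_tendsto_of_le_of_le tendsto_const_nhds h1 (fun _ => zero_le) ?_
  intro j
  refine eLpNorm_le_mul_eLpNorm_of_ae_le_mul (hB.mono fun x hx => ?_) 2
  rw [← mul_sub, norm_mul]
  exact mul_le_mul_of_nonneg_right hx (norm_nonneg _)

lemma tendsto_lpNorm (h : L2Lim μ f g) :
    Tendsto (fun j => lpNorm (f j) 2 μ) atTop (𝓝 (lpNorm g 2 μ)) := by
  rw [tendsto_iff_dist_tendsto_zero]
  refine squeeze_zero (fun _ => dist_nonneg) (fun j => ?_) h.tendsto_lpNorm_sub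
  rw [Real.dist_eq, abs_sub_le_iff]
  have h1 := lpNorm_le_lpNorm_add_lpNorm_sub (f := f j) h.memLp_lim one_le_two
  have h2 := lpNorm_le_lpNorm_add_lpNorm_sub (f := g) (h.memLp j) one_le_two
  have h3 : lpNorm (f j - g) 2 μ = lpNorm (fun x => f j x - g x) 2 μ := rfl
  have h4 := lpNorm_sub_comm (f j) g 2 μ
  constructor <;> linarith

lemma integral_mul {F : α → ℝ} (h : L2Lim μ f g) (hF : MemLp F 2 μ) :
    Tendsto (fun j => ∫ x, F x * f j x ∂μ) atTop (𝓝 (∫ x, F x * g x ∂μ)) := by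
  rw [tendsto_iff_dist_tendsto_zero]
  have h1 := h.tendsto_lpNorm_sub.const_mul (lpNorm F 2 μ)
  rw [mul_zero] at h1
  refine squeeze_zero (fun _ => dist_nonneg) (fun j => ?_) h1
  rw [Real.dist_eq, ← integral_sub (integrable_mul_of_memLp hF (h.memLp j))
    (integrable_mul_of_memLp hF h.memLp_lim)]
  simp_rw [← mul_sub]
  exact abs_integral_mul_le hF ((h.memLp j).sub h.memLp_lim)

lemma exists_ae (h : L2Lim μ f g) : ∃ ns : ℕ → ℕ, StrictMono ns ∧
    ∀ᵐ x ∂μ, Tendsto (fun i => f (ns i) x) atTop (𝓝 (g x)) :=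
  (tendstoInMeasure_of_tendsto_eLpNorm (by norm_num) (fun j => (h.memLp j).1) h.memLp_lim.1
    h.tendsto).exists_seq_tendsto_ae

end L2Lim

end LTwo

/-! ### Test functions of class `C¹` and the calculus of weak derivatives. -/

variable {n : ℕ}

/-- The class `C_c^1(S)`. -/
def IsC1Test (S : Set (Eu n)) (φ : Eu n → ℝ) : Prop :=
  ContDiff ℝ 1 φ ∧ HasCompactSupport φ ∧ tsupport φ ⊆ S

lemma IsTestFunction.c1 {S : Set (Eu n)} {φ : Eu n → ℝ} (h : IsTestFunction S φ) :
    IsC1Test S φ := ⟨h.1.of_le (by simp), h.2⟩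

lemma IsTestFunction.mono {S S' : Set (Eu n)} {φ : Eu n → ℝ} (h : IsTestFunction S φ)
    (hS : S ⊆ S') : IsTestFunction S' φ := ⟨h.1, h.2.1, h.2.2.trans hS⟩

lemma IsC1Test.mono {S S' : Set (Eu n)} {φ : Eu n → ℝ} (h : IsC1Test S φ)
    (hS : S ⊆ S') : IsC1Test S' φ := ⟨h.1, h.2.1, h.2.2.trans hS⟩

lemma tsupport_partialD_subset (i : Fin n) (φ : Eu n → ℝ) :
    tsupport (partialD i φ) ⊆ tsupport φ := tsupport_fderiv_apply_subset ℝ _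

lemma partialD_eq_zero {i : Fin n} {φ : Eu n → ℝ} {x : Eu n} (hx : x ∉ tsupport φ) :
    partialD i φ x = 0 :=
  image_eq_zero_of_notMem_tsupport fun h => hx (tsupport_partialD_subset i φ h)

lemma contDiff_partialD {φ : Eu n → ℝ} (hφ : ContDiff ℝ ∞ φ) (i : Fin n) :
    ContDiff ℝ ∞ (partialD i φ) :=
  (hφ.fderiv_right (m := ∞) (by simp)).clm_apply contDiff_const

lemma IsTestFunction.partialD {S : Set (Eu n)} {φ : Eu n → ℝ} (h : IsTestFunction S φ)
    (i : Fin n) : IsTestFunction S (partialD i φ) :=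
  ⟨contDiff_partialD h.1 i, h.2.1.fderiv_apply ℝ _, (tsupport_partialD_subset i φ).trans h.2.2⟩

lemma continuous_partialD {φ : Eu n → ℝ} (hφ : ContDiff ℝ 1 φ) (i : Fin n) :
    Continuous (partialD i φ) :=
  (hφ.continuous_fderiv (by simp)).clm_apply continuous_const

lemma IsC1Test.memLp {S : Set (Eu n)} {φ : Eu n → ℝ} (h : IsC1Test S φ) {p : ℝ≥0∞}
    {μ : Measure (Eu n)} [IsFiniteMeasureOnCompacts μ] : MemLp φ p μ :=
  h.1.continuous.memLp_of_hasCompactSupport h.2.1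

lemma IsC1Test.memLp_partialD {S : Set (Eu n)} {φ : Eu n → ℝ} (h : IsC1Test S φ) (i : Fin n)
    {p : ℝ≥0∞} {μ : Measure (Eu n)} [IsFiniteMeasureOnCompacts μ] :
    MemLp (partialD i φ) p μ :=
  (continuous_partialD h.1 i).memLp_of_hasCompactSupport (h.2.1.fderiv_apply ℝ _)

lemma IsC1Test.bound {S : Set (Eu n)} {φ : Eu n → ℝ} (h : IsC1Test S φ) :
    ∃ B, ∀ x, |φ x| ≤ B := by
  obtain ⟨B, hB⟩ := h.1.continuous.bounded_above_of_compact_support h.2.1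
  exact ⟨B, hB⟩

lemma IsC1Test.bound_partialD {S : Set (Eu n)} {φ : Eu n → ℝ} (h : IsC1Test S φ) (i : Fin n) :
    ∃ B, ∀ x, |partialD i φ x| ≤ B := by
  obtain ⟨B, hB⟩ := (continuous_partialD h.1 i).bounded_above_of_compact_support
    (h.2.1.fderiv_apply ℝ _)
  exact ⟨B, hB⟩

lemma partialD_comm {φ : Eu n → ℝ} (hφ : ContDiff ℝ ∞ φ) (i k : Fin n) :
    partialD i (partialD k φ) = partialD k (partialD i φ) := by
  ext x
  have hd : Differentiable ℝ (fderiv ℝ φ) :=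
    (hφ.fderiv_right (m := ∞) (by simp)).differentiable (by simp)
  have h1 : ∀ (v w : Eu n), fderiv ℝ (fun y => fderiv ℝ φ y v) x w
      = fderiv ℝ (fderiv ℝ φ) x w v := fun v w => by
    rw [fderiv_clm_apply (hd x) (differentiableAt_const v)]
    simp
  have h2 := (hφ.contDiffAt (x := x)).isSymmSndFDerivAt
    (by simpa using WithTop.coe_le_coe.2 (le_top : (2 : ℕ∞) ≤ ⊤))
  exact ((h1 _ _).trans (h2 _ _)).trans (h1 _ _).symm

lemma partialD_mul {f g : Eu n → ℝ} {x : Eu n} (hf : DifferentiableAt ℝ f x)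
    (hg : DifferentiableAt ℝ g x) (i : Fin n) :
    partialD i (fun y => f y * g y) x = f x * partialD i g x + partialD i f x * g x := by
  rw [partialD, fderiv_fun_mul hf hg]
  simp [partialD, mul_comm]

lemma integral_mul_partialD {f φ : Eu n → ℝ} (hf : ContDiff ℝ 1 f) {S : Set (Eu n)}
    (hφ : IsC1Test S φ) (i : Fin n) :
    ∫ x, f x * partialD i φ x = -∫ x, partialD i f x * φ x := by
  refine integral_mul_fderiv_eq_neg_fderiv_mul_of_integrable ?_ ?_ ?_
    (fun x _ => hf.differentiable (by simp) x) (fun x _ => hφ.1.differentiable (by simp) x)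
  · exact ((continuous_partialD hf i).mul hφ.1.continuous).integrable_of_hasCompactSupport
      hφ.2.1.mul_left
  · exact (hf.continuous.mul (continuous_partialD hφ.1 i)).integrable_of_hasCompactSupport
      ((hφ.2.1.fderiv_apply ℝ _).mul_left)
  · exact (hf.continuous.mul hφ.1.continuous).integrable_of_hasCompactSupport hφ.2.1.mul_left

/-- Mollification with `e = 0`, at a scale below the distance from the support to the complement of
`S`. Products with coefficients and compositions with the shear are only `C¹`, so identities given
for smooth test functions have to be extended to this class. -/
lemma IsC1Test.exists_smooth {S : Set (Eu n)} (hS : IsOpen S) {φ : Eu n → ℝ}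
    (hφ : IsC1Test S φ) : ∃ w : ℕ → Eu n → ℝ, (∀ j, IsTestFunction S (w j)) ∧
      L2Lim volume w φ ∧ ∀ i, L2Lim volume (fun j => partialD i (w j)) (partialD i φ) := by
  obtain ⟨r, hr, hrS⟩ := IsCompact.exists_cthickening_subset_open hφ.2.1 hS hφ.2.2
  have key : ∀ j : ℕ, ∃ w, IsTestFunction S w ∧
      eLpNorm (fun x => w x - φ x) 2 volume ≤ ENNReal.ofReal (1 / ((j : ℝ) + 1)) ∧
      ∀ i, eLpNorm (fun x => partialD i w x - partialD i φ x) 2 volume ≤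
        ENNReal.ofReal (1 / ((j : ℝ) + 1)) := by
    intro j
    have hj : 0 < min (1 / ((j : ℝ) + 1)) r := lt_min (by positivity) hr
    obtain ⟨h, hh, V, hV, hVK, hV1, hV2⟩ := exists_mollification (n := n) (S := univ) (e := 0)
      (hφ.memLp (μ := volume) (p := 2)) (fun i => hφ.memLp_partialD i (μ := volume) (p := 2))
      (fun i ψ hψ => by
        simpa using integral_mul_partialD hφ.1 hψ.c1 i) (by simp) hj
    obtain ⟨hVc, hVs⟩ := hVK (tsupport φ) hφ.2.1 fun x hx => image_eq_zero_of_notMem_tsupport hx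
    refine ⟨V, ⟨hV, hVc, fun x hx => hrS ?_⟩, hV1.trans ?_, fun i => (le_of_eq_of_le ?_
      (hV2 i univ (by simp) MeasurableSet.univ)).trans ?_⟩
    · obtain ⟨z, hz, hxz⟩ := hVs x hx
      refine Metric.mem_cthickening_of_dist_le x z r _ hz ?_
      have := min_le_right (1 / ((j : ℝ) + 1)) r
      simp only [smul_zero, add_zero] at hxz
      linarith [hh.1, hh.2]
    · exact ENNReal.ofReal_le_ofReal (min_le_left _ _)
    · simp
    · exact ENNReal.ofReal_le_ofReal (min_le_left _ _)
  choose w hw1 hw2 hw3 using key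
  exact ⟨w, hw1, .of_le (fun j => (hw1 j).c1.memLp) hφ.memLp hw2, fun i =>
    .of_le (fun j => (hw1 j).c1.memLp_partialD i) (hφ.memLp_partialD i) (fun j => hw3 j i)⟩

lemma WD.c1 {W S : Set (Eu n)} (hS : IsOpen S) {i : Fin n} {u g : Eu n → ℝ}
    (hu : MemLp u 2 (volume.restrict W)) (hg : MemLp g 2 (volume.restrict W))
    (h : WD W S i u g) {φ : Eu n → ℝ} (hφ : IsC1Test S φ) :
    ∫ x in W, u x * partialD i φ x = -∫ x in W, g x * φ x := by
  obtain ⟨w, hw, hw1, hw2⟩ := hφ.exists_smooth hS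
  have h1 := ((hw2 i).mono (Measure.restrict_le_self (s := W))).integral_mul hu
  have h2 := (hw1.mono (Measure.restrict_le_self (s := W))).integral_mul hg
  exact tendsto_nhds_unique h1 (h2.neg.congr fun j => (h _ (hw j)).symm)

/-- `c φ` is a test function if `c` is `C¹` where `φ` lives. -/
lemma IsC1Test.mul_left {S : Set (Eu n)} (hS : IsOpen S) {c φ : Eu n → ℝ}
    (hc : ContDiffOn ℝ 1 c S) (hφ : IsC1Test S φ) :
    IsC1Test S (fun x => c x * φ x) ∧ ∀ i x, partialD i (fun x => c x * φ x) x =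
      c x * partialD i φ x + partialD i c x * φ x := by
  have hloc : ∀ x ∉ S, (fun x => c x * φ x) =ᶠ[𝓝 x] fun _ => 0 := fun x hx => by
    have : x ∉ tsupport φ := fun h => hx (hφ.2.2 h)
    filter_upwards [notMem_tsupport_iff_eventuallyEq.1 this] with y hy
    simp [hy]
  have hts : tsupport (fun x => c x * φ x) ⊆ tsupport φ := closure_mono fun x hx => by
    intro h0; exact hx (by simp [h0])
  refine ⟨⟨contDiff_iff_contDiffAt.2 fun x => ?_, hφ.2.1.mul_left, hts.trans hφ.2.2⟩, ?_⟩
  · by_cases hx : x ∈ S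
    · exact (hc.contDiffAt (hS.mem_nhds hx)).mul hφ.1.contDiffAt
    · exact contDiffAt_const.congr_of_eventuallyEq (hloc x hx)
  · intro i x
    by_cases hx : x ∈ S
    · exact partialD_mul ((hc.contDiffAt (hS.mem_nhds hx)).differentiableAt (by simp))
        (hφ.1.differentiable (by simp) x) i
    · have h1 : x ∉ tsupport φ := fun h => hx (hφ.2.2 h)
      rw [partialD_eq_zero fun h => h1 (hts h), partialD_eq_zero h1,
        image_eq_zero_of_notMem_tsupport h1]
      simp

lemma WD.mul_c1 {W S : Set (Eu n)} (hS : IsOpen S) {i : Fin n} {u g c : Eu n → ℝ}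
    (hu : MemLp u 2 (volume.restrict W)) (hg : MemLp g 2 (volume.restrict W))
    (hc : ContDiffOn ℝ 1 c S) (hcm : ∃ B, ∀ x ∈ W, |partialD i c x| ≤ B) (hWm : MeasurableSet W)
    (hcW : ContinuousOn (partialD i c) W)
    (h : WD W S i u g) : WD W S i (fun x => c x * u x)
      (fun x => c x * g x + partialD i c x * u x) := by
  intro φ hφ
  obtain ⟨hm, hd⟩ := hφ.c1.mul_left hS hc
  have h1 := h.c1 hS hu hg hm
  obtain ⟨B, hB⟩ := hcm
  have i1 : Integrable (fun x => u x * partialD i (fun x => c x * φ x) x) (volume.restrict W) :=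
    integrable_mul_of_memLp hu (hm.memLp_partialD i)
  have i2 : Integrable (fun x => partialD i c x * u x * φ x) (volume.restrict W) :=
    integrable_mul_of_memLp (memLp_bdd_mul hu (hcW.aestronglyMeasurable hWm)
      ((ae_restrict_mem hWm).mono hB)) hφ.c1.memLp
  have i3 : Integrable (fun x => g x * (c x * φ x)) (volume.restrict W) :=
    integrable_mul_of_memLp hg hm.memLp
  have e1 : ∀ x, c x * u x * partialD i φ x =
      u x * partialD i (fun x => c x * φ x) x - partialD i c x * u x * φ x := fun x => by
    rw [hd]; ring
  have e2 : ∀ x, (c x * g x + partialD i c x * u x) * φ x =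
      g x * (c x * φ x) + partialD i c x * u x * φ x := fun x => by ring
  simp_rw [e1, e2]
  rw [integral_sub i1 i2, integral_add i3 i2, h1]
  ring

lemma ae_eq_of_forall_test {W : Set (Eu n)} (hW : IsOpen W) {f g : Eu n → ℝ}
    (hf : LocallyIntegrableOn f W) (hg : LocallyIntegrableOn g W)
    (h : ∀ φ, IsTestFunction W φ → ∫ x in W, f x * φ x = ∫ x in W, g x * φ x) :
    f =ᵐ[volume.restrict W] g := by
  have key := hW.ae_eq_zero_of_integral_contDiff_smul_eq_zero (μ := volume) (f := fun x => f x - g x)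
    (hf.sub hg) fun φ h1 h2 h3 => by
      have hK : ∀ {F : Eu n → ℝ}, LocallyIntegrableOn F W →
          Integrable (fun x => F x * φ x) (volume.restrict W) := fun {F} hF => by
        have h4 := hF.integrableOn_compact_subset h3 h2
        have h5 : IntegrableOn (fun x => F x * φ x) (tsupport φ) :=
          (h4.mul_continuousOn h1.continuous.continuousOn h2)
        refine (integrableOn_iff_integrable_of_support_subset ?_).1 h5 |>.integrableOn
        intro x hx
        exact subset_tsupport _ fun h0 => hx (by simp [h0])
      have h4 := h φ ⟨h1, h2, h3⟩
      rw [← setIntegral_eq_integral_of_forall_compl_eq_zero (s := W)]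
      · simp_rw [smul_eq_mul, mul_comm (φ _), sub_mul]
        rw [integral_sub (hK hf) (hK hg), h4, sub_self]
      · intro x hx
        rw [image_eq_zero_of_notMem_tsupport fun h5 => hx (h3 h5), zero_smul]
  rw [Filter.EventuallyEq, ae_restrict_iff' hW.measurableSet]
  filter_upwards [key] with x hx hxW
  linarith [hx hxW]

lemma locallyIntegrableOn_of_memLp {W : Set (Eu n)} {f : Eu n → ℝ}
    (hf : MemLp f 2 (volume.restrict W)) : LocallyIntegrableOn f W :=
  locallyIntegrableOn_of_locallyIntegrable_restrict (hf.locallyIntegrable (by norm_num))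

lemma WD.unique {W : Set (Eu n)} (hW : IsOpen W) {i : Fin n} {u g g' : Eu n → ℝ}
    (hg : MemLp g 2 (volume.restrict W)) (hg' : MemLp g' 2 (volume.restrict W))
    (h : WD W W i u g) (h' : WD W W i u g') : g =ᵐ[volume.restrict W] g' :=
  ae_eq_of_forall_test hW (locallyIntegrableOn_of_memLp hg) (locallyIntegrableOn_of_memLp hg')
    fun φ hφ => neg_injective ((h φ hφ).symm.trans (h' φ hφ))

/-- Symmetry of second derivatives, applied to the test function. One mixed derivative of `u`
existing as a function is enough to produce the other, which the normal derivative estimate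
exploits. -/
lemma WD.comm {W S : Set (Eu n)} {i k : Fin n} {u gi gk h : Eu n → ℝ} (hi : WD W S i u gi)
    (hk : WD W S k u gk) (hki : WD W S i gk h) : WD W S k gi h := by
  intro φ hφ
  have h1 := hi _ (hφ.partialD k)
  have h2 := hk _ (hφ.partialD i)
  have h3 := hki φ hφ
  rw [partialD_comm hφ.1] at h1
  linarith

lemma WD.congr {W S : Set (Eu n)} {i : Fin n} {u u' g g' : Eu n → ℝ} (h : WD W S i u g)
    (hu : u =ᵐ[volume.restrict W] u') (hg : g =ᵐ[volume.restrict W] g') : WD W S i u' g' := by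
  intro φ hφ
  have h1 : ∫ x in W, u' x * partialD i φ x = ∫ x in W, u x * partialD i φ x :=
    integral_congr_ae (hu.mono fun x hx => by simp [hx])
  have h2 : ∫ x in W, g' x * φ x = ∫ x in W, g x * φ x :=
    integral_congr_ae (hg.mono fun x hx => by simp [hx])
  rw [h1, h2, h φ hφ]

lemma setIntegral_eq_of_tsupport {W W' S : Set (Eu n)} (hW : MeasurableSet W) (hWW : W' ⊆ W)
    (hS : W ∩ S ⊆ W') {F φ : Eu n → ℝ} (hφ : tsupport φ ⊆ S) (hF : ∀ x ∉ tsupport φ, F x = 0) :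
    ∫ x in W, F x = ∫ x in W', F x :=
  setIntegral_eq_of_subset_of_forall_sdiff_eq_zero hW hWW fun x hx =>
    hF x fun h => hx.2 (hS ⟨hx.1, hφ h⟩)

/-- The condition `W ∩ S' ⊆ W'` is weaker than `S' ⊆ W'`: the new test functions may cross the
boundary of `W'`, provided they do so only where `W` ends as well. This keeps the information about
the flat boundary when the domain shrinks. -/
lemma WD.restrict {W W' S S' : Set (Eu n)} (hW : MeasurableSet W) (hWW : W' ⊆ W) (hSS : S' ⊆ S)
    (hS : W ∩ S' ⊆ W') {i : Fin n} {u g : Eu n → ℝ} (h : WD W S i u g) : WD W' S' i u g := by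
  intro φ hφ
  rw [← setIntegral_eq_of_tsupport hW hWW hS hφ.2.2, ← setIntegral_eq_of_tsupport hW hWW hS hφ.2.2,
    h φ (hφ.mono hSS)]
  · intro x hx
    rw [image_eq_zero_of_notMem_tsupport hx, mul_zero]
  · intro x hx
    rw [partialD_eq_zero hx, mul_zero]

lemma WD.add {W S : Set (Eu n)} {i : Fin n} {u u' g g' : Eu n → ℝ}
    (hu : MemLp u 2 (volume.restrict W)) (hg : MemLp g 2 (volume.restrict W))
    (hu' : MemLp u' 2 (volume.restrict W)) (hg' : MemLp g' 2 (volume.restrict W))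
    (h : WD W S i u g) (h' : WD W S i u' g') :
    WD W S i (fun x => u x + u' x) (fun x => g x + g' x) := by
  intro φ hφ
  simp_rw [add_mul]
  rw [integral_add (integrable_mul_of_memLp hu (hφ.c1.memLp_partialD i))
      (integrable_mul_of_memLp hu' (hφ.c1.memLp_partialD i)),
    integral_add (integrable_mul_of_memLp hg hφ.c1.memLp)
      (integrable_mul_of_memLp hg' hφ.c1.memLp), h φ hφ, h' φ hφ]
  ring

lemma WD.const_mul {W S : Set (Eu n)} {i : Fin n} {u g : Eu n → ℝ} (h : WD W S i u g) (c : ℝ) :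
    WD W S i (fun x => c * u x) (fun x => c * g x) := by
  intro φ hφ
  simp_rw [mul_assoc]
  rw [integral_const_mul, integral_const_mul, h φ hφ]
  ring

/-! ### The chain rule for weak derivatives. -/

section Chain

variable {n : ℕ}

lemma WD.univ_indicator {W S : Set (Eu n)} (hW : MeasurableSet W) {i : Fin n} {u g : Eu n → ℝ}
    (h : WD W S i u g) : WD univ S i (W.indicator u) (W.indicator g) := by
  intro φ hφ
  have e : ∀ f ψ : Eu n → ℝ, ∫ x in univ, W.indicator f x * ψ x = ∫ x in W, f x * ψ x := by
    intro f ψ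
    rw [setIntegral_univ, ← integral_indicator hW]
    congr 1
    ext x
    by_cases hx : x ∈ W <;> simp [hx]
  rw [e, e, h φ hφ]

lemma partialD_comp {G : ℝ → ℝ} {f : Eu n → ℝ} {x : Eu n} (hG : DifferentiableAt ℝ G (f x))
    (hf : DifferentiableAt ℝ f x) (i : Fin n) :
    partialD i (fun y => G (f y)) x = deriv G (f x) * partialD i f x := by
  have := (hG.hasDerivAt.hasFDerivAt.comp x hf.hasFDerivAt).fderiv
  rw [partialD, show (fun y => G (f y)) = G ∘ f from rfl, this]
  simp [partialD, mul_comm]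

/-- Chain rule for weak derivatives. -/
lemma WD.chain_univ {S : Set (Eu n)} (hS : IsOpen S) {u : Eu n → ℝ} {g : Fin n → Eu n → ℝ}
    (hu : MemLp u 2 volume) (hg : ∀ i, MemLp (g i) 2 volume)
    (h : ∀ i, WD univ S i u (g i)) {G : ℝ → ℝ} (hG : ContDiff ℝ 1 G) {B : ℝ}
    (hB : ∀ t, |deriv G t| ≤ B) (i : Fin n) :
    WD univ S i (fun x => G (u x)) (fun x => deriv G (u x) * g i x) := by
  intro φ hφ
  rw [setIntegral_univ, setIntegral_univ]
  have hB0 : 0 ≤ B := (abs_nonneg _).trans (hB 0)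
  obtain ⟨r, hr, hrS⟩ := IsCompact.exists_cthickening_subset_open hφ.2.1 hS hφ.2.2
  have hK : MeasurableSet (tsupport φ) := (isClosed_tsupport _).measurableSet
  -- The gradient relation is available only in `S`, so the derivatives of the mollifications
  -- converge only on the support of `φ`, while the functions themselves converge everywhere.
  have key : ∀ j : ℕ, ∃ w : Eu n → ℝ, ContDiff ℝ ∞ w ∧ MemLp w 2 volume ∧
      eLpNorm (fun x => w x - u x) 2 volume ≤ ENNReal.ofReal (1 / ((j : ℝ) + 1)) ∧
      eLpNorm (fun x => partialD i w x - g i x) 2 (volume.restrict (tsupport φ)) ≤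
        ENNReal.ofReal (1 / ((j : ℝ) + 1)) := by
    intro j
    have hj : 0 < min (1 / ((j : ℝ) + 1)) r := lt_min (by positivity) hr
    obtain ⟨k, hk, V, hV, -, hV1, hV2⟩ := exists_mollification hu hg h (e := 0) (by simp) hj
    refine ⟨V, hV, ?_, hV1.trans (ENNReal.ofReal_le_ofReal (min_le_left _ _)),
      (hV2 i _ ?_ hK).trans (ENNReal.ofReal_le_ofReal (min_le_left _ _))⟩
    · have h1 : MemLp (fun x => V x - u x) 2 volume :=
        ⟨hV.continuous.aestronglyMeasurable.sub hu.1, hV1.trans_lt (by simp)⟩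
      have := h1.add hu
      refine this.ae_eq (Eventually.of_forall fun x => by simp)
    · intro x hx y hy
      refine hrS (Metric.mem_cthickening_of_dist_le y x r _ hx ?_)
      have h1 := min_le_right (1 / ((j : ℝ) + 1)) r
      simp only [smul_zero, sub_zero, Metric.mem_closedBall] at hy
      linarith [hk.1, hk.2]
  choose w hw1 hw2 hw3 hw4 using key
  have hwm : ∀ j, MemLp (partialD i (w j)) 2 (volume.restrict (tsupport φ)) := fun j => by
    have hc := continuous_partialD ((hw1 j).of_le (by simp)) i
    have : IsFiniteMeasure (volume.restrict (tsupport φ)) := ⟨by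
      rw [Measure.restrict_apply_univ]; exact hφ.2.1.isCompact.measure_lt_top⟩
    obtain ⟨C, hC⟩ := hφ.2.1.isCompact.exists_bound_of_continuousOn hc.continuousOn
    exact MemLp.of_bound hc.aestronglyMeasurable C ((ae_restrict_mem hK).mono hC)
  have L1 : L2Lim volume w u := .of_le hw2 hu hw3
  have L2 : L2Lim (volume.restrict (tsupport φ)) (fun j => partialD i (w j)) (g i) :=
    .of_le hwm ((hg i).mono_measure Measure.restrict_le_self) hw4
  obtain ⟨ns, hns, hae⟩ := L1.exists_ae
  have hGL : ∀ s t, |G s - G t| ≤ B * |s - t| := fun s t => by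
    have := Convex.norm_image_sub_le_of_norm_deriv_le (f := G) (s := univ) (x := t) (y := s) (C := B)
      (fun x _ => hG.differentiable (by simp) x) (fun x _ => hB x) convex_univ trivial trivial
    simpa using this
  have hGm : ∀ j, Continuous fun x => G (w j x) := fun j => hG.continuous.comp (hw1 j).continuous
  have hDc : Continuous (deriv G) := hG.continuous_deriv (by simp)
  -- left side
  have hL : Tendsto (fun j => ∫ x, G (w j x) * partialD i φ x) atTop
      (𝓝 (∫ x, G (u x) * partialD i φ x)) := by
    obtain ⟨M, hM⟩ := hφ.c1.bound_partialD i
    have i1 : ∀ v : Eu n → ℝ, MemLp v 2 volume →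
        Integrable (fun x => G (v x) * partialD i φ x) := fun v hv => by
      have h1 : MemLp (fun x => G (v x) - G 0) 2 volume :=
        hv.of_le_mul (c := B) ((hG.continuous.comp_aestronglyMeasurable hv.1).sub
          aestronglyMeasurable_const) (Eventually.of_forall fun x => by simpa using hGL (v x) 0)
      have h2 := integrable_mul_of_memLp h1 (hφ.c1.memLp_partialD i (μ := volume) (p := 2))
      have h3 : Integrable (partialD i φ) volume :=
        memLp_one_iff_integrable.1 (hφ.c1.memLp_partialD i)
      refine (h2.add (h3.const_mul (G 0))).congr (Eventually.of_forall fun x => ?_)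
      simp only [Pi.add_apply]; ring
    rw [tendsto_iff_dist_tendsto_zero]
    have h1 := L1.tendsto_lpNorm_sub.const_mul (B * lpNorm (partialD i φ) 2 volume)
    rw [mul_zero] at h1
    refine squeeze_zero (fun _ => dist_nonneg) (fun j => ?_) h1
    rw [Real.dist_eq, ← integral_sub (i1 _ (hw2 j)) (i1 _ hu)]
    have h2 : MemLp (fun x => |w j x - u x|) 2 volume := ((hw2 j).sub hu).abs
    have h3 : MemLp (fun x => |partialD i φ x|) 2 volume := (hφ.c1.memLp_partialD i).abs
    have h4 := abs_integral_mul_le h3 h2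
    rw [lpNorm_fun_abs (hφ.c1.memLp_partialD i (p := 2)).1,
      lpNorm_fun_abs (f := fun x => w j x - u x) ((hw2 j).1.sub hu.1)] at h4
    calc |∫ x, (G (w j x) * partialD i φ x - G (u x) * partialD i φ x)|
        ≤ ∫ x, B * (|partialD i φ x| * |w j x - u x|) := by
          refine norm_integral_le_of_norm_le (f := fun x => G (w j x) * partialD i φ x - G (u x) * partialD i φ x) ((integrable_mul_of_memLp h3 h2).const_mul B)
            (Eventually.of_forall fun x => ?_)
          rw [← sub_mul, norm_mul, Real.norm_eq_abs, Real.norm_eq_abs]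
          nlinarith [hGL (w j x) (u x), abs_nonneg (partialD i φ x)]
      _ ≤ _ := by
          rw [integral_const_mul, mul_assoc]
          exact mul_le_mul_of_nonneg_left ((le_abs_self _).trans h4) hB0
  -- right side
  have hR : Tendsto (fun j => ∫ x, deriv G (w (ns j) x) * partialD i (w (ns j)) x * φ x) atTop
      (𝓝 (∫ x, deriv G (u x) * g i x * φ x)) := by
    have e : ∀ f : Eu n → ℝ, ∫ x, f x * φ x = ∫ x in tsupport φ, f x * φ x := fun f => by
      rw [setIntegral_eq_integral_of_forall_compl_eq_zero]
      intro x hx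
      rw [image_eq_zero_of_notMem_tsupport hx, mul_zero]
    simp_rw [e]
    have m1 : ∀ v : Eu n → ℝ, AEStronglyMeasurable v volume →
        AEStronglyMeasurable (fun x => deriv G (v x)) (volume.restrict (tsupport φ)) :=
      fun v hv => (hDc.comp_aestronglyMeasurable hv).mono_measure Measure.restrict_le_self
    have hφm : MemLp φ 2 (volume.restrict (tsupport φ)) := hφ.c1.memLp
    -- The difference `G'(w) ∂w - G'(u) g` is split as `G'(w) (∂w - g) + (G'(w) - G'(u)) g`. The
    -- first part vanishes because `G'` is bounded; the second by dominated convergence along the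
    -- almost everywhere convergent subsequence.
    have t1 : Tendsto (fun j => ∫ x in tsupport φ, (deriv G (w (ns j) x) *
        (partialD i (w (ns j)) x - g i x)) * φ x) atTop (𝓝 0) := by
      have h1 := ((L2.comp hns.tendsto_atTop).tendsto_lpNorm_sub).const_mul
        (B * lpNorm φ 2 (volume.restrict (tsupport φ)))
      rw [mul_zero] at h1
      refine squeeze_zero_norm (fun j => ?_) h1
      have hd : MemLp (fun x => partialD i (w (ns j)) x - g i x) 2 (volume.restrict (tsupport φ)) :=
        (L2.memLp _).sub L2.memLp_lim
      have h2 := (abs_integral_mul_le hφm.abs hd.abs)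
      rw [lpNorm_abs hφm.1, lpNorm_abs hd.1] at h2
      calc ‖∫ x in tsupport φ, (deriv G (w (ns j) x) * (partialD i (w (ns j)) x - g i x)) * φ x‖
          ≤ ∫ x in tsupport φ, B * (|φ x| * |partialD i (w (ns j)) x - g i x|) := by
            refine norm_integral_le_of_norm_le ((integrable_mul_of_memLp hφm.abs
              hd.abs).const_mul B) (Eventually.of_forall fun x => ?_)
            rw [norm_mul, norm_mul, Real.norm_eq_abs, Real.norm_eq_abs, Real.norm_eq_abs]
            have h5 : 0 ≤ |partialD i (w (ns j)) x - g i x| * |φ x| := by positivity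
            nlinarith [hB (w (ns j) x)]
        _ ≤ _ := by
            rw [integral_const_mul, mul_assoc]
            exact mul_le_mul_of_nonneg_left ((le_abs_self _).trans h2) hB0
    have hgφ : Integrable (fun x => g i x * φ x) (volume.restrict (tsupport φ)) :=
      integrable_mul_of_memLp L2.memLp_lim hφm
    have t2 : Tendsto (fun j => ∫ x in tsupport φ, deriv G (w (ns j) x) * (g i x * φ x)) atTop
        (𝓝 (∫ x in tsupport φ, deriv G (u x) * (g i x * φ x))) := by
      refine tendsto_integral_of_dominated_convergence (fun x => B * |g i x * φ x|)
        (fun j => (m1 _ (hw2 _).1).mul hgφ.1) (hgφ.abs.const_mul B) (fun j => ?_) ?_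
      · refine Eventually.of_forall fun x => ?_
        rw [norm_mul]
        exact mul_le_mul_of_nonneg_right (hB _) (abs_nonneg _)
      · filter_upwards [ae_mono Measure.restrict_le_self hae] with x hx
        exact ((hDc.tendsto _).comp hx).mul_const _
    have t3 := t1.add t2
    rw [zero_add] at t3
    have e2 : ∀ j, (∫ x in tsupport φ, (deriv G (w (ns j) x) *
        (partialD i (w (ns j)) x - g i x)) * φ x) +
        (∫ x in tsupport φ, deriv G (w (ns j) x) * (g i x * φ x)) =
        ∫ x in tsupport φ, deriv G (w (ns j) x) * partialD i (w (ns j)) x * φ x := fun j => by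
      rw [← integral_add]
      · refine integral_congr_ae (Eventually.of_forall fun x => ?_)
        simp only; ring
      · have hd : MemLp (fun x => partialD i (w (ns j)) x - g i x) 2
          (volume.restrict (tsupport φ)) := (L2.memLp _).sub L2.memLp_lim
        exact integrable_mul_of_memLp (memLp_bdd_mul hd (m1 _ (hw2 _).1)
          (Eventually.of_forall fun x => hB _)) hφm
      · exact hgφ.bdd_mul (m1 _ (hw2 _).1) (Eventually.of_forall fun x => hB _)
    refine (t3.congr e2).congr' ?_ |>.trans ?_
    · exact EventuallyEq.rfl
    · simp_rw [mul_assoc]; exact le_rfl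
  have hLR : ∀ j, ∫ x, G (w j x) * partialD i φ x =
      -∫ x, deriv G (w j x) * partialD i (w j) x * φ x := fun j => by
    rw [integral_mul_partialD (f := fun x => G (w j x)) (hG.comp ((hw1 j).of_le (by simp))) hφ.c1]
    congr 1
    refine integral_congr_ae (Eventually.of_forall fun x => ?_)
    simp only
    rw [partialD_comp (hG.differentiable (by simp) _) ((hw1 j).differentiable (by simp) x)]
  exact tendsto_nhds_unique (hL.comp hns.tendsto_atTop) (hR.neg.congr fun j => (hLR _).symm)

end Chain

/-! ### The two boundary conditions below a flat boundary. -/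

section HalfSpace

variable {m : ℕ}

/-- The lower half space. -/
def lowerHalf (m : ℕ) : Set (Eu (m + 1)) := {x | vert x < 0}

lemma continuous_vert : Continuous (vert : Eu (m + 1) → ℝ) := by
  unfold vert; fun_prop

lemma isOpen_lowerHalf : IsOpen (lowerHalf m) := isOpen_lt continuous_vert continuous_const

/-- The set in which the gradient relation of a function with boundary condition `bc` is tested:
in case (D) the function extended by zero has a weak gradient. -/
def gradSet (bc : BC) (O : Set (Eu (m + 1))) : Set (Eu (m + 1)) :=
  match bc with
  | BC.D => O
  | BC.N => O ∩ lowerHalf m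

/-- The set in which the equation is tested. -/
def eqnSet (bc : BC) (O : Set (Eu (m + 1))) : Set (Eu (m + 1)) :=
  match bc with
  | BC.D => O ∩ lowerHalf m
  | BC.N => O

lemma inter_subset_gradSet (bc : BC) (O : Set (Eu (m + 1))) : O ∩ lowerHalf m ⊆ gradSet bc O := by
  cases bc
  · exact inter_subset_left
  · exact subset_rfl

lemma inter_subset_eqnSet (bc : BC) (O : Set (Eu (m + 1))) : O ∩ lowerHalf m ⊆ eqnSet bc O := by
  cases bc
  · exact subset_rfl
  · exact inter_subset_left

lemma gradSet_subset (bc : BC) (O : Set (Eu (m + 1))) : gradSet bc O ⊆ O := by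
  cases bc
  · exact subset_rfl
  · exact inter_subset_left

lemma eqnSet_subset (bc : BC) (O : Set (Eu (m + 1))) : eqnSet bc O ⊆ O := by
  cases bc
  · exact inter_subset_left
  · exact subset_rfl

lemma isOpen_gradSet (bc : BC) {O : Set (Eu (m + 1))} (hO : IsOpen O) : IsOpen (gradSet bc O) := by
  cases bc
  · exact hO
  · exact hO.inter isOpen_lowerHalf

lemma gradSet_mono (bc : BC) {O O' : Set (Eu (m + 1))} (h : O' ⊆ O) :
    gradSet bc O' ⊆ gradSet bc O := by
  cases bc
  · exact h
  · exact inter_subset_inter_left _ h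

lemma eqnSet_mono (bc : BC) {O O' : Set (Eu (m + 1))} (h : O' ⊆ O) :
    eqnSet bc O' ⊆ eqnSet bc O := by
  cases bc
  · exact inter_subset_inter_left _ h
  · exact h

lemma hasFDerivAt_vert (x : Eu (m + 1)) :
    HasFDerivAt (vert : Eu (m + 1) → ℝ) (EuclideanSpace.proj (𝕜 := ℝ) (Fin.last m) : Eu (m + 1) →L[ℝ] ℝ) x :=
  (EuclideanSpace.proj (𝕜 := ℝ) (Fin.last m) : Eu (m + 1) →L[ℝ] ℝ).hasFDerivAt

lemma contDiff_vert {k : WithTop ℕ∞} : ContDiff ℝ k (vert : Eu (m + 1) → ℝ) :=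
  (EuclideanSpace.proj (𝕜 := ℝ) (Fin.last m) : Eu (m + 1) →L[ℝ] ℝ).contDiff

lemma partialD_comp_vert {G : ℝ → ℝ} (hG : Differentiable ℝ G) {i : Fin (m + 1)}
    (hi : i ≠ Fin.last m) (x : Eu (m + 1)) : partialD i (fun y => G (vert y)) x = 0 := by
  rw [partialD_comp (hG _) (hasFDerivAt_vert x).differentiableAt, partialD,
    (hasFDerivAt_vert x).fderiv]
  simp [Ne.symm hi]

/-- In tangential directions the weak derivative relation holds up to the boundary. -/
lemma WD.tangential {O : Set (Eu (m + 1))} {i : Fin (m + 1)}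
    (hi : i ≠ Fin.last m) (hO : IsOpen O) {u g : Eu (m + 1) → ℝ}
    (hu : MemLp u 2 (volume.restrict (O ∩ lowerHalf m)))
    (hg : MemLp g 2 (volume.restrict (O ∩ lowerHalf m)))
    (h : WD (O ∩ lowerHalf m) (O ∩ lowerHalf m) i u g) : WD (O ∩ lowerHalf m) O i u g := by
  intro φ hφ
  -- Cutoffs in the vertical variable alone commute with a tangential derivative, so their unbounded
  -- gradients never appear. They vanish for `t ≥ -1/(j+1)` and tend to `1` for every `t < 0`.
  let s : ℕ → ℝ → ℝ := fun j t => Real.smoothTransition (-((j : ℝ) + 1) * t - 1)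
  have hs : ∀ j, ContDiff ℝ ∞ (s j) := fun j =>
    Real.smoothTransition.contDiff.comp (by fun_prop)
  have hs0 : ∀ (j : ℕ) (t : ℝ), -(1 / ((j : ℝ) + 1)) ≤ t → s j t = 0 := fun j t ht => by
    refine Real.smoothTransition.zero_of_nonpos ?_
    have hj : (0 : ℝ) < (j : ℝ) + 1 := by positivity
    have := mul_le_mul_of_nonneg_left ht hj.le
    field_simp at this
    linarith
  have hs1 : ∀ t < 0, Tendsto (fun j => s j t) atTop (𝓝 1) := fun t ht => by
    obtain ⟨N, hN⟩ := exists_nat_gt (2 / (-t))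
    refine tendsto_const_nhds.congr' ?_
    filter_upwards [eventually_ge_atTop N] with j hj
    refine (Real.smoothTransition.one_of_one_le ?_).symm
    have hjN : (N : ℝ) ≤ j := by exact_mod_cast hj
    rw [div_lt_iff₀ (by linarith)] at hN
    nlinarith
  have hsb : ∀ j t, |s j t| ≤ 1 := fun j t => by
    rw [abs_of_nonneg (Real.smoothTransition.nonneg _)]
    exact Real.smoothTransition.le_one _
  have hcut : ∀ j, ContDiff ℝ ∞ fun x : Eu (m + 1) => s j (vert x) := fun j =>
    (hs j).comp contDiff_vert
  have htest : ∀ j, IsTestFunction (O ∩ lowerHalf m) fun x => s j (vert x) * φ x := fun j => by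
    have h1 : tsupport (fun x => s j (vert x) * φ x) ⊆
        tsupport φ ∩ {x | vert x ≤ -(1 / ((j : ℝ) + 1))} := by
      refine closure_minimal ?_ ((isClosed_tsupport _).inter
        (isClosed_le continuous_vert continuous_const))
      intro x hx
      refine ⟨subset_tsupport _ fun h0 => hx (by simp [h0]), ?_⟩
      by_contra hlt
      have h2 : -(1 / ((j : ℝ) + 1)) ≤ vert x := le_of_not_ge hlt
      exact hx (by simp only [hs0 j (vert x) h2, zero_mul])
    refine ⟨(hcut j).mul hφ.1, hφ.2.1.mul_left, h1.trans ?_⟩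
    rintro x ⟨hx1, hx2⟩
    have h2 : vert x ≤ -(1 / ((j : ℝ) + 1)) := hx2
    have : (0 : ℝ) < 1 / ((j : ℝ) + 1) := by positivity
    exact ⟨hφ.2.2 hx1, show vert x < 0 by linarith⟩
  have hd : ∀ j x, partialD i (fun x => s j (vert x) * φ x) x = s j (vert x) * partialD i φ x :=
    fun j x => by
      rw [partialD_mul ((hcut j).differentiable (by simp) x) (hφ.1.differentiable (by simp) x),
        partialD_comp_vert ((hs j).differentiable (by simp)) hi]
      ring
  have lim : ∀ f ψ : Eu (m + 1) → ℝ, MemLp f 2 (volume.restrict (O ∩ lowerHalf m)) →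
      MemLp ψ 2 (volume.restrict (O ∩ lowerHalf m)) →
      Tendsto (fun j => ∫ x in O ∩ lowerHalf m, f x * (s j (vert x) * ψ x)) atTop
        (𝓝 (∫ x in O ∩ lowerHalf m, f x * ψ x)) := fun f ψ hf hψ => by
    have hfψ := integrable_mul_of_memLp hf hψ
    refine tendsto_integral_of_dominated_convergence (fun x => |f x * ψ x|)
      (fun j => hf.1.mul ((hcut j).continuous.aestronglyMeasurable.mul hψ.1)) hfψ.abs
      (fun j => Eventually.of_forall fun x => ?_) ?_
    · rw [show f x * (s j (vert x) * ψ x) = s j (vert x) * (f x * ψ x) by ring, norm_mul]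
      exact mul_le_of_le_one_left (norm_nonneg _) (hsb _ _)
    · filter_upwards [ae_restrict_mem (hO.inter isOpen_lowerHalf).measurableSet] with x hx
      have := ((hs1 _ hx.2).mul_const (ψ x)).const_mul (f x)
      simpa using this
  have l1 := lim u (partialD i φ) hu (hφ.c1.memLp_partialD i)
  have l2 := lim g φ hg hφ.c1.memLp
  refine tendsto_nhds_unique l1 (l2.neg.congr fun j => ?_)
  rw [← h _ (htest j)]
  simp_rw [hd]

lemma abs_vert_sub_le (x y : Eu (m + 1)) : |vert x - vert y| ≤ dist x y := by
  rw [dist_eq_norm]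
  exact PiLp.norm_apply_le (x - y) (Fin.last m)

/-- Functions cut off away from the sides and the bottom are limits of test functions. -/
lemma exists_test_approx {bc : BC} {O : Set (Eu (m + 1))} (hO : IsOpen O)
    {u : Eu (m + 1) → ℝ} {g : Fin (m + 1) → Eu (m + 1) → ℝ}
    (hu : MemLp u 2 (volume.restrict (O ∩ lowerHalf m)))
    (hg : ∀ i, MemLp (g i) 2 (volume.restrict (O ∩ lowerHalf m)))
    (h : ∀ i, WD (O ∩ lowerHalf m) (gradSet bc O) i u (g i))
    {ζ : Eu (m + 1) → ℝ} (hζ : IsC1Test O ζ) :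
    ∃ w : ℕ → Eu (m + 1) → ℝ, (∀ j, IsTestFunction (eqnSet bc O) (w j)) ∧
      L2Lim (volume.restrict (O ∩ lowerHalf m)) w (fun x => ζ x * u x) ∧
      ∀ i, L2Lim (volume.restrict (O ∩ lowerHalf m)) (fun j => partialD i (w j))
        (fun x => ζ x * g i x + partialD i ζ x * u x) := by
  set W := O ∩ lowerHalf m with hW
  have hWm : MeasurableSet W := (hO.inter isOpen_lowerHalf).measurableSet
  obtain ⟨B, hB⟩ := hζ.bound
  have hζu : MemLp (fun x => ζ x * u x) 2 (volume.restrict W) :=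
    memLp_bdd_mul hu hζ.1.continuous.aestronglyMeasurable (Eventually.of_forall hB)
  have hζg : ∀ i, MemLp (fun x => ζ x * g i x + partialD i ζ x * u x) 2 (volume.restrict W) :=
    fun i => by
      obtain ⟨B', hB'⟩ := hζ.bound_partialD i
      exact (memLp_bdd_mul (hg i) hζ.1.continuous.aestronglyMeasurable
        (Eventually.of_forall hB)).add (memLp_bdd_mul hu
          (continuous_partialD hζ.1 i).aestronglyMeasurable (Eventually.of_forall hB'))
  let V : Eu (m + 1) → ℝ := W.indicator fun x => ζ x * u x
  let G : Fin (m + 1) → Eu (m + 1) → ℝ := fun i =>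
    W.indicator fun x => ζ x * g i x + partialD i ζ x * u x
  have hV : MemLp V 2 volume := (memLp_indicator_iff_restrict hWm).2 hζu
  have hG : ∀ i, MemLp (G i) 2 volume := fun i => (memLp_indicator_iff_restrict hWm).2 (hζg i)
  -- The factor `ζ` confines the support to `O`, so the test functions themselves no longer have to.
  -- What remains of the domain is only the flat boundary: none in case (D), where the zero
  -- extension is differentiable across it, and the half space in case (N).
  have hWD : ∀ i, WD univ (gradSet bc univ) i V (G i) := fun i => by
    refine WD.univ_indicator hWm fun φ hφ => ?_
    have hm : IsC1Test (gradSet bc O) fun x => ζ x * φ x := by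
      refine ⟨hζ.1.mul hφ.c1.1, hφ.2.1.mul_left, ?_⟩
      have h1 : tsupport (fun x => ζ x * φ x) ⊆ tsupport ζ := tsupport_mul_subset_left
      have h2 : tsupport (fun x => ζ x * φ x) ⊆ tsupport φ := tsupport_mul_subset_right
      have h3 := hφ.2.2
      cases bc
      · exact h1.trans hζ.2.2
      · exact subset_inter (h1.trans hζ.2.2) (h2.trans (h3.trans inter_subset_right))
    obtain ⟨B', hB'⟩ := hζ.bound_partialD i
    have h1 := (h i).c1 (isOpen_gradSet bc hO) hu (hg i) hm
    have i1 := integrable_mul_of_memLp hu (hm.memLp_partialD i (μ := volume.restrict W) (p := 2))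
    have i2 := integrable_mul_of_memLp (memLp_bdd_mul hu
      (continuous_partialD hζ.1 i).aestronglyMeasurable (Eventually.of_forall hB'))
      (hφ.c1.memLp (μ := volume.restrict W) (p := 2))
    have i3 := integrable_mul_of_memLp (hg i) (hm.memLp (μ := volume.restrict W) (p := 2))
    have e1 : ∀ x, ζ x * u x * partialD i φ x =
        u x * partialD i (fun x => ζ x * φ x) x - partialD i ζ x * u x * φ x := fun x => by
      rw [partialD_mul (hζ.1.differentiable (by simp) x) (hφ.1.differentiable (by simp) x)]; ring
    have e2 : ∀ x, (ζ x * g i x + partialD i ζ x * u x) * φ x =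
        g i x * (ζ x * φ x) + partialD i ζ x * u x * φ x := fun x => by ring
    simp_rw [e1, e2]
    rw [integral_sub i1 i2, integral_add i3 i2, h1]
    ring
  obtain ⟨r, hr, hrO⟩ := IsCompact.exists_cthickening_subset_open hζ.2.1 hO hζ.2.2
  let K : Set (Eu (m + 1)) := tsupport ζ ∩ {x | vert x ≤ 0}
  have hK : IsCompact K := hζ.2.1.isCompact.inter_right
    (isClosed_le continuous_vert continuous_const)
  have hVK : ∀ x ∉ K, V x = 0 := fun x hx => by
    by_cases hxW : x ∈ W
    · have : x ∉ tsupport ζ := fun h1 => hx ⟨h1, (show vert x < 0 from hxW.2).le⟩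
      simp [V, hxW, image_eq_zero_of_notMem_tsupport this]
    · simp [V, hxW]
  -- In case (D) the mollification is shifted down, so its support lies strictly below the flat
  -- boundary. In case (N) it is shifted up: its values below the boundary are then averages over
  -- points further down, where the gradient relation holds, and its support may cross the boundary.
  let σ : ℝ := match bc with
    | BC.D => -1
    | BC.N => 1
  let e : Eu (m + 1) := EuclideanSpace.single (Fin.last m) σ
  have hσ : |σ| = 1 := by cases bc <;> simp [σ]
  have he : ‖e‖ = 1 := by simp [e, hσ]
  have hev : ∀ (x : Eu (m + 1)) (c : ℝ), vert (x + c • e) = vert x + c * σ := fun x c => by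
    simp [vert, e]
  have key : ∀ j : ℕ, ∃ w, IsTestFunction (eqnSet bc O) w ∧
      eLpNorm (fun x => w x - ζ x * u x) 2 (volume.restrict W) ≤
        ENNReal.ofReal (1 / ((j : ℝ) + 1)) ∧
      ∀ i, eLpNorm (fun x => partialD i w x - (ζ x * g i x + partialD i ζ x * u x)) 2
        (volume.restrict W) ≤ ENNReal.ofReal (1 / ((j : ℝ) + 1)) := by
    intro j
    have hj : 0 < min (1 / ((j : ℝ) + 1)) (r / 2) := lt_min (by positivity) (by positivity)
    obtain ⟨k, hk, w, hw, hwK, hw1, hw2⟩ := exists_mollification hV hG hWD he.le hj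
    obtain ⟨hwc, hws⟩ := hwK K hK hVK
    have hkr : k < r / 2 := hk.2.trans_le (min_le_right _ _)
    have hle := ENNReal.ofReal_le_ofReal (min_le_left (1 / ((j : ℝ) + 1)) (r / 2))
    refine ⟨w, ⟨hw, hwc, ?_⟩, ?_, fun i => ?_⟩
    · intro x hx
      obtain ⟨z, hz, hxz⟩ := hws x hx
      have hxO : x ∈ O := by
        refine hrO (Metric.mem_cthickening_of_dist_le x z r _ hz.1 ?_)
        have h1 := dist_triangle x (z + k • e) z
        have h2 : dist (z + k • e) z = k := by
          rw [dist_eq_norm, add_sub_cancel_left, norm_smul, he, mul_one, Real.norm_of_nonneg hk.1.le]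
        linarith
      have h3 := (abs_le.1 ((abs_vert_sub_le x (z + k • e)).trans hxz)).2
      rw [hev] at h3
      cases bc
      · refine ⟨hxO, ?_⟩
        have h4 : vert z ≤ 0 := hz.2
        have hk0 := hk.1
        simp only [σ, mul_neg, mul_one] at h3
        change vert x < 0
        linarith
      · exact hxO
    · refine (le_of_eq_of_le ?_ ((eLpNorm_restrict_le _ _ volume W).trans hw1)).trans hle
      refine eLpNorm_congr_ae ?_
      filter_upwards [ae_restrict_mem hWm] with x hx
      simp [V, hx]
    · refine (le_of_eq_of_le ?_ (hw2 i W ?_ hWm)).trans hle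
      · refine eLpNorm_congr_ae ?_
        filter_upwards [ae_restrict_mem hWm] with x hx
        simp [G, hx]
      · intro x hx y hy
        have h3 := (abs_le.1 ((abs_vert_sub_le y (x - k • e)).trans hy)).2
        have h5 : vert (x - k • e) = vert x - k * σ := by simp [vert, e]
        rw [h5] at h3
        cases bc
        · trivial
        · refine ⟨trivial, ?_⟩
          have h4 : vert x < 0 := hx.2
          have hk0 := hk.1
          simp only [σ, mul_one] at h3
          change vert y < 0
          linarith
  choose w hw1 hw2 hw3 using key
  exact ⟨w, hw1, .of_le (fun j => (hw1 j).c1.memLp) hζu hw2, fun i =>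
    .of_le (fun j => (hw1 j).c1.memLp_partialD i) (hζg i) (fun j => hw3 j i)⟩

/-- Chain rule, respecting the boundary condition. -/
lemma WD.chain {bc : BC} {O : Set (Eu (m + 1))} (hO : IsOpen O)
    {u : Eu (m + 1) → ℝ} {g : Fin (m + 1) → Eu (m + 1) → ℝ}
    (hu : MemLp u 2 (volume.restrict (O ∩ lowerHalf m)))
    (hg : ∀ i, MemLp (g i) 2 (volume.restrict (O ∩ lowerHalf m)))
    (h : ∀ i, WD (O ∩ lowerHalf m) (gradSet bc O) i u (g i)) {G : ℝ → ℝ} (hG : ContDiff ℝ 1 G)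
    {B : ℝ} (hB : ∀ t, |deriv G t| ≤ B) (hG0 : bc = BC.D → G 0 = 0) (i : Fin (m + 1)) :
    WD (O ∩ lowerHalf m) (gradSet bc O) i (fun x => G (u x)) (fun x => deriv G (u x) * g i x) := by
  set W := O ∩ lowerHalf m with hW
  have hWm : MeasurableSet W := (hO.inter isOpen_lowerHalf).measurableSet
  have h1 := WD.chain_univ (isOpen_gradSet bc hO) ((memLp_indicator_iff_restrict hWm).2 hu)
    (fun i => (memLp_indicator_iff_restrict hWm).2 (hg i)) (fun i => (h i).univ_indicator hWm)
    hG hB i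
  intro φ hφ
  have h2 := h1 φ hφ
  rw [setIntegral_univ, setIntegral_univ] at h2
  have e1 : ∫ x, deriv G (W.indicator u x) * W.indicator (g i) x * φ x =
      ∫ x in W, deriv G (u x) * g i x * φ x := by
    rw [← integral_indicator hWm]
    congr 1
    ext x
    by_cases hx : x ∈ W <;> simp [hx]
  have e2 : ∫ x, G (W.indicator u x) * partialD i φ x = ∫ x in W, G (u x) * partialD i φ x := by
    -- Outside `W` the zero extension of `u` produces the value `G 0`. In case (D) this is `0`; in
    -- case (N) the test function vanishes there.
    have h3 : ∀ x ∉ W, G (W.indicator u x) * partialD i φ x = 0 := fun x hx => by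
      cases bc
      · simp [hx, hG0 rfl]
      · rw [partialD_eq_zero fun h4 => hx (hφ.2.2 h4), mul_zero]
    rw [← setIntegral_eq_integral_of_forall_compl_eq_zero h3]
    refine setIntegral_congr_fun hWm fun x hx => ?_
    simp [hx]
  rw [← e1, ← e2, h2]

end HalfSpace

/-! ### Norm comparisons and weak compactness in `L²`. -/

section LTwoNorm

variable {α : Type*} [MeasurableSpace α] {μ : Measure α}

lemma lpNorm_bdd_mul_le {c f : α → ℝ} {B : ℝ} (hf : MemLp f 2 μ)
    (hc : AEStronglyMeasurable c μ) (hB0 : 0 ≤ B) (hB : ∀ᵐ x ∂μ, |c x| ≤ B) :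
    lpNorm (fun x => c x * f x) 2 μ ≤ B * lpNorm f 2 μ := by
  have h1 := eLpNorm_le_mul_eLpNorm_of_ae_le_mul (f := fun x => c x * f x) (g := f) (c := B)
    (hB.mono fun x hx => by
      rw [norm_mul]; exact mul_le_mul_of_nonneg_right hx (norm_nonneg _)) 2
  rw [← ofReal_lpNorm hf, ← ofReal_lpNorm (memLp_bdd_mul hf hc hB),
    ← ENNReal.ofReal_mul hB0] at h1
  exact (ENNReal.ofReal_le_ofReal_iff (mul_nonneg hB0 lpNorm_nonneg)).1 h1

lemma lpNorm_mono_measure {p : ℝ≥0∞} {ν : Measure α} {f : α → ℝ} (hf : MemLp f p μ)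
    (h : ν ≤ μ) : lpNorm f p ν ≤ lpNorm f p μ := by
  have := eLpNorm_mono_measure f h (p := p)
  rw [← ofReal_lpNorm hf, ← ofReal_lpNorm (hf.mono_measure h)] at this
  exact (ENNReal.ofReal_le_ofReal_iff lpNorm_nonneg).1 this

lemma lpNorm_congr_ae {p : ℝ≥0∞} {F : Type*} [NormedAddCommGroup F] {f g : α → F}
    (h : f =ᵐ[μ] g) : lpNorm f p μ = lpNorm g p μ := by
  by_cases hf : AEStronglyMeasurable f μ
  · rw [← toReal_eLpNorm hf, ← toReal_eLpNorm (hf.congr h), eLpNorm_congr_ae h]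
  · have hg : ¬AEStronglyMeasurable g μ := fun hg => hf (hg.congr h.symm)
    rw [lpNorm_of_not_aestronglyMeasurable hf, lpNorm_of_not_aestronglyMeasurable hg]

/-- Bounded sequences in `L²` have a weak limit along an ultrafilter. -/
lemma exists_weak_limit {f : ℕ → α → ℝ} (hf : ∀ j, MemLp (f j) 2 μ) {M : ℝ}
    (hM : ∀ j, lpNorm (f j) 2 μ ≤ M) :
    ∃ g, MemLp g 2 μ ∧ ∀ φ, MemLp φ 2 μ →
      Tendsto (fun j => ∫ x, f j x * φ x ∂μ) (hyperfilter ℕ) (𝓝 (∫ x, g x * φ x ∂μ)) := by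
  -- Riesz representation turns the sequence into functionals in a ball of the dual, which is weak-*
  -- compact; an ultrafilter limit needs no extraction of a subsequence.
  let F : ℕ → WeakDual ℝ (Lp ℝ 2 μ) := fun j =>
    StrongDual.toWeakDual (InnerProductSpace.toDual ℝ (Lp ℝ 2 μ) ((hf j).toLp (f j)))
  have hF : ∀ j, F j ∈ WeakDual.toStrongDual ⁻¹' Metric.closedBall (0 : StrongDual ℝ (Lp ℝ 2 μ)) M := by
    intro j
    simp only [mem_preimage, Metric.mem_closedBall, dist_zero_right, F]
    rw [show WeakDual.toStrongDual (StrongDual.toWeakDual (InnerProductSpace.toDual ℝ (Lp ℝ 2 μ)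
      ((hf j).toLp (f j)))) = InnerProductSpace.toDual ℝ (Lp ℝ 2 μ) ((hf j).toLp (f j)) from rfl,
      LinearIsometryEquiv.norm_map, Lp.norm_toLp, toReal_eLpNorm (hf j).1]
    exact hM j
  obtain ⟨ℓ, -, hℓ⟩ := (WeakDual.isCompact_closedBall (𝕜 := ℝ) (0 : StrongDual ℝ (Lp ℝ 2 μ)) M).ultrafilter_le_nhds
    ((hyperfilter ℕ).map F) (by
      rw [le_principal_iff]
      exact Filter.mem_map.2 (univ_mem' hF))
  let g : Lp ℝ 2 μ := (InnerProductSpace.toDual ℝ (Lp ℝ 2 μ)).symm (WeakDual.toStrongDual ℓ)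
  refine ⟨g, Lp.memLp g, fun φ hφ => ?_⟩
  have h1 : Tendsto (fun j => F j (hφ.toLp φ)) (hyperfilter ℕ) (𝓝 (ℓ (hφ.toLp φ))) :=
    ((WeakDual.eval_continuous (hφ.toLp φ)).tendsto ℓ).comp hℓ
  have h2 : ∀ j, F j (hφ.toLp φ) = ∫ x, f j x * φ x ∂μ := fun j => by
    change inner ℝ ((hf j).toLp (f j)) (hφ.toLp φ) = _
    rw [L2.inner_def]
    refine integral_congr_ae ?_
    filter_upwards [(hf j).coeFn_toLp, hφ.coeFn_toLp] with x h3 h4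
    rw [h3, h4]
    simp [mul_comm]
  have h5 : ℓ (hφ.toLp φ) = ∫ x, g x * φ x ∂μ := by
    have h6 : ℓ (hφ.toLp φ) = inner ℝ g (hφ.toLp φ) := by
      rw [InnerProductSpace.toDual_symm_apply]
      rfl
    rw [h6, L2.inner_def]
    refine integral_congr_ae ?_
    filter_upwards [hφ.coeFn_toLp] with x h4
    rw [h4]
    simp [mul_comm]
  rw [← h5]
  exact h1.congr h2

end LTwoNorm

/-! ### The energy estimate below a flat boundary. -/

section Flat

variable {m : ℕ}

/-- The vector field `a g`. -/
def flux {n : ℕ} (a : Fin n → Fin n → Eu n → ℝ) (g : Fin n → Eu n → ℝ) (i : Fin n) (x : Eu n) : ℝ :=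
  ∑ l, a i l x * g l x

/-- Bounded measurable elliptic coefficients on `W`. -/
structure IsElliptic {n : ℕ} (W : Set (Eu n)) (a : Fin n → Fin n → Eu n → ℝ) (η Λ : ℝ) : Prop where
  meas : ∀ i l, AEStronglyMeasurable (a i l) (volume.restrict W)
  bound : ∀ i l, ∀ x ∈ W, |a i l x| ≤ Λ
  elliptic : ∀ x ∈ W, ∀ ξ : Fin n → ℝ, η * ∑ i, ξ i ^ 2 ≤ ∑ i, ∑ l, a i l x * ξ l * ξ i

lemma IsElliptic.mono {n : ℕ} {W W' : Set (Eu n)} {a : Fin n → Fin n → Eu n → ℝ} {η Λ : ℝ}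
    (h : IsElliptic W a η Λ) (hW : W' ⊆ W) : IsElliptic W' a η Λ :=
  ⟨fun i l => (h.meas i l).mono_measure (Measure.restrict_mono hW le_rfl),
    fun i l x hx => h.bound i l x (hW hx), fun x hx => h.elliptic x (hW hx)⟩

lemma IsElliptic.memLp_flux {n : ℕ} {W : Set (Eu n)} (hW : MeasurableSet W)
    {a : Fin n → Fin n → Eu n → ℝ} {η Λ : ℝ} (h : IsElliptic W a η Λ) {g : Fin n → Eu n → ℝ}
    (hg : ∀ i, MemLp (g i) 2 (volume.restrict W)) (i : Fin n) :
    MemLp (flux a g i) 2 (volume.restrict W) :=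
  memLp_finsetSum _ fun l _ => memLp_bdd_mul (hg l) (h.meas i l)
    ((ae_restrict_mem hW).mono (h.bound i l))

lemma IsC1Test.sq {S : Set (Eu (m + 1))} {ζ : Eu (m + 1) → ℝ} (hζ : IsC1Test S ζ) :
    IsC1Test S (fun x => ζ x * ζ x) ∧
    ∀ i x, partialD i (fun x => ζ x * ζ x) x = 2 * ζ x * partialD i ζ x := by
  refine ⟨⟨hζ.1.mul hζ.1, hζ.2.1.mul_left, (tsupport_mul_subset_left).trans hζ.2.2⟩,
    fun i x => ?_⟩
  rw [partialD_mul (hζ.1.differentiable (by simp) x) (hζ.1.differentiable (by simp) x)]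
  ring

/-- The constant in the energy estimate. -/
noncomputable def energyConst (n : ℕ) (η Λ : ℝ) : ℝ :=
  2 / η * (1 + (n ^ 2 / η + n) + (4 * n ^ 4 * Λ ^ 2 / η + n))

lemma energyConst_pos (n : ℕ) {η : ℝ} (hη : 0 < η) (Λ : ℝ) : 0 < energyConst n η Λ := by
  unfold energyConst; positivity

/-- Absorption by Young's inequality. Here `X` is the norm of `ζ∇u`, `U` the norm of `u` and `K` the
bound for `∇ζ`. The two terms linear in `X` cost `η X² / 4` each, so half of `η X²` survives, whence
the factor `2 / η` in the constant. -/
lemma energy_arith {η Λ A B K U X : ℝ} {n : ℕ} (hη : 0 < η)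
    (hN0 : (0 : ℝ) ≤ n) (hA : 0 ≤ A) (hU0 : 0 ≤ U)
    (main : η * X ^ 2 ≤ A * U + B * (n * (X + 2 * K * U)) + n * (n * (Λ * X * (2 * K * U)))) :
    X ^ 2 ≤ energyConst n η Λ * (K ^ 2 * U ^ 2 + A * U + B ^ 2) := by
  rw [energyConst, div_mul_eq_mul_div, div_mul_eq_mul_div, le_div_iff₀ hη]
  generalize (n : ℝ) = N at *
  have q1 : B * N * X ≤ η * X ^ 2 / 4 + N ^ 2 / η * B ^ 2 := by
    have : N ^ 2 / η * B ^ 2 = (N * B) ^ 2 / η := by ring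
    rw [this, ← sub_le_iff_le_add', le_div_iff₀ hη]
    nlinarith [sq_nonneg (η * X / 2 - N * B)]
  have q2 : N * (N * (Λ * X * (2 * K * U))) ≤
      η * X ^ 2 / 4 + 4 * N ^ 4 * Λ ^ 2 / η * (K ^ 2 * U ^ 2) := by
    have : 4 * N ^ 4 * Λ ^ 2 / η * (K ^ 2 * U ^ 2) = (2 * N ^ 2 * Λ * K * U) ^ 2 / η := by ring
    rw [this, ← sub_le_iff_le_add', le_div_iff₀ hη]
    nlinarith [sq_nonneg (η * X / 2 - 2 * N ^ 2 * Λ * K * U)]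
  have q3 : B * (N * (2 * K * U)) ≤ N * B ^ 2 + N * (K ^ 2 * U ^ 2) := by
    nlinarith [mul_nonneg hN0 (sq_nonneg (B - K * U))]
  have p3 : 0 ≤ N ^ 2 / η := by positivity
  have p4 : 0 ≤ 4 * N ^ 4 * Λ ^ 2 / η := by positivity
  have p1 : 0 ≤ A * U := by positivity
  have p2 : 0 ≤ K ^ 2 * U ^ 2 := by positivity
  have p5 : 0 ≤ B ^ 2 := by positivity
  have e1 : B * (N * (X + 2 * K * U)) = B * N * X + B * (N * (2 * K * U)) := by ring
  generalize N ^ 2 / η = P at *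
  generalize 4 * N ^ 4 * Λ ^ 2 / η = Q at *
  generalize N * (N * (Λ * X * (2 * K * U))) = T at *
  generalize B * (N * (2 * K * U)) = T' at *
  generalize B * N * X = T'' at *
  generalize K ^ 2 * U ^ 2 = k at *
  generalize A * U = l at *
  generalize B ^ 2 = b at *
  rw [e1] at main
  nlinarith [mul_nonneg p3 p1, mul_nonneg hN0 p1, mul_nonneg p4 p1, mul_nonneg p3 p2,
    mul_nonneg hN0 p2, mul_nonneg p4 p5, mul_nonneg hN0 p5]

/-- The energy estimate. -/
theorem energy_estimate {bc : BC} {O : Set (Eu (m + 1))} (hO : IsOpen O)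
    {a : Fin (m + 1) → Fin (m + 1) → Eu (m + 1) → ℝ} {η Λ : ℝ} (hη : 0 < η) (hΛ : 0 ≤ Λ)
    (ha : IsElliptic (O ∩ lowerHalf m) a η Λ)
    {u : Eu (m + 1) → ℝ} {g : Fin (m + 1) → Eu (m + 1) → ℝ}
    (hu : MemLp u 2 (volume.restrict (O ∩ lowerHalf m)))
    (hg : ∀ i, MemLp (g i) 2 (volume.restrict (O ∩ lowerHalf m)))
    (h : ∀ i, WD (O ∩ lowerHalf m) (gradSet bc O) i u (g i))
    {ζ : Eu (m + 1) → ℝ} (hζ : IsC1Test O ζ) (hζ0 : ∀ x, 0 ≤ ζ x ∧ ζ x ≤ 1) {K : ℝ}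
    (hζK : ∀ i x, |partialD i ζ x| ≤ K) {A B : ℝ} (hA : 0 ≤ A) (hB : 0 ≤ B)
    (heq : ∀ φ, IsTestFunction (eqnSet bc O) φ →
      |∫ x in O ∩ lowerHalf m, ∑ i, flux a g i x * partialD i φ x| ≤
        A * lpNorm φ 2 (volume.restrict (O ∩ lowerHalf m)) +
          B * ∑ i, lpNorm (partialD i φ) 2 (volume.restrict (O ∩ lowerHalf m))) :
    ∑ i, lpNorm (fun x => ζ x * g i x) 2 (volume.restrict (O ∩ lowerHalf m)) ^ 2 ≤
      energyConst (m + 1) η Λ * (K ^ 2 * lpNorm u 2 (volume.restrict (O ∩ lowerHalf m)) ^ 2 +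
        A * lpNorm u 2 (volume.restrict (O ∩ lowerHalf m)) + B ^ 2) := by
  set W := O ∩ lowerHalf m with hW
  have hWm : MeasurableSet W := (hO.inter isOpen_lowerHalf).measurableSet
  set μ := volume.restrict W with hμ
  have hK : 0 ≤ K := (abs_nonneg _).trans (hζK 0 0)
  obtain ⟨hζ2, hζd⟩ := hζ.sq
  have hF := ha.memLp_flux hWm hg
  -- The intended test function `ζ² u` is not smooth; it is reached as a limit of functions `w j`
  -- for which the equation is given.
  obtain ⟨w, hw, hw1, hw2⟩ := exists_test_approx hO hu hg h hζ2
  set v : Eu (m + 1) → ℝ := fun x => ζ x * ζ x * u x with hv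
  set Dv : Fin (m + 1) → Eu (m + 1) → ℝ := fun i x =>
    ζ x * ζ x * g i x + partialD i (fun x => ζ x * ζ x) x * u x with hDv
  have hζm : AEStronglyMeasurable ζ μ := hζ.1.continuous.aestronglyMeasurable
  have hζb : ∀ᵐ x ∂μ, |ζ x| ≤ 1 := Eventually.of_forall fun x => by
    rw [abs_of_nonneg (hζ0 x).1]; exact (hζ0 x).2
  have hζg : ∀ i, MemLp (fun x => ζ x * g i x) 2 μ := fun i => memLp_bdd_mul (hg i) hζm hζb
  -- pass to the limit
  have hlim : |∑ i, ∫ x, flux a g i x * Dv i x ∂μ| ≤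
      A * lpNorm v 2 μ + B * ∑ i, lpNorm (Dv i) 2 μ := by
    have t1 : Tendsto (fun j => |∑ i, ∫ x, flux a g i x * partialD i (w j) x ∂μ|) atTop
        (𝓝 |∑ i, ∫ x, flux a g i x * Dv i x ∂μ|) :=
      (tendsto_finsetSum _ fun i _ => (hw2 i).integral_mul (hF i)).abs
    have t2 : Tendsto (fun j => A * lpNorm (w j) 2 μ + B * ∑ i, lpNorm (partialD i (w j)) 2 μ) atTop
        (𝓝 (A * lpNorm v 2 μ + B * ∑ i, lpNorm (Dv i) 2 μ)) :=
      (hw1.tendsto_lpNorm.const_mul A).add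
        ((tendsto_finsetSum _ fun i _ => (hw2 i).tendsto_lpNorm).const_mul B)
    refine le_of_tendsto_of_tendsto' t1 t2 fun j => ?_
    rw [← integral_finsetSum _ fun i _ => integrable_mul_of_memLp (hF i) ((hw2 i).memLp j)]
    exact heq _ (hw j)
  set U := lpNorm u 2 μ with hU
  have hU0 : 0 ≤ U := lpNorm_nonneg
  set X := √(∑ i, lpNorm (fun x => ζ x * g i x) 2 μ ^ 2) with hX
  have hX0 : 0 ≤ X := Real.sqrt_nonneg _
  have hXsq : X ^ 2 = ∑ i, lpNorm (fun x => ζ x * g i x) 2 μ ^ 2 :=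
    Real.sq_sqrt (Finset.sum_nonneg fun _ _ => sq_nonneg _)
  have hgX : ∀ i, lpNorm (fun x => ζ x * g i x) 2 μ ≤ X := fun i => by
    refine Real.le_sqrt_of_sq_le ?_
    exact Finset.single_le_sum (f := fun i => lpNorm (fun x => ζ x * g i x) 2 μ ^ 2)
      (fun _ _ => sq_nonneg _) (Finset.mem_univ i)
  have hvU : lpNorm v 2 μ ≤ U := by
    have := lpNorm_bdd_mul_le (c := fun x => ζ x * ζ x) hu (hζm.mul hζm) zero_le_one
      (hζb.mono fun x hx => by rw [abs_mul]; nlinarith [abs_nonneg (ζ x)])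
    rwa [one_mul] at this
  have hmix : ∀ i, MemLp (fun x => 2 * ζ x * partialD i ζ x * u x) 2 μ ∧
      lpNorm (fun x => 2 * ζ x * partialD i ζ x * u x) 2 μ ≤ 2 * K * U := fun i => by
    have hm : AEStronglyMeasurable (fun x => 2 * ζ x * partialD i ζ x) μ :=
      ((hζm.const_mul 2).mul (continuous_partialD hζ.1 i).aestronglyMeasurable)
    have hb : ∀ᵐ x ∂μ, |2 * ζ x * partialD i ζ x| ≤ 2 * K := hζb.mono fun x hx => by
      rw [abs_mul, abs_mul, abs_two]
      have := mul_le_mul hx (hζK i x) (abs_nonneg _) zero_le_one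
      linarith
    exact ⟨memLp_bdd_mul hu hm hb, lpNorm_bdd_mul_le hu hm (by positivity) hb⟩
  have hDvX : ∀ i, lpNorm (Dv i) 2 μ ≤ X + 2 * K * U := fun i => by
    have h1 : MemLp (fun x => ζ x * (ζ x * g i x)) 2 μ := memLp_bdd_mul (hζg i) hζm hζb
    have h2 := lpNorm_add_le (g := fun x => 2 * ζ x * partialD i ζ x * u x) h1 one_le_two
    have h3 := lpNorm_bdd_mul_le (hζg i) hζm zero_le_one hζb
    have h4 : Dv i = (fun x => ζ x * (ζ x * g i x)) + fun x => 2 * ζ x * partialD i ζ x * u x := by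
      ext x
      simp only [hDv, hζd, Pi.add_apply]
      ring
    rw [h4]
    linarith [(hmix i).2, hgX i]
  -- the quadratic part
  have hquad : η * X ^ 2 ≤ ∑ i, ∑ l, ∫ x, a i l x * (ζ x * g l x) * (ζ x * g i x) ∂μ := by
    have hi1 : ∀ i l, Integrable (fun x => a i l x * (ζ x * g l x) * (ζ x * g i x)) μ :=
      fun i l => integrable_mul_of_memLp (memLp_bdd_mul (hζg l) (ha.meas i l)
        ((ae_restrict_mem hWm).mono (ha.bound i l))) (hζg i)
    have hi2 : ∀ i, Integrable (fun x => (ζ x * g i x) ^ 2) μ := fun i => (hζg i).integrable_sq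
    rw [hXsq]
    simp_rw [fun i => sq_lpNorm_two (hζg i)]
    simp_rw [fun i => (integral_finsetSum Finset.univ fun l _ => hi1 i l).symm]
    rw [← integral_finsetSum _ fun i _ => hi2 i, ← integral_const_mul,
      ← integral_finsetSum _ fun i _ => integrable_finsetSum _ fun l _ => hi1 i l]
    refine integral_mono_ae ((integrable_finsetSum _ fun i _ => hi2 i).const_mul η)
      (integrable_finsetSum _ fun i _ => integrable_finsetSum _ fun l _ => hi1 i l) ?_
    filter_upwards [ae_restrict_mem hWm] with x hx
    exact ha.elliptic x hx fun i => ζ x * g i x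
  have hcross : ∀ i l, |∫ x, a i l x * (ζ x * g l x) * (2 * partialD i ζ x * u x) ∂μ| ≤
      Λ * X * (2 * K * U) := fun i l => by
    have hal : ∀ᵐ x ∂μ, |a i l x| ≤ Λ := (ae_restrict_mem hWm).mono (ha.bound i l)
    have hm : AEStronglyMeasurable (fun x => 2 * partialD i ζ x) μ :=
      (continuous_partialD hζ.1 i).aestronglyMeasurable.const_mul 2
    have hb : ∀ᵐ x ∂μ, |2 * partialD i ζ x| ≤ 2 * K := Eventually.of_forall fun x => by
      rw [abs_mul, abs_two]; linarith [hζK i x]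
    refine (abs_integral_mul_le (memLp_bdd_mul (hζg l) (ha.meas i l) hal)
      (memLp_bdd_mul hu hm hb)).trans ?_
    refine mul_le_mul ((lpNorm_bdd_mul_le (hζg l) (ha.meas i l) hΛ hal).trans ?_)
      (lpNorm_bdd_mul_le hu hm (by positivity) hb) lpNorm_nonneg (by positivity)
    exact mul_le_mul_of_nonneg_left (hgX l) hΛ
  -- In `∇(ζ² u) = ζ² ∇u + 2 ζ u ∇ζ` one factor `ζ` is attached to the gradient in the flux. The
  -- first term becomes the quadratic form at `ζ∇u`, and the cross term is bounded by `X` times the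
  -- norm of `u`.
  have hsplit : ∑ i, ∫ x, flux a g i x * Dv i x ∂μ =
      ∑ i, ∑ l, ∫ x, a i l x * (ζ x * g l x) * (ζ x * g i x) ∂μ +
      ∑ i, ∑ l, ∫ x, a i l x * (ζ x * g l x) * (2 * partialD i ζ x * u x) ∂μ := by
    rw [← Finset.sum_add_distrib]
    refine Finset.sum_congr rfl fun i _ => ?_
    rw [← Finset.sum_add_distrib]
    have hi1 : ∀ l, Integrable (fun x => a i l x * (ζ x * g l x) * (ζ x * g i x)) μ :=
      fun l => integrable_mul_of_memLp (memLp_bdd_mul (hζg l) (ha.meas i l)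
        ((ae_restrict_mem hWm).mono (ha.bound i l))) (hζg i)
    have hi2 : ∀ l, Integrable (fun x => a i l x * (ζ x * g l x) * (2 * partialD i ζ x * u x)) μ :=
      fun l => integrable_mul_of_memLp (memLp_bdd_mul (hζg l) (ha.meas i l)
        ((ae_restrict_mem hWm).mono (ha.bound i l)))
        (memLp_bdd_mul hu ((continuous_partialD hζ.1 i).aestronglyMeasurable.const_mul 2)
          (B := 2 * K) (Eventually.of_forall fun x => by
            rw [abs_mul, abs_two]; linarith [hζK i x]))
    simp_rw [fun l => (integral_add (hi1 l) (hi2 l)).symm]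
    rw [← integral_finsetSum (f := fun l x => a i l x * (ζ x * g l x) * (ζ x * g i x) +
      a i l x * (ζ x * g l x) * (2 * partialD i ζ x * u x)) _ fun l _ => (hi1 l).add (hi2 l)]
    refine integral_congr_ae (Eventually.of_forall fun x => ?_)
    simp only [flux, Finset.sum_mul, hDv, hζd]
    refine Finset.sum_congr rfl fun l _ => ?_
    ring
  set N : ℝ := ((m + 1 : ℕ) : ℝ) with hN
  have hN0 : 0 ≤ N := Nat.cast_nonneg _
  have hsum : |∑ i, ∑ l, ∫ x, a i l x * (ζ x * g l x) * (2 * partialD i ζ x * u x) ∂μ| ≤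
      N * (N * (Λ * X * (2 * K * U))) := by
    refine (Finset.abs_sum_le_sum_abs _ _).trans ?_
    refine (Finset.sum_le_card_nsmul _ _ (N * (Λ * X * (2 * K * U))) fun i _ => ?_).trans ?_
    · refine (Finset.abs_sum_le_sum_abs _ _).trans ?_
      refine (Finset.sum_le_card_nsmul _ _ _ fun l _ => hcross i l).trans ?_
      simp [hN]
    · simp [hN]
  have hDsum : ∑ i, lpNorm (Dv i) 2 μ ≤ N * (X + 2 * K * U) := by
    refine (Finset.sum_le_card_nsmul _ _ _ fun i _ => hDvX i).trans (le_of_eq ?_)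
    simp [hN]
    ring
  have main : η * X ^ 2 ≤ A * U + B * (N * (X + 2 * K * U)) + N * (N * (Λ * X * (2 * K * U))) := by
    have h1 := (abs_le.1 hlim).2
    rw [hsplit] at h1
    have h2 := (abs_le.1 hsum).1
    have h3 := mul_le_mul_of_nonneg_left hvU hA
    have h4 := mul_le_mul_of_nonneg_left hDsum hB
    linarith
  rw [← hXsq]
  exact energy_arith hη hN0 hA hU0 main

/-- `u` solves `div (a ∇u) = -f + div Φ` in `O`, below the boundary, with the boundary condition
`bc` on the part of the boundary in `O`, and weak gradient `g`. -/
structure FlatSol (bc : BC) (O : Set (Eu (m + 1)))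
    (a : Fin (m + 1) → Fin (m + 1) → Eu (m + 1) → ℝ) (f : Eu (m + 1) → ℝ)
    (Φ : Fin (m + 1) → Eu (m + 1) → ℝ) (u : Eu (m + 1) → ℝ)
    (g : Fin (m + 1) → Eu (m + 1) → ℝ) : Prop where
  memLp_u : MemLp u 2 (volume.restrict (O ∩ lowerHalf m))
  memLp_g : ∀ i, MemLp (g i) 2 (volume.restrict (O ∩ lowerHalf m))
  memLp_f : MemLp f 2 (volume.restrict (O ∩ lowerHalf m))
  memLp_Φ : ∀ i, MemLp (Φ i) 2 (volume.restrict (O ∩ lowerHalf m))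
  grad : ∀ i, WD (O ∩ lowerHalf m) (gradSet bc O) i u (g i)
  eqn : ∀ φ, IsTestFunction (eqnSet bc O) φ →
    ∫ x in O ∩ lowerHalf m, ∑ i, flux a g i x * partialD i φ x =
      ∫ x in O ∩ lowerHalf m, (f x * φ x + ∑ i, Φ i x * partialD i φ x)

/-- There is a cutoff function between `O'` and `O` with gradient bounded by `K`. -/
def Gap (O' O : Set (Eu (m + 1))) (K : ℝ) : Prop :=
  ∃ ζ, IsC1Test O ζ ∧ (∀ x ∈ O', ζ x = 1) ∧ (∀ x, 0 ≤ ζ x ∧ ζ x ≤ 1) ∧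
    ∀ i x, |partialD i ζ x| ≤ K

lemma Gap.subset {O' O : Set (Eu (m + 1))} {K : ℝ} (h : Gap O' O K) : O' ⊆ O := by
  obtain ⟨ζ, hζ, h1, -⟩ := h
  exact fun x hx => hζ.2.2 (subset_tsupport _ (by simp [h1 x hx]))

lemma FlatSol.restrict {bc : BC} {O O' : Set (Eu (m + 1))} (hO : IsOpen O)
    {a : Fin (m + 1) → Fin (m + 1) → Eu (m + 1) → ℝ} {f u : Eu (m + 1) → ℝ}
    {Φ g : Fin (m + 1) → Eu (m + 1) → ℝ} (h : FlatSol bc O a f Φ u g) (hOO : O' ⊆ O) :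
    FlatSol bc O' a f Φ u g := by
  have hWm : MeasurableSet (O ∩ lowerHalf m) := (hO.inter isOpen_lowerHalf).measurableSet
  have hWW : O' ∩ lowerHalf m ⊆ O ∩ lowerHalf m := inter_subset_inter_left _ hOO
  have hle := Measure.restrict_mono hWW (le_refl (volume : Measure (Eu (m + 1))))
  have hS : ∀ {S}, S ⊆ O' → (O ∩ lowerHalf m) ∩ S ⊆ O' ∩ lowerHalf m :=
    fun hS x hx => ⟨hS hx.2, hx.1.2⟩
  refine ⟨h.memLp_u.mono_measure hle, fun i => (h.memLp_g i).mono_measure hle,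
    h.memLp_f.mono_measure hle, fun i => (h.memLp_Φ i).mono_measure hle,
    fun i => (h.grad i).restrict hWm hWW (gradSet_mono bc hOO) (hS (gradSet_subset bc O')),
    fun φ hφ => ?_⟩
  have hz : ∀ x ∉ tsupport φ, φ x = 0 ∧ ∀ i, partialD i φ x = 0 := fun x hx =>
    ⟨image_eq_zero_of_notMem_tsupport hx, fun i => partialD_eq_zero hx⟩
  rw [← setIntegral_eq_of_tsupport hWm hWW (hS (eqnSet_subset bc O')) hφ.2.2,
    ← setIntegral_eq_of_tsupport hWm hWW (hS (eqnSet_subset bc O')) hφ.2.2,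
    h.eqn φ (hφ.mono (eqnSet_mono bc hOO))]
  · intro x hx; simp [hz x hx]
  · intro x hx; simp [hz x hx]

/-- The energy estimate on the scale `ε`. -/
theorem FlatSol.energy {bc : BC} {O O' : Set (Eu (m + 1))} (hO : IsOpen O)
    {a : Fin (m + 1) → Fin (m + 1) → Eu (m + 1) → ℝ} {f u : Eu (m + 1) → ℝ}
    {Φ g : Fin (m + 1) → Eu (m + 1) → ℝ} (h : FlatSol bc O a f Φ u g) {η Λ : ℝ} (hη : 0 < η)
    (hΛ : 0 ≤ Λ) (ha : IsElliptic (O ∩ lowerHalf m) a η Λ) (hO' : MeasurableSet O') {κ ε M : ℝ}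
    (hε : 0 < ε) (hgap : Gap O' O (κ / ε))
    (hu : lpNorm u 2 (volume.restrict (O ∩ lowerHalf m)) ≤ M)
    (hf : ε ^ 2 * lpNorm f 2 (volume.restrict (O ∩ lowerHalf m)) ≤ M)
    (hΦ : ∀ i, ε * lpNorm (Φ i) 2 (volume.restrict (O ∩ lowerHalf m)) ≤ M) (i : Fin (m + 1)) :
    ε * lpNorm (g i) 2 (volume.restrict (O' ∩ lowerHalf m)) ≤
      √(energyConst (m + 1) η Λ * (κ ^ 2 + 2)) * M := by
  have hOO := hgap.subset
  obtain ⟨ζ, hζ, hζ1, hζ0, hζK⟩ := hgap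
  set W := O ∩ lowerHalf m with hW
  have hWm : MeasurableSet W := (hO.inter isOpen_lowerHalf).measurableSet
  set μ := volume.restrict W with hμ
  have hM : 0 ≤ M := lpNorm_nonneg.trans hu
  -- The scaled hypothesis `ε |Φ i| ≤ M` is used as the bound `B = M / ε` for each component of the
  -- field.
  have key := energy_estimate hO hη hΛ ha h.memLp_u h.memLp_g h.grad hζ hζ0 hζK
    (A := lpNorm f 2 μ) (B := M / ε) lpNorm_nonneg (by positivity) fun φ hφ => by
      have i1 := integrable_mul_of_memLp h.memLp_f (hφ.c1.memLp (μ := μ) (p := 2))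
      have i2 := fun i => integrable_mul_of_memLp (h.memLp_Φ i)
        (hφ.c1.memLp_partialD i (μ := μ) (p := 2))
      rw [h.eqn φ hφ, integral_add i1 (integrable_finsetSum _ fun i _ => i2 i),
        integral_finsetSum _ fun i _ => i2 i]
      refine (abs_add_le _ _).trans (add_le_add (abs_integral_mul_le h.memLp_f hφ.c1.memLp) ?_)
      refine (Finset.abs_sum_le_sum_abs _ _).trans ?_
      rw [Finset.mul_sum]
      refine Finset.sum_le_sum fun i _ => ?_
      refine (abs_integral_mul_le (h.memLp_Φ i) (hφ.c1.memLp_partialD i)).trans ?_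
      refine mul_le_mul_of_nonneg_right ?_ lpNorm_nonneg
      rw [le_div_iff₀ hε]
      linarith [hΦ i]
  have hC := energyConst_pos (m + 1) hη Λ
  set C := energyConst (m + 1) η Λ with hCdef
  have h1 : lpNorm (g i) 2 (volume.restrict (O' ∩ lowerHalf m)) ≤
      lpNorm (fun x => ζ x * g i x) 2 μ := by
    obtain ⟨B, hB⟩ := hζ.bound
    have e1 : lpNorm (g i) 2 (volume.restrict (O' ∩ lowerHalf m)) =
        lpNorm (fun x => ζ x * g i x) 2 (volume.restrict (O' ∩ lowerHalf m)) := by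
      refine lpNorm_congr_ae ?_
      filter_upwards [ae_restrict_mem (hO'.inter isOpen_lowerHalf.measurableSet)] with x hx
      rw [hζ1 x hx.1, one_mul]
    rw [e1]
    exact lpNorm_mono_measure (memLp_bdd_mul (h.memLp_g i)
      hζ.1.continuous.aestronglyMeasurable (Eventually.of_forall hB))
      (Measure.restrict_mono (inter_subset_inter_left _ hOO) le_rfl)
  have h2 : lpNorm (fun x => ζ x * g i x) 2 μ ^ 2 ≤
      ∑ i, lpNorm (fun x => ζ x * g i x) 2 μ ^ 2 :=
    Finset.single_le_sum (f := fun i => lpNorm (fun x => ζ x * g i x) 2 μ ^ 2)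
      (fun _ _ => sq_nonneg _) (Finset.mem_univ i)
  have hL0 : 0 ≤ lpNorm (g i) 2 (volume.restrict (O' ∩ lowerHalf m)) := lpNorm_nonneg
  refine (pow_le_pow_iff_left₀ (by positivity) (by positivity) two_ne_zero).1 ?_
  rw [mul_pow, mul_pow, Real.sq_sqrt (by positivity)]
  have h3 := pow_le_pow_left₀ hL0 h1 2
  set U := lpNorm u 2 μ with hU
  have hU0 : 0 ≤ U := lpNorm_nonneg
  -- After multiplication by `ε²` each of the three terms is at most a multiple of `M²`: `κ²` from
  -- the cutoff, and `1` each from `f` and from `Φ`. No power of `ε` is left.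
  calc ε ^ 2 * lpNorm (g i) 2 (volume.restrict (O' ∩ lowerHalf m)) ^ 2
      ≤ ε ^ 2 * (C * ((κ / ε) ^ 2 * U ^ 2 + lpNorm f 2 μ * U + (M / ε) ^ 2)) :=
        mul_le_mul_of_nonneg_left (h3.trans (h2.trans key)) (by positivity)
    _ = C * (κ ^ 2 * U ^ 2 + (ε ^ 2 * lpNorm f 2 μ) * U + M ^ 2) := by field_simp
    _ ≤ C * (κ ^ 2 * M ^ 2 + M * M + M ^ 2) := by
        have := mul_le_mul hf hu hU0 hM
        gcongr
    _ = C * (κ ^ 2 + 2) * M ^ 2 := by ring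

end Flat

/-! ### Averages over segments. -/

section Average

variable {n : ℕ}

lemma memLp_prod_translate {μ : Measure (Eu n)} [IsProbabilityMeasure μ] {f : Eu n → ℝ}
    (hf : MemLp f 2 volume) :
    MemLp (fun p : Eu n × Eu n => f (p.1 - p.2)) 2 (volume.prod μ) := by
  have hm : AEStronglyMeasurable (fun p : Eu n × Eu n => f (p.1 - p.2)) (volume.prod μ) :=
    hf.1.comp_quasiMeasurePreserving (quasiMeasurePreserving_sub_of_right_invariant volume μ)
  refine ⟨hm, ?_⟩
  have h1 : eLpNorm (fun p : Eu n × Eu n => f (p.1 - p.2)) 2 (volume.prod μ) ^ 2 < ⊤ := by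
    rw [sq_eLpNorm_two, lintegral_prod_symm _ (hm.enorm.pow_const 2)]
    have : ∀ t : Eu n, ∫⁻ x, ‖f (x - t)‖ₑ ^ 2 = eLpNorm f 2 volume ^ 2 := fun t => by
      rw [sq_eLpNorm_two]
      exact lintegral_sub_right_eq_self (fun x => ‖f x‖ₑ ^ 2) t
    simp_rw [this]
    simpa using hf.2
  simpa using h1

/-- Averages of translates, moved from one factor to the other. -/
lemma integral_average_mul {μ : Measure (Eu n)} [IsProbabilityMeasure μ] {f φ : Eu n → ℝ}
    (hf : MemLp f 2 volume) (hφ : MemLp φ 2 volume) :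
    ∫ x, (∫ t, f (x - t) ∂μ) * φ x = ∫ t, (∫ x, f x * φ (x + t)) ∂μ := by
  have h1 : Integrable (fun p : Eu n × Eu n => f (p.1 - p.2) * φ p.1) (volume.prod μ) :=
    integrable_mul_of_memLp (memLp_prod_translate hf) (hφ.comp_fst μ)
  have h2 : ∀ t, ∫ x, f x * φ (x + t) = ∫ x, f (x - t) * φ x := fun t => by
    rw [← integral_sub_right_eq_self _ t]
    simp
  simp_rw [h2, ← integral_mul_const]
  exact integral_integral_swap h1

lemma integral_mul_average {μ : Measure (Eu n)} [IsProbabilityMeasure μ] {f φ : Eu n → ℝ}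
    (hf : MemLp f 2 volume) (hφ : MemLp φ 2 volume) :
    ∫ x, f x * ∫ t, φ (x - t) ∂μ = ∫ t, (∫ x, f x * φ (x - t)) ∂μ := by
  have h1 : Integrable (fun p : Eu n × Eu n => f p.1 * φ (p.1 - p.2)) (volume.prod μ) :=
    integrable_mul_of_memLp (hf.comp_fst μ) (memLp_prod_translate hφ)
  simp_rw [← integral_const_mul]
  exact integral_integral_swap h1

/-- The uniform distribution on the segment from `0` to `v`. -/
noncomputable def segMeasure (v : Eu n) : Measure (Eu n) :=
  (volume.restrict (Icc (0 : ℝ) 1)).map fun s => s • v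

instance (v : Eu n) : IsProbabilityMeasure (segMeasure v) := by
  have : IsProbabilityMeasure (volume.restrict (Icc (0 : ℝ) 1)) := ⟨by simp⟩
  exact Measure.isProbabilityMeasure_map (by fun_prop)

lemma ae_segMeasure (v : Eu n) : ∀ᵐ t ∂segMeasure v, ∃ s ∈ Icc (0 : ℝ) 1, s • v = t := by
  have h1 : MeasurableSet ((fun s : ℝ => s • v) '' Icc (0 : ℝ) 1) :=
    (isCompact_Icc.image (by fun_prop)).isClosed.measurableSet
  rw [segMeasure, ae_map_iff (by fun_prop) h1]
  exact (ae_restrict_mem measurableSet_Icc).mono fun s hs => ⟨s, hs, rfl⟩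

lemma integral_segMeasure_neg (v : Eu n) (F : Eu n → ℝ) :
    ∫ t, F t ∂segMeasure (-v) = ∫ t, F (-t) ∂segMeasure v := by
  have h1 : segMeasure (-v) = (segMeasure v).map (MeasurableEquiv.neg (Eu n)) := by
    rw [segMeasure, segMeasure, Measure.map_map (MeasurableEquiv.measurable _) (by fun_prop)]
    congr 1
    ext s
    simp
  rw [h1, integral_map_equiv]
  rfl

/-- The fundamental theorem of calculus on a segment. -/
lemma integral_segMeasure_partialD {φ : Eu n → ℝ} (hφ : ContDiff ℝ 1 φ) (i : Fin n) (h : ℝ)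
    (x : Eu n) :
    h * ∫ t, partialD i φ (x - t) ∂segMeasure (h • EuclideanSpace.single i (1 : ℝ)) =
      φ x - φ (x - h • EuclideanSpace.single i (1 : ℝ)) := by
  set e : Eu n := EuclideanSpace.single i (1 : ℝ) with he
  have hd := continuous_partialD hφ i
  have hd' : Continuous fun t => partialD i φ (x - t) := by fun_prop
  rw [segMeasure, integral_map (by fun_prop) hd'.aestronglyMeasurable,
    integral_Icc_eq_integral_Ioc, ← intervalIntegral.integral_of_le zero_le_one,
    ← intervalIntegral.integral_const_mul]
  have h1 : ∀ s ∈ uIcc (0 : ℝ) 1, HasDerivAt (fun s : ℝ => -φ (x - s • h • e))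
      (h * partialD i φ (x - s • h • e)) s := fun s _ => by
    have h2 : HasDerivAt (fun s : ℝ => x - s • h • e) (-(h • e)) s := by
      simpa using ((hasDerivAt_id s).smul_const (h • e)).const_sub x
    have h3 := ((hφ.differentiable (by simp) (x - s • h • e)).hasFDerivAt.comp_hasDerivAt s h2).neg
    refine HasDerivAt.congr_deriv (f := fun s : ℝ => -φ (x - s • h • e)) h3 ?_
    rw [map_neg, neg_neg, map_smul]
    rfl
  rw [intervalIntegral.integral_eq_sub_of_hasDerivAt h1]
  · simp; ring
  · exact (Continuous.intervalIntegrable (by fun_prop) _ _)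

end Average

/-! ### Tangential translations and difference quotients. -/

section Translate

variable {m : ℕ}

lemma vert_add_single {i : Fin (m + 1)} (hi : i ≠ Fin.last m) (x : Eu (m + 1)) (h : ℝ) :
    vert (x + h • EuclideanSpace.single i (1 : ℝ)) = vert x := by
  simp [vert, Ne.symm hi]

lemma tsupport_translate (φ : Eu (m + 1) → ℝ) (v : Eu (m + 1)) :
    tsupport (fun x => φ (x - v)) = (fun x => x - v) ⁻¹' tsupport φ := by
  exact tsupport_comp_eq_preimage φ (Homeomorph.subRight v)

lemma partialD_translate (φ : Eu (m + 1) → ℝ) (v : Eu (m + 1)) (i : Fin (m + 1))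
    (x : Eu (m + 1)) : partialD i (fun x => φ (x - v)) x = partialD i φ (x - v) := by
  unfold partialD
  rw [fderiv_comp_sub]

/-- `O` contains the tangential translates of `O₁` by at most `r` in direction `i`. -/
def RoomFor (i : Fin (m + 1)) (r : ℝ) (O₁ O : Set (Eu (m + 1))) : Prop :=
  ∀ x ∈ O₁, ∀ h ∈ Icc (0 : ℝ) r, x + h • EuclideanSpace.single i (1 : ℝ) ∈ O

variable {i : Fin (m + 1)} {O O₁ : Set (Eu (m + 1))} {r h : ℝ}

lemma RoomFor.subset (hR : RoomFor i r O₁ O) (hr : 0 ≤ r) : O₁ ⊆ O := fun x hx => by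
  simpa using hR x hx 0 ⟨le_rfl, hr⟩

/-- The support of the cutoff is compact in `O` and contains `O₁`, so `O₁` has positive distance
from the complement of `O`. The size of `r` never enters a constant. -/
lemma Gap.exists_room {K : ℝ} (hO : IsOpen O) (hg : Gap O₁ O K) (i : Fin (m + 1)) :
    ∃ r > 0, RoomFor i r O₁ O := by
  obtain ⟨ζ, hζ, h1, -⟩ := hg
  obtain ⟨r, hr, hrO⟩ := IsCompact.exists_cthickening_subset_open hζ.2.1 hO hζ.2.2
  refine ⟨r, hr, fun x hx h hh => hrO (Metric.mem_cthickening_of_dist_le _ x r _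
    (subset_tsupport _ (by simp [h1 x hx])) ?_)⟩
  rw [dist_eq_norm, add_sub_cancel_left, norm_smul, Real.norm_of_nonneg hh.1]
  simpa using hh.2

lemma RoomFor.mem (hi : i ≠ Fin.last m) (hR : RoomFor i r O₁ O) (hh : h ∈ Icc 0 r)
    {x : Eu (m + 1)} (hx : x ∈ O₁ ∩ lowerHalf m) :
    x + h • EuclideanSpace.single i (1 : ℝ) ∈ O ∩ lowerHalf m :=
  ⟨hR x hx.1 h hh, by
    change vert _ < 0
    rw [vert_add_single hi]; exact hx.2⟩

lemma RoomFor.translate_grad (hi : i ≠ Fin.last m) (hR : RoomFor i r O₁ O) (hh : h ∈ Icc 0 r)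
    {bc : BC} {φ : Eu (m + 1) → ℝ} (hφ : IsTestFunction (gradSet bc O₁) φ) :
    IsTestFunction (gradSet bc O) fun x => φ (x - h • EuclideanSpace.single i (1 : ℝ)) := by
  refine ⟨hφ.1.comp (contDiff_id.sub contDiff_const),
    hφ.2.1.comp_homeomorph (Homeomorph.subRight _), ?_⟩
  rw [tsupport_translate]
  intro x hx
  have h1 := hφ.2.2 hx
  cases bc
  · have := hR _ h1 h hh
    rwa [sub_add_cancel] at this
  · have := hR.mem hi hh h1
    rwa [sub_add_cancel] at this

lemma RoomFor.translate_eqn (hi : i ≠ Fin.last m) (hR : RoomFor i r O₁ O) (hh : h ∈ Icc 0 r)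
    {bc : BC} {φ : Eu (m + 1) → ℝ} (hφ : IsTestFunction (eqnSet bc O₁) φ) :
    IsTestFunction (eqnSet bc O) fun x => φ (x - h • EuclideanSpace.single i (1 : ℝ)) := by
  cases bc
  · exact hR.translate_grad (bc := BC.N) hi hh hφ
  · exact hR.translate_grad (bc := BC.D) hi hh hφ

lemma lintegral_translate_le (hi : i ≠ Fin.last m) (hR : RoomFor i r O₁ O) (hh : h ∈ Icc 0 r)
    (hO₁ : IsOpen O₁) (hO : IsOpen O) (F : Eu (m + 1) → ℝ≥0∞) :
    ∫⁻ x in O₁ ∩ lowerHalf m, F (x + h • EuclideanSpace.single i (1 : ℝ)) ≤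
      ∫⁻ x in O ∩ lowerHalf m, F x := by
  rw [← lintegral_indicator (hO₁.inter isOpen_lowerHalf).measurableSet,
    ← lintegral_indicator (hO.inter isOpen_lowerHalf).measurableSet,
    ← lintegral_add_right_eq_self ((O ∩ lowerHalf m).indicator F)
      (h • EuclideanSpace.single i (1 : ℝ) : Eu (m + 1))]
  refine lintegral_mono fun x => ?_
  by_cases hx : x ∈ O₁ ∩ lowerHalf m
  · rw [indicator_of_mem hx, indicator_of_mem (hR.mem hi hh hx)]
  · rw [indicator_of_notMem hx]
    exact zero_le

lemma memLp_translate (hi : i ≠ Fin.last m) (hR : RoomFor i r O₁ O) (hh : h ∈ Icc 0 r)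
    (hO₁ : IsOpen O₁) (hO : IsOpen O) {v : Eu (m + 1) → ℝ}
    (hv : MemLp v 2 (volume.restrict (O ∩ lowerHalf m))) :
    MemLp (fun x => v (x + h • EuclideanSpace.single i (1 : ℝ))) 2
      (volume.restrict (O₁ ∩ lowerHalf m)) ∧
    lpNorm (fun x => v (x + h • EuclideanSpace.single i (1 : ℝ))) 2
      (volume.restrict (O₁ ∩ lowerHalf m)) ≤ lpNorm v 2 (volume.restrict (O ∩ lowerHalf m)) := by
  have hWm : MeasurableSet (O ∩ lowerHalf m) := (hO.inter isOpen_lowerHalf).measurableSet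
  have hWm1 : MeasurableSet (O₁ ∩ lowerHalf m) := (hO₁.inter isOpen_lowerHalf).measurableSet
  set e : Eu (m + 1) := h • EuclideanSpace.single i (1 : ℝ) with he
  have hm : AEStronglyMeasurable (fun x => v (x + e)) (volume.restrict (O₁ ∩ lowerHalf m)) := by
    have h1 : AEStronglyMeasurable (fun x => (O ∩ lowerHalf m).indicator v (x + e)) volume :=
      ((aestronglyMeasurable_indicator_iff hWm).2 hv.1).comp_measurePreserving
        (measurePreserving_add_right volume e)
    refine (h1.mono_measure Measure.restrict_le_self).congr ?_
    filter_upwards [ae_restrict_mem hWm1] with x hx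
    rw [indicator_of_mem (hR.mem hi hh hx)]
  have hle : eLpNorm (fun x => v (x + e)) 2 (volume.restrict (O₁ ∩ lowerHalf m)) ≤
      eLpNorm v 2 (volume.restrict (O ∩ lowerHalf m)) := by
    refine (ENNReal.pow_le_pow_left_iff two_ne_zero).1 ?_
    rw [sq_eLpNorm_two, sq_eLpNorm_two]
    exact lintegral_translate_le hi hR hh hO₁ hO fun x => ‖v x‖ₑ ^ 2
  refine ⟨⟨hm, hle.trans_lt hv.2⟩, ?_⟩
  rw [← toReal_eLpNorm hm, ← toReal_eLpNorm hv.1]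
  exact ENNReal.toReal_mono hv.2.ne hle

lemma integral_translate (hi : i ≠ Fin.last m) (hR : RoomFor i r O₁ O) (hh : h ∈ Icc 0 r)
    (hO₁ : IsOpen O₁) (hO : IsOpen O) {v ψ : Eu (m + 1) → ℝ} (hψ : ∀ x ∉ O₁, ψ x = 0) :
    ∫ x in O₁ ∩ lowerHalf m, v (x + h • EuclideanSpace.single i (1 : ℝ)) * ψ x =
      ∫ x in O ∩ lowerHalf m, v x * ψ (x - h • EuclideanSpace.single i (1 : ℝ)) := by
  rw [← integral_indicator (hO₁.inter isOpen_lowerHalf).measurableSet,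
    ← integral_indicator (hO.inter isOpen_lowerHalf).measurableSet,
    ← integral_add_right_eq_self ((O ∩ lowerHalf m).indicator _)
      (h • EuclideanSpace.single i (1 : ℝ) : Eu (m + 1))]
  congr 1
  ext x
  by_cases hx : x ∈ O₁ ∩ lowerHalf m
  · rw [indicator_of_mem hx, indicator_of_mem (hR.mem hi hh hx), add_sub_cancel_right]
  · rw [indicator_of_notMem hx]
    by_cases hx1 : x ∈ O₁
    · rw [indicator_of_notMem]
      intro h2
      refine hx ⟨hx1, ?_⟩
      have := h2.2
      change vert _ < 0 at this
      rwa [vert_add_single hi] at this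
    · simp [indicator, hψ x hx1]

/-- The difference quotient in direction `i`. -/
noncomputable def diffQuot (i : Fin (m + 1)) (h : ℝ) (v : Eu (m + 1) → ℝ) (x : Eu (m + 1)) : ℝ :=
  h⁻¹ * (v (x + h • EuclideanSpace.single i (1 : ℝ)) - v x)

lemma memLp_diffQuot (hi : i ≠ Fin.last m) (hR : RoomFor i r O₁ O) (hh : h ∈ Icc 0 r)
    (hO₁ : IsOpen O₁) (hO : IsOpen O) {v : Eu (m + 1) → ℝ}
    (hv : MemLp v 2 (volume.restrict (O ∩ lowerHalf m))) :
    MemLp (diffQuot i h v) 2 (volume.restrict (O₁ ∩ lowerHalf m)) :=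
  ((memLp_translate hi hR hh hO₁ hO hv).1.sub (hv.mono_measure (Measure.restrict_mono
    (inter_subset_inter_left _ (hR.subset (hh.1.trans hh.2))) le_rfl))).const_mul _

/-- Summation by parts: the change of variables moves the difference onto `ψ`, with the step
reversed. A tangential shift maps the half space to itself, so there is no boundary contribution. -/
lemma integral_diffQuot (hi : i ≠ Fin.last m) (hR : RoomFor i r O₁ O) (hh : h ∈ Icc 0 r)
    (hO₁ : IsOpen O₁) (hO : IsOpen O) {v ψ : Eu (m + 1) → ℝ} (hψ : ∀ x ∉ O₁, ψ x = 0)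
    (hv : MemLp v 2 (volume.restrict (O ∩ lowerHalf m)))
    (hψm : MemLp ψ 2 volume) :
    ∫ x in O₁ ∩ lowerHalf m, diffQuot i h v x * ψ x =
      h⁻¹ * ∫ x in O ∩ lowerHalf m,
        v x * (ψ (x - h • EuclideanSpace.single i (1 : ℝ)) - ψ x) := by
  have hOO : O₁ ∩ lowerHalf m ⊆ O ∩ lowerHalf m :=
    inter_subset_inter_left _ (hR.subset (hh.1.trans hh.2))
  have hψm' : MemLp (fun x => ψ (x - h • EuclideanSpace.single i (1 : ℝ))) 2 volume :=
    hψm.comp_measurePreserving (measurePreserving_sub_right volume _)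
  have hle := Measure.restrict_mono hOO (le_refl (volume : Measure (Eu (m + 1))))
  simp_rw [diffQuot, mul_assoc, integral_const_mul, sub_mul, mul_sub]
  rw [integral_sub, integral_sub, integral_translate hi hR hh hO₁ hO hψ]
  · congr 2
    refine (setIntegral_eq_of_subset_of_forall_sdiff_eq_zero
      (hO.inter isOpen_lowerHalf).measurableSet hOO fun x hx => ?_).symm
    rw [hψ x fun h1 => hx.2 ⟨h1, hx.1.2⟩, mul_zero]
  · exact integrable_mul_of_memLp hv (hψm'.mono_measure Measure.restrict_le_self)
  · exact integrable_mul_of_memLp hv (hψm.mono_measure Measure.restrict_le_self)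
  · exact integrable_mul_of_memLp (memLp_translate hi hR hh hO₁ hO hv).1
      (hψm.mono_measure Measure.restrict_le_self)
  · exact integrable_mul_of_memLp (hv.mono_measure hle)
      (hψm.mono_measure Measure.restrict_le_self)

/-- Difference quotients converge to the weak derivative. -/
lemma tendsto_diffQuot (hi : i ≠ Fin.last m) (hR : RoomFor i r O₁ O) (hr : 0 < r)
    (hO₁ : IsOpen O₁) (hO : IsOpen O) {v w : Eu (m + 1) → ℝ}
    (hv : MemLp v 2 (volume.restrict (O ∩ lowerHalf m)))
    (hw : MemLp w 2 (volume.restrict (O ∩ lowerHalf m)))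
    (hD : WD (O ∩ lowerHalf m) (O ∩ lowerHalf m) i v w) :
    L2Lim (volume.restrict (O₁ ∩ lowerHalf m)) (fun j : ℕ => diffQuot i (r / ((j : ℝ) + 1)) v) w := by
  have hWm : MeasurableSet (O ∩ lowerHalf m) := (hO.inter isOpen_lowerHalf).measurableSet
  have hW1 : IsOpen (O₁ ∩ lowerHalf m) := hO₁.inter isOpen_lowerHalf
  have hWm1 := hW1.measurableSet
  set e : Eu (m + 1) := EuclideanSpace.single i (1 : ℝ) with he
  have hen : ‖e‖ = 1 := by simp [he]
  have hhj : ∀ j : ℕ, r / ((j : ℝ) + 1) ∈ Ioc 0 r := fun j =>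
    ⟨by positivity, div_le_self hr.le (by linarith [Nat.cast_nonneg (α := ℝ) j])⟩
  have hv0 : MemLp ((O ∩ lowerHalf m).indicator v) 2 volume := (memLp_indicator_iff_restrict hWm).2 hv
  have hw0 : MemLp ((O ∩ lowerHalf m).indicator w) 2 volume := (memLp_indicator_iff_restrict hWm).2 hw
  have hOO : O₁ ∩ lowerHalf m ⊆ O ∩ lowerHalf m := inter_subset_inter_left _ (hR.subset hr.le)
  have hle := Measure.restrict_mono hOO (le_refl (volume : Measure (Eu (m + 1))))
  have hw1 := hw.mono_measure hle
  refine ⟨fun j => memLp_diffQuot hi hR ⟨(hhj j).1.le, (hhj j).2⟩ hO₁ hO hv, hw1, ?_⟩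
  rw [ENNReal.tendsto_nhds_zero]
  intro δ hδ
  have hδ1 : 0 < min δ 1 := lt_min hδ one_pos
  obtain ⟨s, hs, hball⟩ := Metric.eventually_nhds_iff.1
    ((tendsto_eLpNorm_translate_sub hw0).eventually_le_const hδ1)
  have hlim : Tendsto (fun j : ℕ => r / ((j : ℝ) + 1)) atTop (𝓝 0) := by
    have := (tendsto_one_div_add_atTop_nhds_zero_nat (𝕜 := ℝ)).const_mul r
    rw [mul_zero] at this
    exact this.congr fun j => by ring
  filter_upwards [hlim.eventually_lt_const hs] with j hj
  set h := r / ((j : ℝ) + 1) with hh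
  have hh0 : h ∈ Ioc 0 r := hhj j
  have hhI : h ∈ Icc 0 r := ⟨hh0.1.le, hh0.2⟩
  set w0 := (O ∩ lowerHalf m).indicator w with hw0def
  set v0 := (O ∩ lowerHalf m).indicator v with hv0def
  -- the average of the derivative over the segment from `x` to `x + h e`
  obtain ⟨ham, -, hav⟩ := eLpNorm_average_sub_le (μ := segMeasure (-(h • e))) hw0 (δ := min δ 1)
    ((ae_segMeasure _).mono fun t ht => by
      obtain ⟨s', hs', rfl⟩ := ht
      refine hball ?_
      rw [dist_zero_right, norm_smul, norm_neg, norm_smul, hen, Real.norm_of_nonneg hs'.1,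
        Real.norm_of_nonneg hh0.1.le]
      nlinarith [hs'.2, hh0.1])
  set avg : Eu (m + 1) → ℝ := fun x => ∫ t, w0 (x - t) ∂segMeasure (-(h • e)) with havg
  have hdq := memLp_diffQuot hi hR hhI hO₁ hO hv
  have havgL : MemLp avg 2 volume := by
    have h1 : MemLp (fun x => avg x - w0 x) 2 volume :=
      ⟨ham.sub hw0.1, hav.trans_lt ((min_le_right _ _).trans_lt ENNReal.one_lt_top)⟩
    have := h1.add hw0
    exact this.congr_norm ham (Eventually.of_forall fun x => by simp)
  -- Fundamental theorem of calculus for weak derivatives, checked against test functions: the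
  -- average is transferred to `φ`, the derivative is integrated by parts, and the average of `∂ᵢφ`
  -- over the segment is a difference of values of `φ`.
  have hae : diffQuot i h v =ᵐ[volume.restrict (O₁ ∩ lowerHalf m)] avg := by
    refine ae_eq_of_forall_test hW1 (locallyIntegrableOn_of_memLp hdq)
      (locallyIntegrableOn_of_memLp (havgL.mono_measure Measure.restrict_le_self)) fun φ hφ => ?_
    have hφ0 : ∀ x ∉ O₁ ∩ lowerHalf m, φ x = 0 := fun x hx =>
      image_eq_zero_of_notMem_tsupport fun h => hx (hφ.2.2 h)
    have hφL : MemLp φ 2 volume := hφ.c1.memLp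
    have hdL : MemLp (partialD i φ) 2 volume := hφ.c1.memLp_partialD i
    have hind : ∀ F G : Eu (m + 1) → ℝ, ∫ x, (O ∩ lowerHalf m).indicator F x * G x =
        ∫ x in O ∩ lowerHalf m, F x * G x := fun F G => by
      rw [← integral_indicator hWm]
      congr 1 with x
      by_cases hx : x ∈ O ∩ lowerHalf m
      · simp [indicator_of_mem hx]
      · simp [indicator_of_notMem hx]
    rw [integral_diffQuot hi hR hhI hO₁ hO (fun x hx => hφ0 x fun h => hx h.1) hv hφL,
      setIntegral_eq_integral_of_forall_compl_eq_zero (f := fun x => avg x * φ x)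
        fun x hx => by rw [hφ0 x hx, mul_zero],
      havg, integral_average_mul hw0 hφL, integral_segMeasure_neg]
    have h1 : ∀ᵐ t ∂segMeasure (h • e), ∫ x, w0 x * φ (x + -t) =
        -∫ x, v0 x * partialD i φ (x - t) := by
      refine (ae_segMeasure (h • e)).mono fun t ht => ?_
      obtain ⟨s', hs', rfl⟩ := ht
      have h2 : s' * h ∈ Icc 0 r := ⟨mul_nonneg hs'.1 hh0.1.le,
        (mul_le_of_le_one_left hh0.1.le hs'.2).trans hh0.2⟩
      have h3 := hD _ (hR.translate_grad (bc := BC.N) hi h2 hφ)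
      simp_rw [partialD_translate] at h3
      rw [hind, hind, smul_smul, h3, neg_neg]
      rfl
    rw [integral_congr_ae h1, integral_neg, ← integral_mul_average hv0 hdL, hind]
    have h4 : ∀ x, ∫ t, partialD i φ (x - t) ∂segMeasure (h • e) =
        h⁻¹ * (φ x - φ (x - h • e)) := fun x => by
      rw [← integral_segMeasure_partialD hφ.c1.1 i h x, inv_mul_cancel_left₀ hh0.1.ne']
    simp_rw [h4]
    rw [← integral_const_mul, ← integral_neg]
    congr 1 with x
    ring
  calc eLpNorm (fun x => diffQuot i h v x - w x) 2 (volume.restrict (O₁ ∩ lowerHalf m))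
      = eLpNorm (fun x => avg x - w0 x) 2 (volume.restrict (O₁ ∩ lowerHalf m)) := by
        refine eLpNorm_congr_ae ?_
        filter_upwards [hae, ae_restrict_mem hWm1] with x hx hx1
        rw [hx, hw0def, indicator_of_mem (hOO hx1)]
    _ ≤ eLpNorm (fun x => avg x - w0 x) 2 volume := eLpNorm_restrict_le _ _ _ _
    _ ≤ δ := hav.trans (min_le_left _ _)

end Translate

lemma lpNorm_indicator {α : Type*} [MeasurableSpace α] {μ : Measure α} {s : Set α}
    (hs : MeasurableSet s) {f : α → ℝ} (hf : MemLp f 2 (μ.restrict s)) :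
    lpNorm (s.indicator f) 2 μ = lpNorm f 2 (μ.restrict s) := by
  rw [← toReal_eLpNorm hf.1, ← toReal_eLpNorm ((aestronglyMeasurable_indicator_iff hs).2 hf.1),
    eLpNorm_indicator_eq_eLpNorm_restrict hs]

lemma lpNorm_le_add {α : Type*} [MeasurableSpace α] {μ : Measure α} {f g : α → ℝ}
    (hf : MemLp f 2 μ) : lpNorm (fun x => f x + g x) 2 μ ≤ lpNorm f 2 μ + lpNorm g 2 μ :=
  lpNorm_add_le hf one_le_two

lemma WD.zero {n : ℕ} {W S : Set (Eu n)} {i : Fin n} :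
    WD W S i (fun _ => (0 : ℝ)) (fun _ => 0) := fun φ _ => by simp

lemma WD.sum {n : ℕ} {ι : Type*} {W S : Set (Eu n)} {i : Fin n} (s : Finset ι)
    {u g : ι → Eu n → ℝ} (hu : ∀ j, MemLp (u j) 2 (volume.restrict W))
    (hg : ∀ j, MemLp (g j) 2 (volume.restrict W)) (h : ∀ j, WD W S i (u j) (g j)) :
    WD W S i (fun x => ∑ j ∈ s, u j x) (fun x => ∑ j ∈ s, g j x) := by
  classical
  induction s using Finset.induction_on with
  | empty => simpa using WD.zero
  | insert a s ha ih =>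
    simp_rw [Finset.sum_insert ha]
    exact (h a).add (hu a) (hg a) (memLp_finsetSum _ fun j _ => hu j)
      (memLp_finsetSum _ fun j _ => hg j) ih

lemma abs_integral_mul_average_le {n : ℕ} {μ : Measure (Eu n)} [IsProbabilityMeasure μ]
    {f P : Eu n → ℝ} (hf : MemLp f 2 volume) (hP : MemLp P 2 volume) :
    |∫ x, f x * ∫ t, P (x - t) ∂μ| ≤ lpNorm f 2 volume * lpNorm P 2 volume := by
  rw [integral_mul_average hf hP]
  have h1 : ∀ t, ‖∫ x, f x * P (x - t)‖ ≤ lpNorm f 2 volume * lpNorm P 2 volume := fun t => by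
    have hmp := measurePreserving_sub_right (volume : Measure (Eu n)) t
    have hPt : MemLp (fun x => P (x - t)) 2 volume := hP.comp_measurePreserving hmp
    have h2 : lpNorm (fun x => P (x - t)) 2 volume = lpNorm P 2 volume := by
      rw [← toReal_eLpNorm hPt.1, ← toReal_eLpNorm hP.1]
      exact congrArg ENNReal.toReal (eLpNorm_comp_measurePreserving hP.1 hmp)
    rw [← h2]
    exact abs_integral_mul_le hf hPt
  have h3 := norm_integral_le_of_norm_le_const (μ := μ) (Eventually.of_forall h1)
  rwa [probReal_univ, mul_one] at h3

/-! ### Tangential regularity of solutions. -/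

section Tangential

variable {m : ℕ} {i : Fin (m + 1)} {O O₁ O₂ : Set (Eu (m + 1))} {r h : ℝ}

/-- The difference of `φ` is `h` times an average of `∂ᵢφ` over a tangential segment, which stays
below the boundary. Thus only the norm of `∂ᵢφ` in the half space enters, and no derivative falls on
`f`. -/
lemma abs_integral_shift_sub_le (hi : i ≠ Fin.last m) (hh : 0 ≤ h)
    (hO₁ : IsOpen O₁) (hO : IsOpen O) {f φ : Eu (m + 1) → ℝ}
    (hf : MemLp f 2 (volume.restrict (O ∩ lowerHalf m))) (hφ : IsC1Test O₁ φ) :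
    |∫ x in O ∩ lowerHalf m, f x * (φ (x - h • EuclideanSpace.single i (1 : ℝ)) - φ x)| ≤
      h * (lpNorm f 2 (volume.restrict (O ∩ lowerHalf m)) *
        lpNorm (partialD i φ) 2 (volume.restrict (O₁ ∩ lowerHalf m))) := by
  have hWm : MeasurableSet (O ∩ lowerHalf m) := (hO.inter isOpen_lowerHalf).measurableSet
  have hWm1 : MeasurableSet (O₁ ∩ lowerHalf m) := (hO₁.inter isOpen_lowerHalf).measurableSet
  have hdL : MemLp (partialD i φ) 2 (volume.restrict (O₁ ∩ lowerHalf m)) := hφ.memLp_partialD i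
  set e : Eu (m + 1) := EuclideanSpace.single i (1 : ℝ) with he
  have hP : MemLp ((O₁ ∩ lowerHalf m).indicator (partialD i φ)) 2 volume :=
    (memLp_indicator_iff_restrict hWm1).2 hdL
  have hf0 : MemLp ((O ∩ lowerHalf m).indicator f) 2 volume := (memLp_indicator_iff_restrict hWm).2 hf
  have hPn := lpNorm_indicator hWm1 hdL
  have hfn := lpNorm_indicator hWm hf
  set P := (O₁ ∩ lowerHalf m).indicator (partialD i φ) with hPdef
  set f0 := (O ∩ lowerHalf m).indicator f with hf0def
  have h1 : ∀ x ∈ O ∩ lowerHalf m,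
      φ (x - h • e) - φ x = -(h * ∫ t, P (x - t) ∂segMeasure (h • e)) := fun x hx => by
    rw [← neg_sub, ← integral_segMeasure_partialD hφ.1 i h x]
    congr 2
    refine integral_congr_ae ((ae_segMeasure _).mono fun t ht => ?_)
    obtain ⟨s, hs, rfl⟩ := ht
    change partialD i φ (x - s • h • e) = P (x - s • h • e)
    by_cases hx1 : x - s • h • e ∈ O₁
    · rw [hPdef, indicator_of_mem]
      refine ⟨hx1, ?_⟩
      change vert _ < 0
      rw [sub_eq_add_neg, smul_smul, ← neg_smul, he, vert_add_single hi]
      exact hx.2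
    · rw [hPdef, indicator_of_notMem fun h => hx1 h.1]
      exact partialD_eq_zero fun h => hx1 (hφ.2.2 h)
  have h2 : ∫ x in O ∩ lowerHalf m, f x * (φ (x - h • e) - φ x) =
      -(h * ∫ x, f0 x * ∫ t, P (x - t) ∂segMeasure (h • e)) := by
    rw [← integral_const_mul, ← integral_neg, ← integral_indicator hWm]
    congr 1 with x
    by_cases hx : x ∈ O ∩ lowerHalf m
    · simp only [indicator_of_mem hx, hf0def, h1 x hx]
      ring
    · simp [indicator_of_notMem hx, hf0def]
  rw [h2, abs_neg, abs_mul, abs_of_nonneg hh, ← hPn, ← hfn]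
  exact mul_le_mul_of_nonneg_left (abs_integral_mul_average_le hf0 hP) hh

lemma abs_diffQuot_le (hi : i ≠ Fin.last m) (hR : RoomFor i r O₁ O) (hh : h ∈ Ioc 0 r)
    (hO : IsOpen O) {c : Eu (m + 1) → ℝ} {B : ℝ} (hc : ContDiffOn ℝ 1 c (O ∩ lowerHalf m))
    (hB : ∀ x ∈ O ∩ lowerHalf m, |partialD i c x| ≤ B) {x : Eu (m + 1)}
    (hx : x ∈ O₁ ∩ lowerHalf m) : |diffQuot i h c x| ≤ B := by
  set e : Eu (m + 1) := EuclideanSpace.single i (1 : ℝ) with he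
  have hmem : ∀ s ∈ Icc 0 h, x + s • e ∈ O ∩ lowerHalf m := fun s hs =>
    hR.mem hi ⟨hs.1, hs.2.trans hh.2⟩ hx
  have h1 := norm_image_sub_le_of_norm_deriv_le_segment' (f := fun s : ℝ => c (x + s • e))
    (f' := fun s => partialD i c (x + s • e)) (a := 0) (b := h) (C := B)
    (fun s hs => by
      have h2 : HasDerivAt (fun s : ℝ => x + s • e) e s := by
        simpa using ((hasDerivAt_id s).smul_const e).const_add x
      have h3 : DifferentiableAt ℝ c (x + s • e) :=
        (hc.differentiableOn (by simp) _ (hmem s hs)).differentiableAt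
          ((hO.inter isOpen_lowerHalf).mem_nhds (hmem s hs))
      exact (h3.hasFDerivAt.comp_hasDerivAt s h2).hasDerivWithinAt)
    (fun s hs => hB _ (hmem s ⟨hs.1, hs.2.le⟩)) h ⟨hh.1.le, le_rfl⟩
  rw [zero_smul, add_zero, sub_zero, Real.norm_eq_abs] at h1
  rw [diffQuot, abs_mul, abs_inv, abs_of_pos hh.1, inv_mul_le_iff₀ hh.1, mul_comm h]
  exact h1

lemma WD.diffQuot (hi : i ≠ Fin.last m) (hR : RoomFor i r O₁ O) (hh : h ∈ Icc 0 r)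
    (hO₁ : IsOpen O₁) (hO : IsOpen O) {bc : BC} {l : Fin (m + 1)} {u g : Eu (m + 1) → ℝ}
    (hu : MemLp u 2 (volume.restrict (O ∩ lowerHalf m)))
    (hg : MemLp g 2 (volume.restrict (O ∩ lowerHalf m)))
    (hD : WD (O ∩ lowerHalf m) (gradSet bc O) l u g) :
    WD (O₁ ∩ lowerHalf m) (gradSet bc O₁) l (diffQuot i h u) (diffQuot i h g) := by
  intro φ hφ
  have hsub := gradSet_subset bc O₁
  have hφ' := hφ.mono (gradSet_mono bc (hR.subset (hh.1.trans hh.2)))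
  have hφt := hR.translate_grad hi hh hφ
  have i1 : ∀ {v ψ}, MemLp v 2 (volume.restrict (O ∩ lowerHalf m)) → IsTestFunction (gradSet bc O) ψ →
      Integrable (fun x => v x * ψ x) (volume.restrict (O ∩ lowerHalf m)) :=
    fun hv hψ => integrable_mul_of_memLp hv hψ.c1.memLp
  have i2 : ∀ {v ψ}, MemLp v 2 (volume.restrict (O ∩ lowerHalf m)) → IsTestFunction (gradSet bc O) ψ →
      Integrable (fun x => v x * partialD l ψ x) (volume.restrict (O ∩ lowerHalf m)) :=
    fun hv hψ => integrable_mul_of_memLp hv (hψ.c1.memLp_partialD l)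
  rw [integral_diffQuot hi hR hh hO₁ hO (fun x hx => partialD_eq_zero fun h' =>
      hx (hsub (hφ.2.2 h'))) hu (hφ.c1.memLp_partialD l),
    integral_diffQuot hi hR hh hO₁ hO (fun x hx => image_eq_zero_of_notMem_tsupport fun h' =>
      hx (hsub (hφ.2.2 h'))) hg hφ.c1.memLp, ← mul_neg, ← integral_neg]
  have e1 := hD _ hφt
  have e2 := hD _ hφ'
  have j1 := i2 hu hφt
  simp_rw [partialD_translate] at e1 j1
  simp_rw [mul_sub, neg_sub]
  rw [integral_sub j1 (i2 hu hφ'), integral_sub (i1 hg hφ') (i1 hg hφt), e1, e2]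
  ring

/-- The difference quotients of a solution solve an equation with bounded right-hand side. -/
lemma FlatSol.abs_integral_diffQuot_le {bc : BC} {a : Fin (m + 1) → Fin (m + 1) → Eu (m + 1) → ℝ}
    {f u : Eu (m + 1) → ℝ} {Φ g : Fin (m + 1) → Eu (m + 1) → ℝ} {η Λ Λ' B : ℝ}
    (hsol : FlatSol bc O a f Φ u g) (ha : IsElliptic (O ∩ lowerHalf m) a η Λ)
    (hi : i ≠ Fin.last m) (hR : RoomFor i r O₁ O) (hh : h ∈ Ioc 0 r)
    (hO₁ : IsOpen O₁) (hO : IsOpen O)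
    (hac : ∀ l k, ContDiffOn ℝ 1 (a l k) (O ∩ lowerHalf m)) (hΛ' : 0 ≤ Λ')
    (hab : ∀ l k, ∀ x ∈ O ∩ lowerHalf m, |partialD i (a l k) x| ≤ Λ')
    (hB : ∀ l, lpNorm (diffQuot i h (Φ l)) 2 (volume.restrict (O₁ ∩ lowerHalf m)) ≤ B)
    {φ : Eu (m + 1) → ℝ} (hφ : IsTestFunction (eqnSet bc O₁) φ) :
    |∫ x in O₁ ∩ lowerHalf m, ∑ l, flux a (fun k => diffQuot i h (g k)) l x * partialD l φ x| ≤
      (lpNorm f 2 (volume.restrict (O ∩ lowerHalf m)) + B +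
        Λ' * ∑ k, lpNorm (g k) 2 (volume.restrict (O ∩ lowerHalf m))) *
      ∑ l, lpNorm (partialD l φ) 2 (volume.restrict (O₁ ∩ lowerHalf m)) := by
  have hWm : MeasurableSet (O ∩ lowerHalf m) := (hO.inter isOpen_lowerHalf).measurableSet
  have hWm1 : MeasurableSet (O₁ ∩ lowerHalf m) := (hO₁.inter isOpen_lowerHalf).measurableSet
  have hhI : h ∈ Icc 0 r := ⟨hh.1.le, hh.2⟩
  have hOO := hR.subset (hh.1.le.trans hh.2)
  have hle := Measure.restrict_mono (inter_subset_inter_left (lowerHalf m) hOO)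
    (le_refl (volume : Measure (Eu (m + 1))))
  set W := O ∩ lowerHalf m with hW
  set W₁ := O₁ ∩ lowerHalf m with hW₁
  set e : Eu (m + 1) := EuclideanSpace.single i (1 : ℝ) with he
  have hF := ha.memLp_flux hWm hsol.memLp_g
  have hF' : ∀ l, MemLp (diffQuot i h (flux a g l)) 2 (volume.restrict W₁) := fun l =>
    memLp_diffQuot hi hR hhI hO₁ hO (hF l)
  have hG' : ∀ k, MemLp (diffQuot i h (g k)) 2 (volume.restrict W₁) := fun k =>
    memLp_diffQuot hi hR hhI hO₁ hO (hsol.memLp_g k)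
  have hΦ' : ∀ l, MemLp (diffQuot i h (Φ l)) 2 (volume.restrict W₁) := fun l =>
    memLp_diffQuot hi hR hhI hO₁ hO (hsol.memLp_Φ l)
  have hdφ : ∀ l, MemLp (partialD l φ) 2 (volume.restrict W₁) := fun l => hφ.c1.memLp_partialD l
  -- the commutator
  set q : Fin (m + 1) → Fin (m + 1) → Eu (m + 1) → ℝ := fun l k x =>
    diffQuot i h (a l k) x * g k (x + h • e) with hq
  have hgt := fun k => memLp_translate hi hR hhI hO₁ hO (hsol.memLp_g k)
  have hqm : ∀ l k, AEStronglyMeasurable (diffQuot i h (a l k)) (volume.restrict W₁) := fun l k => by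
    have h1 : ContinuousOn (diffQuot i h (a l k)) W₁ := by
      refine continuousOn_const.mul (((hac l k).continuousOn.comp (by fun_prop) fun x hx =>
        hR.mem hi hhI hx).sub ((hac l k).continuousOn.mono (inter_subset_inter_left _ hOO)))
    exact h1.aestronglyMeasurable hWm1
  have hqb : ∀ l k, ∀ᵐ x ∂volume.restrict W₁, |diffQuot i h (a l k) x| ≤ Λ' := fun l k =>
    (ae_restrict_mem hWm1).mono fun x hx => abs_diffQuot_le hi hR hh hO (hac l k) (hab l k) hx
  have hqL : ∀ l k, MemLp (q l k) 2 (volume.restrict W₁) := fun l k =>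
    memLp_bdd_mul (hgt k).1 (hqm l k) (hqb l k)
  have hqn : ∀ l k, lpNorm (q l k) 2 (volume.restrict W₁) ≤
      Λ' * lpNorm (g k) 2 (volume.restrict W) := fun l k =>
    (lpNorm_bdd_mul_le (hgt k).1 (hqm l k) hΛ' (hqb l k)).trans
      (mul_le_mul_of_nonneg_left (hgt k).2 hΛ')
  -- Discrete product rule: differencing the flux produces the flux of the differenced gradient and
  -- an error in which the coefficients are differenced and the gradient is only translated.
  have hprod : ∀ l x, flux a (fun k => diffQuot i h (g k)) l x =
      diffQuot i h (flux a g l) x - ∑ k, q l k x := fun l x => by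
    simp only [flux, diffQuot, hq, ← Finset.sum_sub_distrib, Finset.mul_sum]
    refine Finset.sum_congr rfl fun k _ => ?_
    ring
  have hz : ∀ x ∉ O₁, φ x = 0 ∧ ∀ l, partialD l φ x = 0 := fun x hx => by
    have : x ∉ tsupport φ := fun h => hx (eqnSet_subset bc O₁ (hφ.2.2 h))
    exact ⟨image_eq_zero_of_notMem_tsupport this, fun l => partialD_eq_zero this⟩
  -- the equation tested with the difference quotient
  have hmain : ∑ l, ∫ x in W₁, diffQuot i h (flux a g l) x * partialD l φ x =
      h⁻¹ * (∫ x in W, f x * (φ (x - h • e) - φ x)) +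
        ∑ l, ∫ x in W₁, diffQuot i h (Φ l) x * partialD l φ x := by
    have hφt := hR.translate_eqn hi hhI hφ
    have hφ' := hφ.mono (eqnSet_mono bc hOO)
    have e1 := hsol.eqn _ hφt
    have e2 := hsol.eqn _ hφ'
    have i1 : ∀ {v ψ : Eu (m + 1) → ℝ}, MemLp v 2 (volume.restrict W) →
        IsTestFunction (eqnSet bc O) ψ → Integrable (fun x => v x * ψ x) (volume.restrict W) :=
      fun hv hψ => integrable_mul_of_memLp hv hψ.c1.memLp
    have i2 : ∀ {v ψ : Eu (m + 1) → ℝ}, MemLp v 2 (volume.restrict W) →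
        IsTestFunction (eqnSet bc O) ψ → ∀ l,
        Integrable (fun x => v x * partialD l ψ x) (volume.restrict W) :=
      fun hv hψ l => integrable_mul_of_memLp hv (hψ.c1.memLp_partialD l)
    have expand : ∀ {ψ : Eu (m + 1) → ℝ}, IsTestFunction (eqnSet bc O) ψ →
        ∑ l, ∫ x in W, flux a g l x * partialD l ψ x =
        (∫ x in W, f x * ψ x) + ∑ l, ∫ x in W, Φ l x * partialD l ψ x := fun {ψ} hψ => by
      have := hsol.eqn _ hψ
      rwa [integral_finsetSum _ fun l _ => i2 (hF l) hψ l, integral_add (i1 hsol.memLp_f hψ)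
        (integrable_finsetSum _ fun l _ => i2 (hsol.memLp_Φ l) hψ l),
        integral_finsetSum _ fun l _ => i2 (hsol.memLp_Φ l) hψ l] at this
    have dq : ∀ {v : Eu (m + 1) → ℝ}, MemLp v 2 (volume.restrict W) → ∀ l,
        ∫ x in W₁, diffQuot i h v x * partialD l φ x =
        h⁻¹ * ((∫ x in W, v x * partialD l (fun x => φ (x - h • e)) x) -
          ∫ x in W, v x * partialD l φ x) := fun {v} hv l => by
      rw [integral_diffQuot hi hR hhI hO₁ hO (fun x hx => (hz x hx).2 l) hv
        (hφ.c1.memLp_partialD l), ← integral_sub (i2 hv hφt l) (i2 hv hφ' l)]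
      simp_rw [partialD_translate, mul_sub]
      rfl
    simp_rw [fun l => dq (hF l) l, fun l => dq (hsol.memLp_Φ l) l, mul_sub,
      Finset.sum_sub_distrib, ← Finset.mul_sum]
    rw [expand hφt, expand hφ', integral_sub (i1 hsol.memLp_f hφt) (i1 hsol.memLp_f hφ')]
    ring
  have hsplit : ∫ x in W₁, ∑ l, flux a (fun k => diffQuot i h (g k)) l x * partialD l φ x =
      h⁻¹ * (∫ x in W, f x * (φ (x - h • e) - φ x)) +
        (∑ l, ∫ x in W₁, diffQuot i h (Φ l) x * partialD l φ x) -
        ∑ l, ∑ k, ∫ x in W₁, q l k x * partialD l φ x := by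
    have i3 : ∀ l, Integrable (fun x => diffQuot i h (flux a g l) x * partialD l φ x)
        (volume.restrict W₁) := fun l => integrable_mul_of_memLp (hF' l) (hdφ l)
    have i4 : ∀ l k, Integrable (fun x => q l k x * partialD l φ x)
        (volume.restrict W₁) := fun l k => integrable_mul_of_memLp (hqL l k) (hdφ l)
    rw [← hmain, ← Finset.sum_sub_distrib]
    simp_rw [hprod, sub_mul, Finset.sum_mul]
    rw [integral_finsetSum (f := fun l x => diffQuot i h (flux a g l) x * partialD l φ x -
      ∑ k, q l k x * partialD l φ x) _ fun l _ =>
      (i3 l).sub (integrable_finsetSum _ fun k _ => i4 l k)]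
    refine Finset.sum_congr rfl fun l _ => ?_
    rw [integral_sub (i3 l) (integrable_finsetSum _ fun k _ => i4 l k),
      integral_finsetSum _ fun k _ => i4 l k]
  rw [hsplit, sub_eq_add_neg]
  have hN : ∀ l, 0 ≤ lpNorm (partialD l φ) 2 (volume.restrict W₁) := fun l => lpNorm_nonneg
  have b1 : |h⁻¹ * (∫ x in W, f x * (φ (x - h • e) - φ x))| ≤
      lpNorm f 2 (volume.restrict W) * ∑ l, lpNorm (partialD l φ) 2 (volume.restrict W₁) := by
    have h1 := abs_integral_shift_sub_le hi hh.1.le hO₁ hO hsol.memLp_f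
      (hφ.c1.mono (eqnSet_subset bc O₁))
    rw [abs_mul, abs_inv, abs_of_pos hh.1, inv_mul_le_iff₀ hh.1]
    refine h1.trans (mul_le_mul_of_nonneg_left (mul_le_mul_of_nonneg_left ?_ lpNorm_nonneg) hh.1.le)
    exact Finset.single_le_sum (f := fun l => lpNorm (partialD l φ) 2 (volume.restrict W₁))
      (fun l _ => hN l) (Finset.mem_univ i)
  have b2 : |∑ l, ∫ x in W₁, diffQuot i h (Φ l) x * partialD l φ x| ≤
      B * ∑ l, lpNorm (partialD l φ) 2 (volume.restrict W₁) := by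
    refine (Finset.abs_sum_le_sum_abs _ _).trans ?_
    rw [Finset.mul_sum]
    exact Finset.sum_le_sum fun l _ => (abs_integral_mul_le (hΦ' l) (hdφ l)).trans
      (mul_le_mul_of_nonneg_right (hB l) (hN l))
  have b3 : |∑ l, ∑ k, ∫ x in W₁, q l k x * partialD l φ x| ≤
      (Λ' * ∑ k, lpNorm (g k) 2 (volume.restrict W)) *
        ∑ l, lpNorm (partialD l φ) 2 (volume.restrict W₁) := by
    refine (Finset.abs_sum_le_sum_abs _ _).trans ?_
    rw [Finset.mul_sum]
    refine Finset.sum_le_sum fun l _ => (Finset.abs_sum_le_sum_abs _ _).trans ?_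
    rw [Finset.mul_sum, Finset.sum_mul]
    exact Finset.sum_le_sum fun k _ => (abs_integral_mul_le (hqL l k) (hdφ l)).trans
      (mul_le_mul_of_nonneg_right (hqn l k) (hN l))
  refine (abs_add_le _ _).trans ((add_le_add (abs_add_le _ _) (abs_neg _).le).trans ?_)
  linarith

lemma ContDiffOn.continuousOn_partialD {n : ℕ} {W : Set (Eu n)} (hW : IsOpen W) {c : Eu n → ℝ}
    (hc : ContDiffOn ℝ 1 c W) (i : Fin n) : ContinuousOn (partialD i c) W :=
  (hc.continuousOn_fderiv_of_isOpen hW (by simp)).clm_apply continuousOn_const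

/-- Tangential derivatives of a solution are in `H¹`, and solve the differentiated equation. -/
theorem FlatSol.exists_tangential {bc : BC} {a : Fin (m + 1) → Fin (m + 1) → Eu (m + 1) → ℝ}
    {f u : Eu (m + 1) → ℝ} {Φ Φ' g : Fin (m + 1) → Eu (m + 1) → ℝ} {η Λ Λ' K₁ K₂ : ℝ}
    (hO : IsOpen O) (hO₁ : IsOpen O₁) (hO₂ : IsOpen O₂) (hη : 0 < η) (hΛ : 0 ≤ Λ)
    (hsol : FlatSol bc O a f Φ u g) (ha : IsElliptic (O ∩ lowerHalf m) a η Λ)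
    (hi : i ≠ Fin.last m) (hgap₁ : Gap O₁ O K₁) (hgap₂ : Gap O₂ O₁ K₂)
    (hac : ∀ l k, ContDiffOn ℝ 1 (a l k) (O ∩ lowerHalf m)) (hΛ' : 0 ≤ Λ')
    (hab : ∀ l k, ∀ x ∈ O ∩ lowerHalf m, |partialD i (a l k) x| ≤ Λ')
    (hΦ' : ∀ l, MemLp (Φ' l) 2 (volume.restrict (O ∩ lowerHalf m)))
    (hΦD : ∀ l, WD (O ∩ lowerHalf m) (O ∩ lowerHalf m) i (Φ l) (Φ' l)) :
    ∃ G, FlatSol bc O₂ a (fun _ => 0) (fun l x => Φ' l x - ∑ k, partialD i (a l k) x * g k x -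
      if l = i then f x else 0) (g i) G := by
  have hWo : IsOpen (O ∩ lowerHalf m) := hO.inter isOpen_lowerHalf
  have hWo1 : IsOpen (O₁ ∩ lowerHalf m) := hO₁.inter isOpen_lowerHalf
  have hWo2 : IsOpen (O₂ ∩ lowerHalf m) := hO₂.inter isOpen_lowerHalf
  have hWm := hWo.measurableSet
  have hWm1 := hWo1.measurableSet
  have hWm2 := hWo2.measurableSet
  have hs1 := hgap₁.subset
  have hs2 := hgap₂.subset
  have hsub1 := inter_subset_inter_left (lowerHalf m) hs1
  have hsub2 := inter_subset_inter_left (lowerHalf m) hs2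
  have hle1 := Measure.restrict_mono hsub1 (le_refl (volume : Measure (Eu (m + 1))))
  have hle2 := Measure.restrict_mono hsub2 (le_refl (volume : Measure (Eu (m + 1))))
  obtain ⟨r, hr, hR⟩ := hgap₁.exists_room hO i
  have hhj : ∀ j : ℕ, r / ((j : ℝ) + 1) ∈ Ioc 0 r := fun j =>
    ⟨by positivity, div_le_self hr.le (by linarith [Nat.cast_nonneg (α := ℝ) j])⟩
  have hhI : ∀ j : ℕ, r / ((j : ℝ) + 1) ∈ Icc 0 r := fun j => ⟨(hhj j).1.le, (hhj j).2⟩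
  have hguW : WD (O ∩ lowerHalf m) (O ∩ lowerHalf m) i u (g i) := fun φ hφ =>
    hsol.grad i φ (hφ.mono (inter_subset_gradSet bc O))
  have hlu := tendsto_diffQuot hi hR hr hO₁ hO hsol.memLp_u (hsol.memLp_g i) hguW
  have hlΦ := fun l => tendsto_diffQuot hi hR hr hO₁ hO (hsol.memLp_Φ l) (hΦ' l) (hΦD l)
  obtain ⟨B₀, hB₀⟩ := hlu.tendsto_lpNorm.bddAbove_range
  have hBl : ∀ l, ∃ B, ∀ j : ℕ, lpNorm (diffQuot i (r / ((j : ℝ) + 1)) (Φ l)) 2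
      (volume.restrict (O₁ ∩ lowerHalf m)) ≤ B := fun l => by
    obtain ⟨B, hB⟩ := (hlΦ l).tendsto_lpNorm.bddAbove_range
    exact ⟨B, fun j => hB ⟨j, rfl⟩⟩
  choose Bl hBl using hBl
  have hBl0 : ∀ l, 0 ≤ Bl l := fun l => lpNorm_nonneg.trans (hBl l 0)
  set B := lpNorm f 2 (volume.restrict (O ∩ lowerHalf m)) + ∑ l, Bl l +
        Λ' * ∑ k, lpNorm (g k) 2 (volume.restrict (O ∩ lowerHalf m)) with hB
  have hB0 : 0 ≤ B := by
    have h1 : 0 ≤ ∑ l, Bl l := Finset.sum_nonneg fun l _ => hBl0 l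
    have h2 : 0 ≤ ∑ k, lpNorm (g k) 2 (volume.restrict (O ∩ lowerHalf m)) :=
      Finset.sum_nonneg fun k _ => lpNorm_nonneg
    have h3 : 0 ≤ lpNorm f 2 (volume.restrict (O ∩ lowerHalf m)) := lpNorm_nonneg
    positivity
  have hG' : ∀ (j : ℕ) k, MemLp (diffQuot i (r / ((j : ℝ) + 1)) (g k)) 2
      (volume.restrict (O₁ ∩ lowerHalf m)) := fun j k =>
    memLp_diffQuot hi hR (hhI j) hO₁ hO (hsol.memLp_g k)
  have hWDj : ∀ (j : ℕ) l, WD (O₁ ∩ lowerHalf m) (gradSet bc O₁) l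
      (diffQuot i (r / ((j : ℝ) + 1)) u) (diffQuot i (r / ((j : ℝ) + 1)) (g l)) := fun j l =>
    (hsol.grad l).diffQuot hi hR (hhI j) hO₁ hO hsol.memLp_u (hsol.memLp_g l)
  obtain ⟨ζ, hζ, hζ1, hζ0, hζK⟩ := id hgap₂
  -- The difference quotient of `u` satisfies on `O₁` an inequality whose constant `B` does not
  -- depend on the step, so the energy estimate with `A = 0` bounds its gradient on `O₂` uniformly.
  -- The first gap makes room for the translations, the second carries the cutoff.
  have hbound : ∃ M, ∀ (j : ℕ) l, lpNorm (diffQuot i (r / ((j : ℝ) + 1)) (g l)) 2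
      (volume.restrict (O₂ ∩ lowerHalf m)) ≤ M := by
    refine ⟨√(energyConst (m + 1) η Λ * (K₂ ^ 2 * B₀ ^ 2 + B ^ 2)), fun j l => ?_⟩
    have key := energy_estimate hO₁ hη hΛ (ha.mono hsub1) (hlu.memLp j) (hG' j) (hWDj j) hζ hζ0 hζK
      (A := 0) (B := B) le_rfl hB0 fun φ hφ => by
        rw [zero_mul, zero_add]
        exact hsol.abs_integral_diffQuot_le ha hi hR (hhj j) hO₁ hO hac hΛ' hab
          (fun l => (hBl l j).trans (Finset.single_le_sum (fun l _ => hBl0 l) (Finset.mem_univ l))) hφ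
    rw [zero_mul, add_zero] at key
    obtain ⟨Bζ, hBζ⟩ := hζ.bound
    have h1 : lpNorm (diffQuot i (r / ((j : ℝ) + 1)) (g l)) 2 (volume.restrict (O₂ ∩ lowerHalf m)) ≤
        lpNorm (fun x => ζ x * diffQuot i (r / ((j : ℝ) + 1)) (g l) x) 2
          (volume.restrict (O₁ ∩ lowerHalf m)) := by
      rw [lpNorm_congr_ae (g := fun x => ζ x * diffQuot i (r / ((j : ℝ) + 1)) (g l) x)]
      · exact lpNorm_mono_measure (memLp_bdd_mul (hG' j l)
          hζ.1.continuous.aestronglyMeasurable (Eventually.of_forall hBζ)) hle2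
      · filter_upwards [ae_restrict_mem hWm2] with x hx
        rw [hζ1 x hx.1, one_mul]
    refine h1.trans (Real.le_sqrt_of_sq_le ?_)
    refine le_trans ?_ (key.trans ?_)
    · exact Finset.single_le_sum (f := fun l => lpNorm (fun x =>
        ζ x * diffQuot i (r / ((j : ℝ) + 1)) (g l) x) 2 (volume.restrict (O₁ ∩ lowerHalf m)) ^ 2)
        (fun _ _ => sq_nonneg _) (Finset.mem_univ l)
    · have h2 := hB₀ ⟨j, rfl⟩
      have h3 := (energyConst_pos (m + 1) hη Λ).le
      have h4 : 0 ≤ lpNorm (diffQuot i (r / ((j : ℝ) + 1)) u) 2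
        (volume.restrict (O₁ ∩ lowerHalf m)) := lpNorm_nonneg
      gcongr
  obtain ⟨M, hM⟩ := hbound
  -- The quotients of `u` converge strongly to `g i` and their gradients weakly. The limit relation
  -- is still tested on `gradSet bc O₂`, so the tangential derivative inherits the boundary
  -- condition.
  have hlim : ∀ l, ∃ G, MemLp G 2 (volume.restrict (O₂ ∩ lowerHalf m)) ∧
      WD (O₂ ∩ lowerHalf m) (gradSet bc O₂) l (g i) G := fun l => by
    obtain ⟨G, hG, hGl⟩ := exists_weak_limit (fun j => (hG' j l).mono_measure hle2) fun j => hM j l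
    refine ⟨G, hG, fun φ hφ => ?_⟩
    have t1 := ((hlu.mono hle2).integral_mul (F := partialD l φ) (hφ.c1.memLp_partialD l)).mono_left
      (Nat.hyperfilter_le_atTop)
    have t2 := (hGl φ hφ.c1.memLp).neg
    have h1 : ∀ j : ℕ, ∫ x in O₂ ∩ lowerHalf m, partialD l φ x * diffQuot i (r / ((j : ℝ) + 1)) u x =
        -∫ x in O₂ ∩ lowerHalf m, diffQuot i (r / ((j : ℝ) + 1)) (g l) x * φ x := fun j => by
      rw [← ((hWDj j l).restrict hWm1 hsub2 (gradSet_mono bc hs2)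
        fun x hx => ⟨gradSet_subset bc O₂ hx.2, hx.1.2⟩) φ hφ]
      simp_rw [mul_comm]
    simp_rw [h1] at t1
    rw [← tendsto_nhds_unique t1 t2]
    simp_rw [mul_comm]
  choose G hG hGD using hlim
  have hsol2 := hsol.restrict hO (hs2.trans hs1)
  have hsub := hsub2.trans hsub1
  have hle := Measure.restrict_mono hsub (le_refl (volume : Measure (Eu (m + 1))))
  have ha2 := ha.mono hsub
  have hac2 : ∀ l k, ContDiffOn ℝ 1 (a l k) (O₂ ∩ lowerHalf m) := fun l k => (hac l k).mono hsub
  have hacm : ∀ l k, AEStronglyMeasurable (partialD i (a l k)) (volume.restrict (O₂ ∩ lowerHalf m)) :=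
    fun l k => (ContDiffOn.continuousOn_partialD hWo2 (hac2 l k) i).aestronglyMeasurable hWm2
  have hcg : ∀ l k, MemLp (fun x => partialD i (a l k) x * g k x) 2
      (volume.restrict (O₂ ∩ lowerHalf m)) := fun l k =>
    memLp_bdd_mul (hsol2.memLp_g k) (hacm l k)
      ((ae_restrict_mem hWm2).mono fun x hx => hab l k x (hsub hx))
  have hcgs : ∀ l, MemLp (fun x => ∑ k, partialD i (a l k) x * g k x) 2
      (volume.restrict (O₂ ∩ lowerHalf m)) := fun l => memLp_finsetSum _ fun k _ => hcg l k
  have hag : ∀ l k, MemLp (fun x => a l k x * g k x) 2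
      (volume.restrict (O₂ ∩ lowerHalf m)) := fun l k => memLp_bdd_mul (hsol2.memLp_g k)
        (ha2.meas l k) ((ae_restrict_mem hWm2).mono (ha2.bound l k))
  have haG : ∀ l k, MemLp (fun x => a l k x * G k x) 2
      (volume.restrict (O₂ ∩ lowerHalf m)) := fun l k => memLp_bdd_mul (hG k)
        (ha2.meas l k) ((ae_restrict_mem hWm2).mono (ha2.bound l k))
  -- Being tangential, the derivative of the flux may be tested up to the boundary, so case (N)
  -- gains no boundary term when the equation is differentiated.
  have hflux : ∀ l, WD (O₂ ∩ lowerHalf m) O₂ i (flux a g l)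
      (fun x => ∑ k, (a l k x * G k x + partialD i (a l k) x * g k x)) := fun l => by
    refine WD.tangential hi hO₂ (memLp_finsetSum _ fun k _ => hag l k)
      (memLp_finsetSum _ fun k _ => (haG l k).add (hcg l k)) ?_
    refine WD.sum _ (hag l) (fun k => (haG l k).add (hcg l k)) fun k => ?_
    have h1 : WD (O₂ ∩ lowerHalf m) (O₂ ∩ lowerHalf m) i (g k) (G k) :=
      ((hsol2.grad k).comm (hsol2.grad i) (hGD k)).restrict hWm2 le_rfl
        (inter_subset_gradSet bc O₂) inter_subset_left
    exact h1.mul_c1 hWo2 (hsol2.memLp_g k) (hG k) (hac2 l k)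
      ⟨Λ', fun x hx => hab l k x (hsub hx)⟩ hWm2
      (ContDiffOn.continuousOn_partialD hWo2 (hac2 l k) i)
  have hΦt : ∀ l, WD (O₂ ∩ lowerHalf m) O₂ i (Φ l) (Φ' l) := fun l =>
    WD.tangential hi hO₂ (hsol2.memLp_Φ l) ((hΦ' l).mono_measure hle)
      ((hΦD l).restrict hWm hsub hsub inter_subset_right)
  have hif : ∀ l, MemLp (fun x => if l = i then f x else 0) 2
      (volume.restrict (O₂ ∩ lowerHalf m)) := fun l => by
    by_cases hl : l = i
    · simpa [hl] using hsol2.memLp_f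
    · simp [hl]
  have hΨ : ∀ l, MemLp (fun x => Φ' l x - ∑ k, partialD i (a l k) x * g k x -
      if l = i then f x else 0) 2 (volume.restrict (O₂ ∩ lowerHalf m)) := fun l =>
    (((hΦ' l).mono_measure hle).sub (hcgs l)).sub (hif l)
  refine ⟨G, hsol2.memLp_g i, hG, MemLp.zero', hΨ, hGD, fun φ hφ => ?_⟩
  -- The differentiated equation is the original one tested with `∂ᵢφ`. The term `f ∂ᵢφ` is not
  -- integrated by parts; it becomes the `i`-th component of the new field, so `f` loses no
  -- derivative.
  have hφ' := hφ.partialD i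
  have e1 := hsol2.eqn _ hφ'
  have hφO : IsTestFunction O₂ φ := hφ.mono (eqnSet_subset bc O₂)
  have i1 : ∀ {v : Eu (m + 1) → ℝ}, MemLp v 2 (volume.restrict (O₂ ∩ lowerHalf m)) → ∀ l,
      Integrable (fun x => v x * partialD l φ x) (volume.restrict (O₂ ∩ lowerHalf m)) :=
    fun hv l => integrable_mul_of_memLp hv (hφ.c1.memLp_partialD l)
  have i2 : ∀ {v : Eu (m + 1) → ℝ}, MemLp v 2 (volume.restrict (O₂ ∩ lowerHalf m)) → ∀ l,
      Integrable (fun x => v x * partialD l (partialD i φ) x)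
        (volume.restrict (O₂ ∩ lowerHalf m)) :=
    fun hv l => integrable_mul_of_memLp hv (hφ'.c1.memLp_partialD l)
  have hfl := fun l => ha2.memLp_flux hWm2 hsol2.memLp_g l
  have hflG := fun l => ha2.memLp_flux hWm2 hG l
  rw [integral_finsetSum _ fun l _ => i2 (hfl l) l, integral_add (i1 hsol2.memLp_f i)
    (integrable_finsetSum _ fun l _ => i2 (hsol2.memLp_Φ l) l),
    integral_finsetSum _ fun l _ => i2 (hsol2.memLp_Φ l) l] at e1
  have e2 : ∀ l, ∫ x in O₂ ∩ lowerHalf m, flux a g l x * partialD l (partialD i φ) x =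
      -(∫ x in O₂ ∩ lowerHalf m, flux a G l x * partialD l φ x) -
        ∫ x in O₂ ∩ lowerHalf m, (∑ k, partialD i (a l k) x * g k x) * partialD l φ x := fun l => by
    rw [partialD_comm hφ.1 l i, hflux l _ (hφO.partialD l)]
    rw [← neg_add', ← integral_add (i1 (hflG l) l) (i1 (hcgs l) l)]
    congr 2 with x
    simp only [flux, Finset.sum_add_distrib, add_mul]
  have e3 : ∀ l, ∫ x in O₂ ∩ lowerHalf m, Φ l x * partialD l (partialD i φ) x =
      -∫ x in O₂ ∩ lowerHalf m, Φ' l x * partialD l φ x := fun l => by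
    rw [partialD_comm hφ.1 l i, hΦt l _ (hφO.partialD l)]
  simp_rw [e2, e3, Finset.sum_sub_distrib, Finset.sum_neg_distrib] at e1
  have e4 : ∑ l, ∫ x in O₂ ∩ lowerHalf m, (if l = i then f x else 0) * partialD l φ x =
      ∫ x in O₂ ∩ lowerHalf m, f x * partialD i φ x := by
    rw [Finset.sum_eq_single i]
    · simp
    · intro l _ hl; simp [hl]
    · simp
  simp only [zero_mul, zero_add]
  rw [integral_finsetSum _ fun l _ => i1 (hflG l) l, integral_finsetSum _ fun l _ => i1 (hΨ l) l]
  have e5 : ∀ l, ∫ x in O₂ ∩ lowerHalf m, (Φ' l x - ∑ k, partialD i (a l k) x * g k x -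
      if l = i then f x else 0) * partialD l φ x =
      (∫ x in O₂ ∩ lowerHalf m, Φ' l x * partialD l φ x) -
      (∫ x in O₂ ∩ lowerHalf m, (∑ k, partialD i (a l k) x * g k x) * partialD l φ x) -
      ∫ x in O₂ ∩ lowerHalf m, (if l = i then f x else 0) * partialD l φ x := fun l => by
    simp_rw [sub_mul]
    rw [integral_sub _ (i1 (hif l) l), integral_sub (i1 ((hΦ' l).mono_measure hle) l) (i1 (hcgs l) l)]
    exact (i1 ((hΦ' l).mono_measure hle) l).sub (i1 (hcgs l) l)
  simp_rw [e5, Finset.sum_sub_distrib]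
  rw [e4]
  linarith

end Tangential

/-! ### Sobolev and `C^k` bounds with one factor `ε` per derivative. -/

section Scaled

variable {n : ℕ} {W : Set (Eu n)} {ε : ℝ}

/-- `u ∈ H^k(W)`, with `ε^{|α|} |D^α u| ≤ M` in `L²(W)`. -/
def SobB (W : Set (Eu n)) (ε : ℝ) : ℕ → (Eu n → ℝ) → ℝ → Prop
  | 0, u, M => MemLp u 2 (volume.restrict W) ∧ lpNorm u 2 (volume.restrict W) ≤ M
  | k + 1, u, M => (MemLp u 2 (volume.restrict W) ∧ lpNorm u 2 (volume.restrict W) ≤ M) ∧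
      ∀ i, ∃ g, WD W W i u g ∧ SobB W ε k (fun x => ε * g x) M

/-- The weak derivative of `u` in direction `i` is in `H^k(W)`, with bounds. -/
def SobD (W : Set (Eu n)) (ε : ℝ) (i : Fin n) (k : ℕ) (u : Eu n → ℝ) (M : ℝ) : Prop :=
  ∃ g, WD W W i u g ∧ SobB W ε k (fun x => ε * g x) M

/-- `c ∈ C^k(W)`, with `ε^{|α|} |D^α c| ≤ B`. -/
def CB (W : Set (Eu n)) (ε : ℝ) : ℕ → (Eu n → ℝ) → ℝ → Prop
  | 0, c, B => ContinuousOn c W ∧ ∀ x ∈ W, |c x| ≤ B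
  | k + 1, c, B => (ContDiffOn ℝ 1 c W ∧ ∀ x ∈ W, |c x| ≤ B) ∧
      ∀ i, CB W ε k (fun x => ε * partialD i c x) B

namespace SobB

variable {k : ℕ} {u v : Eu n → ℝ} {M M' : ℝ}

lemma base (h : SobB W ε k u M) :
    MemLp u 2 (volume.restrict W) ∧ lpNorm u 2 (volume.restrict W) ≤ M := by
  cases k
  · exact h
  · exact h.1

lemma nonneg (h : SobB W ε k u M) : 0 ≤ M := lpNorm_nonneg.trans h.base.2

lemma sobD (h : SobB W ε (k + 1) u M) (i : Fin n) : SobD W ε i k u M := h.2 i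

lemma mono_const (h : SobB W ε k u M) (hM : M ≤ M') : SobB W ε k u M' := by
  induction k generalizing u with
  | zero => exact ⟨h.1, h.2.trans hM⟩
  | succ k ih =>
    refine ⟨⟨h.1.1, h.1.2.trans hM⟩, fun i => ?_⟩
    obtain ⟨g, hg, hg'⟩ := h.2 i
    exact ⟨g, hg, ih hg'⟩

lemma of_succ (h : SobB W ε (k + 1) u M) : SobB W ε k u M := by
  induction k generalizing u with
  | zero => exact h.1
  | succ k ih =>
    refine ⟨h.1, fun i => ?_⟩
    obtain ⟨g, hg, hg'⟩ := h.2 i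
    exact ⟨g, hg, ih hg'⟩

lemma of_le {k' : ℕ} (h : SobB W ε k u M) (hk : k' ≤ k) : SobB W ε k' u M := by
  induction hk with
  | refl => exact h
  | step _ ih => exact ih h.of_succ

lemma congr (h : SobB W ε k u M) (huv : u =ᵐ[volume.restrict W] v) : SobB W ε k v M := by
  have hb : MemLp v 2 (volume.restrict W) ∧ lpNorm v 2 (volume.restrict W) ≤ M :=
    ⟨(memLp_congr_ae huv).1 h.base.1, (lpNorm_congr_ae huv).symm.trans_le h.base.2⟩
  cases k with
  | zero => exact hb
  | succ k =>
    refine ⟨hb, fun i => ?_⟩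
    obtain ⟨g, hg, hg'⟩ := h.2 i
    exact ⟨g, hg.congr huv EventuallyEq.rfl, hg'⟩

lemma restrict {W' : Set (Eu n)} (hW : MeasurableSet W) (hWW : W' ⊆ W) (h : SobB W ε k u M) :
    SobB W' ε k u M := by
  have hle := Measure.restrict_mono hWW (le_refl (volume : Measure (Eu n)))
  have hb : ∀ {u}, MemLp u 2 (volume.restrict W) ∧ lpNorm u 2 (volume.restrict W) ≤ M →
      MemLp u 2 (volume.restrict W') ∧ lpNorm u 2 (volume.restrict W') ≤ M := fun h =>
    ⟨h.1.mono_measure hle, (lpNorm_mono_measure h.1 hle).trans h.2⟩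
  induction k generalizing u with
  | zero => exact hb h
  | succ k ih =>
    refine ⟨hb h.1, fun i => ?_⟩
    obtain ⟨g, hg, hg'⟩ := h.2 i
    exact ⟨g, hg.restrict hW hWW hWW inter_subset_right, ih hg'⟩

lemma memLp_of_mul {g : Eu n → ℝ} (hε : ε ≠ 0) (h : SobB W ε k (fun x => ε * g x) M) :
    MemLp g 2 (volume.restrict W) := by
  simpa [← mul_assoc, hε] using h.base.1.const_mul ε⁻¹

lemma add (hε : ε ≠ 0) (h : SobB W ε k u M) (h' : SobB W ε k v M') :
    SobB W ε k (fun x => u x + v x) (M + M') := by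
  have hb : ∀ {u v}, MemLp u 2 (volume.restrict W) ∧ lpNorm u 2 (volume.restrict W) ≤ M →
      MemLp v 2 (volume.restrict W) ∧ lpNorm v 2 (volume.restrict W) ≤ M' →
      MemLp (fun x => u x + v x) 2 (volume.restrict W) ∧
        lpNorm (fun x => u x + v x) 2 (volume.restrict W) ≤ M + M' := fun h h' =>
    ⟨h.1.add h'.1, (lpNorm_le_add h.1).trans (add_le_add h.2 h'.2)⟩
  induction k generalizing u v with
  | zero => exact hb h h'
  | succ k ih =>
    refine ⟨hb h.1 h'.1, fun i => ?_⟩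
    obtain ⟨g, hg, hg'⟩ := h.2 i
    obtain ⟨f, hf, hf'⟩ := h'.2 i
    refine ⟨_, hg.add h.1.1 (hg'.memLp_of_mul hε) h'.1.1 (hf'.memLp_of_mul hε) hf, ?_⟩
    simp_rw [mul_add]
    exact ih hg' hf'

lemma const_mul (h : SobB W ε k u M) (c : ℝ) : SobB W ε k (fun x => c * u x) (|c| * M) := by
  have hb : ∀ {u}, MemLp u 2 (volume.restrict W) ∧ lpNorm u 2 (volume.restrict W) ≤ M →
      MemLp (fun x => c * u x) 2 (volume.restrict W) ∧
        lpNorm (fun x => c * u x) 2 (volume.restrict W) ≤ |c| * M := fun h =>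
    ⟨h.1.const_mul c, (lpNorm_bdd_mul_le h.1 aestronglyMeasurable_const (abs_nonneg c)
      (Eventually.of_forall fun _ => le_rfl)).trans (mul_le_mul_of_nonneg_left h.2 (abs_nonneg c))⟩
  induction k generalizing u with
  | zero => exact hb h
  | succ k ih =>
    refine ⟨hb h.1, fun i => ?_⟩
    obtain ⟨g, hg, hg'⟩ := h.2 i
    refine ⟨_, hg.const_mul c, ?_⟩
    simp_rw [mul_left_comm ε c]
    exact ih hg'

lemma neg (h : SobB W ε k u M) : SobB W ε k (fun x => -u x) M := by
  simpa using h.const_mul (-1)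

lemma zero (hM : 0 ≤ M) : SobB W ε k (fun _ => 0) M := by
  induction k with
  | zero => exact ⟨MemLp.zero', by simpa using hM⟩
  | succ k ih => exact ⟨⟨MemLp.zero', by simpa using hM⟩, fun i => ⟨_, WD.zero, by simpa using ih⟩⟩

lemma sum {ι : Type*} (hε : ε ≠ 0) (s : Finset ι) {u : ι → Eu n → ℝ}
    (h : ∀ j ∈ s, SobB W ε k (u j) M) : SobB W ε k (fun x => ∑ j ∈ s, u j x) (s.card * M) := by
  classical
  induction s using Finset.induction_on with
  | empty => simpa using zero (W := W) (ε := ε) (k := k) (le_refl 0)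
  | insert a s ha ih =>
    simp_rw [Finset.sum_insert ha]
    rw [Finset.card_insert_of_notMem ha, Nat.cast_add, Nat.cast_one, add_comm, add_mul, one_mul]
    rw [add_comm]
    have := (h a (Finset.mem_insert_self a s)).add hε
      (ih fun j hj => h j (Finset.mem_insert_of_mem hj))
    rwa [add_comm M] at this

lemma deriv (hW : IsOpen W) (hε : ε ≠ 0) (h : SobB W ε (k + 1) u M) {i : Fin n} {g : Eu n → ℝ}
    (hg : MemLp g 2 (volume.restrict W)) (hD : WD W W i u g) :
    SobB W ε k (fun x => ε * g x) M := by
  obtain ⟨f, hf, hf'⟩ := h.2 i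
  refine hf'.congr ?_
  filter_upwards [hf.unique hW (hf'.memLp_of_mul hε) hg hD] with x hx
  rw [hx]

end SobB

namespace CB

variable {k : ℕ} {c d : Eu n → ℝ} {B B' : ℝ}

lemma continuousOn (h : CB W ε k c B) : ContinuousOn c W := by
  cases k
  · exact h.1
  · exact h.1.1.continuousOn

lemma bound (h : CB W ε k c B) {x : Eu n} (hx : x ∈ W) : |c x| ≤ B := by
  cases k
  · exact h.2 x hx
  · exact h.1.2 x hx

lemma mono_const (h : CB W ε k c B) (hB : B ≤ B') : CB W ε k c B' := by
  induction k generalizing c with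
  | zero => exact ⟨h.1, fun x hx => (h.2 x hx).trans hB⟩
  | succ k ih => exact ⟨⟨h.1.1, fun x hx => (h.1.2 x hx).trans hB⟩, fun i => ih (h.2 i)⟩

lemma of_succ (h : CB W ε (k + 1) c B) : CB W ε k c B := by
  induction k generalizing c with
  | zero => exact ⟨h.1.1.continuousOn, h.1.2⟩
  | succ k ih => exact ⟨h.1, fun i => ih (h.2 i)⟩

lemma of_le {k' : ℕ} (h : CB W ε k c B) (hk : k' ≤ k) : CB W ε k' c B := by
  induction hk with
  | refl => exact h
  | step _ ih => exact ih h.of_succ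

lemma mono {W' : Set (Eu n)} (hWW : W' ⊆ W) (h : CB W ε k c B) : CB W' ε k c B := by
  induction k generalizing c with
  | zero => exact ⟨h.1.mono hWW, fun x hx => h.2 x (hWW hx)⟩
  | succ k ih => exact ⟨⟨h.1.1.mono hWW, fun x hx => h.1.2 x (hWW hx)⟩, fun i => ih (h.2 i)⟩

lemma congr (hW : IsOpen W) (h : CB W ε k c B) (hcd : EqOn c d W) : CB W ε k d B := by
  induction k generalizing c d with
  | zero => exact ⟨h.1.congr hcd.symm, fun x hx => hcd hx ▸ h.2 x hx⟩
  | succ k ih =>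
    refine ⟨⟨h.1.1.congr hcd.symm, fun x hx => hcd hx ▸ h.1.2 x hx⟩, fun i => ih (h.2 i) ?_⟩
    intro x hx
    have : c =ᶠ[𝓝 x] d := hcd.eventuallyEq_of_mem (hW.mem_nhds hx)
    simp only [partialD]
    rw [this.fderiv_eq]

lemma add (hW : IsOpen W) (h : CB W ε k c B) (h' : CB W ε k d B') :
    CB W ε k (fun x => c x + d x) (B + B') := by
  have hb : ∀ {k c d}, CB W ε k c B → CB W ε k d B' → ∀ x ∈ W, |c x + d x| ≤ B + B' :=
    fun h h' x hx => (abs_add_le _ _).trans (add_le_add (h.bound hx) (h'.bound hx))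
  induction k generalizing c d with
  | zero => exact ⟨h.1.add h'.1, hb h h'⟩
  | succ k ih =>
    refine ⟨⟨h.1.1.add h'.1.1, hb h h'⟩, fun i => (ih (h.2 i) (h'.2 i)).congr hW fun x hx => ?_⟩
    have h1 := (h.1.1.differentiableOn (by simp) x hx).differentiableAt (hW.mem_nhds hx)
    have h2 := (h'.1.1.differentiableOn (by simp) x hx).differentiableAt (hW.mem_nhds hx)
    simp only [partialD]
    rw [fderiv_fun_add h1 h2, _root_.add_apply, mul_add]

/-- Each use of the product rule doubles the number of terms, each bounded by `B * B'` because the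
factor `ε` travels with the derivative; hence `2 ^ k`. -/
lemma mul (hW : IsOpen W) (hB : 0 ≤ B) (hB' : 0 ≤ B') (h : CB W ε k c B) (h' : CB W ε k d B') :
    CB W ε k (fun x => c x * d x) (2 ^ k * (B * B')) := by
  have hb : ∀ {k c d}, CB W ε k c B → CB W ε k d B' → ∀ x ∈ W, |c x * d x| ≤ 2 ^ k * (B * B') :=
    fun {k c d} h h' x hx => by
      rw [abs_mul]
      have h1 := mul_le_mul (h.bound hx) (h'.bound hx) (abs_nonneg _) hB
      have h2 : (1 : ℝ) ≤ 2 ^ k := one_le_pow₀ one_le_two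
      have h3 : 0 ≤ B * B' := by positivity
      nlinarith
  induction k generalizing c d with
  | zero => exact ⟨h.1.mul h'.1, hb h h'⟩
  | succ k ih =>
    refine ⟨⟨h.1.1.mul h'.1.1, hb h h'⟩, fun i => ?_⟩
    have h1 := (ih h.of_succ (h'.2 i)).add hW (ih (h.2 i) h'.of_succ)
    rw [← two_mul, ← mul_assoc, ← pow_succ'] at h1
    refine h1.congr hW fun x hx => ?_
    have h1 := (h.1.1.differentiableOn (by simp) x hx).differentiableAt (hW.mem_nhds hx)
    have h2 := (h'.1.1.differentiableOn (by simp) x hx).differentiableAt (hW.mem_nhds hx)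
    rw [partialD_mul h1 h2]
    ring

lemma const (hB : |B| ≤ B') : CB W ε k (fun _ => B) B' := by
  have hz : ∀ (i : Fin n), (fun x => ε * partialD i (fun _ : Eu n => B) x) = fun _ => 0 :=
    fun i => by ext x; simp [partialD]
  have h0 : 0 ≤ B' := (abs_nonneg B).trans hB
  induction k generalizing B with
  | zero => exact ⟨continuousOn_const, fun _ _ => hB⟩
  | succ k ih =>
    refine ⟨⟨contDiffOn_const, fun _ _ => hB⟩, fun i => ?_⟩
    rw [hz i]
    refine ih (by simpa using h0) fun j => ?_
    ext x; simp [partialD]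

lemma const_mul (hW : IsOpen W) (hB : 0 ≤ B) (h : CB W ε k c B) (r : ℝ) :
    CB W ε k (fun x => r * c x) (2 ^ k * (|r| * B)) :=
  (const le_rfl).mul hW (abs_nonneg r) hB h

lemma sum {ι : Type*} (hW : IsOpen W) (s : Finset ι) {c : ι → Eu n → ℝ}
    (h : ∀ j ∈ s, CB W ε k (c j) B) : CB W ε k (fun x => ∑ j ∈ s, c j x) (s.card * B) := by
  classical
  induction s using Finset.induction_on with
  | empty => simpa using const (W := W) (ε := ε) (k := k) (B := 0) (B' := 0) (by simp)
  | insert a s ha ih =>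
    simp_rw [Finset.sum_insert ha]
    rw [Finset.card_insert_of_notMem ha, Nat.cast_add, Nat.cast_one, add_mul, one_mul, add_comm]
    exact (h a (Finset.mem_insert_self a s)).add hW
      (ih fun j hj => h j (Finset.mem_insert_of_mem hj))

/-- Induction through `∂(1/c) = -∂c (1/c)²`, where `1/c` is needed only to one order less. The lower
bound `η` starts the induction. -/
lemma exists_inv (n k : ℕ) {η B : ℝ} (hη : 0 < η) (hB : 0 ≤ B) :
    ∃ B', 0 ≤ B' ∧ ∀ (W : Set (Eu n)) (ε : ℝ) (c : Eu n → ℝ), IsOpen W → CB W ε k c B →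
      (∀ x ∈ W, η ≤ c x) → CB W ε k (fun x => (c x)⁻¹) B' := by
  have hb : ∀ {W : Set (Eu n)} {c : Eu n → ℝ}, (∀ x ∈ W, η ≤ c x) → ∀ x ∈ W, |(c x)⁻¹| ≤ η⁻¹ :=
    fun h x hx => by
      rw [abs_inv, abs_of_pos (hη.trans_le (h x hx))]
      exact inv_anti₀ hη (h x hx)
  induction k with
  | zero =>
    exact ⟨η⁻¹, by positivity, fun W ε c _ h hc =>
      ⟨h.1.inv₀ fun x hx => (hη.trans_le (hc x hx)).ne', hb hc⟩⟩
  | succ k ih =>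
    obtain ⟨B', hB', ih⟩ := ih
    refine ⟨max η⁻¹ (2 ^ k * (1 * (2 ^ k * (B * (2 ^ k * (B' * B')))))), by positivity,
      fun W ε c hW h hc => ⟨⟨h.1.1.inv fun x hx => (hη.trans_le (hc x hx)).ne',
        fun x hx => (hb hc x hx).trans (le_max_left _ _)⟩, fun i => ?_⟩⟩
    have h1 := ih W ε c hW h.of_succ hc
    have h2 := ((h.2 i).mul hW hB (by positivity) (h1.mul hW hB' hB' h1)).const_mul hW
      (by positivity) (-1)
    rw [abs_neg, abs_one] at h2
    refine (h2.mono_const (le_max_right _ _)).congr hW fun x hx => ?_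
    have h3 := (h.1.1.differentiableOn (by simp) x hx).differentiableAt (hW.mem_nhds hx)
    have h4 : (c x) ≠ 0 := (hη.trans_le (hc x hx)).ne'
    rw [partialD_comp (G := fun t => t⁻¹) (differentiableAt_inv h4) h3, deriv_inv]
    field_simp

end CB

section Products

variable {k : ℕ} {c u v : Eu n → ℝ} {B M M' : ℝ} {i : Fin n}

lemma CB.aestronglyMeasurable (hW : IsOpen W) (h : CB W ε k c B) :
    AEStronglyMeasurable c (volume.restrict W) :=
  h.continuousOn.aestronglyMeasurable hW.measurableSet

lemma CB.ae_bound (hW : IsOpen W) (h : CB W ε k c B) : ∀ᵐ x ∂volume.restrict W, |c x| ≤ B :=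
  (ae_restrict_mem hW.measurableSet).mono fun _ hx => h.bound hx

lemma CB.bound_partialD (hε : 0 < ε) (h : CB W ε (k + 1) c B) (i : Fin n) {x : Eu n}
    (hx : x ∈ W) : |partialD i c x| ≤ B / ε := by
  have := (h.2 i).bound hx
  rw [abs_mul, abs_of_pos hε] at this
  rwa [le_div_iff₀' hε]

lemma CB.wd_mul (hW : IsOpen W) (hε : 0 < ε) (hc : CB W ε (k + 1) c B) {g : Eu n → ℝ}
    (hu : MemLp u 2 (volume.restrict W)) (hg : MemLp g 2 (volume.restrict W))
    (h : WD W W i u g) :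
    WD W W i (fun x => c x * u x) (fun x => c x * g x + partialD i c x * u x) :=
  h.mul_c1 hW hu hg hc.1.1 ⟨B / ε, fun _ hx => hc.bound_partialD hε i hx⟩ hW.measurableSet
    (ContDiffOn.continuousOn_partialD hW hc.1.1 i)

lemma SobB.mul (hW : IsOpen W) (hε : 0 < ε) (hB : 0 ≤ B) (hc : CB W ε k c B)
    (h : SobB W ε k u M) : SobB W ε k (fun x => c x * u x) (2 ^ k * (B * M)) := by
  have hM := h.nonneg
  have hb : ∀ {k c u}, CB W ε k c B → SobB W ε k u M →
      MemLp (fun x => c x * u x) 2 (volume.restrict W) ∧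
        lpNorm (fun x => c x * u x) 2 (volume.restrict W) ≤ 2 ^ k * (B * M) := fun {k c u} hc h => by
    refine ⟨memLp_bdd_mul h.base.1 (hc.aestronglyMeasurable hW) (hc.ae_bound hW),
      (lpNorm_bdd_mul_le h.base.1 (hc.aestronglyMeasurable hW) hB (hc.ae_bound hW)).trans ?_⟩
    have h1 := mul_le_mul_of_nonneg_left h.base.2 hB
    have h2 : (1 : ℝ) ≤ 2 ^ k := one_le_pow₀ one_le_two
    have h3 : 0 ≤ B * M := by positivity
    nlinarith
  induction k generalizing c u with
  | zero => exact hb hc h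
  | succ k ih =>
    refine ⟨hb hc h, fun i => ?_⟩
    obtain ⟨g, hg, hg'⟩ := h.2 i
    refine ⟨_, hc.wd_mul hW hε h.1.1 (hg'.memLp_of_mul hε.ne') hg, ?_⟩
    have h1 := (ih hc.of_succ hg').add hε.ne' (ih (hc.2 i) h.of_succ)
    rw [← two_mul, ← mul_assoc, ← pow_succ'] at h1
    refine h1.congr (Eventually.of_forall fun x => ?_)
    ring

namespace SobD

lemma mono_const (h : SobD W ε i k u M) (hM : M ≤ M') : SobD W ε i k u M' := by
  obtain ⟨g, hg, hg'⟩ := h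
  exact ⟨g, hg, hg'.mono_const hM⟩

lemma congr (h : SobD W ε i k u M) (huv : u =ᵐ[volume.restrict W] v) : SobD W ε i k v M := by
  obtain ⟨g, hg, hg'⟩ := h
  exact ⟨g, hg.congr huv EventuallyEq.rfl, hg'⟩

lemma add (hε : ε ≠ 0) (hu : MemLp u 2 (volume.restrict W)) (hv : MemLp v 2 (volume.restrict W))
    (h : SobD W ε i k u M) (h' : SobD W ε i k v M') :
    SobD W ε i k (fun x => u x + v x) (M + M') := by
  obtain ⟨g, hg, hg'⟩ := h
  obtain ⟨f, hf, hf'⟩ := h'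
  refine ⟨_, hg.add hu (hg'.memLp_of_mul hε) hv (hf'.memLp_of_mul hε) hf, ?_⟩
  simp_rw [mul_add]
  exact hg'.add hε hf'

lemma neg (h : SobD W ε i k u M) : SobD W ε i k (fun x => -u x) M := by
  obtain ⟨g, hg, hg'⟩ := h
  refine ⟨fun x => -g x, by simpa using hg.const_mul (-1), ?_⟩
  simp_rw [mul_neg]
  exact hg'.neg

lemma sum {ι : Type*} (hε : ε ≠ 0) (s : Finset ι) {u : ι → Eu n → ℝ}
    (hu : ∀ j ∈ s, MemLp (u j) 2 (volume.restrict W))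
    (h : ∀ j ∈ s, SobD W ε i k (u j) M) : SobD W ε i k (fun x => ∑ j ∈ s, u j x) (s.card * M) := by
  classical
  induction s using Finset.induction_on with
  | empty => exact ⟨_, by simpa using WD.zero, by simpa using SobB.zero (le_refl 0)⟩
  | insert a s ha ih =>
    simp_rw [Finset.sum_insert ha]
    rw [Finset.card_insert_of_notMem ha, Nat.cast_add, Nat.cast_one, add_mul, one_mul, add_comm]
    exact (h a (Finset.mem_insert_self a s)).add hε (hu a (Finset.mem_insert_self a s))
      (memLp_finsetSum _ fun j hj => hu j (Finset.mem_insert_of_mem hj))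
      (ih (fun j hj => hu j (Finset.mem_insert_of_mem hj))
        fun j hj => h j (Finset.mem_insert_of_mem hj))

lemma mul (hW : IsOpen W) (hε : 0 < ε) (hB : 0 ≤ B) (hc : CB W ε (k + 1) c B)
    (hu : SobB W ε k u M) (h : SobD W ε i k u M) :
    SobD W ε i k (fun x => c x * u x) (2 ^ (k + 1) * (B * M)) := by
  obtain ⟨g, hg, hg'⟩ := h
  refine ⟨_, hc.wd_mul hW hε hu.base.1 (hg'.memLp_of_mul hε.ne') hg, ?_⟩
  have h1 := (hg'.mul hW hε hB hc.of_succ).add hε.ne' (hu.mul hW hε hB (hc.2 i))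
  rw [← two_mul, ← mul_assoc, ← pow_succ'] at h1
  refine h1.congr (Eventually.of_forall fun x => ?_)
  ring

end SobD

end Products

end Scaled

lemma lpNorm_const_mul {α : Type*} [MeasurableSpace α] {μ : Measure α} {p : ℝ≥0∞} {c : ℝ}
    (hc : 0 ≤ c) (f : α → ℝ) : lpNorm (fun x => c * f x) p μ = c * lpNorm f p μ := by
  have := lpNorm_const_smul c f μ (p := p)
  rwa [coe_nnnorm, Real.norm_of_nonneg hc] at this

/-! ### Regularity of all orders below a flat boundary. -/

section Regularity

variable {m : ℕ}

lemma elliptic_diag {n : ℕ} {a : Fin n → Fin n → ℝ} {η : ℝ}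
    (h : ∀ ξ : Fin n → ℝ, η * ∑ i, ξ i ^ 2 ≤ ∑ i, ∑ l, a i l * ξ l * ξ i) (i : Fin n) :
    η ≤ a i i := by
  classical
  simpa [Pi.single_apply, ite_pow] using h (Pi.single i 1)

lemma isElliptic_of_cb {n : ℕ} {W : Set (Eu n)} (hW : IsOpen W) {ε η B : ℝ} {j : ℕ}
    {a : Fin n → Fin n → Eu n → ℝ} (hc : ∀ l q, CB W ε j (a l q) B)
    (h : ∀ x ∈ W, ∀ ξ : Fin n → ℝ, η * ∑ i, ξ i ^ 2 ≤ ∑ i, ∑ l, a i l x * ξ l * ξ i) :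
    IsElliptic W a η B :=
  ⟨fun l q => (hc l q).aestronglyMeasurable hW, fun l q _ hx => (hc l q).bound hx, h⟩

lemma FlatSol.const_mul {bc : BC} {O : Set (Eu (m + 1))}
    {a : Fin (m + 1) → Fin (m + 1) → Eu (m + 1) → ℝ} {f u : Eu (m + 1) → ℝ}
    {Φ g : Fin (m + 1) → Eu (m + 1) → ℝ} (h : FlatSol bc O a f Φ u g) (c : ℝ) :
    FlatSol bc O a (fun x => c * f x) (fun l x => c * Φ l x) (fun x => c * u x)
      (fun l x => c * g l x) := by
  refine ⟨h.memLp_u.const_mul c, fun i => (h.memLp_g i).const_mul c, h.memLp_f.const_mul c,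
    fun i => (h.memLp_Φ i).const_mul c, fun i => (h.grad i).const_mul c, fun φ hφ => ?_⟩
  have h1 := congrArg (fun t => c * t) (h.eqn φ hφ)
  simp only [← integral_const_mul, mul_add, Finset.mul_sum] at h1
  simp only [flux, Finset.sum_mul, mul_assoc] at h1 ⊢
  rw [← h1]
  congr 1 with x
  refine Finset.sum_congr rfl fun i _ => ?_
  rw [Finset.mul_sum]
  refine Finset.sum_congr rfl fun l _ => ?_
  ring

/-- The equation gives the second normal derivative in terms of the others. -/
lemma FlatSol.exists_sobB_normal (m k : ℕ) {η B : ℝ} (hη : 0 < η) (hB : 0 ≤ B) :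
    ∃ C, 1 ≤ C ∧ ∀ (bc : BC) (O : Set (Eu (m + 1))) (ε : ℝ)
      (a : Fin (m + 1) → Fin (m + 1) → Eu (m + 1) → ℝ) (f u : Eu (m + 1) → ℝ)
      (Φ g : Fin (m + 1) → Eu (m + 1) → ℝ) (N : ℝ), IsOpen O → 0 < ε → FlatSol bc O a f Φ u g →
      (∀ x ∈ O ∩ lowerHalf m, ∀ ξ : Fin (m + 1) → ℝ,
        η * ∑ i, ξ i ^ 2 ≤ ∑ i, ∑ l, a i l x * ξ l * ξ i) →
      (∀ l q, CB (O ∩ lowerHalf m) ε (k + 1) (a l q) B) →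
      (∀ l, SobB (O ∩ lowerHalf m) ε k (fun x => ε * g l x) N) →
      (∀ l ≠ Fin.last m, SobB (O ∩ lowerHalf m) ε (k + 1) (fun x => ε * g l x) N) →
      SobB (O ∩ lowerHalf m) ε k (fun x => ε ^ 2 * f x) N →
      (∀ l, SobB (O ∩ lowerHalf m) ε (k + 1) (fun x => ε * Φ l x) N) →
      SobB (O ∩ lowerHalf m) ε (k + 1) (fun x => ε * g (Fin.last m) x) (C * N) := by
  obtain ⟨B', hB', hinv⟩ := CB.exists_inv (m + 1) (k + 1) hη hB
  -- `N1` counts the terms of a tangential derivative of the flux: one for each coefficient in its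
  -- row and one for `Φ`. `N2` counts those for the normal derivative of `aₙₙ ∂ₙu`: `f` and `m`
  -- tangential flux derivatives, then `Φₙ`, then the `m` off-diagonal coefficients.
  set N1 : ℝ := (m + 1) * (2 ^ (k + 1) * B) + 1 with hN1
  set N2 : ℝ := (1 + m * N1) + 1 + m * (2 ^ (k + 1) * B) with hN2
  refine ⟨1 + 2 ^ (k + 1) * (B' * (N2 + 2 ^ k * B)), by
    have : 0 ≤ 2 ^ (k + 1) * (B' * (N2 + 2 ^ k * B)) := by positivity
    linarith, ?_⟩
  intro bc O ε a f u Φ g N hO hε hsol hell hCB hG hGt hf hΦ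
  have hW : IsOpen (O ∩ lowerHalf m) := hO.inter isOpen_lowerHalf
  have hε' := hε.ne'
  set W := O ∩ lowerHalf m with hWdef
  have hN : 0 ≤ N := hf.nonneg
  have hgradW : ∀ l, WD W W l (fun x => ε * u x) (fun x => ε * g l x) := fun l =>
    ((hsol.grad l).restrict hW.measurableSet le_rfl (inter_subset_gradSet bc O)
      inter_subset_left).const_mul ε
  set e := (Finset.univ : Finset (Fin (m + 1))).erase (Fin.last m) with he
  have hcard : (e.card : ℝ) = m := by simp [he]
  have hne : ∀ l ∈ e, l ≠ Fin.last m := fun l hl => Finset.ne_of_mem_erase hl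
  -- Every second derivative with a tangential index is known: the bound is given for one order of
  -- differentiation and holds for the other by symmetry.
  have hcross : ∀ l ≠ Fin.last m, ∀ q, SobD W ε l k (fun x => ε * g q x) N := fun l hl q => by
    obtain ⟨h, hh, hh'⟩ := (hGt l hl).2 q
    exact ⟨h, (hgradW q).comm (hgradW l) hh, hh'⟩
  have hagL : ∀ l q, MemLp (fun x => a l q x * (ε * g q x)) 2 (volume.restrict W) := fun l q =>
    memLp_bdd_mul (hG q).base.1 ((hCB l q).aestronglyMeasurable hW) ((hCB l q).ae_bound hW)
  have hag : ∀ i q l, SobD W ε i k (fun x => ε * g q x) N →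
      SobD W ε i k (fun x => a l q x * (ε * g q x)) (2 ^ (k + 1) * (B * N)) := fun i q l h =>
    h.mul hW hε hB (hCB l q) (hG q)
  -- `b` is `ε (a∇u - Φ)`, and the equation says that its divergence is `-ε f`.
  set b : Fin (m + 1) → Eu (m + 1) → ℝ := fun l x =>
    (∑ q, a l q x * (ε * g q x)) + -(ε * Φ l x) with hb
  have hbL : ∀ l, MemLp (b l) 2 (volume.restrict W) := fun l =>
    (memLp_finsetSum _ fun q _ => hagL l q).add (hΦ l).base.1.neg
  have hbD : ∀ l ≠ Fin.last m, SobD W ε l k (b l) (N1 * N) := fun l hl => by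
    have h1 := (SobD.sum hε' Finset.univ (fun q _ => hagL l q)
      fun q _ => hag l q l (hcross l hl q)).add hε' (memLp_finsetSum _ fun q _ => hagL l q)
        (hΦ l).base.1.neg ((hΦ l).sobD l).neg
    refine h1.mono_const (le_of_eq ?_)
    rw [Finset.card_univ, Fintype.card_fin, hN1]
    push_cast
    ring
  choose! β hβ hβ' using hbD
  have hbn : SobD W ε (Fin.last m) k (b (Fin.last m)) ((1 + m * N1) * N) := by
    -- The equation solved for the normal derivative of `bₙ`, the tangential derivatives `β l` of
    -- the other components being already known.
    refine ⟨fun x => -(ε * f x) + -∑ l ∈ e, β l x, fun φ hφ => ?_, ?_⟩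
    · have h1 := hsol.eqn φ (hφ.mono (inter_subset_eqnSet bc O))
      have hell' := isElliptic_of_cb hW hCB hell
      have i1 : ∀ {v : Eu (m + 1) → ℝ}, MemLp v 2 (volume.restrict W) →
          Integrable (fun x => v x * φ x) (volume.restrict W) :=
        fun hv => integrable_mul_of_memLp hv hφ.c1.memLp
      have i2 : ∀ {v : Eu (m + 1) → ℝ}, MemLp v 2 (volume.restrict W) → ∀ l,
          Integrable (fun x => v x * partialD l φ x) (volume.restrict W) :=
        fun hv l => integrable_mul_of_memLp hv (hφ.c1.memLp_partialD l)
      have hfl := fun l => hell'.memLp_flux hW.measurableSet hsol.memLp_g l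
      rw [integral_finsetSum _ fun l _ => i2 (hfl l) l, integral_add (i1 hsol.memLp_f)
        (integrable_finsetSum _ fun l _ => i2 (hsol.memLp_Φ l) l),
        integral_finsetSum _ fun l _ => i2 (hsol.memLp_Φ l) l] at h1
      have h2 : ∀ l, ∫ x in W, b l x * partialD l φ x =
          ε * ((∫ x in W, flux a g l x * partialD l φ x) - ∫ x in W, Φ l x * partialD l φ x) :=
        fun l => by
          rw [← integral_sub (i2 (hfl l) l) (i2 (hsol.memLp_Φ l) l), ← integral_const_mul]
          congr 1 with x
          simp only [hb, flux, add_mul, mul_sub, Finset.sum_mul, Finset.mul_sum]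
          rw [neg_mul, ← sub_eq_add_neg, mul_assoc]
          congr 1
          refine Finset.sum_congr rfl fun q _ => ?_
          ring
      have h3 : ∑ l, ∫ x in W, b l x * partialD l φ x = ε * ∫ x in W, f x * φ x := by
        simp_rw [h2, ← Finset.mul_sum, Finset.sum_sub_distrib]
        rw [h1]
        ring
      rw [← Finset.add_sum_erase _ _ (Finset.mem_univ (Fin.last m)), ← he,
        Finset.sum_congr rfl fun l hl => hβ l (hne l hl) φ hφ, Finset.sum_neg_distrib] at h3
      have hβL : ∀ l ∈ e, MemLp (β l) 2 (volume.restrict W) := fun l hl =>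
        (hβ' l (hne l hl)).memLp_of_mul hε'
      have h4 : ∫ x in W, (-(ε * f x) + -∑ l ∈ e, β l x) * φ x =
          -(ε * ∫ x in W, f x * φ x) - ∑ l ∈ e, ∫ x in W, β l x * φ x := by
        rw [← integral_finsetSum _ fun l hl => i1 (hβL l hl), ← integral_const_mul,
          ← integral_neg, ← integral_sub (f := fun x => -(ε * (f x * φ x)))
            ((i1 hsol.memLp_f).const_mul ε).neg (integrable_finsetSum _ fun l hl => i1 (hβL l hl))]
        congr 1 with x
        rw [← Finset.sum_mul]
        ring
      rw [h4]
      linarith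
    · have h1 := hf.neg.add hε' (SobB.sum hε' e fun l hl => hβ' l (hne l hl)).neg
      rw [hcard] at h1
      refine (h1.mono_const (le_of_eq (by ring))).congr (Eventually.of_forall fun x => ?_)
      simp only [mul_add, mul_neg, Finset.mul_sum]
      ring
  -- Removing `Φₙ` and the off-diagonal terms from `bₙ` leaves `v = aₙₙ ε ∂ₙu`. Its normal
  -- derivative is controlled, and division by `aₙₙ ≥ η` transfers the control to `∂ₙu`.
  set v : Eu (m + 1) → ℝ := fun x =>
    (b (Fin.last m) x + ε * Φ (Fin.last m) x) +
      -∑ l ∈ e, a (Fin.last m) l x * (ε * g l x) with hv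
  have hv1 : v = fun x => a (Fin.last m) (Fin.last m) x * (ε * g (Fin.last m) x) := by
    ext x
    have := Finset.add_sum_erase Finset.univ (fun l => a (Fin.last m) l x * (ε * g l x))
      (Finset.mem_univ (Fin.last m))
    simp only [hv, hb, he, ← this]
    ring
  have hvD : SobD W ε (Fin.last m) k v (N2 * N) := by
    have hs : ∀ l ∈ e, SobD W ε (Fin.last m) k (fun x => a (Fin.last m) l x * (ε * g l x))
        (2 ^ (k + 1) * (B * N)) := fun l hl =>
      hag _ _ _ ((hGt l (hne l hl)).sobD _)
    have h1 := (hbn.add hε' (hbL _) (hΦ (Fin.last m)).base.1 ((hΦ (Fin.last m)).sobD _)).add hε'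
      ((hbL _).add (hΦ (Fin.last m)).base.1) (memLp_finsetSum _ fun l _ => hagL _ l).neg
      (SobD.sum hε' e (fun l _ => hagL _ l) hs).neg
    rw [hcard] at h1
    exact h1.mono_const (le_of_eq (by rw [hN2]; ring))
  have hvB : SobB W ε k v (2 ^ k * (B * N)) := by
    rw [hv1]
    exact (hG _).mul hW hε hB (hCB _ _).of_succ
  have hpos : 0 ≤ N2 := by positivity
  have hGn : SobD W ε (Fin.last m) k (fun x => ε * g (Fin.last m) x)
      (2 ^ (k + 1) * (B' * (N2 + 2 ^ k * B)) * N) := by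
    have hann : ∀ x ∈ W, η ≤ a (Fin.last m) (Fin.last m) x := fun x hx =>
      elliptic_diag (hell x hx) _
    have h1 := (hvD.mono_const (M' := (N2 + 2 ^ k * B) * N) (by
        have : 0 ≤ 2 ^ k * B * N := by positivity
        linarith)).mul hW hε hB'
      (hinv W ε _ hW (hCB (Fin.last m) (Fin.last m)) hann)
      (hvB.mono_const (by
        have : 0 ≤ N2 * N := by positivity
        linarith))
    refine (h1.mono_const (le_of_eq (by ring))).congr ?_
    filter_upwards [ae_restrict_mem hW.measurableSet] with x hx
    rw [hv1]
    have := (hη.trans_le (hann x hx)).ne'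
    field_simp
  have hle : N ≤ (1 + 2 ^ (k + 1) * (B' * (N2 + 2 ^ k * B))) * N := by
    have : 0 ≤ 2 ^ (k + 1) * (B' * (N2 + 2 ^ k * B)) * N := by positivity
    linarith
  refine ⟨⟨(hG _).base.1, (hG _).base.2.trans hle⟩, fun i => ?_⟩
  by_cases hi : i = Fin.last m
  · rw [hi]
    exact hGn.mono_const (by linarith)
  · exact (hcross i hi _).mono_const hle

lemma SobB.succ_of_grad {n : ℕ} {W : Set (Eu n)} {ε M : ℝ} {k : ℕ} {u : Eu n → ℝ}
    {g : Fin n → Eu n → ℝ} (hu : MemLp u 2 (volume.restrict W))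
    (hM : lpNorm u 2 (volume.restrict W) ≤ M) (h : ∀ i, WD W W i u (g i))
    (hg : ∀ i, SobB W ε k (fun x => ε * g i x) M) : SobB W ε (k + 1) u M :=
  ⟨⟨hu, hM⟩, fun i => ⟨g i, h i, hg i⟩⟩

/-- Interior and boundary regularity on nested sets. -/
theorem FlatSol.regularity (m j : ℕ) : ∃ L : ℕ, ∀ η B K : ℝ, 0 < η → 0 ≤ B →
    ∃ C, 0 ≤ C ∧ ∀ (bc : BC) (D : ℕ → Set (Eu (m + 1))) (ε : ℝ), 0 < ε → (∀ t, IsOpen (D t)) →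
      (∀ t, Gap (D (t + 1)) (D t) (K / ε)) →
      ∀ (a : Fin (m + 1) → Fin (m + 1) → Eu (m + 1) → ℝ) (f u : Eu (m + 1) → ℝ)
      (Φ g : Fin (m + 1) → Eu (m + 1) → ℝ) (M : ℝ), FlatSol bc (D 0) a f Φ u g →
      (∀ x ∈ D 0 ∩ lowerHalf m, ∀ ξ : Fin (m + 1) → ℝ,
        η * ∑ i, ξ i ^ 2 ≤ ∑ i, ∑ l, a i l x * ξ l * ξ i) →
      (∀ l q, CB (D 0 ∩ lowerHalf m) ε j (a l q) B) →
      lpNorm u 2 (volume.restrict (D 0 ∩ lowerHalf m)) ≤ M →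
      SobB (D 0 ∩ lowerHalf m) ε (j - 1) (fun x => ε ^ 2 * f x) M →
      (∀ l, SobB (D 0 ∩ lowerHalf m) ε j (fun x => ε * Φ l x) M) →
      SobB (D L ∩ lowerHalf m) ε (j + 1) u (C * M) := by
  induction j with
  | zero =>
    refine ⟨1, fun η B K hη hB => ⟨max 1 √(energyConst (m + 1) η B * (K ^ 2 + 2)), by positivity,
      fun bc D ε hε hD hgap a f u Φ g M hsol hell hCB hu hf hΦ => ?_⟩⟩
    have hW : IsOpen (D 0 ∩ lowerHalf m) := (hD 0).inter isOpen_lowerHalf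
    have ha := isElliptic_of_cb hW hCB hell
    have hM : 0 ≤ M := lpNorm_nonneg.trans hu
    have hs := (hgap 0).subset
    have hsol' := hsol.restrict (hD 0) hs
    have hle := Measure.restrict_mono (inter_subset_inter_left (lowerHalf m) hs)
      (le_refl (volume : Measure (Eu (m + 1))))
    have key := hsol.energy (hD 0) hη hB ha (hD 1).measurableSet hε (hgap 0) hu
      (by rw [← lpNorm_const_mul (by positivity)]; exact hf.2)
      (fun i => by rw [← lpNorm_const_mul hε.le]; exact (hΦ i).2)
    refine SobB.succ_of_grad hsol'.memLp_u ((lpNorm_mono_measure hsol.memLp_u hle).trans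
      (hu.trans (le_mul_of_one_le_left hM (le_max_left _ _)))) (fun i =>
      (hsol'.grad i).restrict ((hD 1).inter isOpen_lowerHalf).measurableSet le_rfl
        (inter_subset_gradSet bc _) inter_subset_left) fun i => ?_
    refine ⟨(hsol'.memLp_g i).const_mul ε, ?_⟩
    rw [lpNorm_const_mul hε.le]
    exact (key i).trans (mul_le_mul_of_nonneg_right (le_max_right _ _) hM)
  | succ j ih =>
    obtain ⟨L, ih⟩ := ih
    -- `L` sets are spent on `u` at the previous order, two on the difference quotients, and `L`
    -- more on applying the previous order to the tangential derivatives.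
    refine ⟨L + 2 + L, fun η B K hη hB => ?_⟩
    obtain ⟨C1, hC1, ih⟩ := ih η B K hη hB
    obtain ⟨C2, hC2, hnormal⟩ := FlatSol.exists_sobB_normal m j hη hB
    -- Bounds the data of the equation for `ε ∂ᵢu`: the derivative of `Φ`, the terms with
    -- differentiated coefficients, `f` in the `i`-th component, and finally the norm of `ε ∂ᵢu`
    -- itself.
    set N1 : ℝ := 1 + (m + 1) * (2 ^ j * (B * C1)) + 1 + C1 with hN1
    have hN1' : 0 ≤ N1 := by positivity
    refine ⟨C2 * (1 + C1 + C1 * N1), by positivity,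
      fun bc D ε hε hD hgap a f u Φ g M hsol hell hCB hu hf hΦ => ?_⟩
    have hε' := hε.ne'
    have hM : 0 ≤ M := lpNorm_nonneg.trans hu
    have hW : ∀ t, IsOpen (D t ∩ lowerHalf m) := fun t => (hD t).inter isOpen_lowerHalf
    have hanti : Antitone D := antitone_nat_of_succ_le fun t => (hgap t).subset
    have hWanti : ∀ {s t}, s ≤ t → D t ∩ lowerHalf m ⊆ D s ∩ lowerHalf m := fun h =>
      inter_subset_inter_left _ (hanti h)
    rw [Nat.add_sub_cancel] at hf
    have hu1 : SobB (D L ∩ lowerHalf m) ε (j + 1) u (C1 * M) :=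
      ih bc D ε hε hD hgap a f u Φ g M hsol hell (fun l q => (hCB l q).of_succ) hu
        (hf.of_le (Nat.sub_le _ _)) fun l => (hΦ l).of_succ
    have hsolL := hsol.restrict (hD 0) (hanti (Nat.zero_le L))
    have hgL : ∀ i, WD (D L ∩ lowerHalf m) (D L ∩ lowerHalf m) i u (g i) := fun i =>
      (hsolL.grad i).restrict (hW L).measurableSet le_rfl (inter_subset_gradSet bc _)
        inter_subset_left
    have hGL : ∀ i, SobB (D L ∩ lowerHalf m) ε j (fun x => ε * g i x) (C1 * M) := fun i =>
      hu1.deriv (hW L) hε' (hsolL.memLp_g i) (hgL i)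
    -- tangential derivatives
    have htan : ∀ i ≠ Fin.last m, SobB (D (L + 2 + L) ∩ lowerHalf m) ε (j + 1)
        (fun x => ε * g i x) (C1 * (N1 * M)) := fun i hi => by
      choose Φ' hΦ' hΦ'' using fun l => (hΦ l).2 i
      have hΦ'L : ∀ l, MemLp (Φ' l) 2 (volume.restrict (D 0 ∩ lowerHalf m)) := fun l =>
        (hΦ'' l).memLp_of_mul hε'
      have hle := Measure.restrict_mono (hWanti (Nat.zero_le L))
        (le_refl (volume : Measure (Eu (m + 1))))
      obtain ⟨G, hG⟩ := FlatSol.exists_tangential (Φ' := fun l x => ε⁻¹ * Φ' l x) (Λ' := B / ε)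
        (hD L) (hD (L + 1)) (hD (L + 2)) hη hB
        hsolL ((isElliptic_of_cb (hW 0) hCB hell).mono (hWanti (Nat.zero_le L))) hi (hgap L)
        (hgap (L + 1)) (fun l q => (hCB l q).1.1.mono (hWanti (Nat.zero_le L))) (by positivity)
        (fun l q x hx => (hCB l q).bound_partialD hε i (hWanti (Nat.zero_le L) hx))
        (fun l => ((hΦ'L l).mono_measure hle).const_mul _) (fun l => by
          have h1 := ((hΦ' l).restrict (hW 0).measurableSet (hWanti (Nat.zero_le L))
            (hWanti (Nat.zero_le L)) inter_subset_right).const_mul ε⁻¹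
          simpa [← mul_assoc, hε'] using h1)
      have hm2 : L ≤ L + 2 := by omega
      have hr : ∀ {k v N}, SobB (D L ∩ lowerHalf m) ε k v N →
          SobB (D (L + 2) ∩ lowerHalf m) ε k v N := fun h =>
        h.restrict (hW L).measurableSet (hWanti hm2)
      have hr0 : ∀ {k v N}, SobB (D 0 ∩ lowerHalf m) ε k v N →
          SobB (D (L + 2) ∩ lowerHalf m) ε k v N := fun h =>
        h.restrict (hW 0).measurableSet (hWanti (Nat.zero_le _))
      -- The tangential derivative solves an equation of the same kind with zero scalar term and a
      -- field of order `j`, so the induction hypothesis applies to it along the remaining sets.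
      refine ih bc (fun t => D (L + 2 + t)) ε hε (fun t => hD _) (fun t => hgap (L + 2 + t)) a _ _ _ _
        (N1 * M) (hG.const_mul ε) (fun x hx => hell x (hWanti (Nat.zero_le _) hx))
        (fun l q => (hCB l q).of_succ.mono (hWanti (Nat.zero_le _))) ?_ ?_ fun l => ?_
      · refine (hr (hGL i)).base.2.trans ?_
        rw [hN1]
        have : 0 ≤ (1 + (m + 1) * (2 ^ j * (B * C1)) + 1) * M := by positivity
        linarith
      · simpa using SobB.zero (W := D (L + 2) ∩ lowerHalf m) (ε := ε) (k := j - 1)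
          (mul_nonneg hN1' hM)
      · have h1 : SobB (D (L + 2) ∩ lowerHalf m) ε j
            (fun x => ∑ q, ε * partialD i (a l q) x * (ε * g q x))
            (((Finset.univ : Finset (Fin (m + 1))).card : ℝ) * (2 ^ j * (B * (C1 * M)))) :=
          SobB.sum hε' _ fun q _ => (hr (hGL q)).mul (hW _) hε hB
            (((hCB l q).2 i).mono (hWanti (Nat.zero_le _)))
        rw [Finset.card_univ, Fintype.card_fin] at h1
        have h2 : SobB (D (L + 2) ∩ lowerHalf m) ε j
            (fun x => if l = i then ε ^ 2 * f x else 0) M := by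
          by_cases hl : l = i
          · simpa [hl] using hr0 hf
          · simpa [hl] using SobB.zero hM
        refine ((((hr0 (hΦ'' l)).add hε' h1.neg).add hε' h2.neg).mono_const (M' := N1 * M) ?_).congr
          (Eventually.of_forall fun x => ?_)
        · rw [hN1]
          have : 0 ≤ C1 * M := by positivity
          push_cast
          linarith
        · simp only
          rw [mul_sub, mul_sub, mul_sub, mul_sub, mul_inv_cancel_left₀ hε', Finset.mul_sum,
            Finset.mul_sum, ← sub_eq_add_neg, ← sub_eq_add_neg]
          congr 1
          · congr 1
            refine Finset.sum_congr rfl fun q _ => ?_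
            ring
          · split_ifs <;> ring
    -- the normal derivative
    set T := L + 2 + L with hT
    have hLT : L ≤ T := by omega
    have hrL : ∀ {k v N}, SobB (D L ∩ lowerHalf m) ε k v N →
        SobB (D T ∩ lowerHalf m) ε k v N := fun h =>
      h.restrict (hW L).measurableSet (hWanti hLT)
    have hr0 : ∀ {k v N}, SobB (D 0 ∩ lowerHalf m) ε k v N →
        SobB (D T ∩ lowerHalf m) ε k v N := fun h =>
      h.restrict (hW 0).measurableSet (hWanti (Nat.zero_le _))
    have c0 : 0 ≤ C1 * M := by positivity
    have c1 : 0 ≤ C1 * N1 * M := by positivity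
    set N : ℝ := (1 + C1 + C1 * N1) * M with hN
    have hNM : M ≤ N := by rw [hN]; linarith
    have hNC : C1 * M ≤ N := by rw [hN]; linarith
    have hNT : C1 * (N1 * M) ≤ N := by rw [hN]; linarith
    have hn := hnormal bc (D T) ε a f u Φ g N (hD T) hε
      (hsol.restrict (hD 0) (hanti (Nat.zero_le T)))
      (fun x hx => hell x (hWanti (Nat.zero_le T) hx))
      (fun l q => (hCB l q).mono (hWanti (Nat.zero_le T)))
      (fun l => (hrL (hGL l)).mono_const hNC) (fun l hl => (htan l hl).mono_const hNT)
      ((hr0 hf).mono_const hNM) (fun l => (hr0 (hΦ l)).mono_const hNM)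
    have hNN : N ≤ C2 * N := le_mul_of_one_le_left (hM.trans hNM) hC2
    rw [mul_assoc]
    refine SobB.succ_of_grad (hrL hu1).base.1 ((hrL hu1).base.2.trans (hNC.trans hNN))
      (fun i => (hgL i).restrict (hW L).measurableSet (hWanti hLT) (hWanti hLT)
        inter_subset_right) fun i => ?_
    by_cases hi : i = Fin.last m
    · rw [hi]; exact hn
    · exact (htan i hi).mono_const (hNT.trans hNN)

end Regularity

/-! ### Straightening the boundary. -/

section Shear

variable {m : ℕ}

/-- The horizontal part as a continuous linear map. -/
noncomputable def horizL (m : ℕ) : Eu (m + 1) →L[ℝ] Eu m :=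
  LinearMap.toContinuousLinearMap
    { toFun := horiz
      map_add' := fun x y => by ext i; simp [horiz]
      map_smul' := fun c x => by ext i; simp [horiz] }

lemma horizL_apply (z : Eu (m + 1)) : horizL m z = horiz z := rfl

lemma contDiff_horiz {k : WithTop ℕ∞} : ContDiff ℝ k (horiz : Eu (m + 1) → Eu m) :=
  (horizL m).contDiff

lemma horiz_single_last : horiz (EuclideanSpace.single (Fin.last m) (1 : ℝ)) = 0 := by
  ext i; simp [horiz]

lemma horiz_add_smul (z : Eu (m + 1)) (t : ℝ) :
    horiz (z + t • EuclideanSpace.single (Fin.last m) (1 : ℝ)) = horiz z := by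
  rw [← horizL_apply, map_add, map_smul, horizL_apply, horizL_apply, horiz_single_last, smul_zero,
    add_zero]

lemma vert_add_smul (z : Eu (m + 1)) (t : ℝ) :
    vert (z + t • EuclideanSpace.single (Fin.last m) (1 : ℝ)) = vert z + t := by
  simp [vert]

/-- Splitting off the vertical coordinate. -/
noncomputable def splitEquiv (m : ℕ) : Eu (m + 1) ≃ᵐ Eu m × ℝ :=
  ((MeasurableEquiv.toLp 2 (Fin (m + 1) → ℝ)).symm.trans
    (MeasurableEquiv.piFinSuccAbove (fun _ => ℝ) (Fin.last m))).trans
    (MeasurableEquiv.prodComm.trans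
      ((MeasurableEquiv.toLp 2 (Fin m → ℝ)).prodCongr (MeasurableEquiv.refl ℝ)))

lemma splitEquiv_apply (z : Eu (m + 1)) : splitEquiv m z = (horiz z, vert z) := by
  refine Prod.ext ?_ rfl
  ext i
  change z.ofLp ((Fin.last m).succAbove i) = _
  rw [Fin.succAbove_last]
  rfl

lemma measurePreserving_splitEquiv (m : ℕ) : MeasurePreserving (splitEquiv m) := by
  have h1 := (PiLp.volume_preserving_ofLp (Fin (m + 1)))
  have h2 := volume_preserving_piFinSuccAbove (fun _ => ℝ) (Fin.last m)
  have h3 : MeasurePreserving (Prod.swap : ℝ × (Fin m → ℝ) → (Fin m → ℝ) × ℝ) :=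
    Measure.measurePreserving_swap
  have h4 : MeasurePreserving (Prod.map (WithLp.toLp 2) id : (Fin m → ℝ) × ℝ → Eu m × ℝ) :=
    (PiLp.volume_preserving_toLp (Fin m)).prod (MeasurePreserving.id volume)
  exact h4.comp (h3.comp (h2.comp h1))

/-- The map that straightens the graph of `ψ`. -/
noncomputable def shear (ψ : Eu m → ℝ) (z : Eu (m + 1)) : Eu (m + 1) :=
  z + ψ (horiz z) • EuclideanSpace.single (Fin.last m) (1 : ℝ)

variable {ψ : Eu m → ℝ}

lemma horiz_shear (z : Eu (m + 1)) : horiz (shear ψ z) = horiz z := horiz_add_smul _ _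

lemma vert_shear (z : Eu (m + 1)) : vert (shear ψ z) = vert z + ψ (horiz z) := vert_add_smul _ _

lemma shear_neg_shear (z : Eu (m + 1)) : shear (fun y => -ψ y) (shear ψ z) = z := by
  rw [shear, horiz_shear, shear, neg_smul, add_neg_cancel_right]

lemma shear_shear_neg (z : Eu (m + 1)) : shear ψ (shear (fun y => -ψ y) z) = z := by
  rw [shear, horiz_shear, shear, neg_smul, neg_add_cancel_right]

lemma contDiff_shear {k : WithTop ℕ∞} (hψ : ContDiff ℝ k ψ) : ContDiff ℝ k (shear ψ) :=
  contDiff_id.add ((hψ.comp contDiff_horiz).smul contDiff_const)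

lemma continuous_shear (hψ : Continuous ψ) : Continuous (shear ψ) :=
  continuous_id.add ((hψ.comp (contDiff_horiz (k := 0)).continuous).smul continuous_const)

/-- The shear as a homeomorphism. -/
noncomputable def shearHomeo (hψ : Continuous ψ) : Eu (m + 1) ≃ₜ Eu (m + 1) where
  toFun := shear ψ
  invFun := shear fun y => -ψ y
  left_inv := shear_neg_shear
  right_inv := shear_shear_neg
  continuous_toFun := continuous_shear hψ
  continuous_invFun := continuous_shear hψ.neg

lemma measurableEmbedding_shear (hψ : Continuous ψ) : MeasurableEmbedding (shear ψ) :=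
  (shearHomeo hψ).measurableEmbedding

/-- The shear translates each vertical line by a constant, so Fubini gives the invariance with no
Jacobian. -/
lemma measurePreserving_shear (hψ : Continuous ψ) : MeasurePreserving (shear ψ) := by
  have h1 : MeasurePreserving (fun q : Eu m × ℝ => (q.1, q.2 + ψ q.1)) (volume.prod volume)
      (volume.prod volume) :=
    MeasurePreserving.skew_product (g := fun y t => t + ψ y) (MeasurePreserving.id _)
      (measurable_snd.add (hψ.measurable.comp measurable_fst))
      (Eventually.of_forall fun y => map_add_right_eq_self volume (ψ y))
  have h2 := measurePreserving_splitEquiv m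
  have h3 := h2.symm.comp (h1.comp h2)
  have h4 : (splitEquiv m).symm ∘ (fun q => (q.1, q.2 + ψ q.1)) ∘ splitEquiv m = shear ψ := by
    ext1 z
    apply (splitEquiv m).injective
    simp only [Function.comp_apply, MeasurableEquiv.apply_symm_apply, splitEquiv_apply, horiz_shear,
      vert_shear]
  rwa [← h4]

lemma setIntegral_shear (hψ : Continuous ψ) (W : Set (Eu (m + 1))) (F : Eu (m + 1) → ℝ) :
    ∫ y in shear ψ ⁻¹' W, F (shear ψ y) = ∫ x in W, F x :=
  (measurePreserving_shear hψ).setIntegral_preimage_emb (measurableEmbedding_shear hψ) F W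

lemma measurePreserving_shear_restrict (hψ : Continuous ψ) (W : Set (Eu (m + 1))) :
    MeasurePreserving (shear ψ) (volume.restrict (shear ψ ⁻¹' W)) (volume.restrict W) :=
  (measurePreserving_shear hψ).restrict_preimage_emb (measurableEmbedding_shear hψ) W

lemma memLp_shear (hψ : Continuous ψ) {W : Set (Eu (m + 1))} {u : Eu (m + 1) → ℝ} {p : ℝ≥0∞}
    (hu : MemLp u p (volume.restrict W)) :
    MemLp (fun y => u (shear ψ y)) p (volume.restrict (shear ψ ⁻¹' W)) :=
  hu.comp_measurePreserving (measurePreserving_shear_restrict hψ W)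

lemma lpNorm_shear (hψ : Continuous ψ) {W : Set (Eu (m + 1))} {u : Eu (m + 1) → ℝ} {p : ℝ≥0∞}
    (hu : MemLp u p (volume.restrict W)) :
    lpNorm (fun y => u (shear ψ y)) p (volume.restrict (shear ψ ⁻¹' W)) =
      lpNorm u p (volume.restrict W) := by
  rw [← toReal_eLpNorm hu.1, ← toReal_eLpNorm (memLp_shear hψ hu).1]
  exact congrArg ENNReal.toReal
    (eLpNorm_comp_measurePreserving hu.1 (measurePreserving_shear_restrict hψ W))

/-- The partial derivatives of `z ↦ ψ(z̃)`. -/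
noncomputable def slope (ψ : Eu m → ℝ) (i : Fin (m + 1)) (z : Eu (m + 1)) : ℝ :=
  fderiv ℝ ψ (horiz z) (horiz (EuclideanSpace.single i (1 : ℝ)))

lemma slope_last (z : Eu (m + 1)) : slope ψ (Fin.last m) z = 0 := by
  rw [slope, horiz_single_last, map_zero]

lemma slope_shear (i : Fin (m + 1)) (χ : Eu m → ℝ) (z : Eu (m + 1)) :
    slope ψ i (shear χ z) = slope ψ i z := by
  rw [slope, slope, horiz_shear]

lemma slope_neg (i : Fin (m + 1)) (z : Eu (m + 1)) :
    slope (fun y => -ψ y) i z = -slope ψ i z := by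
  rw [slope, fderiv_fun_neg, slope]; rfl

lemma contDiff_slope (hψ : ContDiff ℝ 2 ψ) (i : Fin (m + 1)) : ContDiff ℝ 1 (slope ψ i) :=
  ((hψ.fderiv_right (m := 1) (by norm_num)).comp contDiff_horiz).clm_apply contDiff_const

lemma partialD_last_of_horiz {f : Eu m → ℝ} {z : Eu (m + 1)}
    (hf : DifferentiableAt ℝ f (horiz z)) :
    partialD (Fin.last m) (fun z => f (horiz z)) z = 0 := by
  have h1 := (hf.hasFDerivAt.comp z (horizL m).hasFDerivAt).fderiv
  rw [partialD, show (fun z => f (horiz z)) = f ∘ horiz from rfl, h1]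
  simp [horizL_apply, horiz_single_last]

lemma partialD_last_slope (hψ : ContDiff ℝ 2 ψ) (i : Fin (m + 1)) (z : Eu (m + 1)) :
    partialD (Fin.last m) (slope ψ i) z = 0 := by
  refine partialD_last_of_horiz (f := fun y => fderiv ℝ ψ y (horiz (EuclideanSpace.single i 1))) ?_
  exact ((hψ.fderiv_right (m := 1) (by norm_num)).differentiable (by simp) _).clm_apply
    (differentiableAt_const _)

lemma partialD_shear {f : Eu (m + 1) → ℝ} {z : Eu (m + 1)}
    (hψ : DifferentiableAt ℝ ψ (horiz z)) (hf : DifferentiableAt ℝ f (shear ψ z))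
    (i : Fin (m + 1)) : partialD i (fun y => f (shear ψ y)) z =
      partialD i f (shear ψ z) + slope ψ i z * partialD (Fin.last m) f (shear ψ z) := by
  have h0 : HasFDerivAt (fun z : Eu (m + 1) => ψ (horiz z))
      ((fderiv ℝ ψ (horiz z)).comp (horizL m)) z :=
    HasFDerivAt.comp z (f := horizL m) hψ.hasFDerivAt (horizL m).hasFDerivAt
  have h1 := (hasFDerivAt_id z).add
    (h0.smul_const (EuclideanSpace.single (Fin.last m) (1 : ℝ)))
  have h2 : HasFDerivAt (fun y => f (shear ψ y)) _ z :=
    HasFDerivAt.comp z (f := shear ψ) hf.hasFDerivAt h1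
  rw [partialD, h2.fderiv]
  simp [partialD, slope, horizL_apply]

lemma IsC1Test.shear (hψ : ContDiff ℝ 1 ψ) {S : Set (Eu (m + 1))} {φ : Eu (m + 1) → ℝ}
    (hφ : IsC1Test S φ) : IsC1Test (shear ψ ⁻¹' S) fun y => φ (shear ψ y) := by
  refine ⟨hφ.1.comp (contDiff_shear hψ),
    hφ.2.1.comp_homeomorph (shearHomeo hψ.continuous), ?_⟩
  have := tsupport_comp_eq_preimage φ (shearHomeo hψ.continuous)
  exact this.subset.trans (preimage_mono hφ.2.2)

lemma preimage_shear_neg (S : Set (Eu (m + 1))) :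
    shear (fun y => -ψ y) ⁻¹' (shear ψ ⁻¹' S) = S := by
  ext x; simp [shear_shear_neg]

lemma IsC1Test.unshear (hψ : ContDiff ℝ 1 ψ) {S : Set (Eu (m + 1))} {φ : Eu (m + 1) → ℝ}
    (hφ : IsC1Test (BoundaryEstimates.shear ψ ⁻¹' S) φ) :
    IsC1Test S fun x => φ (BoundaryEstimates.shear (fun y => -ψ y) x) := by
  have := hφ.shear hψ.neg
  rwa [preimage_shear_neg] at this

lemma partialD_unshear (hψ : ContDiff ℝ 1 ψ) {φ : Eu (m + 1) → ℝ} (hφ : ContDiff ℝ 1 φ)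
    (i : Fin (m + 1)) (y : Eu (m + 1)) :
    partialD i (fun x => φ (shear (fun y => -ψ y) x)) (shear ψ y) =
      partialD i φ y - slope ψ i y * partialD (Fin.last m) φ y := by
  rw [partialD_shear ((hψ.neg).differentiable (by simp) _) (hφ.differentiable (by simp) _),
    shear_neg_shear, slope_shear, slope_neg, neg_mul, sub_eq_add_neg]

/-- Weak derivatives in the straightened variables. -/
lemma WD.shear (hψ : ContDiff ℝ 2 ψ) {W S : Set (Eu (m + 1))} (hS : IsOpen S)
    {i : Fin (m + 1)} {u g gn : Eu (m + 1) → ℝ} (hu : MemLp u 2 (volume.restrict W))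
    (hg : MemLp g 2 (volume.restrict W)) (hgn : MemLp gn 2 (volume.restrict W))
    (hi : WD W S i u g) (hn : WD W S (Fin.last m) u gn) :
    WD (shear ψ ⁻¹' W) (shear ψ ⁻¹' S) i (fun y => u (shear ψ y))
      (fun y => g (shear ψ y) + slope ψ i y * gn (shear ψ y)) := by
  intro φ hφ
  have h1ψ : ContDiff ℝ 1 ψ := hψ.of_le (by norm_num)
  have hc := h1ψ.continuous
  -- Pulling back a test function creates the term `slope · ∂ₙφ`. The slope does not depend on the
  -- vertical variable, so this is `∂ₙ(slope · φ)`, and the relation for `∂ₙu` applies. The product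
  -- is `C¹` because `ψ` is `C²`.
  have hξ : IsC1Test (BoundaryEstimates.shear ψ ⁻¹' S) fun y => slope ψ i y * φ y :=
    ⟨(contDiff_slope hψ i).mul (hφ.1.of_le (by simp)), hφ.2.1.mul_left,
      tsupport_mul_subset_right.trans hφ.2.2⟩
  have hφ1 := hφ.c1.unshear h1ψ
  have hξ1 := hξ.unshear h1ψ
  have e1 := hi.c1 hS hu hg hφ1
  have e2 := hn.c1 hS hu hgn hξ1
  rw [← setIntegral_shear hc W, ← setIntegral_shear hc W] at e1 e2
  simp only [partialD_unshear h1ψ hφ.c1.1, shear_neg_shear] at e1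
  have e2' := fun y => partialD_unshear h1ψ hξ.1 (Fin.last m) y
  simp only [slope_last, zero_mul, sub_zero] at e2'
  simp_rw [e2', shear_neg_shear] at e2
  have e3 : ∀ y, partialD (Fin.last m) (fun y => slope ψ i y * φ y) y =
      slope ψ i y * partialD (Fin.last m) φ y := fun y => by
    rw [partialD_mul ((contDiff_slope hψ i).differentiable (by simp) y)
      (hφ.1.differentiable (by simp) y), partialD_last_slope hψ, zero_mul, add_zero]
  simp_rw [e3] at e2
  have L := fun {v : Eu (m + 1) → ℝ} (hv : MemLp v 2 (volume.restrict W)) => memLp_shear hc hv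
  have hsc : MemLp (fun y => slope ψ i y * partialD (Fin.last m) φ y) 2
      (volume.restrict (BoundaryEstimates.shear ψ ⁻¹' W)) := by
    have := hξ.memLp_partialD (Fin.last m) (p := 2)
      (μ := volume.restrict (BoundaryEstimates.shear ψ ⁻¹' W))
    exact this.congr_norm ((contDiff_slope hψ i).continuous.mul
      (continuous_partialD hφ.c1.1 _)).aestronglyMeasurable (Eventually.of_forall fun y => by simp only [e3])
  have i1 := integrable_mul_of_memLp (L hu) (hφ.c1.memLp_partialD i)
  have i2 := integrable_mul_of_memLp (L hu) hsc
  have i3 := integrable_mul_of_memLp (L hg) hφ.c1.memLp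
  have i4 := integrable_mul_of_memLp (L hgn) hξ.memLp
  simp_rw [mul_sub] at e1
  rw [integral_sub i1 i2] at e1
  have e4 : ∫ y in BoundaryEstimates.shear ψ ⁻¹' W,
      (g (BoundaryEstimates.shear ψ y) + slope ψ i y * gn (BoundaryEstimates.shear ψ y)) * φ y =
      (∫ y in BoundaryEstimates.shear ψ ⁻¹' W, g (BoundaryEstimates.shear ψ y) * φ y) +
      ∫ y in BoundaryEstimates.shear ψ ⁻¹' W,
        gn (BoundaryEstimates.shear ψ y) * (slope ψ i y * φ y) := by
    rw [← integral_add i3 i4]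
    congr 1 with y
    ring
  rw [e4]
  linarith

/-- Induction through `∂ᵢ(u ∘ shear) = (∂ᵢu + slopeᵢ ∂ₙu) ∘ shear`; passing from order `k` to `k +
1` costs the factor `1 + 2 ^ k * B`. -/
lemma SobB.exists_shear (m k : ℕ) {B : ℝ} (hB : 0 ≤ B) : ∃ C, 1 ≤ C ∧
    ∀ (ψ : Eu m → ℝ) (W : Set (Eu (m + 1))) (ε : ℝ) (u : Eu (m + 1) → ℝ) (M : ℝ), ContDiff ℝ 2 ψ →
      IsOpen W → 0 < ε → (∀ i, CB (BoundaryEstimates.shear ψ ⁻¹' W) ε k (slope ψ i) B) →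
      SobB W ε k u M →
      SobB (BoundaryEstimates.shear ψ ⁻¹' W) ε k (fun y => u (BoundaryEstimates.shear ψ y))
        (C * M) := by
  have hb : ∀ {ψ : Eu m → ℝ} {W : Set (Eu (m + 1))} {u : Eu (m + 1) → ℝ} {M C : ℝ}, ContDiff ℝ 2 ψ →
      1 ≤ C → MemLp u 2 (volume.restrict W) ∧ lpNorm u 2 (volume.restrict W) ≤ M →
      MemLp (fun y => u (BoundaryEstimates.shear ψ y)) 2
        (volume.restrict (BoundaryEstimates.shear ψ ⁻¹' W)) ∧
      lpNorm (fun y => u (BoundaryEstimates.shear ψ y)) 2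
        (volume.restrict (BoundaryEstimates.shear ψ ⁻¹' W)) ≤ C * M := fun hψ hC h =>
    ⟨memLp_shear hψ.continuous h.1, (lpNorm_shear hψ.continuous h.1).trans_le
      (h.2.trans (le_mul_of_one_le_left (lpNorm_nonneg.trans h.2) hC))⟩
  induction k with
  | zero => exact ⟨1, le_rfl, fun ψ W ε u M hψ _ _ _ h => hb hψ le_rfl h⟩
  | succ k ih =>
    obtain ⟨C, hC, ih⟩ := ih
    have hC' : 1 ≤ C * (1 + 2 ^ k * B) := by
      have : 0 ≤ C * (2 ^ k * B) := by positivity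
      linarith
    refine ⟨C * (1 + 2 ^ k * B), hC', fun ψ W ε u M hψ hW hε hs h =>
      ⟨hb hψ hC' h.1, fun i => ?_⟩⟩
    obtain ⟨g, hg, hg'⟩ := h.2 i
    obtain ⟨gn, hgn, hgn'⟩ := h.2 (Fin.last m)
    have hWs : IsOpen (BoundaryEstimates.shear ψ ⁻¹' W) :=
      hW.preimage (continuous_shear hψ.continuous)
    refine ⟨_, hg.shear hψ hW h.1.1 (hg'.memLp_of_mul hε.ne') (hgn'.memLp_of_mul hε.ne') hgn, ?_⟩
    have h1 := (ih ψ W ε _ M hψ hW hε (fun i => (hs i).of_succ) hg').add hε.ne'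
      ((ih ψ W ε _ M hψ hW hε (fun i => (hs i).of_succ) hgn').mul hWs hε hB (hs i).of_succ)
    refine (h1.mono_const (le_of_eq (by ring))).congr (Eventually.of_forall fun y => ?_)
    ring

lemma CB.exists_shear (m k : ℕ) {B : ℝ} (hB : 0 ≤ B) : ∃ C, 1 ≤ C ∧
    ∀ (ψ : Eu m → ℝ) (W : Set (Eu (m + 1))) (ε : ℝ) (c : Eu (m + 1) → ℝ) (M : ℝ), ContDiff ℝ 1 ψ →
      IsOpen W → 0 ≤ M → (∀ i, CB (BoundaryEstimates.shear ψ ⁻¹' W) ε k (slope ψ i) B) →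
      CB W ε k c M →
      CB (BoundaryEstimates.shear ψ ⁻¹' W) ε k (fun y => c (BoundaryEstimates.shear ψ y))
        (C * M) := by
  induction k with
  | zero =>
    exact ⟨1, le_rfl, fun ψ W ε c M hψ _ _ _ h =>
      ⟨h.1.comp (continuous_shear hψ.continuous).continuousOn fun _ hx => hx,
        fun x hx => (h.2 _ hx).trans (one_mul M).ge⟩⟩
  | succ k ih =>
    obtain ⟨C, hC, ih⟩ := ih
    have hC' : 1 ≤ C * (1 + 2 ^ k * B) := by
      have : 0 ≤ C * (2 ^ k * B) := by positivity
      linarith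
    refine ⟨C * (1 + 2 ^ k * B), hC', fun ψ W ε c M hψ hW hM hs h =>
      ⟨⟨h.1.1.comp (contDiff_shear hψ).contDiffOn fun _ hx => hx,
        fun x hx => (h.1.2 _ hx).trans (le_mul_of_one_le_left hM hC')⟩, fun i => ?_⟩⟩
    have hWs : IsOpen (BoundaryEstimates.shear ψ ⁻¹' W) :=
      hW.preimage (continuous_shear hψ.continuous)
    have h1 := (ih ψ W ε _ M hψ hW hM (fun i => (hs i).of_succ) (h.2 i)).add hWs
      ((hs i).of_succ.mul hWs hB (by positivity)
        (ih ψ W ε _ M hψ hW hM (fun i => (hs i).of_succ) (h.2 (Fin.last m))))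
    refine (h1.mono_const (le_of_eq (by ring))).congr hWs fun y hy => ?_
    have h2 : DifferentiableAt ℝ c (BoundaryEstimates.shear ψ y) :=
      (h.1.1.differentiableOn (by simp) _ hy).differentiableAt (hW.mem_nhds hy)
    rw [partialD_shear (hψ.differentiable (by simp) _) h2]
    ring

end Shear

/-! ### Peeling single derivatives off multi-indices. -/

section MultiIndex

variable {n : ℕ}

lemma contDiff_iterate_partialD {φ : Eu n → ℝ} (hφ : ContDiff ℝ ∞ φ) (i : Fin n) (k : ℕ) :
    ContDiff ℝ ∞ ((partialD i)^[k] φ) := by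
  induction k with
  | zero => exact hφ
  | succ k ih => rw [Function.iterate_succ_apply']; exact contDiff_partialD ih i

lemma contDiff_foldr_partialD {φ : Eu n → ℝ} (hφ : ContDiff ℝ ∞ φ) (α : Fin n → ℕ)
    (l : List (Fin n)) : ContDiff ℝ ∞ (l.foldr (fun i g => (partialD i)^[α i] g) φ) := by
  induction l with
  | nil => exact hφ
  | cons j l ih => exact contDiff_iterate_partialD ih j _

lemma partialD_iterate {φ : Eu n → ℝ} (hφ : ContDiff ℝ ∞ φ) (i j : Fin n) (k : ℕ) :
    partialD i ((partialD j)^[k] φ) = (partialD j)^[k] (partialD i φ) := by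
  induction k with
  | zero => rfl
  | succ k ih =>
    rw [Function.iterate_succ_apply', Function.iterate_succ_apply', ← ih,
      partialD_comm (contDiff_iterate_partialD hφ j k)]

lemma partialD_foldr {φ : Eu n → ℝ} (hφ : ContDiff ℝ ∞ φ) (i : Fin n) (α : Fin n → ℕ)
    (l : List (Fin n)) : partialD i (l.foldr (fun i g => (partialD i)^[α i] g) φ) =
      l.foldr (fun i g => (partialD i)^[α i] g) (partialD i φ) := by
  induction l with
  | nil => rfl
  | cons j l ih =>
    rw [List.foldr_cons, List.foldr_cons, partialD_iterate (contDiff_foldr_partialD hφ α l), ih]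

lemma foldr_partialD_congr (φ : Eu n → ℝ) {α β : Fin n → ℕ} {l : List (Fin n)}
    (h : ∀ j ∈ l, α j = β j) : l.foldr (fun i g => (partialD i)^[α i] g) φ =
      l.foldr (fun i g => (partialD i)^[β i] g) φ := by
  induction l with
  | nil => rfl
  | cons j l ih =>
    rw [List.foldr_cons, List.foldr_cons, h j List.mem_cons_self,
      ih fun k hk => h k (List.mem_cons_of_mem j hk)]

lemma foldr_partialD_add_single {φ : Eu n → ℝ} (hφ : ContDiff ℝ ∞ φ) (i : Fin n) (α : Fin n → ℕ)
    {l : List (Fin n)} (hl : l.Nodup) (hi : i ∈ l) :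
    l.foldr (fun j g => (partialD j)^[(α + Pi.single i 1 : Fin n → ℕ) j] g) φ =
      l.foldr (fun j g => (partialD j)^[α j] g) (partialD i φ) := by
  induction l with
  | nil => simp at hi
  | cons j l ih =>
    rw [List.foldr_cons, List.foldr_cons]
    obtain ⟨hjl, hl⟩ := List.nodup_cons.1 hl
    by_cases hij : i = j
    · subst hij
      rw [foldr_partialD_congr φ (β := α) fun k hk => by
        have : k ≠ i := fun h => hjl (h ▸ hk)
        simp [this], ← partialD_foldr hφ]
      simp [Function.iterate_succ_apply]
    · rw [ih hl (by simpa [hij] using hi)]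
      simp [Ne.symm hij]

lemma multiD_add_single {φ : Eu n → ℝ} (hφ : ContDiff ℝ ∞ φ) (i : Fin n) (α : Fin n → ℕ) :
    multiD (α + Pi.single i 1) φ = multiD α (partialD i φ) :=
  foldr_partialD_add_single hφ i α (List.nodup_finRange n) (List.mem_finRange i)

lemma multiD_zero (φ : Eu n → ℝ) : multiD 0 φ = φ := by
  unfold multiD
  induction List.finRange n with
  | nil => rfl
  | cons j l ih => rw [List.foldr_cons, ih]; rfl

lemma multiD_single {φ : Eu n → ℝ} (hφ : ContDiff ℝ ∞ φ) (i : Fin n) :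
    multiD (Pi.single i 1) φ = partialD i φ := by
  rw [← zero_add (Pi.single i 1), multiD_add_single hφ, multiD_zero]

lemma order_add_single (α : Fin n → ℕ) (i : Fin n) : order (α + Pi.single i 1) = order α + 1 := by
  simp [order, Finset.sum_add_distrib]

lemma exists_eq_add_single {α : Fin n → ℕ} {k : ℕ} (h : order α = k + 1) :
    ∃ β i, α = β + Pi.single i 1 ∧ order β = k := by
  have : ∃ i, α i ≠ 0 := by
    by_contra! h0
    simp [order, h0] at h
  obtain ⟨i, hi⟩ := this
  have h1 : α = (α - Pi.single i 1) + Pi.single i 1 := by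
    ext j
    by_cases hj : j = i
    · subst hj; simp; omega
    · simp [hj]
  refine ⟨_, i, h1, ?_⟩
  rw [h1, order_add_single] at h
  omega

lemma order_eq_zero {α : Fin n → ℕ} (h : order α = 0) : α = 0 := by
  ext i
  exact (Finset.sum_eq_zero_iff.1 h) i (Finset.mem_univ i)

end MultiIndex

/-! ### Chosen weak derivatives and `H¹` norms expressed through `WD` and `L2Lim`. -/

section WeakDeriv

variable {n : ℕ} {W : Set (Eu n)} {u g : Eu n → ℝ} {α : Fin n → ℕ}

lemma IsWeakDeriv.zero (hu : LocallyIntegrableOn u W) : IsWeakDeriv W 0 u u :=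
  ⟨hu, hu, fun φ _ => by simp [multiD_zero, order]⟩

lemma isWeakDeriv_single (hu : LocallyIntegrableOn u W) (hg : LocallyIntegrableOn g W) (i : Fin n) :
    IsWeakDeriv W (Pi.single i 1) u g ↔ WD W W i u g := by
  have h1 : order (Pi.single i 1 : Fin n → ℕ) = 1 := by
    rw [← zero_add (Pi.single i 1), order_add_single]; simp [order]
  constructor
  · intro h φ hφ
    have := h.2.2 φ hφ
    rwa [h1, multiD_single hφ.1, pow_one, neg_one_mul] at this
  · intro h
    refine ⟨hu, hg, fun φ hφ => ?_⟩
    rw [h1, multiD_single hφ.1, pow_one, neg_one_mul, h φ hφ]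

/-- Weak derivatives of weak derivatives. -/
lemma IsWeakDeriv.add_single (h : IsWeakDeriv W α u g) {f : Eu n → ℝ}
    (hf : LocallyIntegrableOn f W) {i : Fin n} (hD : WD W W i g f) :
    IsWeakDeriv W (α + Pi.single i 1) u f := by
  refine ⟨h.1, hf, fun φ hφ => ?_⟩
  rw [multiD_add_single hφ.1, h.2.2 _ (hφ.partialD i), hD φ hφ, order_add_single, pow_succ]
  ring

lemma IsWeakDeriv.wd_of_add_single (h : IsWeakDeriv W α u g) {f : Eu n → ℝ} {i : Fin n}
    (h' : IsWeakDeriv W (α + Pi.single i 1) u f) : WD W W i g f := by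
  intro φ hφ
  have e1 := h.2.2 _ (hφ.partialD i)
  have e2 := h'.2.2 _ hφ
  rw [multiD_add_single hφ.1, e1, order_add_single, pow_succ] at e2
  have h3 : ((-1 : ℝ) ^ order α) ≠ 0 := by positivity
  refine mul_left_cancel₀ h3 ?_
  rw [e2]
  ring

/-- Test functions determine a locally integrable function up to a null set, so norms of the chosen
derivative may be computed with any other representative. -/
lemma IsWeakDeriv.ae_eq (hW : IsOpen W) (h : IsWeakDeriv W α u g) :
    weakDeriv W α u =ᵐ[volume.restrict W] g := by
  have hex : ∃ g, IsWeakDeriv W α u g := ⟨g, h⟩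
  have h1 : weakDeriv W α u = hex.choose := by rw [weakDeriv, dif_pos hex]
  have h2 := hex.choose_spec
  rw [h1]
  refine ae_eq_of_forall_test hW h2.2.1 h.2.1 fun φ hφ => ?_
  have h3 := (h2.2.2 φ hφ).symm.trans (h.2.2 φ hφ)
  exact mul_left_cancel₀ (by positivity) h3

lemma MemH.mono {k k' : ℕ} (h : MemH W k u) (hk : k' ≤ k) : MemH W k' u :=
  ⟨h.1, fun α hα => h.2 α (hα.trans hk)⟩

lemma MemH.weakDeriv (hW : IsOpen W) {k : ℕ} (h : MemH W k u) (hα : order α ≤ k) :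
    IsWeakDeriv W α u (weakDeriv W α u) ∧ MemLp (weakDeriv W α u) 2 (volume.restrict W) := by
  obtain ⟨g, hg, hg2⟩ := h.2 α hα
  have h1 := hg.ae_eq hW
  refine ⟨?_, (memLp_congr_ae h1).2 hg2⟩
  have hex : ∃ g, IsWeakDeriv W α u g := ⟨g, hg⟩
  rw [BoundaryEstimates.weakDeriv, dif_pos hex]
  exact hex.choose_spec

lemma memH_one {g : Fin n → Eu n → ℝ} (hu : MemLp u 2 (volume.restrict W))
    (hg : ∀ i, MemLp (g i) 2 (volume.restrict W)) (h : ∀ i, WD W W i u (g i)) : MemH W 1 u := by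
  refine ⟨hu, fun α hα => ?_⟩
  rcases Nat.le_one_iff_eq_zero_or_eq_one.1 hα with h0 | h1
  · rw [order_eq_zero h0]
    exact ⟨u, .zero (locallyIntegrableOn_of_memLp hu), hu⟩
  · obtain ⟨β, i, rfl, hβ⟩ := exists_eq_add_single h1
    rw [order_eq_zero hβ, zero_add]
    exact ⟨g i, (isWeakDeriv_single (locallyIntegrableOn_of_memLp hu)
      (locallyIntegrableOn_of_memLp (hg i)) i).2 (h i), hg i⟩

lemma weakDeriv_single_ae {i : Fin n} (hW : IsOpen W) (hu : MemLp u 2 (volume.restrict W))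
    (hg : MemLp g 2 (volume.restrict W)) (h : WD W W i u g) :
    weakDeriv W (Pi.single i 1) u =ᵐ[volume.restrict W] g :=
  ((isWeakDeriv_single (locallyIntegrableOn_of_memLp hu)
    (locallyIntegrableOn_of_memLp hg) i).2 h).ae_eq hW

lemma MemH.wd (hW : IsOpen W) (h : MemH W 1 u) (i : Fin n) :
    WD W W i u (BoundaryEstimates.weakDeriv W (Pi.single i 1) u) ∧
      MemLp (BoundaryEstimates.weakDeriv W (Pi.single i 1) u) 2 (volume.restrict W) := by
  have h1 : order (Pi.single i 1 : Fin n → ℕ) ≤ 1 := by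
    rw [← zero_add (Pi.single i 1), order_add_single]; simp [order]
  obtain ⟨h2, h3⟩ := h.weakDeriv hW h1
  exact ⟨(isWeakDeriv_single h2.1 h2.2.1 i).1 h2, h3⟩

lemma piAntidiag_one (n : ℕ) : Finset.piAntidiag (Finset.univ : Finset (Fin n)) 1 =
    Finset.univ.image fun i => (Pi.single i 1 : Fin n → ℕ) := by
  ext α
  simp only [Finset.mem_piAntidiag, Finset.mem_univ, implies_true, and_true, Finset.mem_image,
    true_and]
  constructor
  · intro h
    obtain ⟨β, i, rfl, hβ⟩ := exists_eq_add_single (α := α) (k := 0) h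
    exact ⟨i, by rw [order_eq_zero hβ, zero_add]⟩
  · rintro ⟨i, rfl⟩
    simp

lemma normHSq_one_eq {g : Fin n → Eu n → ℝ} (hW : IsOpen W) (hu : MemLp u 2 (volume.restrict W))
    (hg : ∀ i, MemLp (g i) 2 (volume.restrict W)) (h : ∀ i, WD W W i u (g i)) :
    normHSq W 1 u = lpNorm u 2 (volume.restrict W) ^ 2 +
      ∑ i, lpNorm (g i) 2 (volume.restrict W) ^ 2 := by
  rw [normHSq, Finset.sum_range_succ, Finset.sum_range_one, Finset.piAntidiag_zero,
    Finset.sum_singleton, piAntidiag_one, Finset.sum_image]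
  · congr 1
    · rw [normLp, lpNorm_congr_ae ((IsWeakDeriv.zero (locallyIntegrableOn_of_memLp hu)).ae_eq hW)]
    · refine Finset.sum_congr rfl fun i _ => ?_
      rw [normLp, lpNorm_congr_ae (weakDeriv_single_ae hW hu (hg i) (h i))]
  · intro i _ j _ hij
    by_contra hne
    have := congrFun hij i
    simp [hne] at this

lemma WD.of_c1 {S : Set (Eu n)} {W : Set (Eu n)} {w : Eu n → ℝ} (hw : ContDiff ℝ 1 w)
    (hS : S ⊆ W) (i : Fin n) : WD W S i w (partialD i w) := by
  intro φ hφ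
  have h0 : ∀ x ∉ W, φ x = 0 ∧ partialD i φ x = 0 := fun x hx =>
    ⟨image_eq_zero_of_notMem_tsupport fun h => hx (hS (hφ.2.2 h)),
      partialD_eq_zero fun h => hx (hS (hφ.2.2 h))⟩
  rw [setIntegral_eq_integral_of_forall_compl_eq_zero fun x hx => by rw [(h0 x hx).2, mul_zero],
    setIntegral_eq_integral_of_forall_compl_eq_zero fun x hx => by rw [(h0 x hx).1, mul_zero]]
  exact integral_mul_partialD hw hφ.c1 i

/-- A diagonal choice: `φ j` is replaced by a smooth test function at distance at most `1/(j+1)`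
from it together with its derivatives, which does not change the limits. -/
lemma exists_smooth_lim {S : Set (Eu n)} (hS : IsOpen S) {φ : ℕ → Eu n → ℝ} {v : Eu n → ℝ}
    {gv : Fin n → Eu n → ℝ} (hφ : ∀ j, IsC1Test S (φ j))
    (h : L2Lim (volume.restrict W) φ v)
    (h' : ∀ i, L2Lim (volume.restrict W) (fun j => partialD i (φ j)) (gv i)) :
    ∃ w : ℕ → Eu n → ℝ, (∀ j, IsTestFunction S (w j)) ∧ L2Lim (volume.restrict W) w v ∧
      ∀ i, L2Lim (volume.restrict W) (fun j => partialD i (w j)) (gv i) := by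
  have key : ∀ j : ℕ, ∃ w, IsTestFunction S w ∧
      eLpNorm (fun x => w x - φ j x) 2 (volume.restrict W) ≤ ENNReal.ofReal (1 / ((j : ℝ) + 1)) ∧
      ∀ i, eLpNorm (fun x => partialD i w x - partialD i (φ j) x) 2 (volume.restrict W) ≤
        ENNReal.ofReal (1 / ((j : ℝ) + 1)) := fun j => by
    obtain ⟨w, hw, hw1, hw2⟩ := (hφ j).exists_smooth hS
    have hpos : 0 < ENNReal.ofReal (1 / ((j : ℝ) + 1)) := ENNReal.ofReal_pos.2 (by positivity)
    have e1 := (hw1.mono Measure.restrict_le_self (ν := volume.restrict W)).tendsto.eventually_le_const hpos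
    have e2 := eventually_all.2 fun i =>
      ((hw2 i).mono Measure.restrict_le_self (ν := volume.restrict W)).tendsto.eventually_le_const hpos
    obtain ⟨k, hk1, hk2⟩ := (e1.and e2).exists
    exact ⟨w k, hw k, hk1, hk2⟩
  choose w hw hw1 hw2 using key
  refine ⟨w, hw, ?_, fun i => ?_⟩
  · have h1 : L2Lim (volume.restrict W) (fun j x => w j x - φ j x) fun _ => 0 :=
      L2Lim.of_le (fun j => (hw j).c1.memLp.sub (hφ j).memLp) MemLp.zero' (by simpa using hw1)
    refine (h.add h1).congr (fun j => Eventually.of_forall fun x => ?_)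
      (Eventually.of_forall fun x => ?_) <;> simp
  · have h1 : L2Lim (volume.restrict W) (fun j x => partialD i (w j) x - partialD i (φ j) x)
        fun _ => 0 :=
      L2Lim.of_le (fun j => ((hw j).c1.memLp_partialD i).sub ((hφ j).memLp_partialD i)) MemLp.zero'
        (by simpa using fun j => hw2 j i)
    refine ((h' i).add h1).congr (fun j => Eventually.of_forall fun x => ?_)
      (Eventually.of_forall fun x => ?_) <;> simp

lemma normH_sub_eq (hW : IsOpen W) {w v : Eu n → ℝ} {gv : Fin n → Eu n → ℝ}
    (hw : ContDiff ℝ 1 w) (hwm : MemLp w 2 (volume.restrict W))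
    (hwd : ∀ i, MemLp (partialD i w) 2 (volume.restrict W))
    (hv : MemLp v 2 (volume.restrict W)) (hgv : ∀ i, MemLp (gv i) 2 (volume.restrict W))
    (hD : ∀ i, WD W W i v (gv i)) :
    normH W 1 (fun x => w x - v x) =
      √(lpNorm (fun x => w x - v x) 2 (volume.restrict W) ^ 2 +
        ∑ i, lpNorm (fun x => partialD i w x - gv i x) 2 (volume.restrict W) ^ 2) := by
  rw [normH]
  congr 1
  refine normHSq_one_eq hW (hwm.sub hv) (fun i => (hwd i).sub (hgv i)) fun i => ?_
  have := (WD.of_c1 hw subset_rfl i).add hwm (hwd i)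
    (hv.const_mul (-1)) ((hgv i).const_mul (-1)) ((hD i).const_mul (-1))
  simpa [← sub_eq_add_neg] using this

lemma tendsto_normH_one (hW : IsOpen W) {w : ℕ → Eu n → ℝ} {v : Eu n → ℝ} {gv : Fin n → Eu n → ℝ}
    (hw : ∀ j, ContDiff ℝ 1 (w j)) (hD : ∀ i, WD W W i v (gv i))
    (h : L2Lim (volume.restrict W) w v)
    (h' : ∀ i, L2Lim (volume.restrict W) (fun j => partialD i (w j)) (gv i)) :
    Tendsto (fun j => normH W 1 fun x => w j x - v x) atTop (𝓝 0) := by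
  have e1 : ∀ j, normH W 1 (fun x => w j x - v x) =
      √(lpNorm (fun x => w j x - v x) 2 (volume.restrict W) ^ 2 +
        ∑ i, lpNorm (fun x => partialD i (w j) x - gv i x) 2 (volume.restrict W) ^ 2) := fun j => by
    exact normH_sub_eq hW (hw j) (h.memLp j) (fun i => (h' i).memLp j) h.memLp_lim
      (fun i => (h' i).memLp_lim) hD
  simp_rw [e1]
  have t1 := (h.tendsto_lpNorm_sub.pow 2).add
    (tendsto_finsetSum Finset.univ fun i _ => (h' i).tendsto_lpNorm_sub.pow 2)
  simpa using t1.sqrt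

lemma memLp_of_isBounded (hWb : Bornology.IsBounded W) {w : Eu n → ℝ} (hw : Continuous w) :
    MemLp w 2 (volume.restrict W) := by
  have : IsFiniteMeasure (volume.restrict W) := ⟨by simpa using hWb.measure_lt_top⟩
  obtain ⟨B, hB⟩ := hWb.isCompact_closure.exists_bound_of_continuousOn hw.continuousOn
  refine MemLp.of_bound hw.aestronglyMeasurable B ?_
  have h1 : ∀ᵐ x ∂volume.restrict (closure W), ‖w x‖ ≤ B :=
    (ae_restrict_mem isClosed_closure.measurableSet).mono hB
  exact ae_mono (Measure.restrict_mono subset_closure le_rfl) h1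

lemma lim_of_tendsto_normH (hW : IsOpen W) (hWb : Bornology.IsBounded W) {w : ℕ → Eu n → ℝ}
    {v : Eu n → ℝ} {gv : Fin n → Eu n → ℝ}
    (hw : ∀ j, ContDiff ℝ 1 (w j)) (hv : MemLp v 2 (volume.restrict W))
    (hgv : ∀ i, MemLp (gv i) 2 (volume.restrict W)) (hD : ∀ i, WD W W i v (gv i))
    (h : Tendsto (fun j => normH W 1 fun x => w j x - v x) atTop (𝓝 0)) :
    L2Lim (volume.restrict W) w v ∧
      ∀ i, L2Lim (volume.restrict W) (fun j => partialD i (w j)) (gv i) := by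
  have m1 : ∀ j, MemLp (w j) 2 (volume.restrict W) := fun j =>
    memLp_of_isBounded hWb (hw j).continuous
  have m2 : ∀ i j, MemLp (partialD i (w j)) 2 (volume.restrict W) := fun i j =>
    memLp_of_isBounded hWb (continuous_partialD (hw j) i)
  have e1 : ∀ j, normH W 1 (fun x => w j x - v x) = _ := fun j =>
    normH_sub_eq hW (hw j) (m1 j) (fun i => m2 i j) hv hgv hD
  simp_rw [e1] at h
  refine ⟨L2Lim.of_lpNorm m1 hv (squeeze_zero (fun _ => lpNorm_nonneg) (fun j => ?_) h),
    fun i => L2Lim.of_lpNorm (m2 i) (hgv i)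
      (squeeze_zero (fun _ => lpNorm_nonneg) (fun j => ?_) h)⟩
  · exact Real.le_sqrt_of_sq_le (le_add_of_nonneg_right (Finset.sum_nonneg fun _ _ => sq_nonneg _))
  · refine Real.le_sqrt_of_sq_le (le_add_of_nonneg_of_le (sq_nonneg _) ?_)
    exact Finset.single_le_sum (f := fun i =>
      lpNorm (fun x => partialD i (w j) x - gv i x) 2 (volume.restrict W) ^ 2)
      (fun _ _ => sq_nonneg _) (Finset.mem_univ i)

end WeakDeriv

/-! ### The domains `W_δ`, their straightened versions and allowable functions. -/

section Domains

variable {m : ℕ} {ψ : Eu m → ℝ} {δ : ℝ}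

/-- The half-infinite cylinder bounded by the sides and bottom of `W_δ`. -/
def cyl (m : ℕ) (δ : ℝ) : Set (Eu (m + 1)) := {z | ‖horiz z‖ < δ ∧ -δ < vert z}

lemma isOpen_cyl : IsOpen (cyl m δ) :=
  (isOpen_lt (contDiff_horiz (k := 0)).continuous.norm continuous_const).inter
    (isOpen_lt continuous_const continuous_vert)

lemma dom_eq : dom ψ δ = cyl m δ ∩ {z | vert z < ψ (horiz z)} := by
  ext z; simp [dom, cyl, and_assoc]

lemma isOpen_dom (hψ : Continuous ψ) : IsOpen (dom ψ δ) := by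
  rw [dom_eq]
  exact isOpen_cyl.inter (isOpen_lt continuous_vert (hψ.comp (contDiff_horiz (k := 0)).continuous))

lemma norm_sq_eq_horiz (z : Eu (m + 1)) : ‖z‖ ^ 2 = ‖horiz z‖ ^ 2 + vert z ^ 2 := by
  rw [EuclideanSpace.norm_sq_eq, EuclideanSpace.norm_sq_eq, Fin.sum_univ_castSucc]
  simp [horiz, vert]

lemma isBounded_dom (hψ : Continuous ψ) : Bornology.IsBounded (dom ψ δ) := by
  obtain ⟨B, hB⟩ := (isCompact_closedBall (0 : Eu m) δ).exists_bound_of_continuousOn hψ.continuousOn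
  refine (Metric.isBounded_closedBall (x := (0 : Eu (m + 1)))
    (r := √(δ ^ 2 + (|δ| + |B|) ^ 2))).subset fun z hz => ?_
  rw [mem_closedBall_zero_iff]
  refine Real.le_sqrt_of_sq_le ?_
  rw [norm_sq_eq_horiz]
  have h1 := hB (horiz z) (by rw [mem_closedBall_zero_iff]; exact hz.1.le)
  have h2 : |vert z| ≤ |δ| + |B| := by
    rw [abs_le]
    have := abs_le.1 (h1.trans (le_abs_self B))
    have h3 := hz.2.1
    have h4 := hz.2.2
    have h5 := le_abs_self δ
    have h6 := neg_abs_le δ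
    constructor <;> linarith [abs_nonneg B, abs_nonneg δ]
  exact add_le_add (pow_le_pow_left₀ (norm_nonneg _) hz.1.le 2)
    (sq_le_sq.2 (by rwa [abs_of_nonneg (show 0 ≤ |δ| + |B| by positivity)]))

/-- The straightened cylinder. -/
def flat (ψ : Eu m → ℝ) (δ : ℝ) : Set (Eu (m + 1)) := shear ψ ⁻¹' cyl m δ

lemma isOpen_flat (hψ : Continuous ψ) : IsOpen (flat ψ δ) := isOpen_cyl.preimage (continuous_shear hψ)

lemma shear_preimage_dom : shear ψ ⁻¹' dom ψ δ = flat ψ δ ∩ lowerHalf m := by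
  ext z
  rw [dom_eq, preimage_inter]
  refine and_congr_right fun _ => ?_
  simp [vert_shear, horiz_shear, lowerHalf]

/-- The set in which test functions have support. -/
def testSet (bc : BC) (ψ : Eu m → ℝ) (δ : ℝ) : Set (Eu (m + 1)) :=
  match bc with
  | BC.D => dom ψ δ
  | BC.N => cyl m δ

lemma shear_preimage_testSet (bc : BC) : shear ψ ⁻¹' testSet bc ψ δ = eqnSet bc (flat ψ δ) := by
  cases bc
  · exact shear_preimage_dom
  · rfl

lemma isOpen_testSet (hψ : Continuous ψ) (bc : BC) : IsOpen (testSet bc ψ δ) := by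
  cases bc
  · exact isOpen_dom hψ
  · exact isOpen_cyl

/-- Limits in `H¹` of functions with support in `testSet` are allowable. -/
lemma isAllowable_of_lim (hψ : Continuous ψ) (bc : BC) {φ : ℕ → Eu (m + 1) → ℝ}
    {v : Eu (m + 1) → ℝ} {gv : Fin (m + 1) → Eu (m + 1) → ℝ}
    (hφ : ∀ j, IsC1Test (testSet bc ψ δ) (φ j)) (hD : ∀ i, WD (dom ψ δ) (dom ψ δ) i v (gv i))
    (h : L2Lim (volume.restrict (dom ψ δ)) φ v)
    (h' : ∀ i, L2Lim (volume.restrict (dom ψ δ)) (fun j => partialD i (φ j)) (gv i)) :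
    IsAllowable bc ψ δ v := by
  obtain ⟨w, hw, hw1, hw2⟩ := exists_smooth_lim (isOpen_testSet hψ bc) hφ h h'
  have hH := memH_one h.memLp_lim (fun i => (h' i).memLp_lim) hD
  have ht := tendsto_normH_one (isOpen_dom hψ) (fun j => (hw j).c1.1) hD hw1 hw2
  cases bc
  · exact ⟨hH, w, hw, ht⟩
  · refine ⟨hH, w, fun j => (hw j).1, ht, ?_⟩
    -- The approximants are supported in the open cylinder and so vanish identically on the sides
    -- and the bottom; the surface integrals are exactly zero.
    have : ∀ j, ∫⁻ x in sidesBottom ψ δ, ‖w j x‖ₑ ^ 2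
        ∂(Measure.hausdorffMeasure (((m + 1 : ℕ) : ℝ) - 1)) = 0 := fun j => by
      have hs : sidesBottom ψ δ ⊆ (cyl m δ)ᶜ := fun x hx hc => by
        rcases hx with hx | hx
        · exact hc.1.ne hx.1
        · exact hc.2.ne' hx.2
      refine le_antisymm ((lintegral_mono_set hs).trans ?_) zero_le
      rw [setLIntegral_congr_fun isOpen_cyl.measurableSet.compl (g := fun _ => 0) fun x hx => by
        have : w j x = 0 := image_eq_zero_of_notMem_tsupport fun h => hx ((hw j).2.2 h)
        simp [this]]
      simp
    simp_rw [this]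
    exact tendsto_const_nhds

end Domains

/-! ### Vanishing trace and extension by zero. -/

section Trace

variable {m : ℕ} {ψ : Eu m → ℝ} {δ : ℝ}

/-- The point with horizontal part `y` and vertical coordinate `t`. -/
noncomputable def glue (y : Eu m) (t : ℝ) : Eu (m + 1) := (splitEquiv m).symm (y, t)

lemma horiz_glue (y : Eu m) (t : ℝ) : horiz (glue y t) = y := by
  have := congrArg Prod.fst ((splitEquiv m).apply_symm_apply (y, t))
  rwa [splitEquiv_apply] at this

lemma vert_glue (y : Eu m) (t : ℝ) : vert (glue y t) = t := by
  have := congrArg Prod.snd ((splitEquiv m).apply_symm_apply (y, t))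
  rwa [splitEquiv_apply] at this

lemma ext_horiz {z z' : Eu (m + 1)} (h : horiz z = horiz z') (h' : vert z = vert z') : z = z' :=
  (splitEquiv m).injective (by rw [splitEquiv_apply, splitEquiv_apply, h, h'])

lemma glue_eq (y : Eu m) (t : ℝ) :
    glue y t = glue y 0 + t • EuclideanSpace.single (Fin.last m) (1 : ℝ) :=
  ext_horiz (by rw [horiz_add_smul, horiz_glue, horiz_glue])
    (by rw [vert_add_smul, vert_glue, vert_glue, zero_add])

lemma glue_horiz_vert (z : Eu (m + 1)) : glue (horiz z) (vert z) = z :=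
  ext_horiz (horiz_glue _ _) (vert_glue _ _)

lemma shear_glue (y : Eu m) : shear ψ (glue y 0) = glue y (ψ y) := by
  rw [shear, horiz_glue, ← glue_eq]

lemma continuous_glue : Continuous fun q : Eu m × ℝ => glue q.1 q.2 := by
  have h1 : Isometry fun y : Eu m => glue y 0 := by
    refine Isometry.of_dist_eq fun y y' => ?_
    rw [dist_eq_norm, dist_eq_norm, ← sq_eq_sq₀ (norm_nonneg _) (norm_nonneg _), norm_sq_eq_horiz]
    have e1 : horiz (glue y 0 - glue y' 0) = y - y' := by
      rw [← horizL_apply, map_sub, horizL_apply, horizL_apply, horiz_glue, horiz_glue]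
    have e2 : vert (glue y 0 - glue y' 0) = 0 := by
      have h1 := vert_glue y 0
      have h2 := vert_glue y' 0
      simp only [vert, PiLp.sub_apply] at *
      rw [h1, h2, sub_zero]
    rw [e1, e2]
    ring
  simp_rw [fun q : Eu m × ℝ => glue_eq q.1 q.2]
  exact (h1.continuous.comp continuous_fst).add (continuous_snd.smul continuous_const)

/-- The divergence theorem in the lower half space. -/
lemma integral_lowerHalf_partialD_last {F : Eu (m + 1) → ℝ} (hF : ContDiff ℝ 1 F)
    (hc : HasCompactSupport F) :
    ∫ z in lowerHalf m, partialD (Fin.last m) F z = ∫ y, F (glue y 0) := by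
  have hd := continuous_partialD hF (Fin.last m)
  have hdc : HasCompactSupport (partialD (Fin.last m) F) :=
    hc.mono' (subset_tsupport _ |>.trans (tsupport_partialD_subset _ _))
  have hint : Integrable (partialD (Fin.last m) F) := hd.integrable_of_hasCompactSupport hdc
  have hmp := (measurePreserving_splitEquiv m).symm
  have h1 : ∫ z in lowerHalf m, partialD (Fin.last m) F z =
      ∫ q in univ ×ˢ Iio (0 : ℝ), partialD (Fin.last m) F (glue q.1 q.2) := by
    rw [← hmp.setIntegral_preimage_emb (MeasurableEquiv.measurableEmbedding _)]
    have : (splitEquiv m).symm ⁻¹' lowerHalf m = univ ×ˢ Iio (0 : ℝ) := by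
      ext q
      have := vert_glue q.1 q.2
      simp only [glue, Prod.mk.eta] at this
      simp [lowerHalf, this]
    rw [this]
    rfl
  have hint' : Integrable (fun q : Eu m × ℝ => partialD (Fin.last m) F (glue q.1 q.2)) :=
    hmp.integrable_comp_of_integrable hint
  rw [h1, Measure.volume_eq_prod, setIntegral_prod _ (by rw [← Measure.volume_eq_prod]; exact hint'.integrableOn),
    setIntegral_univ]
  congr 1 with y
  have hcl : IsClosedEmbedding fun t : ℝ => glue y t := by
    refine Isometry.isClosedEmbedding (Isometry.of_dist_eq fun t s => ?_)
    rw [glue_eq y t, glue_eq y s, dist_add_left, dist_eq_norm, ← sub_smul, norm_smul]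
    simp [Real.dist_eq]
  have hcont : ContDiff ℝ 1 fun t : ℝ => glue y t := by
    rw [funext (glue_eq y)]
    fun_prop
  have h2 := (hF.comp hcont).continuous
  have h3 : ∀ t, deriv (fun t => F (glue y t)) t = partialD (Fin.last m) F (glue y t) := fun t => by
    have h4 : HasDerivAt (fun t : ℝ => glue y t) (EuclideanSpace.single (Fin.last m) (1 : ℝ)) t := by
      rw [funext (glue_eq y)]
      simpa using ((hasDerivAt_id t).smul_const
        (EuclideanSpace.single (Fin.last m) (1 : ℝ))).const_add (glue y 0)
    exact ((hF.differentiable (by simp) _).hasFDerivAt.comp_hasDerivAt t h4).deriv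
  simp_rw [← h3]
  rw [← integral_Iic_eq_integral_Iio]
  exact HasCompactSupport.integral_Iic_deriv_eq (hF.comp hcont) (hc.comp_isClosedEmbedding hcl) 0

/-- The surface measure of the graph of `ψ` dominates Lebesgue measure of the projection. -/
lemma lintegral_ball_le_top (f : Eu m → ℝ≥0∞) (hf : Measurable f) :
    ∫⁻ y in Metric.ball 0 δ, f y ≤
      ∫⁻ x in top ψ δ, f (horiz x) ∂(Measure.hausdorffMeasure (((m + 1 : ℕ) : ℝ) - 1)) := by
  have hh : Measurable (horiz : Eu (m + 1) → Eu m) := (contDiff_horiz (k := 0)).continuous.measurable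
  have hd : (((m + 1 : ℕ) : ℝ) - 1) = (Fintype.card (Fin m) : ℝ) := by simp
  rw [← lintegral_map hf hh]
  refine lintegral_mono' (Measure.le_iff.2 fun s hs => ?_) le_rfl
  rw [Measure.map_apply hh hs, Measure.restrict_apply hs, Measure.restrict_apply (hh hs), hd]
  have hT : MeasurableSet (s ∩ Metric.ball 0 δ) := hs.inter measurableSet_ball
  have h1 : volume (s ∩ Metric.ball 0 δ) =
      volume ((WithLp.toLp 2 : (Fin m → ℝ) → Eu m) ⁻¹' (s ∩ Metric.ball 0 δ)) :=
    ((PiLp.volume_preserving_toLp (Fin m)).measure_preimage hT.nullMeasurableSet).symm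
  -- The horizontal projection maps the graph onto the ball. It is 1-Lipschitz into the sup norm,
  -- for which `m`-dimensional Hausdorff measure is Lebesgue measure, and Lipschitz maps do not
  -- increase Hausdorff measure; the area formula is not needed.
  have hL : LipschitzWith 1 fun z : Eu (m + 1) => (horiz z).ofLp := by
    refine LipschitzWith.of_dist_le_mul fun z z' => ?_
    rw [NNReal.coe_one, one_mul, dist_pi_le_iff dist_nonneg]
    intro i
    have := PiLp.norm_apply_le (z - z') i.castSucc
    rw [dist_eq_norm z z']
    exact this
  have h2 : (WithLp.toLp 2 : (Fin m → ℝ) → Eu m) ⁻¹' (s ∩ Metric.ball 0 δ) ⊆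
      (fun z : Eu (m + 1) => (horiz z).ofLp) '' (horiz ⁻¹' s ∩ top ψ δ) := by
    intro y hy
    refine ⟨glue (WithLp.toLp 2 y) (ψ (WithLp.toLp 2 y)), ⟨?_, ?_, ?_⟩, ?_⟩
    · rw [mem_preimage, horiz_glue]; exact hy.1
    · rw [horiz_glue]; simpa using hy.2
    · rw [horiz_glue, vert_glue]
    · simp only [horiz_glue]
  rw [h1, ← hausdorffMeasure_pi_real]
  refine (measure_mono h2).trans ?_
  simpa using hL.hausdorffMeasure_image_le (d := (Fintype.card (Fin m) : ℝ)) (by positivity)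
    (horiz ⁻¹' s ∩ top ψ δ)

lemma exists_slope_bound (hψ : ContDiff ℝ 1 ψ) (δ : ℝ) (i : Fin (m + 1)) :
    ∃ B, ∀ z, ‖horiz z‖ ≤ δ → |slope ψ i z| ≤ B := by
  have h1 : Continuous fun y => fderiv ℝ ψ y (horiz (EuclideanSpace.single i (1 : ℝ))) :=
    (hψ.continuous_fderiv (by simp)).clm_apply continuous_const
  obtain ⟨B, hB⟩ := (isCompact_closedBall (0 : Eu m) δ).exists_bound_of_continuousOn h1.continuousOn
  exact ⟨B, fun z hz => hB _ (by rwa [mem_closedBall_zero_iff])⟩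

/-- If the trace of `u` vanishes on the top, then the extension of `u` by zero has weak
derivatives. -/
lemma wd_flat_of_traceZero (hψ : ContDiff ℝ 2 ψ) {u : Eu (m + 1) → ℝ}
    {g : Fin (m + 1) → Eu (m + 1) → ℝ} (hu : TraceZeroOn (dom ψ δ) (top ψ δ) u)
    (hg : ∀ i, MemLp (g i) 2 (volume.restrict (dom ψ δ)))
    (hD : ∀ i, WD (dom ψ δ) (dom ψ δ) i u (g i)) (i : Fin (m + 1)) :
    WD (flat ψ δ ∩ lowerHalf m) (flat ψ δ) i (fun y => u (shear ψ y))
      (fun y => g i (shear ψ y) + slope ψ i y * g (Fin.last m) (shear ψ y)) := by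
  have hc := hψ.continuous
  have h1ψ : ContDiff ℝ 1 ψ := hψ.of_le (by norm_num)
  have hW := isOpen_dom hc (δ := δ)
  have huL : MemLp u 2 (volume.restrict (dom ψ δ)) := hu.1.1
  have hO : IsOpen (flat ψ δ) := isOpen_flat hc
  have key := (hD i).shear hψ hW huL (hg i) (hg _) (hD (Fin.last m))
  have hWm : MeasurableSet (flat ψ δ ∩ lowerHalf m) := (hO.inter isOpen_lowerHalf).measurableSet
  have huS := memLp_shear hc huL
  have hgS := fun i => memLp_shear hc (hg i)
  rw [shear_preimage_dom] at key huS
  simp_rw [shear_preimage_dom] at hgS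
  -- Only the normal direction uses the trace; tangential relations extend up to the boundary for
  -- any function. In the normal direction the smooth approximants are integrated by parts, and
  -- their boundary terms tend to zero.
  by_cases hi : i = Fin.last m
  swap
  · obtain ⟨B, hB⟩ := exists_slope_bound h1ψ δ i
    refine WD.tangential hi hO huS ((hgS i).add (memLp_bdd_mul (hgS _)
      (contDiff_slope hψ i).continuous.aestronglyMeasurable
      ((ae_restrict_mem hWm).mono fun y hy => hB y ?_))) key
    have := hy.1.1
    rw [horiz_shear] at this
    exact this.le
  subst hi
  obtain ⟨w, hw, hwl, hwt⟩ := hu.2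
  have hw1 : ∀ j, ContDiff ℝ 1 (w j) := fun j => (hw j).of_le (by simp)
  obtain ⟨l1, l2⟩ := lim_of_tendsto_normH hW (isBounded_dom hc) hw1 huL hg hD hwl
  have l3 := l2 (Fin.last m)
  intro φ hφ
  have hφ1 := hφ.c1
  simp only [slope_last, zero_mul, add_zero]
  have L : ∀ {f : ℕ → Eu (m + 1) → ℝ} {v}, L2Lim (volume.restrict (dom ψ δ)) f v →
      L2Lim (volume.restrict (flat ψ δ ∩ lowerHalf m)) (fun j y => f j (shear ψ y))
        (fun y => v (shear ψ y)) := fun {f v} h => by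
    rw [← shear_preimage_dom]
    refine ⟨fun j => memLp_shear hc (h.memLp j), memLp_shear hc h.memLp_lim, ?_⟩
    refine h.tendsto.congr fun j => ?_
    exact (eLpNorm_comp_measurePreserving ((h.memLp j).sub h.memLp_lim).1
      (measurePreserving_shear_restrict hc _)).symm
  have t1 := (L l1).integral_mul (F := partialD (Fin.last m) φ) (hφ1.memLp_partialD _)
  have t2 := (L l3).integral_mul (F := φ) hφ1.memLp
  -- the boundary term
  have hbd : ∀ j, (∫ y in flat ψ δ ∩ lowerHalf m, partialD (Fin.last m) φ y * w j (shear ψ y)) +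
      ∫ y in flat ψ δ ∩ lowerHalf m, φ y * partialD (Fin.last m) (w j) (shear ψ y) =
      ∫ y in Metric.ball 0 δ, w j (glue y (ψ y)) * φ (glue y 0) := fun j => by
    have hF : ContDiff ℝ 1 fun y => w j (shear ψ y) * φ y :=
      ((hw1 j).comp (contDiff_shear h1ψ)).mul hφ1.1
    have h1 := integral_lowerHalf_partialD_last hF hφ.2.1.mul_left
    have h2 : ∀ y, partialD (Fin.last m) (fun y => w j (shear ψ y) * φ y) y =
        partialD (Fin.last m) φ y * w j (shear ψ y) +
          φ y * partialD (Fin.last m) (w j) (shear ψ y) := fun y => by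
      rw [partialD_mul (f := fun y => w j (shear ψ y)) (((hw1 j).comp (contDiff_shear h1ψ)).differentiable (by simp) y)
        (hφ1.1.differentiable (by simp) y), partialD_shear (h1ψ.differentiable (by simp) _)
        ((hw1 j).differentiable (by simp) _), slope_last]
      ring
    simp_rw [h2, shear_glue] at h1
    rw [← integral_add (integrable_mul_of_memLp (hφ1.memLp_partialD _) ((L l1).memLp j))
      (integrable_mul_of_memLp hφ1.memLp ((L l3).memLp j))]
    have h3 : ∀ y ∉ Metric.ball (0 : Eu m) δ, w j (glue y (ψ y)) * φ (glue y 0) = 0 := fun y hy => by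
      have : φ (glue y 0) = 0 := image_eq_zero_of_notMem_tsupport fun h => hy (by
        have := (hφ.2.2 h).1
        rw [horiz_shear, horiz_glue] at this
        simpa using this)
      rw [this, mul_zero]
    rw [setIntegral_eq_integral_of_forall_compl_eq_zero h3, ← h1]
    refine (setIntegral_eq_of_subset_of_forall_sdiff_eq_zero isOpen_lowerHalf.measurableSet
      inter_subset_right fun x hx => ?_).symm
    have hx' : x ∉ tsupport φ := fun h => hx.2 ⟨hφ.2.2 h, hx.1⟩
    rw [image_eq_zero_of_notMem_tsupport hx', partialD_eq_zero hx']
    ring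
  have hcg : ∀ χ : Eu m → ℝ, Continuous χ → Continuous fun y : Eu m => glue y (χ y) := fun χ hχ =>
    continuous_glue.comp (continuous_id.prodMk hχ)
  have hb : Bornology.IsBounded (Metric.ball (0 : Eu m) δ) := Metric.isBounded_ball
  have m1 : ∀ j, MemLp (fun y => w j (glue y (ψ y))) 2 (volume.restrict (Metric.ball 0 δ)) := fun j =>
    memLp_of_isBounded hb ((hw1 j).continuous.comp (hcg ψ hc))
  have m2 : MemLp (fun y => φ (glue y 0)) 2 (volume.restrict (Metric.ball 0 δ)) :=
    memLp_of_isBounded hb (hφ1.1.continuous.comp (hcg _ continuous_const))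
  -- The hypothesis concerns surface measure on the graph, which dominates Lebesgue measure of the
  -- projection, so the approximants restricted to the graph tend to zero as functions of `y`.
  have hz : Tendsto (fun j => lpNorm (fun y => w j (glue y (ψ y))) 2
      (volume.restrict (Metric.ball 0 δ))) atTop (𝓝 0) := by
    have hsq : Tendsto (fun j => eLpNorm (fun y => w j (glue y (ψ y))) 2
        (volume.restrict (Metric.ball 0 δ)) ^ 2) atTop (𝓝 0) := by
      refine tendsto_of_tendsto_of_tendsto_of_le_of_le tendsto_const_nhds hwt (fun _ => zero_le)
        fun j => ?_
      simp only
      rw [sq_eLpNorm_two]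
      refine (lintegral_ball_le_top (ψ := ψ) _ ?_).trans (le_of_eq ?_)
      · exact ((hw1 j).continuous.comp (hcg ψ hc)).measurable.enorm.pow_const 2
      · refine setLIntegral_congr_fun ?_ fun x hx => ?_
        · have hh := (contDiff_horiz (k := 0) (m := m)).continuous
          exact (isOpen_lt hh.norm continuous_const).measurableSet.inter
            (isClosed_eq continuous_vert (hc.comp hh)).measurableSet
        · rw [← hx.2, glue_horiz_vert]
    have h1 : Tendsto (fun j => eLpNorm (fun y => w j (glue y (ψ y))) 2
        (volume.restrict (Metric.ball 0 δ))) atTop (𝓝 0) := by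
      have := hsq.ennrpow_const (1 / 2 : ℝ)
      rw [ENNReal.zero_rpow_of_pos (by norm_num)] at this
      refine this.congr fun j => ?_
      rw [← ENNReal.rpow_natCast, ← ENNReal.rpow_mul]
      norm_num
    have h2 := (ENNReal.tendsto_toReal ENNReal.zero_ne_top).comp h1
    refine h2.congr fun j => ?_
    exact toReal_eLpNorm (m1 j).1
  have t3 : Tendsto (fun j => ∫ y in Metric.ball 0 δ, w j (glue y (ψ y)) * φ (glue y 0)) atTop
      (𝓝 0) := by
    have := hz.mul_const (lpNorm (fun y => φ (glue y 0)) 2 (volume.restrict (Metric.ball 0 δ)))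
    rw [zero_mul] at this
    exact squeeze_zero_norm (fun j => abs_integral_mul_le (m1 j) m2) this
  have t4 := (t1.add t2).congr hbd
  have h5 := tendsto_nhds_unique t4 t3
  simp_rw [mul_comm _ (φ _), mul_comm _ (partialD _ φ _)]
  linarith

end Trace

/-! ### From bounds on iterated derivatives to scaled bounds. -/

section Bounds

/-- Each scaled derivative costs a factor `ε ≤ E`; since `E ≥ 1`, the single constant `E ^ k * B`
also covers the lower orders. -/
lemma CB.of_iteratedFDeriv {n : ℕ} {W : Set (Eu n)} (hW : IsOpen W) {ε E : ℝ} (hε : 0 ≤ ε)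
    (hE : ε ≤ E) (hE1 : 1 ≤ E) (k : ℕ) {c : Eu n → ℝ} {B : ℝ} (hc : ContDiffOn ℝ k c W)
    (hB : ∀ j ≤ k, ∀ x ∈ W, ‖iteratedFDeriv ℝ j c x‖ ≤ B) : CB W ε k c (E ^ k * B) := by
  induction k generalizing c B with
  | zero =>
    refine ⟨hc.continuousOn, fun x hx => ?_⟩
    simpa using hB 0 le_rfl x hx
  | succ k ih =>
    have hb : ∀ x ∈ W, |c x| ≤ B := fun x hx => by simpa using hB 0 (Nat.zero_le _) x hx
    refine ⟨⟨hc.of_le (by exact_mod_cast Nat.succ_le_succ (Nat.zero_le k)), fun x hx =>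
      (hb x hx).trans (le_mul_of_one_le_left ((abs_nonneg _).trans (hb x hx))
        (one_le_pow₀ hE1))⟩, fun i => ?_⟩
    rw [pow_succ, mul_assoc]
    set L : (Eu n →L[ℝ] ℝ) →L[ℝ] ℝ :=
      ε • ContinuousLinearMap.apply ℝ ℝ (EuclideanSpace.single i (1 : ℝ)) with hL
    have hLn : ‖L‖ ≤ ε := by
      refine L.opNorm_le_bound hε fun f => ?_
      have := f.le_opNorm (EuclideanSpace.single i (1 : ℝ))
      simp only [PiLp.norm_single, norm_one, mul_one] at this
      simp only [hL, _root_.smul_apply, ContinuousLinearMap.apply_apply, smul_eq_mul,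
        norm_mul, Real.norm_of_nonneg hε]
      exact mul_le_mul_of_nonneg_left this hε
    have hcomp : (fun x => ε * partialD i c x) = L ∘ fderiv ℝ c := by
      ext x; simp [hL, partialD]
    have hd : ∀ x ∈ W, ContDiffAt ℝ (k : WithTop ℕ∞) (fderiv ℝ c) x := fun x hx =>
      (hc.contDiffAt (hW.mem_nhds hx)).fderiv_right (by norm_cast)
    rw [hcomp]
    refine ih (fun x hx => (L.contDiff.contDiffAt.comp x (hd x hx)).contDiffWithinAt)
      fun j hj x hx => ?_
    refine (L.norm_iteratedFDeriv_comp_left (hd x hx) (by exact_mod_cast hj)).trans ?_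
    rw [norm_iteratedFDeriv_fderiv]
    exact mul_le_mul (hLn.trans hE) (hB (j + 1) (by omega) x hx) (norm_nonneg _) (by linarith)

variable {m : ℕ} {ψ : Eu m → ℝ} {δ : ℝ}

lemma norm_horiz_le (z : Eu (m + 1)) : ‖horiz z‖ ≤ ‖z‖ := by
  refine le_of_sq_le_sq ?_ (norm_nonneg z)
  rw [norm_sq_eq_horiz z]
  exact le_add_of_nonneg_right (sq_nonneg _)

lemma norm_horizL_le : ‖horizL m‖ ≤ 1 :=
  (horizL m).opNorm_le_bound zero_le_one fun z => by
    rw [one_mul, horizL_apply]; exact norm_horiz_le z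

lemma norm_iteratedFDeriv_slope_le {k : ℕ} (hψ : ContDiff ℝ (k + 1 : ℕ) ψ) {j : ℕ} (hj : j ≤ k)
    (i : Fin (m + 1)) (z : Eu (m + 1)) :
    ‖iteratedFDeriv ℝ j (slope ψ i) z‖ ≤ ‖iteratedFDeriv ℝ (j + 1) ψ (horiz z)‖ := by
  set L : (Eu m →L[ℝ] ℝ) →L[ℝ] ℝ :=
    ContinuousLinearMap.apply ℝ ℝ (horiz (EuclideanSpace.single i (1 : ℝ))) with hL
  have hLn : ‖L‖ ≤ 1 := by
    refine L.opNorm_le_bound zero_le_one fun f => ?_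
    have h1 := f.le_opNorm (horiz (EuclideanSpace.single i (1 : ℝ)))
    have h2 := norm_horiz_le (EuclideanSpace.single i (1 : ℝ))
    simp only [PiLp.norm_single, norm_one] at h2
    rw [one_mul]
    exact h1.trans (mul_le_of_le_one_right (norm_nonneg _) h2)
  have hd : ContDiff ℝ (k : WithTop ℕ∞) (fderiv ℝ ψ) := hψ.fderiv_right (by norm_cast)
  have hcomp : slope ψ i = (L ∘ fderiv ℝ ψ) ∘ horizL m := by
    ext x; simp [hL, slope, horizL_apply]
  rw [hcomp, (horizL m).iteratedFDeriv_comp_right (L.contDiff.comp hd) z (by exact_mod_cast hj)]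
  refine (ContinuousMultilinearMap.norm_compContinuousLinearMap_le _ _).trans ?_
  refine (mul_le_of_le_one_right (norm_nonneg _)
    (Finset.prod_le_one (fun _ _ => norm_nonneg _) fun _ _ => norm_horizL_le)).trans ?_
  refine (L.norm_iteratedFDeriv_comp_left hd.contDiffAt (by exact_mod_cast hj)).trans ?_
  rw [norm_iteratedFDeriv_fderiv, horizL_apply]
  exact mul_le_of_le_one_left (norm_nonneg _) hLn

lemma cb_slope {k : ℕ} (hψ : ContDiff ℝ (k + 1 : ℕ) ψ) {B : ℝ}
    (hB : ∀ j ≤ k + 1, ∀ y ∈ Metric.ball (0 : Eu m) δ, ‖iteratedFDeriv ℝ j ψ y‖ ≤ B)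
    {W : Set (Eu (m + 1))} (hW : IsOpen W) (hWδ : ∀ z ∈ W, ‖horiz z‖ < δ)
    {ε E : ℝ} (hε : 0 ≤ ε) (hE : ε ≤ E) (hE1 : 1 ≤ E) (i : Fin (m + 1)) :
    CB W ε k (slope ψ i) (E ^ k * B) := by
  refine CB.of_iteratedFDeriv hW hε hE hE1 k ?_ fun j hj z hz =>
    (norm_iteratedFDeriv_slope_le hψ hj i z).trans
      (hB (j + 1) (by omega) _ (mem_ball_zero_iff.2 (hWδ z hz)))
  have hd : ContDiff ℝ (k : WithTop ℕ∞) (fderiv ℝ ψ) := hψ.fderiv_right (by norm_cast)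
  exact ((hd.comp contDiff_horiz).clm_apply contDiff_const).contDiffOn

end Bounds

/-! ### Cutoff functions between straightened domains. -/

section Cutoff

variable {m : ℕ} {ψ : Eu m → ℝ}

/-- A smooth cutoff on the line, equal to `1` on `(-∞, a]` and `0` on `[b, ∞)`. -/
noncomputable def ramp (a b s : ℝ) : ℝ := Real.smoothTransition ((b - s) / (b - a))

lemma exists_smoothTransition_bound : ∃ K, 0 < K ∧ ∀ t, |deriv Real.smoothTransition t| ≤ K := by
  have hc : Continuous (deriv Real.smoothTransition) :=
    (Real.smoothTransition.contDiff (n := 1)).continuous_deriv le_rfl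
  obtain ⟨K, hK⟩ := (isCompact_Icc (a := (0 : ℝ)) (b := 1)).exists_bound_of_continuousOn
    hc.continuousOn
  refine ⟨|K| + 1, by positivity, fun t => ?_⟩
  by_cases ht : t ∈ Icc (0 : ℝ) 1
  · exact (hK t ht).trans (by linarith [le_abs_self K])
  · have : deriv Real.smoothTransition t = 0 := by
      rw [mem_Icc, not_and_or, not_le, not_le] at ht
      rcases ht with ht | ht
      · have : Real.smoothTransition =ᶠ[𝓝 t] fun _ => 0 := by
          filter_upwards [Iio_mem_nhds ht] with s hs
          exact Real.smoothTransition.zero_of_nonpos (le_of_lt hs)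
        rw [this.deriv_eq, deriv_const]
      · have : Real.smoothTransition =ᶠ[𝓝 t] fun _ => 1 := by
          filter_upwards [Ioi_mem_nhds ht] with s hs
          exact Real.smoothTransition.one_of_one_le (le_of_lt hs)
        rw [this.deriv_eq, deriv_const]
    rw [this, abs_zero]; positivity

lemma ramp_of_le {a b s : ℝ} (hab : a < b) (hs : s ≤ a) : ramp a b s = 1 :=
  Real.smoothTransition.one_of_one_le ((one_le_div (by linarith)).2 (by linarith))

lemma ramp_of_ge {a b s : ℝ} (hab : a < b) (hs : b ≤ s) : ramp a b s = 0 :=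
  Real.smoothTransition.zero_of_nonpos (div_nonpos_of_nonpos_of_nonneg (by linarith) (by linarith))

lemma ramp_nonneg (a b s : ℝ) : 0 ≤ ramp a b s := Real.smoothTransition.nonneg _

lemma ramp_le_one (a b s : ℝ) : ramp a b s ≤ 1 := Real.smoothTransition.le_one _

lemma contDiff_ramp (a b : ℝ) : ContDiff ℝ 1 (ramp a b) :=
  Real.smoothTransition.contDiff.comp ((contDiff_const.sub contDiff_id).div_const _)

lemma abs_deriv_ramp_le {a b K : ℝ} (hab : a < b)
    (hK : ∀ t, |deriv Real.smoothTransition t| ≤ K) (s : ℝ) : |deriv (ramp a b) s| ≤ K / (b - a) := by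
  have h1 : HasDerivAt (fun s => (b - s) / (b - a)) (-1 / (b - a)) s :=
    ((hasDerivAt_id s).const_sub b).div_const _
  have h2 := ((Real.smoothTransition.contDiff (n := 1)).differentiable one_ne_zero
    ((b - s) / (b - a))).hasDerivAt.comp s h1
  rw [show ramp a b = Real.smoothTransition ∘ fun s => (b - s) / (b - a) from rfl, h2.deriv, abs_mul,
    abs_div, abs_neg, abs_one, abs_of_pos (sub_pos.2 hab), mul_one_div]
  exact div_le_div_of_nonneg_right (hK _) (by linarith)

/-- The part of the straightened cylinder below height `R`. -/
def bowl (ψ : Eu m → ℝ) (R : ℝ) : Set (Eu (m + 1)) := flat ψ R ∩ {z | vert z < R}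

lemma isOpen_bowl (hψ : Continuous ψ) (R : ℝ) : IsOpen (bowl ψ R) :=
  (isOpen_flat hψ).inter (isOpen_lt continuous_vert continuous_const)

lemma mem_bowl {R : ℝ} {z : Eu (m + 1)} :
    z ∈ bowl ψ R ↔ ‖horiz z‖ < R ∧ -R < vert z + ψ (horiz z) ∧ vert z < R := by
  simp [bowl, flat, cyl, horiz_shear, vert_shear, and_assoc]

/-- The straightened cylinder is unbounded above, so cutoffs equal to `1` on a smaller cylinder
cannot have compact support. Truncation at height `R` repairs this and leaves the part below the
boundary unchanged. -/
lemma bowl_inter {R : ℝ} (hR : 0 ≤ R) : bowl ψ R ∩ lowerHalf m = flat ψ R ∩ lowerHalf m := by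
  ext z
  simp only [bowl, mem_inter_iff, and_assoc, mem_ofPred_eq, lowerHalf]
  exact and_congr_right fun _ => ⟨fun h => h.2, fun h => ⟨h.trans_le hR, h⟩⟩

lemma bowl_eq_empty {R : ℝ} (hR : R ≤ 0) : bowl ψ R = ∅ := by
  ext z
  simp only [mem_bowl, mem_empty_iff_false, iff_false, not_and]
  exact fun h => absurd h (not_lt.2 (hR.trans (norm_nonneg _)))

lemma gap_empty (O : Set (Eu (m + 1))) {K : ℝ} (hK : 0 ≤ K) : Gap ∅ O K :=
  ⟨fun _ => 0, ⟨contDiff_const, HasCompactSupport.zero, by simp⟩, by simp, by simp,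
    fun i x => by simpa [partialD] using hK⟩

lemma partialD_vert (i : Fin (m + 1)) (z : Eu (m + 1)) :
    partialD i (vert : Eu (m + 1) → ℝ) z = if i = Fin.last m then 1 else 0 := by
  rw [partialD, (hasFDerivAt_vert z).fderiv]
  by_cases h : i = Fin.last m
  · simp [h]
  · simp [h, Ne.symm h]

lemma partialD_comp_horiz (hψ : ContDiff ℝ 1 ψ) (i : Fin (m + 1)) (z : Eu (m + 1)) :
    partialD i (fun z => ψ (horiz z)) z = slope ψ i z := by
  have h1 := ((hψ.differentiable one_ne_zero) (horizL m z)).hasFDerivAt.comp z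
    (horizL m).hasFDerivAt
  rw [partialD, slope]
  have : (fun z => ψ (horiz z)) = ψ ∘ horizL m := by ext; simp [horizL_apply]
  rw [this, h1.fderiv]
  simp [horizL_apply]

lemma abs_slope_normSq_le (i : Fin (m + 1)) (z : Eu (m + 1)) :
    |slope (fun y : Eu m => ‖y‖ ^ 2) i z| ≤ 2 * ‖horiz z‖ := by
  rw [slope, ← Real.norm_eq_abs]
  have h2 := norm_horiz_le (EuclideanSpace.single i (1 : ℝ))
  simp only [PiLp.norm_single, norm_one] at h2
  rw [fderiv_norm_sq_apply]
  simp only [_root_.smul_apply, innerSL_apply_apply, nsmul_eq_mul, norm_mul]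
  have := norm_inner_le_norm (𝕜 := ℝ) (horiz z) (horiz (EuclideanSpace.single i (1 : ℝ)))
  have h3 := this.trans (mul_le_of_le_one_right (norm_nonneg _) h2)
  simpa using h3

/-- A product of three ramps: one in the squared horizontal norm, which is smooth on the axis too,
one in the height above the bottom, and one in the height relative to the flat boundary. Their
gradients are of size `1 / (r - r')`. -/
lemma exists_gap_bowl (m : ℕ) {B : ℝ} (hB : 0 ≤ B) : ∃ K, 0 < K ∧ ∀ (ψ : Eu m → ℝ) (r' r : ℝ),
    ContDiff ℝ 1 ψ → r' < r → (∀ i z, ‖horiz z‖ < r → |slope ψ i z| ≤ B) →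
      Gap (bowl ψ r') (bowl ψ r) (K / (r - r')) := by
  obtain ⟨K₀, hK₀, hK⟩ := exists_smoothTransition_bound
  refine ⟨(K₀ * 4 + K₀ * 2 * (1 + B) + K₀ * 2), by positivity, fun ψ r' r hψ hr hs => ?_⟩
  rcases le_or_gt r' 0 with hr0 | hr0
  · rw [bowl_eq_empty hr0]
    exact gap_empty _ (div_nonneg (by positivity) (by linarith))
  -- The ramps reach zero already at the midpoint, so the closed support stays inside the larger
  -- set.
  set r₁ : ℝ := (r' + r) / 2 with hr₁
  have h1 : r' < r₁ := by linarith
  have h2 : r₁ < r := by linarith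
  have hsq : r' ^ 2 < r₁ ^ 2 := pow_lt_pow_left₀ h1 hr0.le two_ne_zero
  set χ₁ : Eu (m + 1) → ℝ := fun z => ramp (r' ^ 2) (r₁ ^ 2) (‖horiz z‖ ^ 2) with hχ₁
  set χ₂ : Eu (m + 1) → ℝ := fun z => ramp r' r₁ (-(vert z + ψ (horiz z))) with hχ₂
  set χ₃ : Eu (m + 1) → ℝ := fun z => ramp r' r₁ (vert z) with hχ₃
  have hhoriz := contDiff_horiz (k := 1) (m := m)
  have hnsq : ContDiff ℝ 1 fun y : Eu m => ‖y‖ ^ 2 := contDiff_norm_sq ℝ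
  have hmid : ContDiff ℝ 1 fun z : Eu (m + 1) => -(vert z + ψ (horiz z)) :=
    (contDiff_vert.add (hψ.comp hhoriz)).neg
  have hrp : ∀ a b, ContDiff ℝ 1 (ramp a b) := contDiff_ramp
  have c1 : ContDiff ℝ 1 χ₁ := (hrp _ _).comp (hnsq.comp hhoriz)
  have c2 : ContDiff ℝ 1 χ₂ := (hrp _ _).comp hmid
  have c3 : ContDiff ℝ 1 χ₃ := (hrp _ _).comp contDiff_vert
  have hz1 : ∀ z, r₁ ≤ ‖horiz z‖ → χ₁ z = 0 := fun z hz =>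
    ramp_of_ge hsq (pow_le_pow_left₀ (by linarith) hz 2)
  have d1 : ∀ i z, |partialD i χ₁ z| ≤ K₀ * 4 / (r - r') := fun i z => by
    rw [hχ₁, partialD_comp (f := fun z => ‖horiz z‖ ^ 2) ((hrp _ _).differentiable one_ne_zero _)
      ((hnsq.comp hhoriz).differentiable one_ne_zero _), abs_mul,
      partialD_comp_horiz (ψ := fun y => ‖y‖ ^ 2) hnsq]
    rcases le_or_gt (‖horiz z‖) r₁ with hz | hz
    · refine (mul_le_mul (abs_deriv_ramp_le hsq hK _)
        ((abs_slope_normSq_le i z).trans (mul_le_mul_of_nonneg_left hz zero_le_two))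
        (abs_nonneg _) (div_nonneg hK₀.le (by linarith))).trans ?_
      -- The ramp in the squared norm has slope of order `1 / (r₁² - r'²)`, and the squared norm has
      -- gradient at most `2 r₁`. The factor `r₁ + r'` cancels this `r₁`, leaving `4 / (r - r')`
      -- whatever the radius.
      rw [show r₁ ^ 2 - r' ^ 2 = (r - r') / 2 * (r₁ + r') by rw [hr₁]; ring, div_mul_eq_mul_div,
        div_le_div_iff₀ (mul_pos (by linarith) (by linarith)) (by linarith)]
      have : 0 < r - r' := by linarith
      have h5 : 0 ≤ K₀ * (r - r') * r' := by positivity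
      nlinarith
    · have : deriv (ramp (r' ^ 2) (r₁ ^ 2)) (‖horiz z‖ ^ 2) = 0 := by
        have : ramp (r' ^ 2) (r₁ ^ 2) =ᶠ[𝓝 (‖horiz z‖ ^ 2)] fun _ => 0 := by
          filter_upwards [Ioi_mem_nhds (pow_lt_pow_left₀ hz (by linarith) two_ne_zero)] with s hs
          exact ramp_of_ge hsq (le_of_lt hs)
        rw [this.deriv_eq, deriv_const]
      rw [this, abs_zero, zero_mul]
      exact div_nonneg (by positivity) (by linarith)
  have hrr : r₁ - r' = (r - r') / 2 := by rw [hr₁]; ring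
  have hramp : ∀ s, |deriv (ramp r' r₁) s| ≤ K₀ * 2 / (r - r') := fun s => by
    refine (abs_deriv_ramp_le h1 hK s).trans (le_of_eq ?_)
    rw [hrr, div_div_eq_mul_div]
  have d3 : ∀ i z, |partialD i χ₃ z| ≤ K₀ * 2 / (r - r') := fun i z => by
    rw [hχ₃, partialD_comp (f := vert) ((hrp _ _).differentiable one_ne_zero _)
      ((contDiff_vert (k := 1)).differentiable one_ne_zero _), abs_mul, partialD_vert]
    refine (mul_le_of_le_one_right (abs_nonneg _) ?_).trans (hramp _)
    split_ifs <;> simp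
  have d2 : ∀ i z, ‖horiz z‖ < r → |partialD i χ₂ z| ≤ K₀ * 2 * (1 + B) / (r - r') := fun i z hz => by
    rw [hχ₂, partialD_comp (f := fun z => -(vert z + ψ (horiz z)))
      ((hrp _ _).differentiable one_ne_zero _) (hmid.differentiable one_ne_zero _), abs_mul]
    have : partialD i (fun z => -(vert z + ψ (horiz z))) z =
        -(partialD i vert z + partialD i (fun z => ψ (horiz z)) z) := by
      simp only [partialD]
      rw [fderiv_fun_neg, fderiv_fun_add ((contDiff_vert (k := 1)).differentiable one_ne_zero _)
        (g := fun z => ψ (horiz z)) ((hψ.comp hhoriz).differentiable one_ne_zero _)]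
      simp
    rw [this, abs_neg, partialD_vert, partialD_comp_horiz hψ, mul_div_right_comm]
    refine mul_le_mul (hramp _) ((abs_add_le _ _).trans (add_le_add ?_ (hs i z hz)))
      (abs_nonneg _) (div_nonneg (by positivity) (by linarith))
    split_ifs <;> simp
  have hts : tsupport (fun z => χ₁ z * (χ₂ z * χ₃ z)) ⊆
      {z | ‖horiz z‖ ≤ r₁ ∧ -r₁ ≤ vert z + ψ (horiz z) ∧ vert z ≤ r₁} := by
    refine closure_minimal (fun z hz => ?_) ?_
    · rw [Function.mem_support] at hz
      have e1 := left_ne_zero_of_mul hz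
      have e2 := left_ne_zero_of_mul (right_ne_zero_of_mul hz)
      have e3 := right_ne_zero_of_mul (right_ne_zero_of_mul hz)
      refine ⟨?_, ?_, ?_⟩
      · by_contra! hc
        exact e1 (hz1 z hc.le)
      · by_contra! hc
        exact e2 (ramp_of_ge h1 (by linarith))
      · by_contra! hc
        exact e3 (ramp_of_ge h1 hc.le)
    · exact (isClosed_le hhoriz.continuous.norm continuous_const).inter
        ((isClosed_le continuous_const
          (continuous_vert.add (hψ.continuous.comp hhoriz.continuous))).inter
          (isClosed_le continuous_vert continuous_const))
  refine ⟨fun z => χ₁ z * (χ₂ z * χ₃ z), ⟨c1.mul (c2.mul c3), ?_, fun z hz => ?_⟩, fun z hz => ?_,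
    fun z => ⟨?_, ?_⟩, fun i z => ?_⟩
  · obtain ⟨b, hb⟩ := (isCompact_closedBall (0 : Eu m) r₁).exists_bound_of_continuousOn
      hψ.continuous.continuousOn
    refine HasCompactSupport.of_support_subset_isCompact
      (isCompact_closedBall (0 : Eu (m + 1)) √(r₁ ^ 2 + (r₁ + |b|) ^ 2)) fun z hz => ?_
    obtain ⟨a1, a2, a3⟩ := hts (subset_tsupport _ hz)
    rw [mem_closedBall_zero_iff]
    refine Real.le_sqrt_of_sq_le ?_
    rw [norm_sq_eq_horiz]
    have h5 := abs_le.1 ((hb (horiz z) (mem_closedBall_zero_iff.2 a1)).trans (le_abs_self b))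
    refine add_le_add (pow_le_pow_left₀ (norm_nonneg _) a1 2) (sq_le_sq.2 ?_)
    rw [abs_of_nonneg (show 0 ≤ r₁ + |b| by linarith [abs_nonneg b]), abs_le]
    constructor <;> linarith [abs_nonneg b]
  · obtain ⟨a1, a2, a3⟩ := hts hz
    exact mem_bowl.2 ⟨by linarith, by linarith, by linarith⟩
  · obtain ⟨a1, a2, a3⟩ := mem_bowl.1 hz
    simp only [hχ₁, hχ₂, hχ₃]
    rw [ramp_of_le hsq (pow_le_pow_left₀ (norm_nonneg _) a1.le 2), ramp_of_le h1 (by linarith),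
      ramp_of_le h1 a3.le]
    norm_num
  · exact mul_nonneg (ramp_nonneg _ _ _) (mul_nonneg (ramp_nonneg _ _ _) (ramp_nonneg _ _ _))
  · exact mul_le_one₀ (ramp_le_one _ _ _) (mul_nonneg (ramp_nonneg _ _ _) (ramp_nonneg _ _ _))
      (mul_le_one₀ (ramp_le_one _ _ _) (ramp_nonneg _ _ _) (ramp_le_one _ _ _))
  · have hd := fun {f : Eu (m + 1) → ℝ} (h : ContDiff ℝ 1 f) => h.differentiable one_ne_zero z
    rw [partialD_mul (hd c1) (hd (c2.mul c3)), partialD_mul (hd c2) (hd c3)]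
    have b1 : |χ₁ z| ≤ 1 := by rw [abs_of_nonneg (ramp_nonneg _ _ _)]; exact ramp_le_one _ _ _
    have b2 : |χ₂ z| ≤ 1 := by rw [abs_of_nonneg (ramp_nonneg _ _ _)]; exact ramp_le_one _ _ _
    have b3 : |χ₃ z| ≤ 1 := by rw [abs_of_nonneg (ramp_nonneg _ _ _)]; exact ramp_le_one _ _ _
    have e1 : |partialD i χ₁ z * (χ₂ z * χ₃ z)| ≤ K₀ * 4 / (r - r') := by
      rw [abs_mul, abs_mul]
      exact (mul_le_of_le_one_right (abs_nonneg _) (mul_le_one₀ b2 (abs_nonneg _) b3)).trans (d1 i z)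
    have e3 : |χ₁ z * (χ₂ z * partialD i χ₃ z)| ≤ K₀ * 2 / (r - r') := by
      rw [abs_mul, abs_mul, ← mul_assoc]
      exact (mul_le_of_le_one_left (abs_nonneg _) (mul_le_one₀ b1 (abs_nonneg _) b2)).trans (d3 i z)
    -- The slope of `ψ` is bounded only over the ball of radius `r`; beyond it `χ₁` vanishes.
    have e2 : |χ₁ z * (partialD i χ₂ z * χ₃ z)| ≤ K₀ * 2 * (1 + B) / (r - r') := by
      rcases lt_or_ge (‖horiz z‖) r with hz | hz
      · rw [abs_mul, abs_mul]
        exact (mul_le_of_le_one_left (by positivity) b1).trans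
          ((mul_le_of_le_one_right (abs_nonneg _) b3).trans (d2 i z hz))
      · rw [hz1 z (by linarith), zero_mul, abs_zero]
        exact div_nonneg (by positivity) (by linarith)
    rw [add_div, add_div, mul_add]
    refine (abs_add_le _ _).trans ?_
    have := abs_add_le (χ₁ z * (χ₂ z * partialD i χ₃ z)) (χ₁ z * (partialD i χ₂ z * χ₃ z))
    linarith

end Cutoff

/-! ### Reduction to a globally defined boundary function. -/

section GraphData

variable {m k : ℕ} {ψ ψ' : Eu m → ℝ} {δ B η : ℝ}
  {A : Eu (m + 1) → Matrix (Fin (m + 1)) (Fin (m + 1)) ℝ}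

/-- Assumptions on a globally defined boundary function and the coefficients over one `W_δ`. -/
structure GraphData (k : ℕ) (δ B η : ℝ) (ψ : Eu m → ℝ)
    (A : Eu (m + 1) → Matrix (Fin (m + 1)) (Fin (m + 1)) ℝ) : Prop where
  psi : ContDiff ℝ (k + 1 : ℕ) ψ
  psi_bound : ∀ j ≤ k + 1, ∀ y ∈ Metric.ball (0 : Eu m) δ, ‖iteratedFDeriv ℝ j ψ y‖ ≤ B
  A_smooth : ∀ i l, ContDiffOn ℝ k (fun x => A x i l) (dom ψ δ)
  A_bound : ∀ i l, ∀ j ≤ k, ∀ x ∈ dom ψ δ, ‖iteratedFDeriv ℝ j (fun x => A x i l) x‖ ≤ B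
  A_elliptic : ∀ x ∈ dom ψ δ, ∀ ξ : Eu (m + 1), η * ‖ξ‖ ^ 2 ≤ inner ℝ (act (A x) ξ) ξ

lemma GraphData.contDiff_two (h : GraphData k δ B η ψ A) (hk : 1 ≤ k) : ContDiff ℝ 2 ψ :=
  h.psi.of_le (by exact_mod_cast Nat.succ_le_succ hk)

lemma dom_mono {r r' : ℝ} (h : r' ≤ r) : dom ψ r' ⊆ dom ψ r :=
  fun _ hz => ⟨hz.1.trans_le h, (neg_le_neg h).trans_lt hz.2.1, hz.2.2⟩

lemma dom_congr (h : EqOn ψ ψ' (Metric.closedBall 0 δ)) {r : ℝ} (hr : r ≤ δ) :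
    dom ψ r = dom ψ' r := by
  ext z
  refine and_congr_right fun hz => ?_
  rw [h (mem_closedBall_zero_iff.2 (hz.le.trans hr))]

lemma top_congr (h : EqOn ψ ψ' (Metric.closedBall 0 δ)) : top ψ δ = top ψ' δ := by
  ext z
  refine and_congr_right fun hz => ?_
  rw [h (mem_closedBall_zero_iff.2 hz.le)]

lemma sidesBottom_congr (h : EqOn ψ ψ' (Metric.closedBall 0 δ)) :
    sidesBottom ψ δ = sidesBottom ψ' δ := by
  ext z
  refine or_congr (and_congr_right fun hz => ?_) Iff.rfl
  rw [h (mem_closedBall_zero_iff.2 hz.le)]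

lemma isAllowable_congr (h : EqOn ψ ψ' (Metric.closedBall 0 δ)) (bc : BC)
    (v : Eu (m + 1) → ℝ) : IsAllowable bc ψ δ v ↔ IsAllowable bc ψ' δ v := by
  cases bc
  · simp only [IsAllowable, dom_congr h le_rfl]
  · simp only [IsAllowable, dom_congr h le_rfl, sidesBottom_congr h]

lemma IsWeakSolution.congr (h : EqOn ψ ψ' (Metric.closedBall 0 δ)) {bc : BC}
    {F : (Eu (m + 1) → ℝ) → ℝ} {u : Eu (m + 1) → ℝ} (hu : IsWeakSolution bc ψ A δ F u) :
    IsWeakSolution bc ψ' A δ F u where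
  memH1 := dom_congr h le_rfl ▸ hu.memH1
  trace hb := by
    rw [← dom_congr h le_rfl, ← top_congr h]
    exact hu.trace hb
  dual := by
    have : dualSpace bc ψ' δ = dualSpace bc ψ δ := by
      ext v
      cases bc <;> simp only [dualSpace, dom_congr h le_rfl]
    rw [← dom_congr h le_rfl, this]
    exact hu.dual
  equation v hv := by
    rw [← dom_congr h le_rfl]
    exact hu.equation v ((isAllowable_congr h bc v).2 hv)

/-- `ψ` is multiplied by a bump equal to `1` on the closed ball of radius `δ` and supported in the
ball of radius `(δ + R₀) / 2`. Derivative bounds are required only over the ball of radius `δ`,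
where nothing has changed, so they do not deteriorate as `δ` approaches `R₀`. -/
lemma Admissible.exists_graphData {R₀ Mψ MA : ℝ} (h : Admissible k R₀ Mψ MA η ψ A)
    (hδ : δ ∈ Ioo 0 R₀) : ∃ ψ', EqOn ψ ψ' (Metric.closedBall 0 δ) ∧
      GraphData k δ (max |Mψ| |MA|) η ψ' A := by
  let f : ContDiffBump (0 : Eu m) := ⟨δ, (δ + R₀) / 2, hδ.1, by linarith [hδ.2]⟩
  have heq : EqOn ψ (fun y => f y * ψ y) (Metric.closedBall 0 δ) := fun y hy => by
    have : f y = 1 := f.one_of_mem_closedBall hy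
    simp [this]
  have hdom : dom (fun y => f y * ψ y) δ ⊆ dom ψ R₀ := by
    rw [← dom_congr heq le_rfl]
    exact dom_mono hδ.2.le
  refine ⟨fun y => f y * ψ y, heq, ?_, fun j hj y hy => ?_, fun i l => (h.A_smooth i l).mono hdom,
    fun i l j hj x hx => (h.A_bound i l j hj x (hdom hx)).trans
      ((le_abs_self _).trans (le_max_right _ _)), fun x hx => h.A_elliptic x (hdom hx)⟩
  · rw [contDiff_iff_contDiffAt]
    intro y
    by_cases hy : y ∈ Metric.ball (0 : Eu m) R₀
    · exact f.contDiff.contDiffAt.mul (h.psi_smooth.contDiffAt (Metric.isOpen_ball.mem_nhds hy))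
    · have : (fun y => f y * ψ y) =ᶠ[𝓝 y] fun _ => 0 := by
        have hy' : y ∈ (tsupport f)ᶜ := by
          rw [f.tsupport_eq, mem_compl_iff, Metric.mem_closedBall]
          rw [Metric.mem_ball] at hy
          show ¬ dist y 0 ≤ (δ + R₀) / 2
          linarith [hδ.2]
        filter_upwards [(isClosed_tsupport f).isOpen_compl.mem_nhds hy'] with z hz
        rw [image_eq_zero_of_notMem_tsupport hz, zero_mul]
      exact contDiffAt_const.congr_of_eventuallyEq this
  · have : (fun y => f y * ψ y) =ᶠ[𝓝 y] ψ := by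
      filter_upwards [Metric.isOpen_ball.mem_nhds hy] with z hz
      exact (heq (Metric.ball_subset_closedBall hz)).symm
    rw [this.iteratedFDeriv ℝ j |>.eq_of_nhds]
    exact (h.psi_bound j hj y (Metric.ball_subset_ball hδ.2.le hy)).trans
      ((le_abs_self _).trans (le_max_left _ _))

end GraphData

/-! ### The coefficients in straightened coordinates. -/

section Coefficients

variable {m k : ℕ} {ψ : Eu m → ℝ} {δ B η : ℝ}
  {A : Eu (m + 1) → Matrix (Fin (m + 1)) (Fin (m + 1)) ℝ}

/-- The matrix expressing the original gradient through the gradient in straightened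
coordinates. -/
noncomputable def tilt (ψ : Eu m → ℝ) (i l : Fin (m + 1)) (y : Eu (m + 1)) : ℝ :=
  (if i = l then 1 else 0) - if l = Fin.last m then slope ψ i y else 0

lemma sum_tilt_mul (ψ : Eu m → ℝ) (i : Fin (m + 1)) (y : Eu (m + 1)) (ξ : Fin (m + 1) → ℝ) :
    ∑ l, tilt ψ i l y * ξ l = ξ i - slope ψ i y * ξ (Fin.last m) := by
  simp [tilt, sub_mul, Finset.sum_sub_distrib]

/-- The coefficients in straightened coordinates. -/
noncomputable def flatCoef (ψ : Eu m → ℝ)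
    (A : Eu (m + 1) → Matrix (Fin (m + 1)) (Fin (m + 1)) ℝ) (i l : Fin (m + 1))
    (y : Eu (m + 1)) : ℝ :=
  ∑ i', ∑ l', tilt ψ i' i y * (A (shear ψ y) i' l' * tilt ψ l' l y)

/-- `flatCoef` is `TᵗAT`, where `T` is the matrix `tilt`. Applied to `ξ`, the tilt subtracts `slope`
times the last component, which is the chain rule for the original gradient. -/
lemma sum_flatCoef (y : Eu (m + 1)) (ξ ζ : Fin (m + 1) → ℝ) :
    ∑ i, (∑ l, flatCoef ψ A i l y * ξ l) * ζ i =
      ∑ i, (∑ l, A (shear ψ y) i l * (ξ l - slope ψ l y * ξ (Fin.last m))) *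
        (ζ i - slope ψ i y * ζ (Fin.last m)) := by
  have key : ∀ i', (∑ l', A (shear ψ y) i' l' * (ξ l' - slope ψ l' y * ξ (Fin.last m))) *
      (ζ i' - slope ψ i' y * ζ (Fin.last m)) =
      ∑ i, ∑ l, ∑ l', tilt ψ i' i y * (A (shear ψ y) i' l' * tilt ψ l' l y) * ξ l * ζ i := by
    intro i'
    rw [← sum_tilt_mul ψ i' y ζ, Finset.mul_sum]
    refine Finset.sum_congr rfl fun i _ => ?_
    rw [Finset.sum_mul, Finset.sum_comm]
    refine Finset.sum_congr rfl fun l' _ => ?_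
    rw [← sum_tilt_mul ψ l' y ξ, Finset.mul_sum, Finset.sum_mul]
    refine Finset.sum_congr rfl fun l _ => ?_
    ring
  simp_rw [key]
  rw [Finset.sum_comm]
  refine Finset.sum_congr rfl fun i _ => ?_
  rw [Finset.sum_comm, Finset.sum_mul]
  refine Finset.sum_congr rfl fun l _ => ?_
  simp_rw [flatCoef, Finset.sum_mul]

lemma inner_act (M : Matrix (Fin (m + 1)) (Fin (m + 1)) ℝ) (ξ ζ : Eu (m + 1)) :
    inner ℝ (act M ξ) ζ = ∑ i, (∑ l, M i l * ξ l) * ζ i := by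
  rw [PiLp.inner_apply]
  refine Finset.sum_congr rfl fun i _ => ?_
  simp [act, Matrix.mulVec, dotProduct, mul_comm]

/-- The tilt is inverted explicitly: since the last slope is zero, the last components of `ξ` and of
the tilted vector `τ` agree, and `ξ i = τ i + slope i * τ n`. Hence `|ξ|² ≤ (2 + 2 (m+1) S²) |τ|²`,
and ellipticity at `τ` gives it at `ξ`. -/
lemma flatCoef_elliptic (hη : 0 < η) {S : ℝ} {y : Eu (m + 1)} (hS : ∀ i, |slope ψ i y| ≤ S)
    (hA : ∀ ξ : Eu (m + 1), η * ‖ξ‖ ^ 2 ≤ inner ℝ (act (A (shear ψ y)) ξ) ξ)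
    (ξ : Fin (m + 1) → ℝ) : η / (2 + 2 * ((m + 1 : ℕ) * S ^ 2)) * ∑ i, ξ i ^ 2 ≤
      ∑ i, ∑ l, flatCoef ψ A i l y * ξ l * ξ i := by
  have h1 : ∑ i, ∑ l, flatCoef ψ A i l y * ξ l * ξ i =
      ∑ i, (∑ l, flatCoef ψ A i l y * ξ l) * ξ i := by simp_rw [Finset.sum_mul]
  set τ : Eu (m + 1) := WithLp.toLp 2 fun l => ξ l - slope ψ l y * ξ (Fin.last m) with hτ
  have h2 := hA τ
  rw [inner_act] at h2
  rw [h1, sum_flatCoef]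
  refine le_trans ?_ h2
  rw [EuclideanSpace.norm_sq_eq, div_mul_eq_mul_div, div_le_iff₀ (by positivity), mul_assoc]
  refine mul_le_mul_of_nonneg_left ?_ hη.le
  have hlast : τ (Fin.last m) = ξ (Fin.last m) := by simp [hτ, slope_last]
  have hl : τ (Fin.last m) ^ 2 ≤ ∑ i, ‖τ i‖ ^ 2 := by
    refine le_trans (le_of_eq ?_) (Finset.single_le_sum (f := fun i => ‖τ i‖ ^ 2)
      (fun i _ => sq_nonneg _) (Finset.mem_univ (Fin.last m)))
    simp
  have hi : ∀ i, ξ i ^ 2 ≤ 2 * ‖τ i‖ ^ 2 + 2 * (S ^ 2 * τ (Fin.last m) ^ 2) := fun i => by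
    have e : ξ i = τ i + slope ψ i y * τ (Fin.last m) := by rw [hlast]; simp [hτ]
    have e2 : slope ψ i y ^ 2 ≤ S ^ 2 := sq_le_sq.2 ((hS i).trans (le_abs_self S))
    have e3 := mul_le_mul_of_nonneg_right e2 (sq_nonneg (τ (Fin.last m)))
    rw [e, Real.norm_eq_abs, sq_abs]
    nlinarith [sq_nonneg (τ i - slope ψ i y * τ (Fin.last m))]
  calc ∑ i, ξ i ^ 2 ≤ ∑ i, (2 * ‖τ i‖ ^ 2 + 2 * (S ^ 2 * τ (Fin.last m) ^ 2)) :=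
        Finset.sum_le_sum fun i _ => hi i
    _ = 2 * ∑ i, ‖τ i‖ ^ 2 + (m + 1 : ℕ) * (2 * (S ^ 2 * τ (Fin.last m) ^ 2)) := by
        rw [Finset.sum_add_distrib, ← Finset.mul_sum]
        simp
    _ ≤ _ := by
        have := mul_le_mul_of_nonneg_left hl (show (0 : ℝ) ≤ (m + 1 : ℕ) * S ^ 2 by positivity)
        nlinarith

lemma mem_flat {y : Eu (m + 1)} : y ∈ flat ψ δ ↔ ‖horiz y‖ < δ ∧ -δ < vert y + ψ (horiz y) := by
  simp [flat, cyl, horiz_shear, vert_shear]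

lemma GraphData.abs_slope_le (h : GraphData k δ B η ψ A) {i : Fin (m + 1)} {y : Eu (m + 1)}
    (hy : ‖horiz y‖ < δ) : |slope ψ i y| ≤ B := by
  have := norm_iteratedFDeriv_slope_le h.psi (Nat.zero_le k) i y
  rw [norm_iteratedFDeriv_zero] at this
  exact this.trans (h.psi_bound 1 (by omega) _ (mem_ball_zero_iff.2 hy))

lemma GraphData.nonneg (h : GraphData k δ B η ψ A) (hδ : 0 < δ) : 0 ≤ B :=
  (norm_nonneg _).trans (h.psi_bound 0 (Nat.zero_le _) 0 (Metric.mem_ball_self hδ))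

lemma shear_mem_dom {y : Eu (m + 1)} (hy : y ∈ flat ψ δ ∩ lowerHalf m) : shear ψ y ∈ dom ψ δ := by
  rwa [← mem_preimage, shear_preimage_dom]

lemma GraphData.elliptic_flatCoef (h : GraphData k δ B η ψ A) (hη : 0 < η) {y : Eu (m + 1)}
    (hy : y ∈ flat ψ δ ∩ lowerHalf m) (ξ : Fin (m + 1) → ℝ) :
    η / (2 + 2 * ((m + 1 : ℕ) * B ^ 2)) * ∑ i, ξ i ^ 2 ≤
      ∑ i, ∑ l, flatCoef ψ A i l y * ξ l * ξ i :=
  flatCoef_elliptic hη (fun _ => h.abs_slope_le (mem_flat.1 hy.1).1)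
    (h.A_elliptic _ (shear_mem_dom hy)) ξ

lemma cb_tilt {W : Set (Eu (m + 1))} (hW : IsOpen W) {ε S : ℝ} (hS : 0 ≤ S)
    (h : ∀ i, CB W ε k (slope ψ i) S) (i l : Fin (m + 1)) :
    CB W ε k (tilt ψ i l) (1 + 2 ^ k * S) := by
  have h1 : CB W ε k (fun _ => (if i = l then 1 else 0 : ℝ)) 1 := CB.const (by split_ifs <;> simp)
  have h2 : CB W ε k (fun y => -(if l = Fin.last m then slope ψ i y else 0)) (2 ^ k * S) := by
    split_ifs
    · have := (h i).const_mul hW hS (-1)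
      simpa using this
    · exact CB.const (by simpa using by positivity)
  exact (h1.add hW h2).congr hW fun y _ => by simp [tilt, sub_eq_add_neg]

lemma exists_cb_flatCoef (m k : ℕ) {B E : ℝ} (hB : 0 ≤ B) (hE : 1 ≤ E) : ∃ B', 0 ≤ B' ∧
    ∀ (δ η : ℝ) (ψ : Eu m → ℝ) (A : Eu (m + 1) → Matrix (Fin (m + 1)) (Fin (m + 1)) ℝ) (ε : ℝ),
      1 ≤ k → GraphData k δ B η ψ A → 0 ≤ ε → ε ≤ E →
      ∀ i l, CB (flat ψ δ ∩ lowerHalf m) ε k (flatCoef ψ A i l) B' := by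
  have hS : 0 ≤ E ^ k * B := by positivity
  obtain ⟨C, hC, hsh⟩ := CB.exists_shear m k hS
  refine ⟨((Finset.univ : Finset (Fin (m + 1))).card : ℝ) *
    (((Finset.univ : Finset (Fin (m + 1))).card : ℝ) * (2 ^ k * ((1 + 2 ^ k * (E ^ k * B)) *
    (2 ^ k * (C * (E ^ k * B) * (1 + 2 ^ k * (E ^ k * B))))))),
    by positivity, fun δ η ψ A ε hk h hε hεE i l => ?_⟩
  have hψ := h.contDiff_two hk
  have hW : IsOpen (flat ψ δ ∩ lowerHalf m) := (isOpen_flat hψ.continuous).inter isOpen_lowerHalf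
  have hs : ∀ i, CB (flat ψ δ ∩ lowerHalf m) ε k (slope ψ i) (E ^ k * B) := fun i =>
    cb_slope h.psi h.psi_bound hW (fun z hz => (mem_flat.1 hz.1).1) hε hεE hE i
  have ht := cb_tilt hW hS hs
  refine CB.sum hW _ fun i' _ => CB.sum hW _ fun l' _ =>
    CB.mul hW (by positivity) (by positivity) (ht i' i)
      (CB.mul hW (by positivity) (by positivity) ?_ (ht l' l))
  rw [← shear_preimage_dom] at hs ⊢
  exact hsh ψ _ ε _ _ (hψ.of_le one_le_two) (isOpen_dom hψ.continuous) hS hs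
    (CB.of_iteratedFDeriv (isOpen_dom hψ.continuous) hε hεE hE k (h.A_smooth i' l')
      (h.A_bound i' l'))

end Coefficients

lemma WD.of_lim {n : ℕ} {W S : Set (Eu n)} {i : Fin n} {f f' : ℕ → Eu n → ℝ} {u g : Eu n → ℝ}
    (h : L2Lim (volume.restrict W) f u) (h' : L2Lim (volume.restrict W) f' g)
    (hD : ∀ j, WD W S i (f j) (f' j)) : WD W S i u g := fun φ hφ => by
  have h1 := h.integral_mul (F := partialD i φ) (hφ.c1.memLp_partialD i)
  have h2 := (h'.integral_mul (F := φ) hφ.c1.memLp).neg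
  refine tendsto_nhds_unique (f := fun j => ∫ x in W, f j x * partialD i φ x) (l := atTop) ?_ ?_
  · simpa only [mul_comm] using h1
  · refine (tendsto_congr fun j => ?_).2 (by simpa only [mul_comm] using h2)
    simpa only [mul_comm] using hD j φ hφ

/-! ### From straightened test functions to allowable ones. -/

section Transfer

variable {m : ℕ} {ψ : Eu m → ℝ} {δ : ℝ}

lemma memLp_unshear (hψ : Continuous ψ) {W : Set (Eu (m + 1))} {v : Eu (m + 1) → ℝ} {p : ℝ≥0∞}
    (hv : MemLp v p (volume.restrict (shear ψ ⁻¹' W))) :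
    MemLp (fun x => v (shear (fun y => -ψ y) x)) p (volume.restrict W) := by
  have := memLp_shear (ψ := fun y => -ψ y) hψ.neg hv
  rwa [preimage_shear_neg] at this

lemma lpNorm_unshear (hψ : Continuous ψ) {W : Set (Eu (m + 1))} {v : Eu (m + 1) → ℝ} {p : ℝ≥0∞}
    (hv : MemLp v p (volume.restrict (shear ψ ⁻¹' W))) :
    lpNorm (fun x => v (shear (fun y => -ψ y) x)) p (volume.restrict W) =
      lpNorm v p (volume.restrict (shear ψ ⁻¹' W)) := by
  have := lpNorm_shear (ψ := fun y => -ψ y) hψ.neg hv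
  rwa [preimage_shear_neg] at this

lemma L2Lim.unshear (hψ : Continuous ψ) {W : Set (Eu (m + 1))} {f : ℕ → Eu (m + 1) → ℝ}
    {g : Eu (m + 1) → ℝ} (h : L2Lim (volume.restrict (shear ψ ⁻¹' W)) f g) :
    L2Lim (volume.restrict W) (fun j x => f j (shear (fun y => -ψ y) x))
      (fun x => g (shear (fun y => -ψ y) x)) := by
  refine L2Lim.of_lpNorm (fun j => memLp_unshear hψ (h.memLp j)) (memLp_unshear hψ h.memLp_lim) ?_
  refine (tendsto_congr fun j => ?_).2 h.tendsto_lpNorm_sub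
  exact lpNorm_unshear hψ (v := fun y => f j y - g y) ((h.memLp j).sub h.memLp_lim)

/-- Limits in `H¹` of test functions in straightened coordinates. -/
structure IsFlatTest (bc : BC) (ψ : Eu m → ℝ) (δ : ℝ) (v : Eu (m + 1) → ℝ)
    (gv : Fin (m + 1) → Eu (m + 1) → ℝ) : Prop where
  exists_lim : ∃ φ : ℕ → Eu (m + 1) → ℝ, (∀ j, IsC1Test (eqnSet bc (flat ψ δ)) (φ j)) ∧
    L2Lim (volume.restrict (flat ψ δ ∩ lowerHalf m)) φ v ∧
    ∀ i, L2Lim (volume.restrict (flat ψ δ ∩ lowerHalf m)) (fun j => partialD i (φ j)) (gv i)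

lemma IsC1Test.isFlatTest {bc : BC} {φ : Eu (m + 1) → ℝ}
    (hφ : IsC1Test (eqnSet bc (flat ψ δ)) φ) : IsFlatTest bc ψ δ φ fun i => partialD i φ :=
  ⟨fun _ => φ, fun _ => hφ, L2Lim.const hφ.memLp, fun i => L2Lim.const (hφ.memLp_partialD i)⟩

namespace IsFlatTest

variable {bc : BC} {v : Eu (m + 1) → ℝ} {gv : Fin (m + 1) → Eu (m + 1) → ℝ}

lemma memLp (h : IsFlatTest bc ψ δ v gv) : MemLp v 2 (volume.restrict (flat ψ δ ∩ lowerHalf m)) :=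
  h.exists_lim.choose_spec.2.1.memLp_lim

lemma memLp_grad (h : IsFlatTest bc ψ δ v gv) (i : Fin (m + 1)) :
    MemLp (gv i) 2 (volume.restrict (flat ψ δ ∩ lowerHalf m)) :=
  (h.exists_lim.choose_spec.2.2 i).memLp_lim

/-- The approximating sequence is sheared back term by term; slopes are bounded over the ball, so
both the functions and their gradients converge. Limits are treated, not only test functions,
because the power estimate tests with a function of the solution. -/
lemma isAllowable_and (hψ : ContDiff ℝ 2 ψ) (h : IsFlatTest bc ψ δ v gv) :
    IsAllowable bc ψ δ (fun x => v (shear (fun y => -ψ y) x)) ∧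
    ∀ i, MemLp (fun x => gv i (shear (fun y => -ψ y) x) - slope ψ i x *
        gv (Fin.last m) (shear (fun y => -ψ y) x)) 2 (volume.restrict (dom ψ δ)) ∧
      weakDeriv (dom ψ δ) (Pi.single i 1) (fun x => v (shear (fun y => -ψ y) x))
        =ᵐ[volume.restrict (dom ψ δ)] fun x => gv i (shear (fun y => -ψ y) x) - slope ψ i x *
          gv (Fin.last m) (shear (fun y => -ψ y) x) := by
  obtain ⟨φ, hφ, hv, hgv⟩ := h.exists_lim
  have hψ1 := hψ.of_le one_le_two
  have hdom := isOpen_dom (δ := δ) hψ.continuous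
  simp_rw [← shear_preimage_testSet] at hφ
  rw [← shear_preimage_dom] at hv
  simp_rw [← shear_preimage_dom] at hgv
  have hφ' := fun j => (hφ j).unshear hψ1
  have hlim := hv.unshear hψ.continuous
  have hD : ∀ i, L2Lim (volume.restrict (dom ψ δ))
      (fun j => partialD i fun x => φ j (shear (fun y => -ψ y) x))
      (fun x => gv i (shear (fun y => -ψ y) x) - slope ψ i x *
        gv (Fin.last m) (shear (fun y => -ψ y) x)) := fun i => by
    obtain ⟨S, hS⟩ := exists_slope_bound (m := m) hψ1 δ i
    have hb := ((hgv (Fin.last m)).unshear hψ.continuous).bdd_mul (c := fun x => -slope ψ i x)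
      ((contDiff_slope hψ i).continuous.neg.aestronglyMeasurable)
      ((ae_restrict_iff' hdom.measurableSet).2 (Eventually.of_forall fun x hx => by
        rw [abs_neg]; exact hS x hx.1.le))
    refine (((hgv i).unshear hψ.continuous).add hb).congr (fun j => ?_) ?_
    · refine Eventually.of_forall fun x => ?_
      have := partialD_unshear hψ1 (hφ j).1 i (shear (fun y => -ψ y) x)
      rw [shear_shear_neg, slope_shear] at this
      rw [this]
      ring
    · exact Eventually.of_forall fun x => by ring
  have hW : ∀ i, WD (dom ψ δ) (dom ψ δ) i (fun x => v (shear (fun y => -ψ y) x))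
      (fun x => gv i (shear (fun y => -ψ y) x) - slope ψ i x *
        gv (Fin.last m) (shear (fun y => -ψ y) x)) := fun i =>
    WD.of_lim hlim (hD i) fun j => WD.of_c1 (hφ' j).1 subset_rfl i
  exact ⟨isAllowable_of_lim hψ.continuous bc hφ' hW hlim hD, fun i => ⟨(hD i).memLp_lim,
    weakDeriv_single_ae hdom hlim.memLp_lim (hD i).memLp_lim (hW i)⟩⟩

lemma isAllowable (hψ : ContDiff ℝ 2 ψ) (h : IsFlatTest bc ψ δ v gv) :
    IsAllowable bc ψ δ (fun x => v (shear (fun y => -ψ y) x)) := (h.isAllowable_and hψ).1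

lemma integral_inner_weakGrad (hψ : ContDiff ℝ 2 ψ) (h : IsFlatTest bc ψ δ v gv)
    {Ψ : Eu (m + 1) → Eu (m + 1)} :
    ∫ x in dom ψ δ, inner ℝ (Ψ x) (weakGrad (dom ψ δ) (fun x => v (shear (fun y => -ψ y) x)) x) =
      ∫ y in flat ψ δ ∩ lowerHalf m,
        ∑ i, Ψ (shear ψ y) i * (gv i y - slope ψ i y * gv (Fin.last m) y) := by
  rw [← shear_preimage_dom]
  have := setIntegral_shear hψ.continuous (dom ψ δ) fun x =>
    ∑ i, Ψ x i * (gv i (shear (fun y => -ψ y) x) - slope ψ i x *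
      gv (Fin.last m) (shear (fun y => -ψ y) x))
  simp only [shear_neg_shear, slope_shear] at this
  rw [this]
  refine integral_congr_ae ?_
  filter_upwards [ae_all_iff.2 fun i => ((h.isAllowable_and hψ).2 i).2] with x hx
  rw [PiLp.inner_apply]
  refine Finset.sum_congr rfl fun i _ => ?_
  simp [weakGrad, hx i, mul_comm]

end IsFlatTest

end Transfer

/-! ### The solution in straightened coordinates. -/

section FlatEquation

variable {m : ℕ} {ψ : Eu m → ℝ} {δ : ℝ} {A : Eu (m + 1) → Matrix (Fin (m + 1)) (Fin (m + 1)) ℝ}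
  {bc : BC} {F : (Eu (m + 1) → ℝ) → ℝ} {u : Eu (m + 1) → ℝ}

/-- The gradient of `u ∘ shear ψ` for `u` defined over `W_δ`. -/
noncomputable def flatGrad (ψ : Eu m → ℝ) (δ : ℝ) (u : Eu (m + 1) → ℝ) (i : Fin (m + 1))
    (y : Eu (m + 1)) : ℝ :=
  weakDeriv (dom ψ δ) (Pi.single i 1) u (shear ψ y) +
    slope ψ i y * weakDeriv (dom ψ δ) (Pi.single (Fin.last m) 1) u (shear ψ y)

lemma flatGrad_sub (i : Fin (m + 1)) (y : Eu (m + 1)) :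
    flatGrad ψ δ u i y - slope ψ i y * flatGrad ψ δ u (Fin.last m) y =
      weakDeriv (dom ψ δ) (Pi.single i 1) u (shear ψ y) := by
  simp [flatGrad, slope_last]

lemma memLp_flat (hψ : Continuous ψ) {p : ℝ≥0∞} {f : Eu (m + 1) → ℝ}
    (hf : MemLp f p (volume.restrict (dom ψ δ))) :
    MemLp (fun y => f (shear ψ y)) p (volume.restrict (flat ψ δ ∩ lowerHalf m)) := by
  rw [← shear_preimage_dom]
  exact memLp_shear hψ hf

lemma lpNorm_flat (hψ : Continuous ψ) {p : ℝ≥0∞} {f : Eu (m + 1) → ℝ}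
    (hf : MemLp f p (volume.restrict (dom ψ δ))) :
    lpNorm (fun y => f (shear ψ y)) p (volume.restrict (flat ψ δ ∩ lowerHalf m)) =
      lpNorm f p (volume.restrict (dom ψ δ)) := by
  rw [← shear_preimage_dom]
  exact lpNorm_shear hψ hf

lemma memLp_slope_mul (hψ : ContDiff ℝ 2 ψ) {p : ℝ≥0∞} {f : Eu (m + 1) → ℝ} (i : Fin (m + 1))
    (hf : MemLp f p (volume.restrict (flat ψ δ ∩ lowerHalf m))) :
    MemLp (fun y => slope ψ i y * f y) p (volume.restrict (flat ψ δ ∩ lowerHalf m)) := by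
  obtain ⟨S, hS⟩ := exists_slope_bound (m := m) (hψ.of_le one_le_two) δ i
  exact memLp_bdd_mul hf (contDiff_slope hψ i).continuous.aestronglyMeasurable
    ((ae_restrict_iff' ((isOpen_flat hψ.continuous).inter isOpen_lowerHalf).measurableSet).2
      (Eventually.of_forall fun y hy => hS y (mem_flat.1 hy.1).1.le))

lemma IsWeakSolution.memLp_flatGrad (hψ : ContDiff ℝ 2 ψ) (h : IsWeakSolution bc ψ A δ F u)
    (i : Fin (m + 1)) :
    MemLp (flatGrad ψ δ u i) 2 (volume.restrict (flat ψ δ ∩ lowerHalf m)) := by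
  have hw := fun i => (h.memH1.wd (isOpen_dom hψ.continuous) i).2
  exact (memLp_flat hψ.continuous (hw i)).add
    (memLp_slope_mul hψ i (memLp_flat hψ.continuous (hw (Fin.last m))))

/-- In case (D) the zero trace is what allows testing across the flat boundary; in case (N) the
interior relation is just carried over by the shear. -/
lemma IsWeakSolution.wd_flatGrad (hψ : ContDiff ℝ 2 ψ) (h : IsWeakSolution bc ψ A δ F u)
    (i : Fin (m + 1)) : WD (flat ψ δ ∩ lowerHalf m) (gradSet bc (flat ψ δ)) i
      (fun y => u (shear ψ y)) (flatGrad ψ δ u i) := by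
  have hw := fun i => h.memH1.wd (isOpen_dom hψ.continuous) i
  cases bc
  · exact wd_flat_of_traceZero hψ (h.trace rfl) (fun i => (hw i).2) (fun i => (hw i).1) i
  · have := WD.shear hψ (isOpen_dom hψ.continuous) h.memH1.1 (hw i).2 (hw (Fin.last m)).2 (hw i).1
      (hw (Fin.last m)).1
    rwa [shear_preimage_dom] at this

lemma IsWeakSolution.flat_eqn (hψ : ContDiff ℝ 2 ψ) (h : IsWeakSolution bc ψ A δ F u)
    {v : Eu (m + 1) → ℝ} {gv : Fin (m + 1) → Eu (m + 1) → ℝ} (hv : IsFlatTest bc ψ δ v gv) :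
    ∫ y in flat ψ δ ∩ lowerHalf m, ∑ i, flux (flatCoef ψ A) (flatGrad ψ δ u) i y * gv i y =
      F (fun x => v (shear (fun y => -ψ y) x)) := by
  rw [← h.equation _ (hv.isAllowable hψ), energyForm,
    hv.integral_inner_weakGrad hψ (Ψ := fun x => act (A x) (weakGrad (dom ψ δ) u x))]
  congr 1
  ext y
  simp only [flux]
  rw [sum_flatCoef]
  simp_rw [flatGrad_sub]
  rfl

lemma sq_lpNorm_vec {n : ℕ} {W : Set (Eu n)} {g : Eu n → Eu n}
    (hg : ∀ i, MemLp (fun x => g x i) 2 (volume.restrict W)) :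
    lpNorm g 2 (volume.restrict W) ^ 2 =
      ∑ i, lpNorm (fun x => g x i) 2 (volume.restrict W) ^ 2 := by
  have hm : MemLp g 2 (volume.restrict W) := MemLp.of_eval_piLp hg
  have h1 : lpNorm g 2 (volume.restrict W) = lpNorm (fun x => ‖g x‖) 2 (volume.restrict W) :=
    (lpNorm_norm hm.1 2).symm
  rw [h1, sq_lpNorm_two hm.norm]
  simp_rw [EuclideanSpace.norm_sq_eq, sq_lpNorm_two (hg _)]
  rw [integral_finsetSum _ fun i _ => by simpa using (hg i).integrable_sq]
  simp

end FlatEquation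

/-! ### The gradient estimate on `W_δ`. -/

section Energy

variable {m k : ℕ} {ψ : Eu m → ℝ} {δ δ' B η : ℝ}
  {A : Eu (m + 1) → Matrix (Fin (m + 1)) (Fin (m + 1)) ℝ} {u : Eu (m + 1) → ℝ}

lemma flat_mono (h : δ' ≤ δ) : flat ψ δ' ⊆ flat ψ δ := fun _ hz =>
  ⟨hz.1.trans_le h, (neg_le_neg h).trans_lt hz.2⟩

lemma bowl_subset_flat : bowl ψ δ ⊆ flat ψ δ := inter_subset_left

/-- The weak derivatives on the two domains are separate choices, so agreement almost everywhere has
to be derived from uniqueness. -/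
lemma weakDeriv_single_mono (hψ : Continuous ψ) (h : δ' ≤ δ) (hu : MemH (dom ψ δ) 1 u)
    (i : Fin (m + 1)) : weakDeriv (dom ψ δ') (Pi.single i 1) u =ᵐ[volume.restrict (dom ψ δ')]
      weakDeriv (dom ψ δ) (Pi.single i 1) u := by
  obtain ⟨h1, h2⟩ := hu.wd (isOpen_dom hψ) i
  have hd := dom_mono (ψ := ψ) h
  have hμ := Measure.restrict_mono hd (le_refl (volume : Measure (Eu (m + 1))))
  exact weakDeriv_single_ae (isOpen_dom hψ) (hu.1.mono_measure hμ) (h2.mono_measure hμ)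
    (h1.restrict (isOpen_dom hψ).measurableSet hd hd inter_subset_right)

lemma GraphData.bdd_slope (h : GraphData k δ B η ψ A) (hk : 1 ≤ k) (i : Fin (m + 1)) :
    AEStronglyMeasurable (slope ψ i) (volume.restrict (flat ψ δ ∩ lowerHalf m)) ∧
    ∀ᵐ y ∂volume.restrict (flat ψ δ ∩ lowerHalf m), |slope ψ i y| ≤ B :=
  ⟨(contDiff_slope (h.contDiff_two hk) i).continuous.aestronglyMeasurable,
    (ae_restrict_iff' ((isOpen_flat h.psi.continuous).inter isOpen_lowerHalf).measurableSet).2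
      (Eventually.of_forall fun _ hy => h.abs_slope_le (mem_flat.1 hy.1).1)⟩

lemma GraphData.lpNorm_sub_slope_le (h : GraphData k δ B η ψ A) (hk : 1 ≤ k) (hδ : 0 < δ)
    {f g : Eu (m + 1) → ℝ} (hf : MemLp f 2 (volume.restrict (flat ψ δ ∩ lowerHalf m)))
    (hg : MemLp g 2 (volume.restrict (flat ψ δ ∩ lowerHalf m))) (i : Fin (m + 1)) :
    lpNorm (fun y => f y - slope ψ i y * g y) 2 (volume.restrict (flat ψ δ ∩ lowerHalf m)) ≤
      lpNorm f 2 (volume.restrict (flat ψ δ ∩ lowerHalf m)) +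
        B * lpNorm g 2 (volume.restrict (flat ψ δ ∩ lowerHalf m)) := by
  obtain ⟨h1, h2⟩ := h.bdd_slope hk i
  have h3 := lpNorm_bdd_mul_le hg h1 (h.nonneg hδ) h2
  refine le_trans ?_ (add_le_add_right h3 _)
  exact lpNorm_sub_le hf (g := fun y => slope ψ i y * g y) one_le_two

lemma lpNorm_vec_le_sum {n : ℕ} {W : Set (Eu n)} {g : Eu n → Eu n}
    (hg : ∀ i, MemLp (fun x => g x i) 2 (volume.restrict W)) :
    lpNorm g 2 (volume.restrict W) ≤ ∑ i, lpNorm (fun x => g x i) 2 (volume.restrict W) := by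
  refine le_of_sq_le_sq ?_ (Finset.sum_nonneg fun _ _ => lpNorm_nonneg)
  rw [sq_lpNorm_vec hg]
  exact Finset.sum_sq_le_sq_sum_of_nonneg fun _ _ => lpNorm_nonneg

lemma GraphData.sum_lpNorm_sub_slope_le (h : GraphData k δ B η ψ A) (hk : 1 ≤ k) (hδ : 0 < δ)
    {g : Fin (m + 1) → Eu (m + 1) → ℝ}
    (hg : ∀ i, MemLp (g i) 2 (volume.restrict (flat ψ δ ∩ lowerHalf m))) :
    ∑ i, lpNorm (fun y => g i y - slope ψ i y * g (Fin.last m) y) 2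
        (volume.restrict (flat ψ δ ∩ lowerHalf m)) ≤
      (1 + (m + 1 : ℕ) * B) * ∑ i, lpNorm (g i) 2 (volume.restrict (flat ψ δ ∩ lowerHalf m)) := by
  have h1 := Finset.sum_le_sum fun i (_ : i ∈ Finset.univ) =>
    h.lpNorm_sub_slope_le hk hδ (hg i) (hg (Fin.last m)) i
  refine h1.trans ?_
  rw [Finset.sum_add_distrib, Finset.sum_const, Finset.card_univ, Fintype.card_fin, nsmul_eq_mul,
    add_mul, one_mul, mul_assoc]
  have h3 := Finset.single_le_sum (f := fun i =>
    lpNorm (g i) 2 (volume.restrict (flat ψ δ ∩ lowerHalf m))) (fun _ _ => lpNorm_nonneg)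
    (Finset.mem_univ (Fin.last m))
  exact add_le_add_right (mul_le_mul_of_nonneg_left (mul_le_mul_of_nonneg_left h3 (h.nonneg hδ))
    (Nat.cast_nonneg _)) _

lemma IsFlatTest.lpNorm_weakGrad_le {bc : BC} {v : Eu (m + 1) → ℝ}
    {gv : Fin (m + 1) → Eu (m + 1) → ℝ} (h : GraphData k δ B η ψ A) (hk : 1 ≤ k) (hδ : 0 < δ)
    (hv : IsFlatTest bc ψ δ v gv) :
    lpNorm (weakGrad (dom ψ δ) fun x => v (shear (fun y => -ψ y) x)) 2
        (volume.restrict (dom ψ δ)) ≤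
      (1 + (m + 1 : ℕ) * B) *
        ∑ i, lpNorm (gv i) 2 (volume.restrict (flat ψ δ ∩ lowerHalf m)) := by
  have hψ := h.contDiff_two hk
  have hw := (hv.isAllowable_and hψ).2
  refine (lpNorm_vec_le_sum fun i => ((hw i).1.ae_eq (hw i).2.symm)).trans ?_
  refine le_trans (le_of_eq (Finset.sum_congr rfl fun i _ => ?_))
    (h.sum_lpNorm_sub_slope_le hk hδ hv.memLp_grad)
  refine (lpNorm_congr_ae (hw i).2).trans ?_
  rw [← lpNorm_flat hψ.continuous (hw i).1]
  simp only [shear_neg_shear, slope_shear]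

/-- The flat energy estimate with `A = a` and `B = b * c`, where `c` compares the gradient of a test
function with that of its image in `W_δ`. Returning to the original gradient of `u`, which is `gᵢ -
slopeᵢ gₙ`, costs the factor `2 * (1 + (m + 1) * B ^ 2)`. -/
theorem exists_energy_const (m k : ℕ) (hk : 1 ≤ k) {B η : ℝ} (hB : 0 ≤ B) (hη : 0 < η) :
    ∃ C, 0 < C ∧ ∀ (ψ : Eu m → ℝ) (A : Eu (m + 1) → Matrix (Fin (m + 1)) (Fin (m + 1)) ℝ)
      (δ δ' : ℝ), 0 < δ' → δ' < δ → GraphData k δ B η ψ A →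
      ∀ (bc : BC) (F : (Eu (m + 1) → ℝ) → ℝ) (u : Eu (m + 1) → ℝ), IsWeakSolution bc ψ A δ F u →
      ∀ a b : ℝ, 0 ≤ a → 0 ≤ b →
      (∀ v, IsAllowable bc ψ δ v →
        |F v| ≤ a * normLp (dom ψ δ) 2 v + b * normLp (dom ψ δ) 2 (weakGrad (dom ψ δ) v)) →
      normLp (dom ψ δ') 2 (weakGrad (dom ψ δ') u) ^ 2 ≤
        C * (((δ - δ') ^ 2)⁻¹ * normLp (dom ψ δ) 2 u ^ 2 + a * normLp (dom ψ δ) 2 u + b ^ 2) := by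
  obtain ⟨K, hK, hgap⟩ := exists_gap_bowl m hB
  obtain ⟨Λ, hΛ, hcb⟩ := exists_cb_flatCoef m k hB le_rfl
  set η' := η / (2 + 2 * ((m + 1 : ℕ) * B ^ 2)) with hη'
  have hη'0 : 0 < η' := by positivity
  set Q := energyConst (m + 1) η' Λ with hQ
  have hQ0 : 0 < Q := energyConst_pos _ hη'0 _
  set c := 1 + (m + 1 : ℕ) * B with hc
  have hc1 : 1 ≤ c := by rw [hc]; exact le_add_of_nonneg_right (by positivity)
  refine ⟨2 * (1 + (m + 1 : ℕ) * B ^ 2) * (Q * (K ^ 2 + 1 + c ^ 2)), by positivity,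
    fun ψ A δ δ' hδ' hδ h bc F u hu a b ha hb hF => ?_⟩
  have hδ0 := hδ'.trans hδ
  have hψ := h.contDiff_two hk
  have hψ1 := hψ.of_le one_le_two
  obtain ⟨ζ, hζ, hζ1, hζ0, hζK⟩ := hgap ψ δ' δ hψ1 hδ fun i z hz => h.abs_slope_le hz
  have hO := isOpen_flat (δ := δ) hψ.continuous
  have hg := hu.memLp_flatGrad hψ
  set μ := volume.restrict (flat ψ δ ∩ lowerHalf m) with hμ
  -- Only the size of the coefficients matters here, so the scaled bound is used at scale `0`, where
  -- its conditions on derivatives have no weight.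
  have hell : IsElliptic (flat ψ δ ∩ lowerHalf m) (flatCoef ψ A) η' Λ :=
    isElliptic_of_cb (hO.inter isOpen_lowerHalf) (hcb δ η ψ A 0 hk h le_rfl zero_le_one)
      fun x hx ξ => h.elliptic_flatCoef hη hx ξ
  have key := energy_estimate hO hη'0 hΛ hell (memLp_flat hψ.continuous hu.memH1.1) hg
    (hu.wd_flatGrad hψ) (hζ.mono bowl_subset_flat) hζ0 hζK (A := a) (B := b * c) ha (by positivity)
    fun φ hφ => by
      have ht := hφ.c1.isFlatTest
      rw [hu.flat_eqn hψ ht]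
      refine (hF _ (ht.isAllowable hψ)).trans (add_le_add (le_of_eq ?_) ?_)
      · have := ht.memLp
        rw [← shear_preimage_dom] at this ⊢
        rw [normLp, lpNorm_unshear hψ.continuous this]
      · rw [mul_assoc]
        exact mul_le_mul_of_nonneg_left (ht.lpNorm_weakGrad_le h hk hδ0) hb
  rw [lpNorm_flat hψ.continuous hu.memH1.1] at key
  set U := normLp (dom ψ δ) 2 u with hU
  have hU0 : 0 ≤ U := lpNorm_nonneg
  have hbd : ∑ i, lpNorm (fun x => ζ x * flatGrad ψ δ u i x) 2 μ ^ 2 ≤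
      Q * (K ^ 2 + 1 + c ^ 2) * (((δ - δ') ^ 2)⁻¹ * U ^ 2 + a * U + b ^ 2) := by
    refine key.trans ?_
    rw [mul_assoc Q]
    refine mul_le_mul_of_nonneg_left ?_ hQ0.le
    rw [div_pow, div_eq_mul_inv, mul_pow]
    change K ^ 2 * ((δ - δ') ^ 2)⁻¹ * U ^ 2 + a * U + b ^ 2 * c ^ 2 ≤ _
    have e1 : 0 ≤ ((δ - δ') ^ 2)⁻¹ * U ^ 2 := by positivity
    have e2 : 0 ≤ a * U := by positivity
    have e3 : 0 ≤ b ^ 2 := by positivity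
    have e4 : 0 ≤ K ^ 2 := by positivity
    have e5 : 0 ≤ c ^ 2 := by positivity
    -- The common factor `K ^ 2 + 1 + c ^ 2` dominates the three separate coefficients `K ^ 2`, `1`
    -- and `c ^ 2`.
    nlinarith [mul_nonneg e4 e2, mul_nonneg e4 e3, mul_nonneg e5 e1, mul_nonneg e5 e2]
  have hw := hu.memH1.wd (isOpen_dom hψ.continuous)
  have hμd := Measure.restrict_mono (dom_mono (ψ := ψ) hδ.le)
    (le_refl (volume : Measure (Eu (m + 1))))
  have hflat' : flat ψ δ' ∩ lowerHalf m ⊆ flat ψ δ ∩ lowerHalf m :=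
    inter_subset_inter_left _ (flat_mono hδ.le)
  have hμf := Measure.restrict_mono hflat' (le_refl (volume : Measure (Eu (m + 1))))
  have hmem : ∀ i, MemLp (fun x => weakGrad (dom ψ δ') u x i) 2
      (volume.restrict (dom ψ δ')) := fun i =>
    ((hw i).2.mono_measure hμd).ae_eq (weakDeriv_single_mono hψ.continuous hδ.le hu.memH1 i).symm
  have hloc : ∀ i, lpNorm (flatGrad ψ δ u i) 2 (volume.restrict (flat ψ δ' ∩ lowerHalf m)) ≤
      lpNorm (fun x => ζ x * flatGrad ψ δ u i x) 2 μ := fun i => by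
    have e : lpNorm (flatGrad ψ δ u i) 2 (volume.restrict (flat ψ δ' ∩ lowerHalf m)) =
        lpNorm (fun x => ζ x * flatGrad ψ δ u i x) 2
          (volume.restrict (flat ψ δ' ∩ lowerHalf m)) := by
      refine lpNorm_congr_ae ((ae_restrict_iff' ((isOpen_flat hψ.continuous).inter
        isOpen_lowerHalf).measurableSet).2 (Eventually.of_forall fun y hy => ?_))
      rw [← bowl_inter hδ'.le] at hy
      simp [hζ1 y hy.1]
    rw [e]
    exact lpNorm_mono_measure (memLp_bdd_mul (hg i) hζ.1.continuous.aestronglyMeasurable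
      (Eventually.of_forall fun y => (abs_le.2 ⟨by linarith [(hζ0 y).1], (hζ0 y).2⟩ : |ζ y| ≤ 1))) hμf
  have h' : GraphData k δ' B η ψ A :=
    ⟨h.psi, fun j hj y hy => h.psi_bound j hj y (Metric.ball_subset_ball hδ.le hy),
      fun i l => (h.A_smooth i l).mono (dom_mono hδ.le),
      fun i l j hj x hx => h.A_bound i l j hj x (dom_mono hδ.le hx),
      fun x hx => h.A_elliptic x (dom_mono hδ.le hx)⟩
  have hcomp : ∀ i, lpNorm (fun x => weakGrad (dom ψ δ') u x i) 2 (volume.restrict (dom ψ δ')) ≤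
      lpNorm (fun x => ζ x * flatGrad ψ δ u i x) 2 μ +
        B * lpNorm (fun x => ζ x * flatGrad ψ δ u (Fin.last m) x) 2 μ := fun i => by
    have e := h'.lpNorm_sub_slope_le hk hδ' ((hg i).mono_measure hμf)
      ((hg (Fin.last m)).mono_measure hμf) i
    simp_rw [flatGrad_sub] at e
    rw [lpNorm_flat hψ.continuous ((hw i).2.mono_measure hμd)] at e
    rw [show lpNorm (fun x => weakGrad (dom ψ δ') u x i) 2 (volume.restrict (dom ψ δ')) = _ from
      lpNorm_congr_ae (weakDeriv_single_mono hψ.continuous hδ.le hu.memH1 i)]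
    exact e.trans (add_le_add (hloc i) (mul_le_mul_of_nonneg_left (hloc _) hB))
  rw [normLp, sq_lpNorm_vec hmem]
  set Z : Fin (m + 1) → ℝ := fun i => lpNorm (fun x => ζ x * flatGrad ψ δ u i x) 2 μ with hZ
  have hZs : Z (Fin.last m) ^ 2 ≤ ∑ i, Z i ^ 2 := Finset.single_le_sum (f := fun i => Z i ^ 2)
    (fun _ _ => sq_nonneg _) (Finset.mem_univ _)
  calc ∑ i, lpNorm (fun x => weakGrad (dom ψ δ') u x i) 2 (volume.restrict (dom ψ δ')) ^ 2
      ≤ ∑ i, (2 * Z i ^ 2 + 2 * (B ^ 2 * Z (Fin.last m) ^ 2)) := by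
        refine Finset.sum_le_sum fun i _ => ?_
        refine (pow_le_pow_left₀ lpNorm_nonneg (hcomp i) 2).trans ?_
        change (Z i + B * Z (Fin.last m)) ^ 2 ≤ _
        nlinarith [sq_nonneg (Z i - B * Z (Fin.last m))]
    _ = 2 * ∑ i, Z i ^ 2 + (m + 1 : ℕ) * (2 * (B ^ 2 * Z (Fin.last m) ^ 2)) := by
        rw [Finset.sum_add_distrib, ← Finset.mul_sum]
        simp
    _ ≤ 2 * (1 + (m + 1 : ℕ) * B ^ 2) * ∑ i, Z i ^ 2 := by
        have := mul_le_mul_of_nonneg_left hZs (show (0 : ℝ) ≤ (m + 1 : ℕ) * B ^ 2 by positivity)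
        nlinarith
    _ ≤ _ := by
        rw [mul_assoc (2 * (1 + ((m + 1 : ℕ) : ℝ) * B ^ 2))]
        exact mul_le_mul_of_nonneg_left hbd (by positivity)

end Energy

/-! ### Between `H^k` norms and scaled bounds. -/

section Sobolev

variable {n : ℕ} {W : Set (Eu n)} {u : Eu n → ℝ} {ε M : ℝ} {k : ℕ}

lemma MemH.sobB (hW : IsOpen W) (hε : 0 < ε) (h : MemH W k u)
    (hM : ∀ α, order α ≤ k → ε ^ order α * lpNorm (BoundaryEstimates.weakDeriv W α u) 2
      (volume.restrict W) ≤ M) : SobB W ε k u M := by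
  have key : ∀ (j : ℕ) (β : Fin n → ℕ), order β + j ≤ k →
      SobB W ε j (fun x => ε ^ order β * BoundaryEstimates.weakDeriv W β u x) M := by
    intro j
    have base : ∀ β : Fin n → ℕ, order β ≤ k →
        MemLp (fun x => ε ^ order β * BoundaryEstimates.weakDeriv W β u x) 2
          (volume.restrict W) ∧ lpNorm (fun x => ε ^ order β *
            BoundaryEstimates.weakDeriv W β u x) 2 (volume.restrict W) ≤ M := fun β hβ => by
      refine ⟨(h.weakDeriv hW hβ).2.const_mul _, ?_⟩
      rw [lpNorm_const_mul (by positivity)]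
      exact hM β hβ
    induction j with
    | zero => exact fun β hβ => base β hβ
    | succ j ih =>
      refine fun β hβ => ⟨base β (by omega), fun i => ?_⟩
      have hi : order (β + Pi.single i 1) ≤ k := by rw [order_add_single]; omega
      refine ⟨_, ((h.weakDeriv hW (α := β) (by omega)).1.wd_of_add_single
        (h.weakDeriv hW hi).1).const_mul (ε ^ order β), ?_⟩
      have := ih (β + Pi.single i 1) (by rw [order_add_single]; omega)
      rw [order_add_single, pow_succ'] at this
      simpa only [mul_assoc] using this
  have h0 := key k 0 (by simp [order])
  refine h0.congr ?_
  filter_upwards [(IsWeakDeriv.zero (locallyIntegrableOn_of_memLp h.1)).ae_eq hW] with x hx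
  simp [order, hx]

lemma SobB.isWeakDeriv (hε : 0 < ε) (h : SobB W ε k u M) {α : Fin n → ℕ} (hα : order α ≤ k) :
    ∃ g, IsWeakDeriv W α u g ∧ SobB W ε (k - order α) (fun x => ε ^ order α * g x) M := by
  generalize hj : order α = j at hα ⊢
  induction j generalizing α with
  | zero =>
    rw [order_eq_zero hj]
    exact ⟨u, IsWeakDeriv.zero (locallyIntegrableOn_of_memLp h.base.1), by simpa using h⟩
  | succ j ih =>
    obtain ⟨β, i, rfl, hβ⟩ := exists_eq_add_single hj
    obtain ⟨g, hg, hs⟩ := ih hβ (by omega)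
    rw [show k - j = (k - (j + 1)) + 1 by omega] at hs
    obtain ⟨g', hD, hs'⟩ := hs.sobD i
    have hεj : ε ^ j ≠ 0 := (pow_pos hε j).ne'
    have hD' := hD.const_mul (ε ^ j)⁻¹
    simp only [inv_mul_cancel_left₀ hεj] at hD'
    have hm : MemLp (fun x => (ε ^ j)⁻¹ * g' x) 2 (volume.restrict W) :=
      (SobB.memLp_of_mul hε.ne' hs').const_mul _
    refine ⟨_, hg.add_single (locallyIntegrableOn_of_memLp hm) hD', ?_⟩
    refine hs'.congr (Eventually.of_forall fun x => ?_)
    simp only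
    rw [pow_succ', mul_assoc, mul_inv_cancel_left₀ hεj]

lemma SobB.scale {c : ℝ} (hc : 0 < c) (h : SobB W ε k u (M / c)) :
    SobB W ε k (fun x => c * u x) M := by
  have := h.const_mul c
  rwa [abs_of_pos hc, mul_div_cancel₀ _ hc.ne'] at this

lemma lpNorm_weakDeriv_le_normH {j : ℕ} {α : Fin n → ℕ} (hα : order α ≤ j) :
    lpNorm (weakDeriv W α u) 2 (volume.restrict W) ≤ normH W j u := by
  refine Real.le_sqrt_of_sq_le ?_
  refine le_trans ?_ (Finset.single_le_sum (f := fun j => ∑ α ∈ Finset.piAntidiag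
    (Finset.univ : Finset (Fin n)) j, normLp W 2 (weakDeriv W α u) ^ 2)
    (fun _ _ => Finset.sum_nonneg fun _ _ => sq_nonneg _)
    (Finset.mem_range.2 (Nat.lt_succ_of_le hα)))
  exact Finset.single_le_sum (f := fun α => normLp W 2 (weakDeriv W α u) ^ 2)
    (fun _ _ => sq_nonneg _) (by simp [order])

lemma normH_le_normHVec {Φ : Eu n → Eu n} (j : ℕ) (i : Fin n) :
    normH W j (fun x => Φ x i) ≤ normHVec W j Φ :=
  Real.sqrt_le_sqrt (Finset.single_le_sum (f := fun i => normHSq W j fun x => Φ x i)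
    (fun _ _ => Finset.sum_nonneg fun _ _ => Finset.sum_nonneg fun _ _ => sq_nonneg _)
    (Finset.mem_univ i))

lemma lpNorm_apply_le {Φ : Eu n → Eu n} (hΦ : ∀ i, MemLp (fun x => Φ x i) 2 (volume.restrict W))
    (i : Fin n) : lpNorm (fun x => Φ x i) 2 (volume.restrict W) ≤
      lpNorm Φ 2 (volume.restrict W) := by
  refine le_of_sq_le_sq ?_ lpNorm_nonneg
  rw [sq_lpNorm_vec hΦ]
  exact Finset.single_le_sum (f := fun i => lpNorm (fun x => Φ x i) 2 (volume.restrict W) ^ 2)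
    (fun _ _ => sq_nonneg _) (Finset.mem_univ i)

end Sobolev

/-! ### The higher order estimate on `W_δ`. -/

section Regularity

variable {m k : ℕ} {ψ : Eu m → ℝ} {δ B η : ℝ}
  {A : Eu (m + 1) → Matrix (Fin (m + 1)) (Fin (m + 1)) ℝ} {bc : BC}
  {F : (Eu (m + 1) → ℝ) → ℝ} {u φ : Eu (m + 1) → ℝ} {Φ : Eu (m + 1) → Eu (m + 1)}

/-- The vector field `Φ` in straightened coordinates. -/
noncomputable def flatField (ψ : Eu m → ℝ) (Φ : Eu (m + 1) → Eu (m + 1)) (i : Fin (m + 1))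
    (y : Eu (m + 1)) : ℝ := ∑ l, tilt ψ l i y * Φ (shear ψ y) l

lemma IsWeakSolution.flatSol (hψ : ContDiff ℝ 2 ψ) (h : IsWeakSolution bc ψ A δ F u)
    (hφ : MemLp φ 2 (volume.restrict (dom ψ δ)))
    (hΦ : ∀ i, MemLp (flatField ψ Φ i) 2 (volume.restrict (flat ψ δ ∩ lowerHalf m)))
    (hF : ∀ v, IsAllowable bc ψ δ v →
      F v = ∫ x in dom ψ δ, (φ x * v x + inner ℝ (Φ x) (weakGrad (dom ψ δ) v x))) :
    FlatSol bc (flat ψ δ) (flatCoef ψ A) (fun y => φ (shear ψ y)) (flatField ψ Φ)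
      (fun y => u (shear ψ y)) (flatGrad ψ δ u) where
  memLp_u := memLp_flat hψ.continuous h.memH1.1
  memLp_g := h.memLp_flatGrad hψ
  memLp_f := memLp_flat hψ.continuous hφ
  memLp_Φ := hΦ
  grad := h.wd_flatGrad hψ
  eqn v hv := by
    have ht := hv.c1.isFlatTest
    rw [h.flat_eqn hψ ht, hF _ (ht.isAllowable hψ), ← shear_preimage_dom]
    have := setIntegral_shear hψ.continuous (dom ψ δ) fun x =>
      φ x * v (shear (fun y => -ψ y) x) + ∑ l, Φ x l *
        (partialD l v (shear (fun y => -ψ y) x) - slope ψ l x *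
          partialD (Fin.last m) v (shear (fun y => -ψ y) x))
    simp only [shear_neg_shear, slope_shear] at this
    refine Eq.trans (integral_congr_ae ?_) (this.symm.trans ?_)
    · filter_upwards [ae_all_iff.2 fun i => ((ht.isAllowable_and hψ).2 i).2] with x hx
      rw [PiLp.inner_apply]
      congr 1
      refine Finset.sum_congr rfl fun i _ => ?_
      simp [weakGrad, hx i, mul_comm]
    · congr 1
      ext y
      congr 1
      simp_rw [flatField, Finset.sum_mul]
      rw [Finset.sum_comm]
      refine Finset.sum_congr rfl fun l _ => ?_
      rw [← sum_tilt_mul ψ l y fun i => partialD i v y, Finset.mul_sum]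
      refine Finset.sum_congr rfl fun i _ => ?_
      ring

lemma neg_cb_slope (h : GraphData k δ B η ψ A) {W : Set (Eu (m + 1))} (hW : IsOpen W)
    (hWδ : ∀ z ∈ W, ‖horiz z‖ < δ) {ε E : ℝ} (hε : 0 ≤ ε) (hE : ε ≤ E) (hE1 : 1 ≤ E)
    (i : Fin (m + 1)) : CB W ε k (slope (fun y => -ψ y) i) (E ^ k * B) := by
  refine cb_slope (ψ := fun y => -ψ y) h.psi.neg (fun j hj y hy => ?_) hW hWδ hε hE hE1 i
  rw [show (fun y => -ψ y) = -ψ from rfl, iteratedFDeriv_neg_apply, norm_neg]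
  exact h.psi_bound j hj y hy

/-- The flat regularity theorem applied to bowls of decreasing radius, followed by the shear with
`-ψ`. The slopes of `ψ` have derivatives up to order `k` bounded, which covers both the order `j` of
the data and the order `j + 1` of the solution. -/
theorem exists_sobolev_bound (m k j : ℕ) (hj : j + 1 ≤ k) {B η E : ℝ} (hB : 0 ≤ B) (hη : 0 < η)
    (hE : 1 ≤ E) : ∃ C, 0 < C ∧
    ∀ (ψ : Eu m → ℝ) (A : Eu (m + 1) → Matrix (Fin (m + 1)) (Fin (m + 1)) ℝ) (δ δ' : ℝ),
      0 < δ' → δ' < δ → δ ≤ E → GraphData k δ B η ψ A →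
      ∀ (bc : BC) (F : (Eu (m + 1) → ℝ) → ℝ) (u : Eu (m + 1) → ℝ), IsWeakSolution bc ψ A δ F u →
      ∀ (φ : Eu (m + 1) → ℝ) (Φ : Eu (m + 1) → Eu (m + 1)) (M : ℝ),
      (∀ v, IsAllowable bc ψ δ v →
        F v = ∫ x in dom ψ δ, (φ x * v x + inner ℝ (Φ x) (weakGrad (dom ψ δ) v x))) →
      lpNorm u 2 (volume.restrict (dom ψ δ)) ≤ M →
      SobB (dom ψ δ) (δ - δ') (j - 1) (fun x => (δ - δ') ^ 2 * φ x) M →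
      (∀ i, SobB (dom ψ δ) (δ - δ') j (fun x => (δ - δ') * Φ x i) M) →
      SobB (dom ψ δ') (δ - δ') (j + 1) u (C * M) := by
  have hk : 1 ≤ k := by omega
  obtain ⟨L, hL⟩ := FlatSol.regularity m j
  obtain ⟨K, hK, hgap⟩ := exists_gap_bowl m hB
  obtain ⟨Λ, hΛ, hcb⟩ := exists_cb_flatCoef m k hB hE
  have hη' : 0 < η / (2 + 2 * ((m + 1 : ℕ) * B ^ 2)) := by positivity
  -- `L` does not depend on the gap constant, so the distance `ε` can be cut into `L + 1` equal
  -- steps; each cutoff then has gradient at most `K (L + 1) / ε`.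
  obtain ⟨C₁, hC₁, hreg⟩ := hL _ Λ (K * (L + 1)) hη' hΛ
  have hS : 0 ≤ E ^ k * B := by positivity
  obtain ⟨C₂, hC₂, hshear⟩ := SobB.exists_shear m j hS
  obtain ⟨C₃, hC₃, hshear'⟩ := SobB.exists_shear m (j - 1) hS
  obtain ⟨C₄, hC₄, hunshear⟩ := SobB.exists_shear m (j + 1) hS
  set T := ((Finset.univ : Finset (Fin (m + 1))).card : ℝ) *
    (2 ^ j * ((1 + 2 ^ k * (E ^ k * B)) * C₂)) with hT
  have hT0 : 0 ≤ T := by positivity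
  refine ⟨C₄ * (C₁ * (1 + C₃ + T)) + 1, by positivity,
    fun ψ A δ δ' hδ' hδ hδE h bc F u hu φ Φ M hF hM hφ hΦ => ?_⟩
  set ε := δ - δ' with hε
  have hε0 : 0 < ε := sub_pos.2 hδ
  have hεE : ε ≤ E := by linarith
  have hδ0 := hδ'.trans hδ
  have hψ := h.contDiff_two hk
  have hψ1 := hψ.of_le one_le_two
  have hM0 : 0 ≤ M := lpNorm_nonneg.trans hM
  have hO := (isOpen_flat (δ := δ) hψ.continuous).inter (isOpen_lowerHalf (m := m))
  have hdom := isOpen_dom (δ := δ) hψ.continuous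
  have hs : ∀ i, CB (flat ψ δ ∩ lowerHalf m) ε k (slope ψ i) (E ^ k * B) := fun i =>
    cb_slope h.psi h.psi_bound hO (fun z hz => (mem_flat.1 hz.1).1) hε0.le hεE hE i
  have hs' := hs
  rw [← shear_preimage_dom] at hs'
  have hΦf : ∀ i, SobB (flat ψ δ ∩ lowerHalf m) ε j (fun y => ε * flatField ψ Φ i y) (T * M) := by
    intro i
    have hterm : ∀ l, SobB (flat ψ δ ∩ lowerHalf m) ε j
        (fun y => tilt ψ l i y * (ε * Φ (shear ψ y) l))
        (2 ^ j * ((1 + 2 ^ k * (E ^ k * B)) * (C₂ * M))) := fun l => by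
      refine SobB.mul hO hε0 (by positivity) ((cb_tilt hO hS hs l i).of_le (by omega)) ?_
      have := hshear ψ (dom ψ δ) ε _ M hψ hdom hε0 (fun i => (hs' i).of_le (by omega)) (hΦ l)
      rwa [shear_preimage_dom] at this
    refine ((SobB.sum hε0.ne' Finset.univ fun l _ => hterm l).congr
      (Eventually.of_forall fun y => ?_)).mono_const (le_of_eq (by rw [hT]; ring))
    simp only [flatField, Finset.mul_sum]
    exact Finset.sum_congr rfl fun l _ => by ring
  have hφf : SobB (flat ψ δ ∩ lowerHalf m) ε (j - 1) (fun y => ε ^ 2 * φ (shear ψ y))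
      (C₃ * M) := by
    have := hshear' ψ (dom ψ δ) ε _ M hψ hdom hε0 (fun i => (hs' i).of_le (by omega)) hφ
    rwa [shear_preimage_dom] at this
  have hsol := hu.flatSol hψ (SobB.memLp_of_mul (k := 0) (pow_pos hε0 2).ne' hφ.base)
    (fun i => SobB.memLp_of_mul hε0.ne' (hΦf i)) hF
  set D : ℕ → Set (Eu (m + 1)) := fun t => bowl ψ (δ - t * (ε / (L + 1))) with hD
  have hD0 : D 0 ∩ lowerHalf m = flat ψ δ ∩ lowerHalf m := by
    simp only [hD, Nat.cast_zero, zero_mul, sub_zero]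
    exact bowl_inter hδ0.le
  have hle : ∀ X Y : ℝ, X ≤ 1 + C₃ + T → 0 ≤ Y → X * Y ≤ (1 + C₃ + T) * Y := fun X Y hX hY =>
    mul_le_mul_of_nonneg_right hX hY
  have hmain := hreg bc D ε hε0 (fun t => isOpen_bowl hψ.continuous _) (fun t => ?_)
    (flatCoef ψ A) (fun y => φ (shear ψ y)) (fun y => u (shear ψ y)) (flatField ψ Φ)
    (flatGrad ψ δ u) ((1 + C₃ + T) * M)
    (hsol.restrict (isOpen_flat hψ.continuous) (by
      simp only [hD, Nat.cast_zero, zero_mul, sub_zero]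
      exact bowl_subset_flat))
    (by rw [hD0]; exact fun y hy ξ => h.elliptic_flatCoef hη hy ξ)
    (by rw [hD0]; exact fun l q => (hcb δ η ψ A ε hk h hε0.le hεE l q).of_le (by omega))
    (by
      rw [hD0, lpNorm_flat hψ.continuous hu.memH1.1]
      exact hM.trans (le_mul_of_one_le_left hM0 (by linarith)))
    (by rw [hD0]; exact hφf.mono_const (hle _ _ (by linarith) hM0))
    (by rw [hD0]; exact fun l => (hΦf l).mono_const (hle _ _ (by linarith) hM0))
  -- After `L` steps of length `ε / (L + 1)` the radius is still at least `δ'`.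
  · have hsub : flat ψ δ' ∩ lowerHalf m ⊆ D L ∩ lowerHalf m := by
      have hle : δ' ≤ δ - L * (ε / (L + 1)) := by
        have : (L : ℝ) * (ε / (L + 1)) ≤ ε := by
          rw [← mul_div_assoc, div_le_iff₀ (by positivity)]
          nlinarith
        linarith
      rw [hD]
      simp only
      rw [bowl_inter (hδ'.le.trans hle)]
      exact inter_subset_inter_left _ (flat_mono hle)
    have hfl := hmain.restrict
      ((isOpen_bowl hψ.continuous _).inter isOpen_lowerHalf).measurableSet hsub
    have hdom' := isOpen_dom (δ := δ') hψ.continuous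
    rw [← shear_preimage_dom] at hfl
    have hback := hunshear (fun y => -ψ y) (shear ψ ⁻¹' dom ψ δ') ε _ _ hψ.neg
      (hdom'.preimage (continuous_shear hψ.continuous)) hε0 (fun i => ?_) hfl
    · rw [preimage_shear_neg] at hback
      simp only [shear_shear_neg] at hback
      refine hback.mono_const ?_
      rw [← mul_assoc, ← mul_assoc, add_mul, mul_assoc C₄]
      linarith
    · rw [preimage_shear_neg]
      exact (neg_cb_slope h hdom' (fun z hz => hz.1.trans hδ) hε0.le hεE hE i).of_le (by omega)
  · have hstep : 0 < ε / (L + 1) := by positivity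
    have := hgap ψ (δ - (t + 1 : ℕ) * (ε / (L + 1))) (δ - t * (ε / (L + 1))) hψ1
      (by push_cast; linarith) fun i z hz => h.abs_slope_le (hz.trans_le
        (by have : 0 ≤ t * (ε / (L + 1)) := by positivity
            linarith))
    rwa [show δ - (t : ℝ) * (ε / (L + 1)) - (δ - (t + 1 : ℕ) * (ε / (L + 1))) = ε / (L + 1) by
      push_cast; ring, div_div_eq_mul_div] at this

end Regularity

/-! ### The norms of the data appearing in the higher order estimate. -/

section SobolevBound

variable {n : ℕ} {W : Set (Eu n)} {ε : ℝ} {φ : Eu n → ℝ} {Φ : Eu n → Eu n}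

/-- The bracket bounding the derivatives of order `j` of the solution. -/
noncomputable def dataNorm (W : Set (Eu n)) (ε : ℝ) (j : ℕ) (u φ : Eu n → ℝ)
    (Φ : Eu n → Eu n) : ℝ :=
  normLp W 2 u + ε ^ 2 * normLp W 2 φ + ε * normLp W 2 Φ +
    ∑ i ∈ Finset.Icc 1 (j - 1), ε ^ (i + 1) * (normH W (i - 1) φ + normHVec W i Φ)

lemma dataNorm_bounds (hε : 0 < ε) (j : ℕ) (u φ : Eu n → ℝ) (Φ : Eu n → Eu n) :
    0 ≤ normLp W 2 u ∧ 0 ≤ ε ^ 2 * normLp W 2 φ ∧ 0 ≤ ε * normLp W 2 Φ ∧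
    (∀ i, 0 ≤ ε ^ (i + 1) * (normH W (i - 1) φ + normHVec W i Φ)) ∧
    0 ≤ ∑ i ∈ Finset.Icc 1 (j - 1), ε ^ (i + 1) * (normH W (i - 1) φ + normHVec W i Φ) ∧
    ∀ i, 1 ≤ i → i ≤ j - 1 → ε ^ (i + 1) * (normH W (i - 1) φ + normHVec W i Φ) ≤
      ∑ i ∈ Finset.Icc 1 (j - 1), ε ^ (i + 1) * (normH W (i - 1) φ + normHVec W i Φ) := by
  have h : ∀ i, 0 ≤ ε ^ (i + 1) * (normH W (i - 1) φ + normHVec W i Φ) := fun i =>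
    mul_nonneg (by positivity) (add_nonneg (Real.sqrt_nonneg _) (Real.sqrt_nonneg _))
  exact ⟨lpNorm_nonneg, mul_nonneg (by positivity) lpNorm_nonneg, mul_nonneg hε.le lpNorm_nonneg,
    h, Finset.sum_nonneg fun i _ => h i, fun i h1 h2 =>
      Finset.single_le_sum (f := fun i => ε ^ (i + 1) * (normH W (i - 1) φ + normHVec W i Φ))
        (fun i _ => h i) (Finset.mem_Icc.2 ⟨h1, h2⟩)⟩

lemma weakDeriv_zero_ae (hW : IsOpen W) {u : Eu n → ℝ} (hu : MemLp u 2 (volume.restrict W))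
    {α : Fin n → ℕ} (hα : order α = 0) : weakDeriv W α u =ᵐ[volume.restrict W] u := by
  rw [order_eq_zero hα]
  exact (IsWeakDeriv.zero (locallyIntegrableOn_of_memLp hu)).ae_eq hW

/-- A derivative of order `s ≥ 1` of `ε² φ` carries `ε^{s+2}`, which is the term `i = s + 1` of the
bracket; for the field, order `s` carries `ε^{s+1}` and belongs to `i = s`. The index `j + 1` makes
the sum run up to `i = j`. -/
lemma sobB_scalar (hW : IsOpen W) (hε : 0 < ε) {j : ℕ} (hφ : MemH W (j - 1) φ)
    (u : Eu n → ℝ) (Φ : Eu n → Eu n) :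
    SobB W ε (j - 1) (fun x => ε ^ 2 * φ x) (dataNorm W ε (j + 1) u φ Φ) := by
  refine SobB.scale (pow_pos hε 2) (hφ.sobB hW hε fun α hα => ?_)
  rw [le_div_iff₀ (pow_pos hε 2), dataNorm]
  obtain ⟨h1, h2, h3, h4, h5, h6⟩ := dataNorm_bounds (W := W) hε (j + 1) u φ Φ
  rcases Nat.eq_zero_or_pos (order α) with h0 | h0
  · rw [h0, pow_zero, one_mul, lpNorm_congr_ae (weakDeriv_zero_ae hW hφ.1 h0), mul_comm]
    change ε ^ 2 * normLp W 2 φ ≤ _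
    linarith
  · have h7 := h6 (order α + 1) (by omega) (by omega)
    have h8 : ε ^ order α * lpNorm (weakDeriv W α φ) 2 (volume.restrict W) * ε ^ 2 ≤
        ε ^ (order α + 1 + 1) * (normH W (order α + 1 - 1) φ + normHVec W (order α + 1) Φ) := by
      rw [mul_right_comm, ← pow_add]
      refine mul_le_mul_of_nonneg_left ((lpNorm_weakDeriv_le_normH le_rfl).trans
        (le_add_of_nonneg_right (Real.sqrt_nonneg _))) (by positivity)
    linarith

lemma sobB_field (hW : IsOpen W) (hε : 0 < ε) {j : ℕ} (hΦ : ∀ i, MemH W j fun x => Φ x i)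
    (u φ : Eu n → ℝ) (i : Fin n) :
    SobB W ε j (fun x => ε * Φ x i) (dataNorm W ε (j + 1) u φ Φ) := by
  refine SobB.scale hε ((hΦ i).sobB hW hε fun α hα => ?_)
  rw [le_div_iff₀ hε, dataNorm]
  obtain ⟨h1, h2, h3, h4, h5, h6⟩ := dataNorm_bounds (W := W) hε (j + 1) u φ Φ
  rcases Nat.eq_zero_or_pos (order α) with h0 | h0
  · rw [h0, pow_zero, one_mul, lpNorm_congr_ae (weakDeriv_zero_ae hW (hΦ i).1 h0), mul_comm]
    have := mul_le_mul_of_nonneg_left (lpNorm_apply_le (fun i => (hΦ i).1) i) hε.le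
    change _ ≤ ε * normLp W 2 Φ at this
    linarith
  · have h7 := h6 (order α) (by omega) (by omega)
    have h8 : ε ^ order α * lpNorm (weakDeriv W α fun x => Φ x i) 2 (volume.restrict W) * ε ≤
        ε ^ (order α + 1) * (normH W (order α - 1) φ + normHVec W (order α) Φ) := by
      rw [mul_right_comm, ← pow_succ]
      refine mul_le_mul_of_nonneg_left (((lpNorm_weakDeriv_le_normH le_rfl).trans
        (normH_le_normHVec _ i)).trans (le_add_of_nonneg_left (Real.sqrt_nonneg _)))
        (by positivity)
    linarith

end SobolevBound

/-- The flat estimate is applied once for each order, with exactly the data norms allowed at that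
order; the estimate of the highest order alone would bring in too many norms of the data for the
lower ones. -/
theorem exists_regularity_const (m k : ℕ) (hk : 1 ≤ k) {B η E : ℝ} (hB : 0 ≤ B) (hη : 0 < η)
    (hE : 1 ≤ E) : ∃ C, 0 < C ∧
    ∀ (ψ : Eu m → ℝ) (A : Eu (m + 1) → Matrix (Fin (m + 1)) (Fin (m + 1)) ℝ) (δ δ' : ℝ),
      0 < δ' → δ' < δ → δ ≤ E → GraphData k δ B η ψ A →
      ∀ (bc : BC) (F : (Eu (m + 1) → ℝ) → ℝ) (u : Eu (m + 1) → ℝ), IsWeakSolution bc ψ A δ F u →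
      ∀ (φ : Eu (m + 1) → ℝ) (Φ : Eu (m + 1) → Eu (m + 1)),
      MemH (dom ψ δ) (k - 2) φ → (∀ i, MemH (dom ψ δ) (k - 1) (fun x => Φ x i)) →
      (∀ v, IsAllowable bc ψ δ v →
        F v = ∫ x in dom ψ δ, (φ x * v x + inner ℝ (Φ x) (weakGrad (dom ψ δ) v x))) →
      MemH (dom ψ δ') k u ∧
      ∀ j ∈ Finset.Icc 1 k,
        ∑ α ∈ Finset.piAntidiag (Finset.univ : Finset (Fin (m + 1))) j,
            normLp (dom ψ δ') 2 (weakDeriv (dom ψ δ') α u) ≤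
          C * ((δ - δ') ^ j)⁻¹ * dataNorm (dom ψ δ) (δ - δ') j u φ Φ := by
  -- Orders beyond `k` receive the dummy constant `1`, so that constants can be chosen for all `j`
  -- at once; only those with `j < k` enter the final sum.
  have hex : ∀ j : ℕ, ∃ C, 0 < C ∧ (j + 1 ≤ k → ∀ (ψ : Eu m → ℝ)
      (A : Eu (m + 1) → Matrix (Fin (m + 1)) (Fin (m + 1)) ℝ) (δ δ' : ℝ),
      0 < δ' → δ' < δ → δ ≤ E → GraphData k δ B η ψ A →
      ∀ (bc : BC) (F : (Eu (m + 1) → ℝ) → ℝ) (u : Eu (m + 1) → ℝ), IsWeakSolution bc ψ A δ F u →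
      ∀ (φ : Eu (m + 1) → ℝ) (Φ : Eu (m + 1) → Eu (m + 1)) (M : ℝ),
      (∀ v, IsAllowable bc ψ δ v →
        F v = ∫ x in dom ψ δ, (φ x * v x + inner ℝ (Φ x) (weakGrad (dom ψ δ) v x))) →
      lpNorm u 2 (volume.restrict (dom ψ δ)) ≤ M →
      SobB (dom ψ δ) (δ - δ') (j - 1) (fun x => (δ - δ') ^ 2 * φ x) M →
      (∀ i, SobB (dom ψ δ) (δ - δ') j (fun x => (δ - δ') * Φ x i) M) →
      SobB (dom ψ δ') (δ - δ') (j + 1) u (C * M)) := fun j => by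
    by_cases hj : j + 1 ≤ k
    · obtain ⟨C, hC, h⟩ := exists_sobolev_bound m k j hj hB hη hE
      exact ⟨C, hC, fun _ => h⟩
    · exact ⟨1, one_pos, fun h => absurd h hj⟩
  choose C hC hsob using hex
  set c : ℕ → ℝ := fun j =>
    ((Finset.piAntidiag (Finset.univ : Finset (Fin (m + 1))) (j + 1)).card : ℝ) * C j with hc
  have hc0 : ∀ j, 0 ≤ c j := fun j => mul_nonneg (Nat.cast_nonneg _) (hC j).le
  refine ⟨∑ j ∈ Finset.range k, c j + 1, add_pos_of_nonneg_of_pos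
    (Finset.sum_nonneg fun j _ => hc0 j) one_pos,
    fun ψ A δ δ' hδ' hδ hδE h bc F u hu φ Φ hφ hΦ hF => ?_⟩
  have hε : 0 < δ - δ' := sub_pos.2 hδ
  have hψ := h.psi.continuous
  have main : ∀ j, j + 1 ≤ k → SobB (dom ψ δ') (δ - δ') (j + 1) u
      (C j * dataNorm (dom ψ δ) (δ - δ') (j + 1) u φ Φ) := fun j hj => by
    refine hsob j hj ψ A δ δ' hδ' hδ hδE h bc F u hu φ Φ _ hF ?_
      (sobB_scalar (isOpen_dom hψ) hε (hφ.mono (by omega)) u Φ)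
      (sobB_field (isOpen_dom hψ) hε (fun i => (hΦ i).mono (by omega)) u φ)
    obtain ⟨h1, h2, h3, h4, h5, h6⟩ := dataNorm_bounds (W := dom ψ δ) hε (j + 1) u φ Φ
    change normLp (dom ψ δ) 2 u ≤ _
    rw [dataNorm]
    linarith
  have hdom' := isOpen_dom (δ := δ') hψ
  refine ⟨⟨?_, fun α hα => ?_⟩, fun j hj => ?_⟩
  · have := main (k - 1) (by omega)
    exact this.base.1
  · have := main (k - 1) (by omega)
    rw [Nat.sub_add_cancel hk] at this
    obtain ⟨g, hg, hs⟩ := this.isWeakDeriv hε hα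
    have hm := hs.base.1.const_mul ((δ - δ') ^ order α)⁻¹
    refine ⟨g, hg, hm.ae_eq (Eventually.of_forall fun x => ?_)⟩
    simp [inv_mul_cancel_left₀ (pow_pos hε (order α)).ne']
  · obtain ⟨h1, h2⟩ := Finset.mem_Icc.1 hj
    obtain ⟨i, rfl⟩ : ∃ i, j = i + 1 := ⟨j - 1, by omega⟩
    have hD : 0 ≤ dataNorm (dom ψ δ) (δ - δ') (i + 1) u φ Φ :=
      nonneg_of_mul_nonneg_right (main i h2).nonneg (hC i)
    have hα : ∀ α ∈ Finset.piAntidiag (Finset.univ : Finset (Fin (m + 1))) (i + 1),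
        normLp (dom ψ δ') 2 (weakDeriv (dom ψ δ') α u) ≤
          ((δ - δ') ^ (i + 1))⁻¹ * (C i * dataNorm (dom ψ δ) (δ - δ') (i + 1) u φ Φ) := by
      intro α hα
      have ho : order α = i + 1 := by simpa [order] using (Finset.mem_piAntidiag.1 hα).1
      obtain ⟨g, hg, hs⟩ := (main i h2).isWeakDeriv hε ho.le
      rw [normLp, lpNorm_congr_ae (hg.ae_eq hdom'), ← div_eq_inv_mul,
        le_div_iff₀ (pow_pos hε _), mul_comm, ← lpNorm_const_mul (by positivity), ← ho]
      rw [← ho] at hs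
      exact hs.base.2
    refine (Finset.sum_le_card_nsmul _ _ _ hα).trans ?_
    rw [nsmul_eq_mul]
    have hle : c i ≤ ∑ j ∈ Finset.range k, c j + 1 :=
      (Finset.single_le_sum (f := c) (fun j _ => hc0 j) (Finset.mem_range.2 h2)).trans
        (by linarith)
    calc _ = c i * (((δ - δ') ^ (i + 1))⁻¹ * dataNorm (dom ψ δ) (δ - δ') (i + 1) u φ Φ) := by
          rw [hc]; ring
      _ ≤ (∑ j ∈ Finset.range k, c j + 1) * (((δ - δ') ^ (i + 1))⁻¹ *
          dataNorm (dom ψ δ) (δ - δ') (i + 1) u φ Φ) :=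
        mul_le_mul_of_nonneg_right hle (mul_nonneg (by positivity) hD)
      _ = _ := (mul_assoc _ _ _).symm

/-! ### The Sobolev inequality in the half space. -/

section HalfSpace

variable {m : ℕ}

/-- A map of the space into the lower half space that regularises the reflection
`(y, t) ↦ (y, -|t|)`. -/
noncomputable def fold (κ : ℝ) (z : Eu (m + 1)) : Eu (m + 1) :=
  glue (horiz z) (-√(vert z ^ 2 + κ ^ 2))

lemma fold_eq (κ : ℝ) (z : Eu (m + 1)) :
    fold κ z = z + (-√(vert z ^ 2 + κ ^ 2) - vert z) •
      EuclideanSpace.single (Fin.last m) (1 : ℝ) :=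
  ext_horiz (by rw [fold, horiz_glue, horiz_add_smul])
    (by rw [fold, vert_glue, vert_add_smul]; ring)

lemma contDiff_fold {κ : ℝ} (hκ : κ ≠ 0) : ContDiff ℝ 1 (fold κ : Eu (m + 1) → Eu (m + 1)) := by
  rw [funext (fold_eq κ)]
  refine contDiff_id.add (((ContDiff.sqrt ((contDiff_vert.pow 2).add contDiff_const)
    fun z => ?_).neg.sub contDiff_vert).smul contDiff_const)
  positivity

lemma continuous_fold : Continuous fun q : ℝ × Eu (m + 1) => fold q.1 q.2 := by
  have hh := (contDiff_horiz (k := 0) (m := m)).continuous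
  exact continuous_glue.comp ((hh.comp continuous_snd).prodMk
    ((((continuous_vert.comp continuous_snd).pow 2).add (continuous_fst.pow 2)).sqrt.neg))

/-- The reverse triangle inequality for the complex numbers `a + iκ` and `b + iκ`. -/
lemma abs_sqrt_sub_sqrt_le (a b κ : ℝ) : |√(a ^ 2 + κ ^ 2) - √(b ^ 2 + κ ^ 2)| ≤ |a - b| := by
  have h := abs_norm_sub_norm_le (⟨a, κ⟩ : ℂ) ⟨b, κ⟩
  simpa [Complex.norm_def, Complex.normSq, ← sq, Real.sqrt_sq_eq_abs] using h

lemma lipschitzWith_fold (κ : ℝ) : LipschitzWith 1 (fold κ : Eu (m + 1) → Eu (m + 1)) := by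
  refine LipschitzWith.of_dist_le_mul fun x y => ?_
  rw [NNReal.coe_one, one_mul, dist_eq_norm, dist_eq_norm]
  refine le_of_sq_le_sq ?_ (norm_nonneg _)
  have hsub : ∀ a b : Eu (m + 1), horiz (a - b) = horiz a - horiz b := fun a b => by
    simpa [horizL_apply] using (horizL m).map_sub a b
  have hvert : ∀ a b : Eu (m + 1), vert (a - b) = vert a - vert b := fun a b => rfl
  rw [norm_sq_eq_horiz, norm_sq_eq_horiz (x - y), hsub, hsub, hvert, hvert]
  simp only [fold, horiz_glue, vert_glue]
  refine add_le_add le_rfl (sq_le_sq.2 ?_)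
  rw [neg_sub_neg, abs_sub_comm]
  exact abs_sqrt_sub_sqrt_le _ _ _

lemma norm_fderiv_comp_fold_le {κ : ℝ} (hκ : κ ≠ 0) {w : Eu (m + 1) → ℝ} (hw : ContDiff ℝ 1 w)
    (z : Eu (m + 1)) : ‖fderiv ℝ (fun z => w (fold κ z)) z‖ ≤ ‖fderiv ℝ w (fold κ z)‖ := by
  have h := ((hw.differentiable one_ne_zero) (fold κ z)).hasFDerivAt.comp z
    ((contDiff_fold hκ).differentiable one_ne_zero z).hasFDerivAt
  rw [show (fun z => w (fold κ z)) = w ∘ fold κ from rfl, h.fderiv]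
  refine (ContinuousLinearMap.opNorm_comp_le _ _).trans (mul_le_of_le_one_right (norm_nonneg _) ?_)
  simpa using norm_fderiv_le_of_lipschitz ℝ (lipschitzWith_fold κ) (x₀ := z)

lemma norm_le_of_norm_fold_le {κ R : ℝ} {z : Eu (m + 1)} (h : ‖fold κ z‖ ≤ R) : ‖z‖ ≤ R := by
  refine le_trans (le_of_sq_le_sq ?_ (norm_nonneg _)) h
  rw [norm_sq_eq_horiz, norm_sq_eq_horiz (fold κ z), fold, horiz_glue, vert_glue, neg_sq,
    Real.sq_sqrt (by positivity)]
  linarith [sq_nonneg κ]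

lemma volume_vert_eq_zero : volume {z : Eu (m + 1) | vert z = 0} = 0 := by
  have h := (measurePreserving_splitEquiv m).measure_preimage_equiv
    ((univ : Set (Eu m)) ×ˢ ({0} : Set ℝ))
  rw [Measure.volume_eq_prod, Measure.prod_prod] at h
  simp only [measure_singleton, mul_zero] at h
  rw [← h]
  congr 1
  ext z
  simp [splitEquiv_apply]

lemma measurePreserving_flip :
    MeasurePreserving (fun z : Eu (m + 1) => glue (horiz z) (-vert z)) := by
  have h := (measurePreserving_splitEquiv m).symm.comp
    (((MeasurePreserving.id (volume : Measure (Eu m))).prod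
      (Measure.measurePreserving_neg (volume : Measure ℝ))).comp (measurePreserving_splitEquiv m))
  have he : (fun z : Eu (m + 1) => glue (horiz z) (-vert z)) =
      (splitEquiv m).symm ∘ (Prod.map id Neg.neg ∘ splitEquiv m) := by
    ext1 z
    simp [splitEquiv_apply, glue]
  rw [he]
  exact h

lemma fold_zero_of_mem {z : Eu (m + 1)} (hz : z ∈ lowerHalf m) : fold 0 z = z := by
  have hz' : vert z < 0 := hz
  rw [fold, zero_pow two_ne_zero, add_zero, Real.sqrt_sq_eq_abs, abs_of_neg hz', neg_neg,
    glue_horiz_vert]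

/-- `fold 0` is the identity below the boundary and the reflection above it; both halves contribute
the same integral, the boundary being a null set. -/
lemma lintegral_fold_zero {f : Eu (m + 1) → ℝ≥0∞} (hf : Measurable f) :
    ∫⁻ z, f (fold 0 z) = 2 * ∫⁻ z in lowerHalf m, f z := by
  rw [← lintegral_add_compl _ (isOpen_lowerHalf (m := m)).measurableSet, two_mul]
  congr 1
  · refine setLIntegral_congr_fun isOpen_lowerHalf.measurableSet fun z hz => ?_
    simp [fold_zero_of_mem hz]
  · have h1 : ∫⁻ z in (lowerHalf m)ᶜ, f (fold 0 z) =
        ∫⁻ z in (fun z : Eu (m + 1) => glue (horiz z) (-vert z)) ⁻¹' {z | vert z ≤ 0},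
          f (glue (horiz z) (-vert z)) := by
      have hs : (fun z : Eu (m + 1) => glue (horiz z) (-vert z)) ⁻¹' {z | vert z ≤ 0} =
          (lowerHalf m)ᶜ := by
        ext z
        simp [vert_glue, lowerHalf]
      rw [hs]
      refine setLIntegral_congr_fun isOpen_lowerHalf.measurableSet.compl fun z hz => ?_
      have hz' : 0 ≤ vert z := not_lt.1 hz
      simp only [fold]
      rw [zero_pow two_ne_zero, add_zero, Real.sqrt_sq_eq_abs, abs_of_nonneg hz']
    rw [h1, measurePreserving_flip.setLIntegral_comp_preimage
      (isClosed_le continuous_vert continuous_const).measurableSet hf]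
    refine setLIntegral_congr ?_
    refine (ae_le_set.2 (measure_mono_null (fun z hz => ?_) volume_vert_eq_zero)).antisymm
      (LE.le.eventuallyLE fun z (hz : vert z < 0) => hz.le)
    exact le_antisymm hz.1 (not_lt.1 hz.2)

/-- The Sobolev exponent `2n/(n-2)` in dimension `n = m + 1`. -/
noncomputable def sobExp (m : ℕ) : ℝ := 2 * (m + 1) / (m - 1)

lemma exists_sobolev (hm : 2 ≤ m) : ∃ C : ℝ≥0∞, C ≠ ⊤ ∧ ∀ w : Eu (m + 1) → ℝ,
    ContDiff ℝ 1 w → HasCompactSupport w →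
    eLpNorm w (ENNReal.ofReal (sobExp m)) volume ≤ C * eLpNorm (fderiv ℝ w) 2 volume := by
  have hm' : (2 : ℝ) ≤ m := by exact_mod_cast hm
  refine ⟨_, ENNReal.coe_ne_top, fun w hw hc => eLpNorm_le_eLpNorm_fderiv_of_eq_inner
    (volume : Measure (Eu (m + 1))) hw hc (p := 2) (p' := (sobExp m).toNNReal) (by norm_num)
    (by simp) ?_⟩
  have h0 : 0 ≤ sobExp m := div_nonneg (by positivity) (by linarith)
  rw [Real.coe_toNNReal _ h0, sobExp, finrank_euclideanSpace, Fintype.card_fin]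
  have : (m : ℝ) - 1 ≠ 0 := by linarith
  push_cast
  field_simp
  ring

lemma continuous_fold_right (κ : ℝ) : Continuous (fold κ : Eu (m + 1) → Eu (m + 1)) :=
  (lipschitzWith_fold κ).continuous

lemma tendsto_fold (z : Eu (m + 1)) : Tendsto (fun j : ℕ => fold (1 / ((j : ℝ) + 1)) z) atTop
    (𝓝 (fold 0 z)) :=
  ((continuous_fold.comp (continuous_id.prodMk continuous_const)).tendsto (0 : ℝ)).comp
    tendsto_one_div_add_atTop_nhds_zero_nat

/-- Folding never decreases the distance to the origin, so all the compositions are supported in one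
ball and dominated convergence applies. -/
lemma tendsto_lintegral_fold {F : Type*} [NormedAddCommGroup F] {g : Eu (m + 1) → F}
    (hg : Continuous g) (hc : HasCompactSupport g) :
    Tendsto (fun j : ℕ => ∫⁻ z, ‖g (fold (1 / ((j : ℝ) + 1)) z)‖ₑ ^ 2) atTop
      (𝓝 (2 * ∫⁻ z in lowerHalf m, ‖g z‖ₑ ^ 2)) := by
  have hm : Continuous fun z => ‖g z‖ₑ ^ 2 := (ENNReal.continuous_pow 2).comp hg.enorm
  rw [← lintegral_fold_zero hm.measurable]
  obtain ⟨b, hb⟩ := hc.exists_bound_of_continuous hg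
  obtain ⟨R, hR⟩ := hc.isCompact.isBounded.subset_closedBall (0 : Eu (m + 1))
  refine tendsto_lintegral_of_dominated_convergence
    ((Metric.closedBall 0 R).indicator fun _ => ENNReal.ofReal b ^ 2)
    (fun j => (hm.comp (continuous_fold_right _)).measurable) (fun j => ?_) ?_ ?_
  · refine Eventually.of_forall fun z => ?_
    by_cases hz : z ∈ Metric.closedBall (0 : Eu (m + 1)) R
    · rw [indicator_of_mem hz]
      refine pow_le_pow_left' ?_ 2
      rw [← ofReal_norm]
      exact ENNReal.ofReal_le_ofReal (hb _)
    · rw [indicator_of_notMem hz]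
      have : g (fold (1 / ((j : ℝ) + 1)) z) = 0 := by
        by_contra hne
        exact hz (mem_closedBall_zero_iff.2 (norm_le_of_norm_fold_le
          (mem_closedBall_zero_iff.1 (hR (subset_tsupport _ hne)))))
      simp only [this]
      simp
  · rw [lintegral_indicator Metric.isClosed_closedBall.measurableSet, setLIntegral_const]
    exact ENNReal.mul_ne_top (by simp) measure_closedBall_lt_top.ne
  · exact Eventually.of_forall fun z => (hm.tendsto _).comp (tendsto_fold z)

/-- The whole space inequality is applied to the even reflection of `w`, so no boundary values of
`w` are needed. The reflection is only Lipschitz and is approximated by the `C¹` functions `w ∘ fold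
κ`, whose gradients are no larger because `fold κ` is 1-Lipschitz. As `κ → 0`, Fatou's lemma handles
the left side. The squared gradient integrals tend to twice the half space integral, and `2 ^ (1/2)`
is bounded by `2`. -/
lemma exists_sobolev_lowerHalf (hm : 2 ≤ m) : ∃ C : ℝ≥0∞, C ≠ ⊤ ∧ ∀ w : Eu (m + 1) → ℝ,
    ContDiff ℝ 1 w → HasCompactSupport w →
    eLpNorm w (ENNReal.ofReal (sobExp m)) (volume.restrict (lowerHalf m)) ≤
      C * eLpNorm (fderiv ℝ w) 2 (volume.restrict (lowerHalf m)) := by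
  obtain ⟨S, hS, hsobolev⟩ := exists_sobolev hm
  refine ⟨S * 2, ENNReal.mul_ne_top hS (by norm_num), fun w hw hc => ?_⟩
  have hD : Continuous (fderiv ℝ w) := hw.continuous_fderiv one_ne_zero
  have hsob : ∀ j : ℕ, eLpNorm (fun z => w (fold (1 / ((j : ℝ) + 1)) z))
      (ENNReal.ofReal (sobExp m)) volume ≤
      S * eLpNorm (fun z => fderiv ℝ w (fold (1 / ((j : ℝ) + 1)) z)) 2 volume := fun j => by
    have hκ : (1 / ((j : ℝ) + 1)) ≠ 0 := by positivity
    have hcs : HasCompactSupport fun z => w (fold (1 / ((j : ℝ) + 1)) z) := by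
      obtain ⟨R, hR⟩ := hc.isCompact.isBounded.subset_closedBall (0 : Eu (m + 1))
      refine HasCompactSupport.of_support_subset_isCompact (isCompact_closedBall 0 R) fun z hz => ?_
      exact mem_closedBall_zero_iff.2 (norm_le_of_norm_fold_le
        (mem_closedBall_zero_iff.1 (hR (subset_tsupport _ hz))))
    refine (hsobolev _ (hw.comp (contDiff_fold hκ)) hcs).trans (mul_le_mul_right ?_ _)
    exact eLpNorm_mono fun z => norm_fderiv_comp_fold_le hκ hw z
  have hlim := (ENNReal.Tendsto.const_mul ((tendsto_lintegral_fold hD (hc.fderiv (𝕜 := ℝ))).ennrpow_const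
    (1 / 2 : ℝ)) (Or.inr hS))
  have hsq : ∀ (μ : Measure (Eu (m + 1))) (g : Eu (m + 1) → Eu (m + 1) →L[ℝ] ℝ),
      eLpNorm g 2 μ = (∫⁻ z, ‖g z‖ₑ ^ 2 ∂μ) ^ (1 / 2 : ℝ) := fun μ g => by
    rw [← sq_eLpNorm_two, ← ENNReal.rpow_natCast, ← ENNReal.rpow_mul]
    norm_num
  have hfatou : eLpNorm w (ENNReal.ofReal (sobExp m)) (volume.restrict (lowerHalf m)) ≤
      liminf (fun j : ℕ => eLpNorm (fun z => w (fold (1 / ((j : ℝ) + 1)) z))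
        (ENNReal.ofReal (sobExp m)) (volume.restrict (lowerHalf m))) atTop := by
    refine Lp.eLpNorm_lim_le_liminf_eLpNorm
      (fun j => (hw.continuous.comp (continuous_fold_right _)).aestronglyMeasurable) _ ?_
    refine (ae_restrict_iff' isOpen_lowerHalf.measurableSet).2 (Eventually.of_forall fun z hz => ?_)
    have := (hw.continuous.tendsto _).comp (tendsto_fold z)
    rwa [fold_zero_of_mem hz] at this
  refine hfatou.trans ((liminf_le_liminf (Eventually.of_forall fun j =>
    ((eLpNorm_mono_measure _ Measure.restrict_le_self).trans (hsob j)).trans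
      (le_of_eq (by rw [hsq])))).trans ?_)
  rw [hlim.liminf_eq, hsq, mul_assoc]
  refine mul_le_mul_right ?_ _
  rw [ENNReal.mul_rpow_of_nonneg _ _ (by norm_num)]
  refine mul_le_mul_left ?_ _
  exact (ENNReal.rpow_le_rpow_of_exponent_le (by norm_num) (by norm_num)).trans
    (le_of_eq (ENNReal.rpow_one 2))

end HalfSpace

/-! ### The Sobolev inequality for limits of test functions. -/

section SobolevLimit

variable {m : ℕ}

lemma norm_le_sum_single {n : ℕ} (L : Eu n →L[ℝ] ℝ) :
    ‖L‖ ≤ ∑ i, |L (EuclideanSpace.single i (1 : ℝ))| := by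
  refine L.opNorm_le_bound (Finset.sum_nonneg fun _ _ => abs_nonneg _) fun x => ?_
  have hx : x = ∑ i, x i • EuclideanSpace.single i (1 : ℝ) := by
    ext l
    simp [Finset.sum_apply, Pi.single_apply]
  conv_lhs => rw [hx]
  rw [map_sum, Finset.sum_mul]
  refine (norm_sum_le _ _).trans (Finset.sum_le_sum fun i _ => ?_)
  rw [map_smul, smul_eq_mul, norm_mul, mul_comm, Real.norm_eq_abs (L _)]
  exact mul_le_mul_of_nonneg_left (PiLp.norm_apply_le x i) (abs_nonneg _)

lemma eLpNorm_fderiv_le {n : ℕ} {μ : Measure (Eu n)} {w : Eu n → ℝ} (hw : ContDiff ℝ 1 w) :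
    eLpNorm (fderiv ℝ w) 2 μ ≤ ∑ i, eLpNorm (partialD i w) 2 μ := by
  have h1 : eLpNorm (fderiv ℝ w) 2 μ ≤ eLpNorm (fun x => ∑ i, |partialD i w x|) 2 μ :=
    eLpNorm_mono_real fun x => norm_le_sum_single (fderiv ℝ w x)
  have h2 := eLpNorm_sum_le (μ := μ) (f := fun i x => |partialD i w x|) (s := Finset.univ)
    (fun i _ => (continuous_partialD hw i).abs.aestronglyMeasurable) one_le_two
  have h3 : (∑ i, fun x => |partialD i w x|) = fun x => ∑ i, |partialD i w x| := by
    ext x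
    simp
  rw [h3] at h2
  refine h1.trans (h2.trans (Finset.sum_le_sum fun i _ => ?_))
  exact (eLpNorm_norm (partialD i w)).le

/-- Fatou's lemma along an almost everywhere convergent subsequence passes the Sobolev norm to the
limit without assuming that the limit lies in that space. -/
lemma exists_sobolev_lim (hm : 2 ≤ m) : ∃ C, 0 ≤ C ∧ ∀ (O : Set (Eu (m + 1))), IsOpen O →
    ∀ (f : Eu (m + 1) → ℝ) (g : Fin (m + 1) → Eu (m + 1) → ℝ) (w : ℕ → Eu (m + 1) → ℝ),
    (∀ j, IsC1Test O (w j)) → L2Lim (volume.restrict (O ∩ lowerHalf m)) w f →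
    (∀ i, L2Lim (volume.restrict (O ∩ lowerHalf m)) (fun j => partialD i (w j)) (g i)) →
    eLpNorm f (ENNReal.ofReal (sobExp m)) (volume.restrict (O ∩ lowerHalf m)) ≤
      ENNReal.ofReal (C * ∑ i, lpNorm (g i) 2 (volume.restrict (O ∩ lowerHalf m))) := by
  obtain ⟨C, hC, hsob⟩ := exists_sobolev_lowerHalf hm
  refine ⟨C.toReal, ENNReal.toReal_nonneg, fun O hO f g w hw hf hg => ?_⟩
  set μ := volume.restrict (O ∩ lowerHalf m) with hμ
  have hμ' : μ = (volume.restrict (lowerHalf m)).restrict O := by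
    rw [hμ, Measure.restrict_restrict hO.measurableSet]
  obtain ⟨ns, hns, hae⟩ := hf.exists_ae
  have hbound : ∀ j, eLpNorm (w j) (ENNReal.ofReal (sobExp m)) μ ≤
      ENNReal.ofReal (C.toReal * ∑ i, lpNorm (partialD i (w j)) 2 μ) := fun j => by
    have h1 := hsob (w j) (hw j).1 (hw j).2.1
    rw [hμ', eLpNorm_restrict_eq_of_support_subset ((subset_tsupport _).trans (hw j).2.2), ← hμ']
    refine h1.trans ?_
    rw [ENNReal.ofReal_mul ENNReal.toReal_nonneg, ENNReal.ofReal_toReal hC]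
    refine mul_le_mul_right ?_ C
    rw [ENNReal.ofReal_sum_of_nonneg fun _ _ => lpNorm_nonneg]
    refine (eLpNorm_fderiv_le (hw j).1).trans (Finset.sum_le_sum fun i _ => ?_)
    have hmem : MemLp (partialD i (w j)) 2 μ := (hw j).memLp_partialD i
    rw [← toReal_eLpNorm hmem.1, ENNReal.ofReal_toReal hmem.eLpNorm_ne_top, hμ',
      eLpNorm_restrict_eq_of_support_subset
        (((subset_tsupport _).trans (tsupport_partialD_subset i _)).trans (hw j).2.2)]
  refine (Lp.eLpNorm_lim_le_liminf_eLpNorm (fun j => (hf.memLp (ns j)).1) f hae).trans ?_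
  refine (liminf_le_liminf (Eventually.of_forall fun j => hbound (ns j))).trans (le_of_eq ?_)
  refine Tendsto.liminf_eq (ENNReal.tendsto_ofReal (Tendsto.const_mul _ ?_))
  exact tendsto_finsetSum _ fun i _ => (hg i).tendsto_lpNorm.comp hns.tendsto_atTop

end SobolevLimit

/-! ### Regularised powers. -/

section PowerFunctions

variable {p σ : ℝ}

/-- A regularisation of `|t|^{p-2} t`. -/
noncomputable def regPow (p σ t : ℝ) : ℝ := (t ^ 2 + σ ^ 2) ^ ((p - 2) / 2) * t

/-- A regularisation of `|t|^{p/2}`. -/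
noncomputable def regRoot (p σ t : ℝ) : ℝ := (t ^ 2 + σ ^ 2) ^ (p / 4)

lemma reg_pos (hσ : 0 < σ) (t : ℝ) : 0 < t ^ 2 + σ ^ 2 := by positivity

lemma hasDerivAt_reg (hσ : 0 < σ) (r t : ℝ) :
    HasDerivAt (fun t => (t ^ 2 + σ ^ 2) ^ r) (2 * t * r * (t ^ 2 + σ ^ 2) ^ (r - 1)) t := by
  have h : HasDerivAt (fun t : ℝ => t ^ 2 + σ ^ 2) (2 * t) t := by
    simpa using (hasDerivAt_pow 2 t).add_const (σ ^ 2)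
  exact h.rpow_const (Or.inl (reg_pos hσ t).ne')

lemma contDiff_reg (hσ : 0 < σ) (r : ℝ) : ContDiff ℝ 1 fun t : ℝ => (t ^ 2 + σ ^ 2) ^ r :=
  ((contDiff_id.pow 2).add contDiff_const).rpow_const_of_ne fun t => (reg_pos hσ t).ne'

lemma contDiff_regPow (hσ : 0 < σ) : ContDiff ℝ 1 (regPow p σ) :=
  (contDiff_reg hσ _).mul contDiff_id

lemma contDiff_regRoot (hσ : 0 < σ) : ContDiff ℝ 1 (regRoot p σ) := contDiff_reg hσ _

lemma deriv_regPow (hσ : 0 < σ) (t : ℝ) : deriv (regPow p σ) t =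
    (t ^ 2 + σ ^ 2) ^ ((p - 2) / 2 - 1) * ((p - 1) * t ^ 2 + σ ^ 2) := by
  have h := (hasDerivAt_reg hσ ((p - 2) / 2) t).mul (hasDerivAt_id t)
  have h2 : (t ^ 2 + σ ^ 2) ^ ((p - 2) / 2) =
      (t ^ 2 + σ ^ 2) ^ ((p - 2) / 2 - 1) * (t ^ 2 + σ ^ 2) := by
    rw [Real.rpow_sub_one (reg_pos hσ t).ne', div_mul_cancel₀ _ (reg_pos hσ t).ne']
  rw [show regPow p σ = (fun t => (t ^ 2 + σ ^ 2) ^ ((p - 2) / 2)) * id from rfl, h.deriv, h2]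
  simp only [id]
  ring

lemma rpow_reg_succ (hσ : 0 < σ) (t : ℝ) : (t ^ 2 + σ ^ 2) ^ ((p - 2) / 2) =
    (t ^ 2 + σ ^ 2) ^ ((p - 2) / 2 - 1) * (t ^ 2 + σ ^ 2) := by
  rw [Real.rpow_sub_one (reg_pos hσ t).ne', div_mul_cancel₀ _ (reg_pos hσ t).ne']

/-- In the derivative `t²` has coefficient `p - 1` and `σ²` has coefficient `1 ≥ p - 1`. This lower
bound supplies the ellipticity of the power estimate. -/
lemma le_deriv_regPow (hσ : 0 < σ) (hp : p ≤ 2) (t : ℝ) :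
    (p - 1) * (t ^ 2 + σ ^ 2) ^ ((p - 2) / 2) ≤ deriv (regPow p σ) t := by
  rw [deriv_regPow hσ, rpow_reg_succ hσ, mul_left_comm]
  refine mul_le_mul_of_nonneg_left ?_ (Real.rpow_nonneg (reg_pos hσ t).le _)
  nlinarith [sq_nonneg σ]

lemma rpow_reg_le (hσ : 0 < σ) {r : ℝ} (hr : r ≤ 0) (t : ℝ) :
    (t ^ 2 + σ ^ 2) ^ r ≤ (σ ^ 2) ^ r :=
  Real.rpow_le_rpow_of_nonpos (by positivity) (le_add_of_nonneg_left (sq_nonneg t)) hr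

lemma abs_deriv_regPow_le (hσ : 0 < σ) (hp1 : 1 ≤ p) (hp : p ≤ 2) (t : ℝ) :
    |deriv (regPow p σ) t| ≤ (σ ^ 2) ^ ((p - 2) / 2) := by
  have h0 := Real.rpow_nonneg (reg_pos hσ t).le ((p - 2) / 2 - 1)
  have h1 : 0 ≤ (p - 1) * t ^ 2 := mul_nonneg (by linarith) (sq_nonneg t)
  refine le_trans ?_ (rpow_reg_le hσ (by linarith) t)
  rw [deriv_regPow hσ, rpow_reg_succ hσ, abs_of_nonneg (mul_nonneg h0 (by positivity))]
  refine mul_le_mul_of_nonneg_left ?_ h0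
  nlinarith [sq_nonneg t]

lemma abs_regPow_le (hσ : 0 < σ) (hp : p ≤ 2) (t : ℝ) :
    |regPow p σ t| ≤ |t| ^ (p - 1) := by
  rcases eq_or_ne t 0 with rfl | ht
  · simp only [regPow, mul_zero, abs_zero]
    exact Real.rpow_nonneg le_rfl _
  have ht' : 0 < |t| := abs_pos.2 ht
  rw [regPow, abs_mul, abs_of_nonneg (Real.rpow_nonneg (reg_pos hσ t).le _)]
  have h1 : (t ^ 2 + σ ^ 2) ^ ((p - 2) / 2) ≤ (t ^ 2) ^ ((p - 2) / 2) :=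
    Real.rpow_le_rpow_of_nonpos (by positivity) (le_add_of_nonneg_right (sq_nonneg σ)) (by linarith)
  have h2 : (t ^ 2) ^ ((p - 2) / 2) = |t| ^ (p - 2) := by
    rw [← sq_abs, ← Real.rpow_natCast, ← Real.rpow_mul ht'.le]
    congr 1
    push_cast
    ring
  calc _ ≤ |t| ^ (p - 2) * |t| := mul_le_mul_of_nonneg_right (h1.trans h2.le) ht'.le
    _ = |t| ^ (p - 1) := by
      rw [← Real.rpow_add_one ht'.ne']
      congr 1
      ring

/-- The square of the test function's power splits into the weight of the gradient term and the
integrand of order `p`. This is what lets the cross term be absorbed. -/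
lemma sq_regPow_le (hσ : 0 < σ) (t : ℝ) : regPow p σ t ^ 2 ≤
    (t ^ 2 + σ ^ 2) ^ ((p - 2) / 2) * (t ^ 2 + σ ^ 2) ^ (p / 2) := by
  have h := reg_pos hσ t
  have e : (t ^ 2 + σ ^ 2) ^ (p / 2) = (t ^ 2 + σ ^ 2) ^ ((p - 2) / 2) * (t ^ 2 + σ ^ 2) := by
    rw [← Real.rpow_add_one h.ne']
    congr 1
    ring
  have h0 := Real.rpow_nonneg h.le ((p - 2) / 2)
  rw [e, regPow, mul_pow, sq ((t ^ 2 + σ ^ 2) ^ ((p - 2) / 2)), mul_assoc]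
  exact mul_le_mul_of_nonneg_left (mul_le_mul_of_nonneg_left
    (le_add_of_nonneg_right (sq_nonneg σ)) h0) h0

lemma sq_regRoot (hσ : 0 < σ) (t : ℝ) : regRoot p σ t ^ 2 = (t ^ 2 + σ ^ 2) ^ (p / 2) := by
  rw [regRoot, ← Real.rpow_natCast, ← Real.rpow_mul (reg_pos hσ t).le]
  congr 1
  push_cast
  ring

/-- The same weight as in the energy estimate for `regPow` bounds the squared derivative of
`regRoot`, so that estimate controls the gradient of `regRoot p σ (u x)` in `L²`. -/
lemma sq_deriv_regRoot_le (hσ : 0 < σ) (hp0 : 0 ≤ p) (hp : p ≤ 2) (t : ℝ) :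
    deriv (regRoot p σ) t ^ 2 ≤ (t ^ 2 + σ ^ 2) ^ ((p - 2) / 2) := by
  have h := reg_pos hσ t
  rw [show regRoot p σ = fun t => (t ^ 2 + σ ^ 2) ^ (p / 4) from rfl,
    (hasDerivAt_reg hσ (p / 4) t).deriv, mul_pow, ← Real.rpow_natCast (_ ^ (p / 4 - 1)),
    ← Real.rpow_mul h.le]
  have e : (t ^ 2 + σ ^ 2) ^ ((p - 2) / 2) =
      (t ^ 2 + σ ^ 2) * (t ^ 2 + σ ^ 2) ^ ((p / 4 - 1) * ((2 : ℕ) : ℝ)) := by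
    rw [mul_comm, ← Real.rpow_add_one h.ne']
    congr 1
    push_cast
    ring
  rw [e]
  refine mul_le_mul_of_nonneg_right ?_ (Real.rpow_nonneg h.le _)
  have : (2 * t * (p / 4)) ^ 2 = (p / 2) ^ 2 * t ^ 2 := by ring
  rw [this]
  have h2 : (p / 2) ^ 2 ≤ 1 := pow_le_one₀ (by linarith) (by linarith)
  nlinarith [sq_nonneg t, sq_nonneg σ, mul_le_mul_of_nonneg_right h2 (sq_nonneg t)]

lemma abs_deriv_regRoot_le (hσ : 0 < σ) (hp0 : 0 ≤ p) (hp : p ≤ 2) (t : ℝ) :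
    |deriv (regRoot p σ) t| ≤ √((σ ^ 2) ^ ((p - 2) / 2)) := by
  refine Real.abs_le_sqrt ((sq_deriv_regRoot_le hσ hp0 hp t).trans ?_)
  exact rpow_reg_le hσ (by linarith) t

lemma rpow_reg_le_add (hp0 : 0 ≤ p) (hp : p ≤ 2) (hσ : 0 < σ) (t : ℝ) :
    (t ^ 2 + σ ^ 2) ^ (p / 2) ≤ |t| ^ p + σ ^ p := by
  refine (Real.rpow_add_le_add_rpow (sq_nonneg t) (sq_nonneg σ) (by linarith)
    (by linarith)).trans (le_of_eq ?_)
  rw [← sq_abs t, ← Real.rpow_natCast, ← Real.rpow_natCast, ← Real.rpow_mul (abs_nonneg t),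
    ← Real.rpow_mul hσ.le]
  congr 2 <;> push_cast <;> ring

lemma abs_rpow_le_regRoot (hp0 : 0 ≤ p) (σ t : ℝ) : |t| ^ (p / 2) ≤ regRoot p σ t := by
  have : |t| ^ (p / 2) = (t ^ 2) ^ (p / 4) := by
    rw [← sq_abs t, ← Real.rpow_natCast, ← Real.rpow_mul (abs_nonneg t)]
    congr 1
    push_cast
    ring
  rw [this]
  exact Real.rpow_le_rpow (sq_nonneg t) (le_add_of_nonneg_right (sq_nonneg σ)) (by linarith)

/-- A scaled form of Young's inequality. -/
lemma mul_rpow_le {a b ε : ℝ} (ha : 0 ≤ a) (hb : 0 ≤ b) (hε : 0 < ε) (hp : 1 < p) :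
    a * b ^ (p - 1) ≤ (ε ^ 2)⁻¹ * b ^ p + ε ^ (2 * (p - 1)) * a ^ p := by
  have hbp : b ^ p = b * b ^ (p - 1) := by
    rcases hb.eq_or_lt with rfl | hb
    · rw [Real.zero_rpow (by linarith), zero_mul]
    · rw [mul_comm, ← Real.rpow_add_one hb.ne']
      congr 1
      ring
  have hap : a ^ p = a * a ^ (p - 1) := by
    rcases ha.eq_or_lt with rfl | ha
    · rw [Real.zero_rpow (by linarith), zero_mul]
    · rw [mul_comm, ← Real.rpow_add_one ha.ne']
      congr 1
      ring
  have h1 : 0 ≤ (ε ^ 2)⁻¹ * b ^ p := by positivity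
  have h2 : 0 ≤ ε ^ (2 * (p - 1)) * a ^ p := by positivity
  -- Comparing `a` with `ε⁻² b` suffices: in each case one of the two terms on the right alone
  -- dominates.
  rcases le_total a ((ε ^ 2)⁻¹ * b) with h | h
  · refine le_trans ?_ (le_add_of_nonneg_right h2)
    rw [hbp, ← mul_assoc]
    exact mul_le_mul_of_nonneg_right h (by positivity)
  · refine le_trans ?_ (le_add_of_nonneg_left h1)
    rw [hap, mul_left_comm]
    refine mul_le_mul_of_nonneg_left ?_ ha
    rw [Real.rpow_mul hε.le, ← Real.mul_rpow (by positivity) ha]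
    refine Real.rpow_le_rpow hb ?_ (by linarith)
    rw [Real.rpow_two]
    rwa [inv_mul_le_iff₀ (by positivity)] at h

end PowerFunctions

/-! ### The energy estimate with the test function `ζ² G(u)`. -/

section PowerEnergy

/-- Pointwise absorption, with `P` the weight `(u² + σ²)^{(p-2)/2}` and `R = (u² + σ²)^{p/2}`.
Ellipticity yields `2τ` times the good term. Half of it absorbs the terms containing `∇ζ`, which is
possible because `G² ≤ P R`. -/
lemma le_sum_flux_mul {n : ℕ} {a : Fin n → Fin n → ℝ} {g z : Fin n → ℝ} {Λ K ζ G G' P R τ : ℝ}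
    (ha : 2 * τ * P * ∑ i, g i ^ 2 ≤ G' * ∑ i, ∑ l, a i l * g l * g i)
    (hΛ : ∀ i l, |a i l| ≤ Λ) (hz : ∀ i, |z i| ≤ K) (hτ : 0 < τ)
    (hP : 0 ≤ P) (hR : 0 ≤ R) (hG : G ^ 2 ≤ P * R) :
    τ * (ζ ^ 2 * P * ∑ i, g i ^ 2) - n * ((n * (Λ * K)) ^ 2 / τ) * R ≤
      ∑ i, (∑ l, a i l * g l) * (ζ * ζ * (G' * g i) + 2 * ζ * z i * G) := by
  have h1 : ∑ i, (∑ l, a i l * g l) * (ζ * ζ * (G' * g i) + 2 * ζ * z i * G) =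
      ζ ^ 2 * (G' * ∑ i, ∑ l, a i l * g l * g i) +
        ∑ l, 2 * (ζ * g l) * G * ∑ i, a i l * z i := by
    simp_rw [mul_add, Finset.sum_add_distrib]
    congr 1
    · simp_rw [Finset.mul_sum, Finset.sum_mul]
      exact Finset.sum_congr rfl fun i _ => Finset.sum_congr rfl fun l _ => by ring
    · simp_rw [Finset.mul_sum, Finset.sum_mul]
      rw [Finset.sum_comm]
      exact Finset.sum_congr rfl fun i _ => Finset.sum_congr rfl fun l _ => by ring
  set c := (n : ℝ) * (Λ * K) with hc
  have h2 : ∀ l, -(τ * (ζ ^ 2 * P * g l ^ 2) + c ^ 2 / τ * R) ≤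
      2 * (ζ * g l) * G * ∑ i, a i l * z i := fun l => by
    have hb : |∑ i, a i l * z i| ≤ c := by
      refine (Finset.abs_sum_le_sum_abs _ _).trans ((Finset.sum_le_card_nsmul _ _ (Λ * K)
        fun i _ => ?_).trans (le_of_eq (by rw [hc]; simp)))
      rw [abs_mul]
      exact mul_le_mul (hΛ i l) (hz i) (abs_nonneg _) ((abs_nonneg _).trans (hΛ i l))
    set b := ∑ i, a i l * z i with hbdef
    have hb2 : b ^ 2 ≤ c ^ 2 := sq_le_sq.2 (hb.trans (le_abs_self c))
    have hA : 0 ≤ τ * (ζ ^ 2 * P * g l ^ 2) := by positivity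
    have hB : 0 ≤ c ^ 2 / τ * R := by positivity
    -- Young's inequality through squares: the square of the cross term is at most `4XY ≤ (X + Y)²`,
    -- where `X` and `Y` are the two terms on the left.
    refine (abs_le.1 (abs_le_of_sq_le_sq ?_ (add_nonneg hA hB))).1
    have e1 : (2 * (ζ * g l) * G * b) ^ 2 = 4 * (ζ * g l) ^ 2 * (G ^ 2 * b ^ 2) := by ring
    have e2 : G ^ 2 * b ^ 2 ≤ P * R * c ^ 2 :=
      mul_le_mul hG hb2 (sq_nonneg _) (mul_nonneg hP hR)
    have e3 : 4 * (ζ * g l) ^ 2 * (P * R * c ^ 2) =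
        4 * (τ * (ζ ^ 2 * P * g l ^ 2)) * (c ^ 2 / τ * R) := by
      field_simp
    rw [e1]
    refine (mul_le_mul_of_nonneg_left e2 (by positivity)).trans ?_
    rw [e3]
    nlinarith [sq_nonneg (τ * (ζ ^ 2 * P * g l ^ 2) - c ^ 2 / τ * R)]
  have h3 := Finset.sum_le_sum fun l (_ : l ∈ Finset.univ) => h2 l
  have h4 := mul_le_mul_of_nonneg_left ha (sq_nonneg ζ)
  rw [Finset.sum_neg_distrib, Finset.sum_add_distrib, Finset.sum_const, Finset.card_univ,
    Fintype.card_fin, nsmul_eq_mul, ← Finset.mul_sum, ← Finset.mul_sum] at h3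
  rw [h1]
  linarith

variable {m : ℕ} {O : Set (Eu (m + 1))} {u ζ : Eu (m + 1) → ℝ}
  {g : Fin (m + 1) → Eu (m + 1) → ℝ} {p σ η Λ K : ℝ}

lemma integrable_reg_mul {α : Type*} [MeasurableSpace α] {μ : Measure α} {u f : α → ℝ} {r : ℝ}
    (hσ : 0 < σ) (hr : r ≤ 0) (hu : AEStronglyMeasurable u μ) (hf : Integrable f μ) :
    Integrable (fun x => (u x ^ 2 + σ ^ 2) ^ r * f x) μ := by
  refine hf.bdd_mul ((contDiff_reg hσ r).continuous.comp_aestronglyMeasurable hu)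
    (c := (σ ^ 2) ^ r) (Eventually.of_forall fun x => ?_)
  rw [Real.norm_of_nonneg (Real.rpow_nonneg (reg_pos hσ _).le _)]
  exact rpow_reg_le hσ hr _

lemma integrable_weight (hσ : 0 < σ) (hp : p ≤ 2) (hζ : IsC1Test O ζ)
    (hζ0 : ∀ x, 0 ≤ ζ x ∧ ζ x ≤ 1) (hu : MemLp u 2 (volume.restrict (O ∩ lowerHalf m)))
    (hg : ∀ i, MemLp (g i) 2 (volume.restrict (O ∩ lowerHalf m))) :
    Integrable (fun x => ζ x ^ 2 * (u x ^ 2 + σ ^ 2) ^ ((p - 2) / 2) * ∑ i, g i x ^ 2)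
      (volume.restrict (O ∩ lowerHalf m)) := by
  have h := integrable_reg_mul (r := (p - 2) / 2) hσ (by linarith) hu.1
    (integrable_finsetSum Finset.univ fun i _ => (hg i).integrable_sq)
  refine (h.bdd_mul (f := fun x => ζ x ^ 2) (c := 1)
    (hζ.1.continuous.pow 2).aestronglyMeasurable (Eventually.of_forall fun x => ?_)).congr
    (Eventually.of_forall fun x => (mul_assoc _ _ _).symm)
  rw [Real.norm_of_nonneg (sq_nonneg _)]
  exact pow_le_one₀ (hζ0 x).1 (hζ0 x).2

/-- The pointwise absorption is integrated with `2τ = η (p - 1)`, the product of the ellipticity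
constant and the lower bound for the derivative of the power. This is where `p > 1` is needed. -/
lemma integral_weight_le (hO : IsOpen O) (hσ : 0 < σ) (hp1 : 1 < p) (hp : p ≤ 2) (hη : 0 < η)
    {a : Fin (m + 1) → Fin (m + 1) → Eu (m + 1) → ℝ}
    (ha : IsElliptic (O ∩ lowerHalf m) a η Λ) (hζ : IsC1Test O ζ)
    (hζ0 : ∀ x, 0 ≤ ζ x ∧ ζ x ≤ 1) (hζK : ∀ i x, |partialD i ζ x| ≤ K)
    (hu : MemLp u 2 (volume.restrict (O ∩ lowerHalf m)))
    (hg : ∀ i, MemLp (g i) 2 (volume.restrict (O ∩ lowerHalf m)))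
    (hR : Integrable (fun x => (u x ^ 2 + σ ^ 2) ^ (p / 2)) (volume.restrict (O ∩ lowerHalf m)))
    (hv : ∀ i, MemLp (fun x => ζ x * ζ x * (deriv (regPow p σ) (u x) * g i x) +
      2 * ζ x * partialD i ζ x * regPow p σ (u x)) 2 (volume.restrict (O ∩ lowerHalf m)))
    {T : ℝ} (hT : ∫ x in O ∩ lowerHalf m, ∑ i, flux a g i x *
      (ζ x * ζ x * (deriv (regPow p σ) (u x) * g i x) +
        2 * ζ x * partialD i ζ x * regPow p σ (u x)) ≤ T) :
    η * (p - 1) / 2 * ∫ x in O ∩ lowerHalf m,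
        ζ x ^ 2 * (u x ^ 2 + σ ^ 2) ^ ((p - 2) / 2) * ∑ i, g i x ^ 2 ≤
      T + (m + 1 : ℕ) * (((m + 1 : ℕ) * (Λ * K)) ^ 2 / (η * (p - 1) / 2)) *
        ∫ x in O ∩ lowerHalf m, (u x ^ 2 + σ ^ 2) ^ (p / 2) := by
  have hW := (hO.inter (isOpen_lowerHalf (m := m))).measurableSet
  have hτ : 0 < η * (p - 1) / 2 := by
    have : 0 < p - 1 := by linarith
    positivity
  have hI := integrable_weight hσ hp hζ hζ0 hu hg
  have hle : ∫ x in O ∩ lowerHalf m, (η * (p - 1) / 2 *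
      (ζ x ^ 2 * (u x ^ 2 + σ ^ 2) ^ ((p - 2) / 2) * ∑ i, g i x ^ 2) -
      (m + 1 : ℕ) * (((m + 1 : ℕ) * (Λ * K)) ^ 2 / (η * (p - 1) / 2)) *
        (u x ^ 2 + σ ^ 2) ^ (p / 2)) ≤ T := by
    refine le_trans (integral_mono_ae ((hI.const_mul _).sub (hR.const_mul _))
      (integrable_finsetSum _ fun i _ => integrable_mul_of_memLp (ha.memLp_flux hW hg i) (hv i))
      ((ae_restrict_iff' hW).2 (Eventually.of_forall fun x hx => ?_))) hT
    have hpos := reg_pos hσ (u x)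
    have hP := Real.rpow_nonneg hpos.le ((p - 2) / 2)
    refine le_sum_flux_mul (a := fun i l => a i l x) (g := fun i => g i x) ?_
      (fun i l => ha.bound i l x hx) (fun i => hζK i x) hτ hP
      (Real.rpow_nonneg hpos.le _) (sq_regPow_le hσ _)
    have e1 := ha.elliptic x hx fun i => g i x
    have e2 := le_deriv_regPow (p := p) hσ hp (u x)
    have e3 : 0 ≤ η * ∑ i, g i x ^ 2 := mul_nonneg hη.le (Finset.sum_nonneg fun _ _ => sq_nonneg _)
    have e4 : 0 ≤ deriv (regPow p σ) (u x) :=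
      (mul_nonneg (by linarith) hP).trans e2
    calc _ = (p - 1) * (u x ^ 2 + σ ^ 2) ^ ((p - 2) / 2) * (η * ∑ i, g i x ^ 2) := by ring
      _ ≤ deriv (regPow p σ) (u x) * (η * ∑ i, g i x ^ 2) := mul_le_mul_of_nonneg_right e2 e3
      _ ≤ _ := mul_le_mul_of_nonneg_left e1 e4
  rw [integral_sub (hI.const_mul _) (hR.const_mul _), integral_const_mul, integral_const_mul] at hle
  linarith

lemma exists_regRoot_bound (hm : 2 ≤ m) : ∃ C, 0 ≤ C ∧ ∀ (bc : BC) (O : Set (Eu (m + 1)))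
    (u ζ : Eu (m + 1) → ℝ) (g : Fin (m + 1) → Eu (m + 1) → ℝ) (p σ K : ℝ),
    IsOpen O → 0 < σ → 1 < p → p ≤ 2 → IsC1Test O ζ → (∀ x, 0 ≤ ζ x ∧ ζ x ≤ 1) →
    (∀ i x, |partialD i ζ x| ≤ K) → MemLp u 2 (volume.restrict (O ∩ lowerHalf m)) →
    (∀ i, MemLp (g i) 2 (volume.restrict (O ∩ lowerHalf m))) →
    (∀ i, WD (O ∩ lowerHalf m) (gradSet bc O) i u (g i)) →
    Integrable (fun x => (u x ^ 2 + σ ^ 2) ^ (p / 2)) (volume.restrict (O ∩ lowerHalf m)) →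
    eLpNorm (fun x => ζ x * regRoot p σ (u x)) (ENNReal.ofReal (sobExp m))
      (volume.restrict (O ∩ lowerHalf m)) ≤ ENNReal.ofReal (C * √(2 * (∫ x in O ∩ lowerHalf m,
        ζ x ^ 2 * (u x ^ 2 + σ ^ 2) ^ ((p - 2) / 2) * ∑ i, g i x ^ 2) +
          2 * (K ^ 2 * ∫ x in O ∩ lowerHalf m, (u x ^ 2 + σ ^ 2) ^ (p / 2)))) := by
  obtain ⟨C, hC, hsob⟩ := exists_sobolev_lim hm
  refine ⟨C * (m + 1 : ℕ), by positivity,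
    fun bc O u ζ g p σ K hO hσ hp1 hp hζ hζ0 hζK hu hg hD hR => ?_⟩
  set μ := volume.restrict (O ∩ lowerHalf m) with hμ
  have hW := (hO.inter (isOpen_lowerHalf (m := m))).measurableSet
  have hp0 : 0 ≤ p := by linarith
  have hroot : MemLp (fun x => regRoot p σ (u x)) 2 μ := by
    refine (memLp_two_iff_integrable_sq
      ((contDiff_regRoot hσ).continuous.comp_aestronglyMeasurable hu.1)).2 ?_
    simpa only [sq_regRoot hσ] using hR
  have hder : ∀ i, MemLp (fun x => deriv (regRoot p σ) (u x) * g i x) 2 μ := fun i =>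
    memLp_bdd_mul (hg i) (((contDiff_regRoot hσ).continuous_deriv le_rfl).comp_aestronglyMeasurable
      hu.1) (Eventually.of_forall fun x => abs_deriv_regRoot_le hσ hp0 hp _)
  -- `regRoot` does not vanish at `0`, so it destroys the Dirichlet condition. The interior relation
  -- of case (N) holds for both boundary conditions and is enough, the Sobolev inequality being free
  -- of boundary values.
  have hWD : ∀ i, WD (O ∩ lowerHalf m) (gradSet BC.N O) i (fun x => regRoot p σ (u x))
      (fun x => deriv (regRoot p σ) (u x) * g i x) := fun i =>
    WD.chain (bc := BC.N) hO hu hg (fun i => (hD i).restrict hW subset_rfl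
      (inter_subset_gradSet bc O) inter_subset_left) (contDiff_regRoot hσ)
      (abs_deriv_regRoot_le hσ hp0 hp) (fun h => by cases h) i
  obtain ⟨w, hw, hw1, hw2⟩ := exists_test_approx (bc := BC.N) hO hroot hder hWD hζ
  refine (hsob O hO _ _ w (fun j => (hw j).c1) hw1 hw2).trans (ENNReal.ofReal_le_ofReal ?_)
  rw [mul_assoc]
  refine mul_le_mul_of_nonneg_left ?_ hC
  refine (Finset.sum_le_card_nsmul _ _ _ fun i _ => ?_).trans
    (le_of_eq (by rw [Finset.card_univ, Fintype.card_fin, nsmul_eq_mul]))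
  refine Real.le_sqrt_of_sq_le ?_
  rw [sq_lpNorm_two (hw2 i).memLp_lim, ← integral_const_mul, ← integral_const_mul,
    ← integral_const_mul]
  have hI := integrable_weight hσ hp hζ hζ0 hu hg
  rw [← integral_add (hI.const_mul 2) ((hR.const_mul _).const_mul 2)]
  refine integral_mono (hw2 i).memLp_lim.integrable_sq
    ((hI.const_mul 2).add ((hR.const_mul _).const_mul 2)) fun x => ?_
  have e1 := sq_deriv_regRoot_le hσ hp0 hp (u x)
  have e2 : partialD i ζ x ^ 2 ≤ K ^ 2 := sq_le_sq.2 ((hζK i x).trans (le_abs_self K))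
  have e3 : g i x ^ 2 ≤ ∑ i, g i x ^ 2 := Finset.single_le_sum (f := fun i => g i x ^ 2)
    (fun _ _ => sq_nonneg _) (Finset.mem_univ i)
  have hP := Real.rpow_nonneg (reg_pos hσ (u x)).le ((p - 2) / 2)
  have hQ := Real.rpow_nonneg (reg_pos hσ (u x)).le (p / 2)
  have e4 : (ζ x * (deriv (regRoot p σ) (u x) * g i x)) ^ 2 ≤
      ζ x ^ 2 * (u x ^ 2 + σ ^ 2) ^ ((p - 2) / 2) * ∑ i, g i x ^ 2 := by
    rw [mul_pow, mul_pow, ← mul_assoc]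
    exact mul_le_mul (mul_le_mul_of_nonneg_left e1 (sq_nonneg _)) e3 (sq_nonneg _) (by positivity)
  have e5 : (partialD i ζ x * regRoot p σ (u x)) ^ 2 ≤ K ^ 2 * (u x ^ 2 + σ ^ 2) ^ (p / 2) := by
    rw [mul_pow, sq_regRoot hσ]
    exact mul_le_mul_of_nonneg_right e2 hQ
  have e6 : (ζ x * (deriv (regRoot p σ) (u x) * g i x) + partialD i ζ x * regRoot p σ (u x)) ^ 2 ≤
      2 * (ζ x * (deriv (regRoot p σ) (u x) * g i x)) ^ 2 +
        2 * (partialD i ζ x * regRoot p σ (u x)) ^ 2 := by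
    nlinarith [sq_nonneg (ζ x * (deriv (regRoot p σ) (u x) * g i x) -
      partialD i ζ x * regRoot p σ (u x))]
  change (ζ x * (deriv (regRoot p σ) (u x) * g i x) + partialD i ζ x * regRoot p σ (u x)) ^ 2 ≤
    2 * (ζ x ^ 2 * (u x ^ 2 + σ ^ 2) ^ ((p - 2) / 2) * ∑ i, g i x ^ 2) +
      2 * (K ^ 2 * (u x ^ 2 + σ ^ 2) ^ (p / 2))
  linarith

end PowerEnergy

/-! ### Higher integrability on `W_δ`. -/

section Integrability

lemma integral_abs_rpow {α : Type*} [MeasurableSpace α] {μ : Measure α} {f : α → ℝ} {p : ℝ}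
    (hp : 0 < p) (hf : MemLp f (ENNReal.ofReal p) μ) :
    Integrable (fun x => |f x| ^ p) μ ∧
      ∫ x, |f x| ^ p ∂μ = lpNorm f (ENNReal.ofReal p) μ ^ p := by
  have h0 : ENNReal.ofReal p ≠ 0 := by simpa using hp
  have h1 := hf.integrable_norm_rpow h0 ENNReal.ofReal_ne_top
  have h2 := lpNorm_eq_integral_norm_rpow_toReal h0 ENNReal.ofReal_ne_top hf.1
  simp only [ENNReal.toReal_ofReal hp.le, Real.norm_eq_abs] at h1 h2
  refine ⟨h1, ?_⟩
  rw [h2, ← Real.rpow_mul (integral_nonneg fun x => Real.rpow_nonneg (abs_nonneg _) _),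
    inv_mul_cancel₀ hp.ne', Real.rpow_one]

lemma integrable_reg {α : Type*} [MeasurableSpace α] {μ : Measure α} [IsFiniteMeasure μ]
    {f : α → ℝ} {p σ : ℝ} (hp0 : 0 < p) (hp : p ≤ 2) (hσ : 0 < σ)
    (hf : MemLp f (ENNReal.ofReal p) μ) :
    Integrable (fun x => (f x ^ 2 + σ ^ 2) ^ (p / 2)) μ ∧
      ∫ x, (f x ^ 2 + σ ^ 2) ^ (p / 2) ∂μ ≤
        lpNorm f (ENNReal.ofReal p) μ ^ p + σ ^ p * μ.real univ := by
  obtain ⟨h1, h2⟩ := integral_abs_rpow hp0 hf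
  have hb := h1.add (integrable_const (σ ^ p))
  have hI : Integrable (fun x => (f x ^ 2 + σ ^ 2) ^ (p / 2)) μ := by
    refine hb.mono' ((contDiff_reg hσ _).continuous.comp_aestronglyMeasurable hf.1)
      (Eventually.of_forall fun x => ?_)
    rw [Real.norm_of_nonneg (Real.rpow_nonneg (reg_pos hσ _).le _)]
    exact rpow_reg_le_add hp0.le hp hσ _
  refine ⟨hI, (integral_mono hI hb fun x => rpow_reg_le_add hp0.le hp hσ _).trans (le_of_eq ?_)⟩
  rw [integral_add' h1 (integrable_const _), h2, integral_const, smul_eq_mul, mul_comm (σ ^ p)]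

variable {m k : ℕ} {ψ : Eu m → ℝ} {δ δ' B η : ℝ}
  {A : Eu (m + 1) → Matrix (Fin (m + 1)) (Fin (m + 1)) ℝ}
  {bc : BC} {F : (Eu (m + 1) → ℝ) → ℝ} {u φ ζ : Eu (m + 1) → ℝ}

lemma volume_flat_lt_top (hψ : Continuous ψ) : volume (flat ψ δ ∩ lowerHalf m) < ⊤ := by
  rw [← shear_preimage_dom, (measurePreserving_shear hψ).measure_preimage
    (isOpen_dom hψ).measurableSet.nullMeasurableSet]
  exact (isBounded_dom hψ).measure_lt_top

/-- The test function `ζ² G(u)` for the regularised power `G`, in straightened coordinates. -/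
lemma IsWeakSolution.isFlatTest_regPow (hψ : ContDiff ℝ 2 ψ) (h : IsWeakSolution bc ψ A δ F u)
    (hζ : IsC1Test (flat ψ δ) ζ) {p σ : ℝ} (hσ : 0 < σ) (hp1 : 1 ≤ p) (hp : p ≤ 2) :
    IsFlatTest bc ψ δ (fun y => ζ y * ζ y * regPow p σ (u (shear ψ y)))
      (fun i y => ζ y * ζ y * (deriv (regPow p σ) (u (shear ψ y)) * flatGrad ψ δ u i y) +
        2 * ζ y * partialD i ζ y * regPow p σ (u (shear ψ y))) := by
  have hu := memLp_flat hψ.continuous h.memH1.1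
  have hg := h.memLp_flatGrad hψ
  have hpow : MemLp (fun y => regPow p σ (u (shear ψ y))) 2
      (volume.restrict (flat ψ δ ∩ lowerHalf m)) := by
    refine memLp_bdd_mul hu ((contDiff_reg hσ ((p - 2) / 2)).continuous.comp_aestronglyMeasurable
      hu.1) (B := (σ ^ 2) ^ ((p - 2) / 2)) (Eventually.of_forall fun x => ?_)
    rw [abs_of_nonneg (Real.rpow_nonneg (reg_pos hσ _).le _)]
    exact rpow_reg_le hσ (by linarith) _
  have hder : ∀ i, MemLp (fun y => deriv (regPow p σ) (u (shear ψ y)) * flatGrad ψ δ u i y) 2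
      (volume.restrict (flat ψ δ ∩ lowerHalf m)) := fun i =>
    memLp_bdd_mul (hg i) (((contDiff_regPow hσ).continuous_deriv le_rfl).comp_aestronglyMeasurable
      hu.1) (Eventually.of_forall fun x => abs_deriv_regPow_le hσ hp1 hp _)
  -- `regPow` vanishes at `0`, so it respects the Dirichlet condition, and for `σ > 0` its
  -- derivative is bounded, so the chain rule applies under either condition.
  obtain ⟨w, hw, hw1, hw2⟩ := exists_test_approx (isOpen_flat hψ.continuous) hpow hder
    (WD.chain (isOpen_flat hψ.continuous) hu hg (h.wd_flatGrad hψ) (contDiff_regPow hσ)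
      (abs_deriv_regPow_le hσ hp1 hp) fun _ => by simp [regPow]) hζ.sq.1
  simp only [hζ.sq.2] at hw2
  exact ⟨w, fun j => (hw j).c1, hw1, hw2⟩

lemma integral_mul_regPow_le {W : Set (Eu (m + 1))} {v : Eu (m + 1) → ℝ} {p ε : ℝ} (hp1 : 1 < p)
    (hε : 0 < ε) (hu : MemLp u (ENNReal.ofReal p) (volume.restrict W))
    (hφ : MemLp φ (ENNReal.ofReal p) (volume.restrict W))
    (hv : IntegrableOn (fun x => φ x * v x) W) (hvu : ∀ x, |v x| ≤ |u x| ^ (p - 1)) :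
    ∫ x in W, φ x * v x ≤ (ε ^ 2)⁻¹ * lpNorm u (ENNReal.ofReal p) (volume.restrict W) ^ p +
      ε ^ (2 * (p - 1)) * lpNorm φ (ENNReal.ofReal p) (volume.restrict W) ^ p := by
  obtain ⟨h1, h2⟩ := integral_abs_rpow (by linarith) hu
  obtain ⟨h3, h4⟩ := integral_abs_rpow (by linarith) hφ
  rw [← h2, ← h4, ← integral_const_mul, ← integral_const_mul,
    ← integral_add (h1.const_mul _) (h3.const_mul _)]
  refine integral_mono hv ((h1.const_mul _).add (h3.const_mul _)) fun x => ?_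
  refine ((le_abs_self _).trans (le_of_eq (abs_mul _ _))).trans ?_
  exact (mul_le_mul_of_nonneg_left (hvu x) (abs_nonneg _)).trans
    (mul_rpow_le (abs_nonneg _) (abs_nonneg _) hε hp1)

/-- `|u|^{p/2}` in the Sobolev space `L^{2n/(n-2)}` means `u` in `L^q` for exactly this `q`. -/
lemma sobExp_mul {p q : ℝ} (hq : q = ((m + 1 : ℕ) : ℝ) * p / (((m + 1 : ℕ) : ℝ) - 2))
    (hm : 2 ≤ m) : ENNReal.ofReal (sobExp m) * ENNReal.ofReal (p / 2) = ENNReal.ofReal q := by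
  have hm' : (2 : ℝ) ≤ m := by exact_mod_cast hm
  have h0 : 0 ≤ sobExp m := div_nonneg (by positivity) (by linarith)
  rw [← ENNReal.ofReal_mul h0, hq, sobExp]
  congr 1
  push_cast
  rw [show (m : ℝ) + 1 - 2 = m - 1 by ring]
  ring

/-- The bound for the regularised power of the solution, with constants made explicit. -/
lemma exists_regPow_bound (m k : ℕ) (hm : 2 ≤ m) (hk : 1 ≤ k) {B η p q : ℝ} (hB : 0 ≤ B)
    (hη : 0 < η) (hp1 : 1 < p) (hp : p ≤ 2)
    (hq : q = ((m + 1 : ℕ) : ℝ) * p / (((m + 1 : ℕ) : ℝ) - 2)) :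
    ∃ C, 0 ≤ C ∧ ∀ (ψ : Eu m → ℝ) (A : Eu (m + 1) → Matrix (Fin (m + 1)) (Fin (m + 1)) ℝ)
      (δ δ' : ℝ), 0 < δ' → δ' < δ → GraphData k δ B η ψ A →
      ∀ (bc : BC) (F : (Eu (m + 1) → ℝ) → ℝ) (u : Eu (m + 1) → ℝ), IsWeakSolution bc ψ A δ F u →
      ∀ φ : Eu (m + 1) → ℝ, MemLp u (ENNReal.ofReal p) (volume.restrict (dom ψ δ)) →
      MemLp φ (ENNReal.ofReal p) (volume.restrict (dom ψ δ)) →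
      (∀ v, IsAllowable bc ψ δ v →
        IntegrableOn (fun x => φ x * v x) (dom ψ δ) ∧ F v = ∫ x in dom ψ δ, φ x * v x) →
      ∀ σ, 0 < σ → eLpNorm (fun y => u (shear ψ y)) (ENNReal.ofReal q)
          (volume.restrict (flat ψ δ' ∩ lowerHalf m)) ^ (p / 2) ≤
        ENNReal.ofReal √(C * (((δ - δ') ^ 2)⁻¹ * normLp (dom ψ δ) (ENNReal.ofReal p) u ^ p +
          (δ - δ') ^ (2 * (p - 1)) * normLp (dom ψ δ) (ENNReal.ofReal p) φ ^ p +
          ((δ - δ') ^ 2)⁻¹ * (σ ^ p *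
            (volume.restrict (flat ψ δ ∩ lowerHalf m)).real univ))) := by
  obtain ⟨K, hK, hgap⟩ := exists_gap_bowl m hB
  obtain ⟨Λ, hΛ, hcb⟩ := exists_cb_flatCoef m k hB le_rfl
  obtain ⟨S, hS, hroot⟩ := exists_regRoot_bound hm
  set η' := η / (2 + 2 * ((m + 1 : ℕ) * B ^ 2)) with hη'
  have hη'0 : 0 < η' := by positivity
  set τ := η' * (p - 1) / 2 with hτ
  have hτ0 : 0 < τ := by
    have : 0 < p - 1 := by linarith
    positivity
  set c := (m + 1 : ℕ) * (((m + 1 : ℕ) * (Λ * K)) ^ 2 / τ) with hc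
  have hc0 : 0 ≤ c := by positivity
  refine ⟨S ^ 2 * (2 * ((1 + c) / τ) + 2 * K ^ 2), by positivity,
    fun ψ A δ δ' hδ' hδ h bc F u hu φ hup hφ hF σ hσ => ?_⟩
  have hψ := h.contDiff_two hk
  have hO := isOpen_flat (δ := δ) hψ.continuous
  set ε := δ - δ' with hε
  have hε0 : 0 < ε := sub_pos.2 hδ
  obtain ⟨ζ, hζ', hζ1, hζ0, hζK⟩ := hgap ψ δ' δ (hψ.of_le one_le_two) hδ
    fun i z hz => h.abs_slope_le hz
  have hζ := hζ'.mono bowl_subset_flat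
  have hu2 := memLp_flat hψ.continuous hu.memH1.1
  have hg := hu.memLp_flatGrad hψ
  have hell : IsElliptic (flat ψ δ ∩ lowerHalf m) (flatCoef ψ A) η' Λ :=
    isElliptic_of_cb (hO.inter isOpen_lowerHalf) (hcb δ η ψ A 0 hk h le_rfl zero_le_one)
      fun x hx ξ => h.elliptic_flatCoef hη hx ξ
  set μ := volume.restrict (flat ψ δ ∩ lowerHalf m) with hμ
  have : IsFiniteMeasure μ := ⟨by
    rw [hμ, Measure.restrict_apply_univ]
    exact volume_flat_lt_top hψ.continuous⟩
  obtain ⟨hR, hRle⟩ := integrable_reg (by linarith) hp hσ (memLp_flat hψ.continuous hup)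
  rw [lpNorm_flat hψ.continuous hup] at hRle
  have ht := hu.isFlatTest_regPow hψ hζ hσ hp1.le hp
  set X := normLp (dom ψ δ) (ENNReal.ofReal p) u with hX
  set Y := normLp (dom ψ δ) (ENNReal.ofReal p) φ with hY
  set J := ∫ x, (u (shear ψ x) ^ 2 + σ ^ 2) ^ (p / 2) ∂μ with hJ
  have hT : F (fun x => ζ (shear (fun y => -ψ y) x) * ζ (shear (fun y => -ψ y) x) *
      regPow p σ (u (shear ψ (shear (fun y => -ψ y) x)))) ≤
      (ε ^ 2)⁻¹ * X ^ p + ε ^ (2 * (p - 1)) * Y ^ p := by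
    obtain ⟨h1, h2⟩ := hF _ (ht.isAllowable hψ)
    rw [h2]
    refine integral_mul_regPow_le hp1 hε0 hup hφ h1 fun x => ?_
    rw [shear_shear_neg, abs_mul]
    refine (mul_le_of_le_one_left (abs_nonneg _) ?_).trans (abs_regPow_le hσ hp _)
    obtain ⟨z1, z2⟩ := hζ0 (shear (fun y => -ψ y) x)
    rw [abs_of_nonneg (mul_nonneg z1 z1)]
    exact mul_le_one₀ z2 z1 z2
  rw [← hu.flat_eqn hψ ht] at hT
  have hI := integral_weight_le hO hσ hp1 hp hη'0 hell hζ hζ0 hζK hu2 hg hR ht.memLp_grad hT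
  have hbd := hroot bc (flat ψ δ) (fun y => u (shear ψ y)) ζ (flatGrad ψ δ u) p σ (K / ε) hO hσ hp1
    hp hζ hζ0 hζK hu2 hg (hu.wd_flatGrad hψ) hR
  set I := ∫ x, ζ x ^ 2 * (u (shear ψ x) ^ 2 + σ ^ 2) ^ ((p - 2) / 2) *
    ∑ i, flatGrad ψ δ u i x ^ 2 ∂μ with hIdef
  set Z := (ε ^ 2)⁻¹ * X ^ p + ε ^ (2 * (p - 1)) * Y ^ p +
    (ε ^ 2)⁻¹ * (σ ^ p * μ.real univ) with hZ
  -- The power `p / 2` of the `L^q` norm of `u` is the Sobolev norm of `|u|^{p/2}`, which lies below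
  -- `regRoot`; on the smaller domain `ζ = 1`.
  have hlocal : eLpNorm (fun y => u (shear ψ y)) (ENNReal.ofReal q)
      (volume.restrict (flat ψ δ' ∩ lowerHalf m)) ^ (p / 2) ≤
      eLpNorm (fun y => ζ y * regRoot p σ (u (shear ψ y))) (ENNReal.ofReal (sobExp m)) μ := by
    rw [← sobExp_mul hq hm, ← eLpNorm_norm_rpow _ (by linarith)]
    have hsub : flat ψ δ' ∩ lowerHalf m ⊆ flat ψ δ ∩ lowerHalf m :=
      inter_subset_inter_left _ (flat_mono hδ.le)
    refine (eLpNorm_mono_ae_real ((ae_restrict_iff' ((isOpen_flat hψ.continuous).inter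
      isOpen_lowerHalf).measurableSet).2 (Eventually.of_forall fun y hy => ?_))).trans
      (eLpNorm_mono_measure _ (Measure.restrict_mono hsub le_rfl))
    rw [← bowl_inter hδ'.le] at hy
    rw [hζ1 y hy.1, one_mul, Real.norm_of_nonneg (Real.rpow_nonneg (norm_nonneg _) _),
      Real.norm_eq_abs]
    exact abs_rpow_le_regRoot (by linarith) σ _
  refine (hlocal.trans hbd).trans (ENNReal.ofReal_le_ofReal ?_)
  rw [mul_assoc (S ^ 2), Real.sqrt_mul (sq_nonneg S), Real.sqrt_sq hS]
  refine mul_le_mul_of_nonneg_left (Real.sqrt_le_sqrt ?_) hS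
  have hX0 : 0 ≤ X := lpNorm_nonneg
  have hY0 : 0 ≤ Y := lpNorm_nonneg
  have hTY : 0 ≤ ε ^ (2 * (p - 1)) * Y ^ p := by positivity
  have hV : 0 ≤ (ε ^ 2)⁻¹ * (σ ^ p * μ.real univ) := by positivity
  have hJZ : (ε ^ 2)⁻¹ * J ≤ Z := by
    have := mul_le_mul_of_nonneg_left hRle (show 0 ≤ (ε ^ 2)⁻¹ by positivity)
    rw [hZ]
    change (ε ^ 2)⁻¹ * J ≤ (ε ^ 2)⁻¹ * (X ^ p + σ ^ p * μ.real univ) at this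
    linarith
  -- The `1` accounts for the right-hand side of the equation and `c` for the absorbed cross terms.
  -- The gradient bound `K / ε` of the cutoff supplies the factor `ε⁻²` that turns `J` into a part
  -- of `Z`.
  have hIZ : I ≤ (1 + c) / τ * Z := by
    rw [div_mul_eq_mul_div, le_div_iff₀ hτ0, mul_comm]
    have e : (m + 1 : ℕ) * (((m + 1 : ℕ) * (Λ * (K / ε))) ^ 2 / τ) * J =
        c * ((ε ^ 2)⁻¹ * J) := by
      rw [hc]
      field_simp
    rw [e] at hI
    have e2 := mul_le_mul_of_nonneg_left hJZ hc0
    have hTZ : (ε ^ 2)⁻¹ * X ^ p + ε ^ (2 * (p - 1)) * Y ^ p ≤ Z := by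
      rw [hZ]
      linarith
    rw [add_mul, one_mul]
    exact hI.trans (add_le_add hTZ e2)
  have hKJ : (K / ε) ^ 2 * J ≤ K ^ 2 * Z := by
    rw [div_pow, div_eq_mul_inv, mul_assoc]
    exact mul_le_mul_of_nonneg_left hJZ (sq_nonneg K)
  linarith

/-- The bound is uniform in `σ` apart from a term `σ ^ p` times the finite volume, which disappears
as `σ → 0`. Taking the power `2 / p` and using subadditivity of `t ↦ t ^ (1 / p)` separates the two
norms. Finiteness of the `L^p` norm of `u` is automatic, as `p ≤ 2` on a bounded domain. -/
theorem exists_integrability_const (m k : ℕ) (hm : 2 ≤ m) (hk : 1 ≤ k) {B η p q : ℝ} (hB : 0 ≤ B)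
    (hη : 0 < η) (hp1 : 1 < p) (hp : p ≤ 2)
    (hq : q = ((m + 1 : ℕ) : ℝ) * p / (((m + 1 : ℕ) : ℝ) - 2)) :
    ∃ C, 0 < C ∧ ∀ (ψ : Eu m → ℝ) (A : Eu (m + 1) → Matrix (Fin (m + 1)) (Fin (m + 1)) ℝ)
      (δ δ' : ℝ), 0 < δ' → δ' < δ → GraphData k δ B η ψ A →
      ∀ (bc : BC) (F : (Eu (m + 1) → ℝ) → ℝ) (u : Eu (m + 1) → ℝ), IsWeakSolution bc ψ A δ F u →
      ∀ φ : Eu (m + 1) → ℝ, MemLp φ (ENNReal.ofReal p) (volume.restrict (dom ψ δ)) →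
      (∀ v, IsAllowable bc ψ δ v →
        IntegrableOn (fun x => φ x * v x) (dom ψ δ) ∧ F v = ∫ x in dom ψ δ, φ x * v x) →
      MemLp u (ENNReal.ofReal q) (volume.restrict (dom ψ δ')) ∧
      normLp (dom ψ δ') (ENNReal.ofReal q) u ≤
        C * ((δ - δ') ^ (-2 / p) * normLp (dom ψ δ) (ENNReal.ofReal p) u
          + (δ - δ') ^ (2 * (p - 1) / p) * normLp (dom ψ δ) (ENNReal.ofReal p) φ) := by
  obtain ⟨C, hC, hbd⟩ := exists_regPow_bound m k hm hk hB hη hp1 hp hq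
  refine ⟨C ^ (1 / p) + 1, by positivity, fun ψ A δ δ' hδ' hδ h bc F u hu φ hφ hF => ?_⟩
  have hp0 : 0 < p := by linarith
  have hψ := h.psi.continuous
  set ε := δ - δ' with hε
  have hε0 : 0 < ε := sub_pos.2 hδ
  have : IsFiniteMeasure (volume.restrict (dom ψ δ)) := ⟨by
    rw [Measure.restrict_apply_univ]
    exact (isBounded_dom hψ).measure_lt_top⟩
  have hup : MemLp u (ENNReal.ofReal p) (volume.restrict (dom ψ δ)) :=
    hu.memH1.1.mono_exponent (by simpa using ENNReal.ofReal_le_ofReal hp)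
  set X := normLp (dom ψ δ) (ENNReal.ofReal p) u with hX
  set Y := normLp (dom ψ δ) (ENNReal.ofReal p) φ with hY
  have hX0 : 0 ≤ X := lpNorm_nonneg
  have hY0 : 0 ≤ Y := lpNorm_nonneg
  set V := (volume.restrict (flat ψ δ ∩ lowerHalf m)).real univ
  set T := (ε ^ 2)⁻¹ * X ^ p + ε ^ (2 * (p - 1)) * Y ^ p with hT
  have hT0 : 0 ≤ T := by positivity
  have hlim : Tendsto (fun σ : ℝ => ENNReal.ofReal √(C * (T + (ε ^ 2)⁻¹ * (σ ^ p * V))))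
      (𝓝[>] 0) (𝓝 (ENNReal.ofReal √(C * (T + (ε ^ 2)⁻¹ * ((0 : ℝ) ^ p * V))))) := by
    have hc : ContinuousAt (fun σ : ℝ => σ ^ p) 0 :=
      continuousAt_id.rpow_const (Or.inr hp0.le)
    refine ENNReal.tendsto_ofReal ((Real.continuous_sqrt.tendsto _).comp ?_)
    exact (((hc.tendsto.mono_left nhdsWithin_le_nhds).mul_const V).const_mul _ |>.const_add
      T).const_mul C
  have hfin := ge_of_tendsto hlim (eventually_nhdsWithin_of_forall fun σ hσ =>
    hbd ψ A δ δ' hδ' hδ h bc F u hu φ hup hφ hF σ hσ)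
  rw [Real.zero_rpow hp0.ne', zero_mul, mul_zero, add_zero] at hfin
  have hflat : eLpNorm (fun y => u (shear ψ y)) (ENNReal.ofReal q)
      (volume.restrict (flat ψ δ' ∩ lowerHalf m)) ≤ ENNReal.ofReal ((C * T) ^ (1 / p)) := by
    have h1 := ENNReal.rpow_le_rpow hfin (show 0 ≤ 2 / p by positivity)
    rw [← ENNReal.rpow_mul, show p / 2 * (2 / p) = 1 by field_simp, ENNReal.rpow_one,
      ENNReal.ofReal_rpow_of_nonneg (Real.sqrt_nonneg _) (by positivity), Real.sqrt_eq_rpow,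
      ← Real.rpow_mul (by positivity)] at h1
    rwa [show 1 / 2 * (2 / p) = 1 / p by field_simp] at h1
  have hsub := dom_mono (ψ := ψ) hδ.le
  have humeas := hup.1.mono_measure (Measure.restrict_mono hsub le_rfl)
  have heq : eLpNorm (fun y => u (shear ψ y)) (ENNReal.ofReal q)
      (volume.restrict (flat ψ δ' ∩ lowerHalf m)) =
      eLpNorm u (ENNReal.ofReal q) (volume.restrict (dom ψ δ')) := by
    rw [← shear_preimage_dom]
    exact eLpNorm_comp_measurePreserving humeas (measurePreserving_shear_restrict hψ (dom ψ δ'))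
  rw [heq] at hflat
  refine ⟨⟨humeas, hflat.trans_lt ENNReal.ofReal_lt_top⟩, ?_⟩
  rw [normLp, ← toReal_eLpNorm humeas]
  refine (ENNReal.toReal_le_of_le_ofReal (by positivity) hflat).trans ?_
  rw [Real.mul_rpow hC hT0]
  have hTle : T ^ (1 / p) ≤ ε ^ (-2 / p) * X + ε ^ (2 * (p - 1) / p) * Y := by
    refine (Real.rpow_add_le_add_rpow (by positivity) (by positivity) (by positivity)
      ((div_le_one hp0).2 hp1.le)).trans (le_of_eq ?_)
    have hpow : ∀ r : ℝ, 0 ≤ r → (r ^ p) ^ (1 / p) = r := fun r hr => by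
      rw [← Real.rpow_mul hr, mul_one_div_cancel hp0.ne', Real.rpow_one]
    rw [Real.mul_rpow (by positivity) (by positivity), Real.mul_rpow (by positivity) (by positivity),
      hpow X hX0, hpow Y hY0, ← Real.rpow_mul hε0.le, mul_one_div, ← Real.rpow_two,
      ← Real.rpow_neg hε0.le, ← Real.rpow_mul hε0.le, mul_one_div]
  exact mul_le_mul (by linarith) hTle (Real.rpow_nonneg hT0 _) (by positivity)

end Integrability

end BoundaryEstimates

open BoundaryEstimates

theorem theorem7p2 (m k : ℕ) (hm : 1 ≤ m) (hk : 1 ≤ k) (θ R₀ Mψ MA η : ℝ)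
    (hθ : θ ∈ Set.Ioo (0 : ℝ) 1) (hR₀ : 0 < R₀) (hη : 0 < η) :
    -- (a)
    (∃ C : ℝ, 0 < C ∧ ∀ (ψ : Eu m → ℝ) (A : Eu (m + 1) → Matrix (Fin (m + 1)) (Fin (m + 1)) ℝ),
      Admissible k R₀ Mψ MA η ψ A →
      ∀ δ ∈ Set.Ioo 0 R₀, ∀ δ' ∈ Set.Ioc 0 (θ * δ),
      ∀ (bc : BC) (F : (Eu (m + 1) → ℝ) → ℝ) (u : Eu (m + 1) → ℝ),
      IsWeakSolution bc ψ A δ F u →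
      ∀ a b : ℝ, 0 ≤ a → 0 ≤ b →
      (∀ v, IsAllowable bc ψ δ v →
        |F v| ≤ a * normLp (dom ψ δ) 2 v + b * normLp (dom ψ δ) 2 (weakGrad (dom ψ δ) v)) →
      normLp (dom ψ δ') 2 (weakGrad (dom ψ δ') u) ^ 2 ≤
        C * (((δ - δ') ^ 2)⁻¹ * normLp (dom ψ δ) 2 u ^ 2 + a * normLp (dom ψ δ) 2 u + b ^ 2)) ∧
    -- (b)
    (∃ C : ℝ, 0 < C ∧ ∀ (ψ : Eu m → ℝ) (A : Eu (m + 1) → Matrix (Fin (m + 1)) (Fin (m + 1)) ℝ),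
      Admissible k R₀ Mψ MA η ψ A →
      ∀ δ ∈ Set.Ioo 0 R₀, ∀ δ' ∈ Set.Ioc 0 (θ * δ),
      ∀ (bc : BC) (F : (Eu (m + 1) → ℝ) → ℝ) (u : Eu (m + 1) → ℝ),
      IsWeakSolution bc ψ A δ F u →
      ∀ (φ : Eu (m + 1) → ℝ) (Φ : Eu (m + 1) → Eu (m + 1)),
      MemH (dom ψ δ) (k - 2) φ →
      (∀ i, MemH (dom ψ δ) (k - 1) (fun x => Φ x i)) →
      (∀ v, IsAllowable bc ψ δ v →
        F v = ∫ x in dom ψ δ, (φ x * v x + inner ℝ (Φ x) (weakGrad (dom ψ δ) v x))) →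
      MemH (dom ψ δ') k u ∧
      ∀ j ∈ Finset.Icc 1 k,
        ∑ α ∈ Finset.piAntidiag (Finset.univ : Finset (Fin (m + 1))) j,
            normLp (dom ψ δ') 2 (weakDeriv (dom ψ δ') α u) ≤
          C * ((δ - δ') ^ j)⁻¹ *
            (normLp (dom ψ δ) 2 u + (δ - δ') ^ 2 * normLp (dom ψ δ) 2 φ
              + (δ - δ') * normLp (dom ψ δ) 2 Φ
              + ∑ i ∈ Finset.Icc 1 (j - 1), (δ - δ') ^ (i + 1) *
                  (normH (dom ψ δ) (i - 1) φ + normHVec (dom ψ δ) i Φ))) ∧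
    -- (c)
    (2 ≤ m → ∀ θ' ∈ Set.Ioo 0 θ, ∀ p ∈ Set.Ioc (1 : ℝ) 2, ∀ q : ℝ,
      q = ((m + 1 : ℕ) : ℝ) * p / (((m + 1 : ℕ) : ℝ) - 2) →
      ∃ C : ℝ, 0 < C ∧ ∀ (ψ : Eu m → ℝ) (A : Eu (m + 1) → Matrix (Fin (m + 1)) (Fin (m + 1)) ℝ),
      Admissible k R₀ Mψ MA η ψ A →
      ∀ δ ∈ Set.Ioo 0 R₀, ∀ δ' ∈ Set.Icc (θ' * δ) (θ * δ),
      ∀ (bc : BC) (F : (Eu (m + 1) → ℝ) → ℝ) (u : Eu (m + 1) → ℝ),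
      IsWeakSolution bc ψ A δ F u →
      ∀ φ : Eu (m + 1) → ℝ, MemLp φ (ENNReal.ofReal p) (volume.restrict (dom ψ δ)) →
      (∀ v, IsAllowable bc ψ δ v →
        IntegrableOn (fun x => φ x * v x) (dom ψ δ) ∧ F v = ∫ x in dom ψ δ, φ x * v x) →
      MemLp u (ENNReal.ofReal q) (volume.restrict (dom ψ δ')) ∧
      normLp (dom ψ δ') (ENNReal.ofReal q) u ≤
        C * ((δ - δ') ^ (-2 / p) * normLp (dom ψ δ) (ENNReal.ofReal p) u
          + (δ - δ') ^ (2 * (p - 1) / p) * normLp (dom ψ δ) (ENNReal.ofReal p) φ)) := by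
  -- One constant bounds both `ψ` and `A`. It replaces `Mψ` and `MA` throughout, so the constants
  -- below depend only on the prescribed quantities.
  have hB : 0 ≤ max |Mψ| |MA| := (abs_nonneg _).trans (le_max_left _ _)
  have hlt : ∀ δ ∈ Set.Ioo 0 R₀, θ * δ < δ := fun δ hδ => mul_lt_of_lt_one_left hδ.1 hθ.2
  refine ⟨?_, ?_, ?_⟩
  · obtain ⟨C, hC, hbd⟩ := exists_energy_const m k hk hB hη
    refine ⟨C, hC, fun ψ A h δ hδ δ' hδ' bc F u hu a b ha hb hF => ?_⟩
    -- Domains, allowable functions and solutions depend on `ψ` only over the closed ball of radius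
    -- `δ`, so `ψ` may be exchanged for its global extension.
    obtain ⟨ψ', heq, hG⟩ := h.exists_graphData hδ
    have hδδ : δ' < δ := hδ'.2.trans_lt (hlt δ hδ)
    simp only [isAllowable_congr heq, dom_congr heq le_rfl] at hF
    rw [dom_congr heq le_rfl, dom_congr heq hδδ.le]
    exact hbd ψ' A δ δ' hδ'.1 hδδ hG bc F u (hu.congr heq) a b ha hb hF
  -- `E = max 1 R₀` bounds every `δ`, and hence every scale `ε`, so the scaled coefficient bounds
  -- are uniform.
  · obtain ⟨C, hC, hbd⟩ := exists_regularity_const m k hk hB hη (le_max_left 1 R₀)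
    refine ⟨C, hC, fun ψ A h δ hδ δ' hδ' bc F u hu φ Φ hφ hΦ hF => ?_⟩
    obtain ⟨ψ', heq, hG⟩ := h.exists_graphData hδ
    have hδδ : δ' < δ := hδ'.2.trans_lt (hlt δ hδ)
    simp only [isAllowable_congr heq, dom_congr heq le_rfl] at hF hφ hΦ
    rw [dom_congr heq le_rfl, dom_congr heq hδδ.le]
    exact hbd ψ' A δ δ' hδ'.1 hδδ (hδ.2.le.trans (le_max_right _ _)) hG bc F u (hu.congr heq)
      φ Φ hφ hΦ hF
  · intro hm2 θ' hθ' p hp q hq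
    obtain ⟨C, hC, hbd⟩ := exists_integrability_const m k hm2 hk hB hη hp.1 hp.2 hq
    refine ⟨C, hC, fun ψ A h δ hδ δ' hδ' bc F u hu φ hφ hF => ?_⟩
    obtain ⟨ψ', heq, hG⟩ := h.exists_graphData hδ
    have hδδ : δ' < δ := hδ'.2.trans_lt (hlt δ hδ)
    simp only [isAllowable_congr heq, dom_congr heq le_rfl] at hF hφ
    rw [dom_congr heq le_rfl, dom_congr heq hδδ.le]
    exact hbd ψ' A δ δ' ((mul_pos hθ'.1 hδ.1).trans_le hδ'.1) hδδ hG bc F u (hu.congr heq)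
      φ hφ hF
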